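/- **Setting.** Let $\mathbb K=\mathbb R$ (real case) or $\mathbb K=\mathbb C$ (complex case). Let $\nu$ be a probability measure on $\mathbb K$ which satisfies a logarithmic Sobolev inequality (for some $c>0$, $\int f^2\log\frac{f^2}{\int f^2d\nu}\,d\nu\le 2c\int|f'|^2d\nu$ for all differentiable $f\in L^2(\nu)$), is centred and has variance $\int|x|^2d\nu=1$; in the complex case its real and imaginary parts are moreover independent and identically distributed. Put $\kappa_4(\nu)=\int x^4d\nu-3$ in the real case and $\kappa_4(\nu)=\int|z|^4d\nu-2$ in the complex case, and assume $\kappa_4(\nu)\neq0$. For each $n$ let $X_n$ be a deterministic self-adjoint $n\times n$ matrix with entries in $\mathbb K$ (so real symmetric in the real case), whose spectral measure $\mu_n$ converges weakly to a compactly supported probability measure $\mu_X$, and whose smallest and largest eigenvalues converge to $a=\min\operatorname{supp}\mu_X$ and $b=\max\operatorname{supp}\mu_X$. Write $G_\mu(z)=\int\frac{d\mu(x)}{z-x}$, $\overline\theta=1/\lim_{z\downarrow b}G_{\mu_X}(z)\ge 0$, $\underline\theta=1/\lim_{z\uparrow a}G_{\mu_X}(z)\le 0$ (with $1/\pm\infty=0$).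 For $\theta\ne0$ let $\rho_\theta$ be the unique $z\notin[a,b]$ with $G_{\mu_X}(z)=1/\theta$ if $\theta<\underline\theta$ or $\theta>\overline\theta$, and otherwise $\rho_\theta=a$ if $\theta<0$ and $\rho_\theta=b$ if $\theta>0$. Let $\theta_1\le\cdots\le\theta_r$ be nonzero reals independent of $n$, and let $g_1,\dots,g_r$ be independent random vectors in $\mathbb K^n$ with i.i.d. entries of law $\nu$. The vectors $u_1^n,\dots,u_r^n$ are either the vectors $g_s/\sqrt n$ (i.i.d. model) or the Gram–Schmidt orthonormalisation of these (orthonormalised model). Let $\widetilde X_n=X_n+\sum_{s=1}^r\theta_su_s^nu_s^{n*}$, with eigenvalues $\widetilde\lambda_1^n\le\cdots\le\widetilde\lambda_n^n$. Let $\alpha_1<\cdots<\alpha_q$ be the different values of those $\theta_s$ with $\rho_{\theta_s}\notin\{a,b\}$, let $k_j=\#\{s:\theta_s=\alpha_j\}$ and $p=k_1+\cdots+k_q$. For $1\le j\le q$, $1\le i\le k_j$ and $m=k_1+\cdots+k_{j-1}+i$ put $$\gamma^n_m=\begin{cases}\sqrt n\,(\widetilde\lambda^n_m-\rho_{\alpha_j})&\text{if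 }\alpha_j<0,\\ \sqrt n\,(\widetilde\lambda^n_{n-p+m}-\rho_{\alpha_j})&\text{if }\alpha_j>0.\end{cases}$$ Assume that $\sqrt n\,(G_{\mu_n}(\rho_{\alpha_j})-G_{\mu_X}(\rho_{\alpha_j}))\to0$ for all $j$, and that for all $z\in\mathbb R\setminus[a,b]$ there is a finite $l(z)$ such that, as $n\to\infty$, $$\frac1n\sum_{i=1}^n\big((z-X_n)^{-1}\big)_{i,i}^2\to l(z)\ \text{(i.i.d. model)},\qquad \frac1n\sum_{i=1}^n\Big(\big((z-X_n)^{-1}\big)_{i,i}-\tfrac1n\operatorname{Tr}(z-X_n)^{-1}\Big)^2\to l(z)\ \text{(orthonormalised model)}.$$ Let $c_\alpha\ge0$ be given, with $s_\alpha=\int(\rho_\alpha-x)^{-2}d\mu_X(x)$, by $c_\alpha^2=1/s_\alpha$ in the i.i.d. model and $c_\alpha^2=(s_\alpha-\alpha^{-2})/s_\alpha^2$ in the orthonormalised model. Let $M_1,\dots,M_q$ be independent, $M_j$ with the $\mathrm{GOE}(k_j)$ law in the real case and the $\mathrm{GUE}(k_j)$ law in the complex case. (A GOE matrix is real symmetric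 with independent entries on and above the diagonal, $N(0,2)$ on the diagonal and $N(0,1)$ above it. A GUE matrix is Hermitian with independent $N(0,1)$ entries on the diagonal and, above it, entries whose real and imaginary parts are independent $N(0,1/2)$, all of them independent.) **Theorem.** Put $$w_j=\frac{l(\rho_{\alpha_j})\,\kappa_4(\nu)}{G_{\mu_X}'(\rho_{\alpha_j})^2},\qquad v_j=\tau c_{\alpha_j}^2+w_j,\qquad \tau=2\text{ in the real case},\ \tau=1\text{ in the complex case}.$$ Then $v_j\ge0$ for all $j$, and the joint law of $(\gamma^n_{k_1+\cdots+k_{j-1}+i},\,1\le i\le k_j)_{1\le j\le q}$ converges weakly, as $n\to\infty$, to the law of $(\lambda_{i,j},\,1\le i\le k_j)_{1\le j\le q}$, where $\lambda_{1,j}\le\cdots\le\lambda_{k_j,j}$ are the eigenvalues of $H_j$. Here $H_1,\dots,H_q$ are obtained from $c_{\alpha_1}M_1,\dots,c_{\alpha_q}M_q$ by replacing all their diagonal entries by real Gaussian variables, independent of each other and of the $M_j$, centred and with variance $v_j$ for those of $H_j$. If $\kappa_4(\nu)>0$, then moreover $w_j\ge0$ for all $j$, and the same convergence holds with $H_j=c_{\alpha_j}M_j+D_j$,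 where $D_1,\dots,D_q$ are diagonal matrices whose diagonal entries are real Gaussian variables, independent of each other and of the $M_j$, centred and with variance $w_j$ for those of $D_j$. -/

import Mathlib

open MeasureTheory ProbabilityTheory Filter Topology
open scoped BoundedContinuousFunction

namespace SpikedModel

/-! ### The law of the entries -/

/-- `ν` satisfies a logarithmic Sobolev inequality: for some constant `c` and all differentiable
`f ∈ L²(ν)`, `∫ f² log (f² / ∫ f² dν) dν ≤ 2 c ∫ |f'|² dν`. If the right-hand side is infinite there
is nothing to check; if it is finite, the left-hand side (whose negative part is always integrable)
has to be finite as well. Here `f'` is the gradient on `𝕜` seen as a real vector space. -/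
def LogSobolev {𝕜 : Type*} [RCLike 𝕜] (ν : Measure 𝕜) : Prop :=
  ∃ c : ℝ, 0 < c ∧ ∀ f : 𝕜 → ℝ, Differentiable ℝ f → MemLp f 2 ν →
    Integrable (fun x => ‖fderiv ℝ f x‖ ^ 2) ν →
      Integrable (fun x => f x ^ 2 * Real.log (f x ^ 2 / ∫ y, f y ^ 2 ∂ν)) ν ∧
      ∫ x, f x ^ 2 * Real.log (f x ^ 2 / ∫ y, f y ^ 2 ∂ν) ∂ν
        ≤ 2 * c * ∫ x, ‖fderiv ℝ f x‖ ^ 2 ∂ν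

/-- The real case is `𝕜 = ℝ`, i.e. `I = 0`; otherwise `𝕜 = ℂ`. -/
def IsRealCase (𝕜 : Type*) [RCLike 𝕜] : Prop := (RCLike.I : 𝕜) = 0

/-- The assumption on the law `ν` of the entries: logarithmic Sobolev inequality, centred, variance
one and, in the complex case, independent and identically distributed real and imaginary parts. -/
structure EntryLaw {𝕜 : Type*} [RCLike 𝕜] (ν : Measure 𝕜) : Prop where
  isProbabilityMeasure : IsProbabilityMeasure ν
  logSobolev : LogSobolev ν
  centred : ∫ x, x ∂ν = 0
  variance_one : ∫ x, ‖x‖ ^ 2 ∂ν = 1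
  re_im : ¬ IsRealCase 𝕜 →
    IndepFun (fun x : 𝕜 => RCLike.re x) (fun x : 𝕜 => RCLike.im x) ν ∧
    IdentDistrib (fun x : 𝕜 => RCLike.re x) (fun x : 𝕜 => RCLike.im x) ν ν

open Classical in
/-- The fourth cumulant: `∫ x⁴ dν - 3` in the real case, `∫ |z|⁴ dν - 2` in the complex case. -/
noncomputable def kappa4 {𝕜 : Type*} [RCLike 𝕜] (ν : Measure 𝕜) : ℝ :=
  (∫ x, ‖x‖ ^ 4 ∂ν) - if IsRealCase 𝕜 then 3 else 2

/-! ### Cauchy-Stieltjes transform, thresholds and limits of the outliers -/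

/-- `G_μ(z) = ∫ 1 / (z - x) dμ(x)`. -/
noncomputable def cauchyG (μ : Measure ℝ) (z : ℝ) : ℝ := ∫ x, 1 / (z - x) ∂μ

/-- `1 / lim_{z ↓ b} G_μ(z)`; as that limit may be `+∞`, with `1 / ∞ = 0`, this is written as the
limit of `1 / G_μ(z)`. -/
noncomputable def thetaUpper (μ : Measure ℝ) (b : ℝ) : ℝ :=
  limUnder (𝓝[>] b) (fun z => 1 / cauchyG μ z)

/-- `1 / lim_{z ↑ a} G_μ(z)`, with the same convention. -/
noncomputable def thetaLower (μ : Measure ℝ) (a : ℝ) : ℝ :=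
  limUnder (𝓝[<] a) (fun z => 1 / cauchyG μ z)

open Classical in
/-- The limit `ρ_θ`, for `θ ≠ 0`. In the first case it is the unique `z` outside `[a, b]` with
`G_μ(z) = 1 / θ`. -/
noncomputable def rho (μ : Measure ℝ) (a b θ : ℝ) : ℝ :=
  if θ < thetaLower μ a ∨ thetaUpper μ b < θ then
    Function.invFunOn (cauchyG μ) (Set.Iio a ∪ Set.Ioi b) (1 / θ)
  else if θ < 0 then a else b

/-! ### Hermitian matrices -/

open Classical in
/-- The `k`-th smallest eigenvalue, `1 ≤ k ≤ m`, of a Hermitian `m × m` matrix, with multiplicity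
(Mathlib's `eigenvalues₀` is in decreasing order); `0` outside this range. -/
noncomputable def eig {𝕜 : Type*} [RCLike 𝕜] {m : ℕ} (A : Matrix (Fin m) (Fin m) 𝕜) (k : ℕ) : ℝ :=
  if h : A.IsHermitian ∧ 1 ≤ k ∧ k ≤ m then
    h.1.eigenvalues₀ ⟨m - k, by rw [Fintype.card_fin]; omega⟩
  else 0

/-- The spectral measure `n⁻¹ ∑ δ_{λ_l}`. -/
noncomputable def spectralMeasure {𝕜 : Type*} [RCLike 𝕜] {n : ℕ} (A : Matrix (Fin n) (Fin n) 𝕜) :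
    Measure ℝ :=
  (n : ENNReal)⁻¹ • ∑ l : Fin n, Measure.dirac (eig A (l + 1))

/-- The resolvent `(z - A)⁻¹`. -/
noncomputable def resolv {𝕜 : Type*} [RCLike 𝕜] {n : ℕ} (A : Matrix (Fin n) (Fin n) 𝕜) (z : ℝ) :
    Matrix (Fin n) (Fin n) 𝕜 :=
  ((z : 𝕜) • (1 : Matrix (Fin n) (Fin n) 𝕜) - A)⁻¹

/-- The spectral hypothesis on the deterministic self-adjoint matrices `X n`: the spectral measures
converge weakly to the probability measure `μ`, whose support is compact with lower and upper
bounds `a` and `b`, and the extreme eigenvalues converge to `a` and `b`. -/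
structure SpectralHyp {𝕜 : Type*} [RCLike 𝕜] (X : (n : ℕ) → Matrix (Fin n) (Fin n) 𝕜)
    (μ : Measure ℝ) (a b : ℝ) : Prop where
  hermitian : ∀ n, (X n).IsHermitian
  isProbabilityMeasure : IsProbabilityMeasure μ
  isLeast : IsLeast μ.support a
  isGreatest : IsGreatest μ.support b
  weak : ∀ f : ℝ →ᵇ ℝ,
    Tendsto (fun n => ∫ x, f x ∂(spectralMeasure (X n))) atTop (𝓝 (∫ x, f x ∂μ))
  smallest : Tendsto (fun n => eig (X n) 1) atTop (𝓝 a)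
  largest : Tendsto (fun n => eig (X n) n) atTop (𝓝 b)

/-! ### The perturbation -/

/-- The two models for the perturbing vectors. -/
inductive Model
  | iid
  | orthonormalised

/-- The vectors `u_1, …, u_r`, as functions of the i.i.d. entries `g`: the vectors
`v_s = n^{-1/2} (g_{s,1}, …, g_{s,n})` themselves, or their Gram-Schmidt orthonormalisation. -/
noncomputable def vecs {𝕜 : Type*} [RCLike 𝕜] {r n : ℕ} (mod : Model) (g : Fin r → Fin n → 𝕜) :
    Fin r → EuclideanSpace 𝕜 (Fin n) :=
  let v : Fin r → EuclideanSpace 𝕜 (Fin n) :=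
    fun s => WithLp.toLp 2 (fun i => (((√(n : ℝ))⁻¹ : ℝ) : 𝕜) * g s i)
  match mod with
  | .iid => v
  | .orthonormalised => InnerProductSpace.gramSchmidtNormed 𝕜 v

/-- The perturbed matrix `A + ∑ θ_s u_s u_s^*`. -/
noncomputable def perturbed {𝕜 : Type*} [RCLike 𝕜] {r n : ℕ} (A : Matrix (Fin n) (Fin n) 𝕜)
    (θ : Fin r → ℝ) (u : Fin r → EuclideanSpace 𝕜 (Fin n)) : Matrix (Fin n) (Fin n) 𝕜 :=
  A + ∑ s, (θ s : 𝕜) • Matrix.vecMulVec (u s).ofLp (star (u s).ofLp)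

/-- The number `k_j` of indices `s` with `θ_s = t`. -/
noncomputable def mult {r : ℕ} (θ : Fin r → ℝ) (t : ℝ) : ℕ := Nat.card {s : Fin r // θ s = t}

/-- The rescaled difference `γ_m`, `m = k_1 + ⋯ + k_{j-1} + i + 1` (here `i` starts from `0`), of the
matrix `B = X̃_n`. The numbers `k_j` with `α_j < 0` add up to `p_-` and all of them add up to
`p_- + p_+`, so the first case is `m ≤ p_-` and the second one is `p_- < m ≤ p_- + p_+`. -/
noncomputable def gam {𝕜 : Type*} [RCLike 𝕜] {n q : ℕ} (B : Matrix (Fin n) (Fin n) 𝕜)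
    (α ρ : Fin q → ℝ) (k : Fin q → ℕ) (j : Fin q) (i : Fin (k j)) : ℝ :=
  let m := ∑ l ∈ Finset.Iio j, k l + i + 1
  if α j < 0 then √(n : ℝ) * (eig B m - ρ j)
  else √(n : ℝ) * (eig B (n + m - ∑ l, k l) - ρ j)

/-- The averages of squares of (centred) diagonal entries of the resolvent. -/
noncomputable def diagAverage {𝕜 : Type*} [RCLike 𝕜] {n : ℕ} (mod : Model)
    (A : Matrix (Fin n) (Fin n) 𝕜) (z : ℝ) : ℝ :=
  match mod with
  | .iid => (n : ℝ)⁻¹ * ∑ i, RCLike.re (resolv A z i i) ^ 2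
  | .orthonormalised => (n : ℝ)⁻¹ *
      ∑ i, (RCLike.re (resolv A z i i) - (n : ℝ)⁻¹ * RCLike.re (resolv A z).trace) ^ 2

/-! ### The limit -/

/-- The constant `c_α`, with `ρ = ρ_α`. -/
noncomputable def cConst (mod : Model) (μ : Measure ℝ) (α ρ : ℝ) : ℝ :=
  let s := ∫ x, 1 / (ρ - x) ^ 2 ∂μ
  match mod with
  | .iid => √(1 / s)
  | .orthonormalised => √((s - 1 / α ^ 2) / s ^ 2)

open Classical in
/-- A matrix of the GOE (real case) or GUE (complex case), built from an array `x` of independent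
standard real Gaussian variables. -/
noncomputable def gaussianMatrix (𝕜 : Type*) [RCLike 𝕜] {k : ℕ} (x : Fin k → Fin k → ℝ) :
    Matrix (Fin k) (Fin k) 𝕜 :=
  Matrix.of fun i j =>
    if IsRealCase 𝕜 then
      if i = j then ((√2 * x i i : ℝ) : 𝕜) else if i < j then (x i j : 𝕜) else (x j i : 𝕜)
    else
      if i = j then (x i i : 𝕜)
      else if i < j then ((x i j / √2 : ℝ) : 𝕜) + ((x j i / √2 : ℝ) : 𝕜) * RCLike.I
      else ((x j i / √2 : ℝ) : 𝕜) - ((x i j / √2 : ℝ) : 𝕜) * RCLike.I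

/-- The probability space of the limit: for all `j ≤ q`, independent families of `k_j²` standard
Gaussian variables and of `k_j` centred Gaussian variables with variance `w_j`. -/
noncomputable def limitMeasure {q : ℕ} (k : Fin q → ℕ) (w : Fin q → ℝ) :
    Measure (((j : Fin q) → Fin (k j) → Fin (k j) → ℝ) × ((j : Fin q) → Fin (k j) → ℝ)) :=
  (Measure.pi fun j => Measure.pi fun _ : Fin (k j) => Measure.pi fun _ : Fin (k j) =>
      gaussianReal 0 1).prod
    (Measure.pi fun j => Measure.pi fun _ : Fin (k j) => gaussianReal 0 (w j).toNNReal)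

instance {q : ℕ} (k : Fin q → ℕ) (w : Fin q → ℝ) : IsProbabilityMeasure (limitMeasure k w) := by
  unfold limitMeasure; infer_instance

/-- `c M + D` with `M` from the GOE or GUE and `D` the diagonal matrix with entries `y`. -/
noncomputable def sumMatrix (𝕜 : Type*) [RCLike 𝕜] {k : ℕ} (c : ℝ) (x : Fin k → Fin k → ℝ)
    (y : Fin k → ℝ) : Matrix (Fin k) (Fin k) 𝕜 :=
  (c : 𝕜) • gaussianMatrix 𝕜 x + Matrix.diagonal (fun i => (y i : 𝕜))

/-- The matrix with the off-diagonal entries of `c M`, `M` from the GOE or GUE, and with diagonal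
entries `y`. -/
noncomputable def replacedMatrix (𝕜 : Type*) [RCLike 𝕜] {k : ℕ} (c : ℝ) (x : Fin k → Fin k → ℝ)
    (y : Fin k → ℝ) : Matrix (Fin k) (Fin k) 𝕜 :=
  Matrix.of fun i j => if i = j then (y i : 𝕜) else (c : 𝕜) * gaussianMatrix 𝕜 x i j

/-- The variance of the diagonal entries of `D_j`. -/
noncomputable def extraVar (μ : Measure ℝ) (l : ℝ → ℝ) (κ ρ : ℝ) : ℝ :=
  l ρ * κ / deriv (cauchyG μ) ρ ^ 2

open Classical in
/-- The total variance of the diagonal entries of the limit matrix: the diagonal entries of `c M`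
have variance `2 c²` in the real case and `c²` in the complex case. -/
noncomputable def totalVar (𝕜 : Type*) [RCLike 𝕜] (mod : Model) (μ : Measure ℝ) (l : ℝ → ℝ)
    (κ α ρ : ℝ) : ℝ :=
  (if IsRealCase 𝕜 then 2 else 1) * cConst mod μ α ρ ^ 2 + extraVar μ l κ ρ

end SpikedModel

namespace SpikedModel

set_option linter.unusedSectionVars false

/-! ### Moments from the logarithmic Sobolev inequality -/

section Moments

variable {𝕜 : Type*} [RCLike 𝕜]

/-! Deterministic part. Fix a spike `α > 0`, put `ρ = ρ_α` and let `U` have the perturbing vectors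
as columns, so that the perturbed matrix is `X + UΘU^*`. With `K(z) = U^*(z - X)⁻¹U`, an `r × r`
matrix, the number of eigenvalues of the perturbed matrix above a point `z` beyond the spectrum of
`X` is read off from the signs of the form `KΘK - K` (`le_eig_perturbation`, `eig_perturbation_le`).
At `z = ρ + x/√n` write `K = 1/α + E/√n`. Then `E` is close to `√n(K(ρ) - 1/α) - x s`, with `s = ∫
(ρ - y)⁻² dμ(y)` (`tendsto_rescaled_sub`), and `KΘK - K = (Θ - α)/α² + O(1/√n)`. Indices with `θ ≠
α` have their sign fixed at leading order. On the block `θ = α` the leading term vanishes and the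
sign is that of `E` (`exists_forall_form_pos`). Hence the rescaled outliers are asymptotically the
eigenvalues of the `α`-block of `√n(K(ρ) - 1/α)/s` (`tendsto_outlier`). Negative spikes follow by
the reflection `X ↦ -X`.

Reduction to quadratic forms. Up to `o(1)`, `√n(K(ρ) - 1/α)` is the matrix of `n^{-1/2}(g_s^* A g_t
- δ_st tr A)`, where `A` is the resolvent in the i.i.d. model and the resolvent minus its normalised
trace in the orthonormalised one: there `U^*U = 1`, so a multiple of the identity does not
fluctuate, and the Gram-Schmidt transition matrix tends to the identity (`rescaled_eq`,
`tendsto_rescaled_sub_qmat`).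

Central limit theorem. A real linear functional of all these matrices, over all spikes at once, is a
single quadratic form in independent real variables (`hermForm_tensorSum`, `quadForm_realMatrix`).
Its characteristic function `φ` nearly solves `φ' = -tVφ`: take out one variable at a time and
expand to second order (`norm_step_le`), then use that the sum of the conditional variances
concentrates at `V` (`integral_abs_sum_sub_quadVar_le`). This is `norm_charFun_quadForm_sub_le`. The
logarithmic Sobolev inequality serves only to provide moments of all orders. The variance is `τ ∑
|M_ij|² + κ₄ ∑ M_ii²`: the first term produces the GOE or GUE, the second one the additional
variance on the diagonal. Blocks of different spikes sit on disjoint index sets, so the cross terms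
vanish (`hermVar_tensorSum`), and this gives independence.

Assembly. Characteristic functions of the real coordinates of the blocks converge, and eigenvalues
are continuous functions of these coordinates (`tendstoInDistribution_eig`). The deterministic part
holds along every filter on which the needed quantities vanish or stay bounded. Second moment bounds
turn this into convergence in probability (`tendsto_measureReal_of_fluct`), and Slutsky's lemma
concludes. All this takes place on one infinite product space, which is enough since only the law of
the entries for each `n` matters. Finally, `v_j ≥ 0` because `κ₄ ≥ -τ` and the mean square of the
diagonal entries is at most the normalised Hilbert-Schmidt norm. -/

lemma sq_integral_add_le_entropy {Ω : Type*} [MeasurableSpace Ω] {ν : Measure Ω}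
    [IsProbabilityMeasure ν] {f : Ω → ℝ} (hf : MemLp f 2 ν) (h1 : ∀ x, 1 ≤ f x)
    (hint : Integrable (fun x => f x ^ 2 * Real.log (f x ^ 2 / ∫ y, f y ^ 2 ∂ν)) ν) :
    ∫ x, f x ^ 2 ∂ν ≤ (∫ x, f x ∂ν) ^ 2 +
      ∫ x, f x ^ 2 * Real.log (f x ^ 2 / ∫ y, f y ^ 2 ∂ν) ∂ν := by
  set m := ∫ y, f y ^ 2 ∂ν with hm
  set e := ∫ y, f y ∂ν with he
  have hi1 : Integrable f ν := hf.integrable (by norm_num)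
  have hi2 : Integrable (fun x => f x ^ 2) ν := hf.integrable_sq
  have hepos : 1 ≤ e := by
    have := integral_mono (integrable_const (1 : ℝ)) hi1 h1
    simpa using this
  have hmpos : 1 ≤ m := by
    have := integral_mono (integrable_const (1 : ℝ)) hi2 (fun x => one_le_pow₀ (h1 x))
    simpa using this
  have he0 : 0 < e := by linarith
  have hm0 : 0 < m := by linarith
  -- The logarithm is split as `2 log (f e / m) - log (e² / m)`, and then `log u ≥ 1 - 1/u` and `log
  -- u ≤ u - 1` are used. The split is chosen so that the integral of the left-hand side is exactly
  -- `m - e²`.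
  have key : ∀ x, 2 * f x ^ 2 - 2 * m / e * f x - (e ^ 2 / m - 1) * f x ^ 2
      ≤ f x ^ 2 * Real.log (f x ^ 2 / m) := by
    intro x
    have hfx : 0 < f x := by linarith [h1 x]
    have e1 : Real.log (f x ^ 2 / m) = 2 * Real.log (f x * e / m) - Real.log (e ^ 2 / m) := by
      rw [Real.log_div (by positivity) (by positivity), Real.log_div (by positivity) (by positivity),
        Real.log_div (by positivity) (by positivity), Real.log_mul (by positivity) (by positivity),
        Real.log_pow, Real.log_pow]
      push_cast; ring
    have e2 : 1 - (f x * e / m)⁻¹ ≤ Real.log (f x * e / m) :=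
      Real.one_sub_inv_le_log_of_pos (by positivity)
    have e3 : Real.log (e ^ 2 / m) ≤ e ^ 2 / m - 1 := Real.log_le_sub_one_of_pos (by positivity)
    have e4 : f x ^ 2 * (2 * (1 - (f x * e / m)⁻¹) - (e ^ 2 / m - 1))
        ≤ f x ^ 2 * Real.log (f x ^ 2 / m) := by
      rw [e1]; gcongr
    refine le_trans (le_of_eq ?_) e4
    field_simp
  have hi3 : Integrable (fun x => 2 * f x ^ 2 - 2 * m / e * f x - (e ^ 2 / m - 1) * f x ^ 2) ν :=
    ((hi2.const_mul _).sub (hi1.const_mul _)).sub (hi2.const_mul _)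
  have := integral_mono hi3 hint key
  have hi4 : Integrable (fun x => 2 * f x ^ 2 - 2 * m / e * f x) ν :=
    (hi2.const_mul _).sub (hi1.const_mul _)
  rw [integral_sub hi4 (hi2.const_mul _),
    integral_sub (hi2.const_mul _) (hi1.const_mul _), integral_const_mul, integral_const_mul,
    integral_const_mul, ← hm, ← he] at this
  have e5 : 2 * m - 2 * m / e * e - (e ^ 2 / m - 1) * m = m - e ^ 2 := by field_simp; ring
  linarith

/-- A bounded approximation of `t`. -/
noncomputable def cutoff (N t : ℝ) : ℝ := N * t / (N + t)

lemma cutoff_nonneg {N t : ℝ} (hN : 0 < N) (ht : 0 ≤ t) : 0 ≤ cutoff N t := by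
  unfold cutoff; positivity

lemma cutoff_le {N t : ℝ} (hN : 0 < N) (ht : 0 ≤ t) : cutoff N t ≤ t := by
  unfold cutoff
  rw [div_le_iff₀ (by positivity)]; nlinarith [mul_nonneg ht ht]

lemma cutoff_le_left {N t : ℝ} (hN : 0 < N) (ht : 0 ≤ t) : cutoff N t ≤ N := by
  unfold cutoff
  rw [div_le_iff₀ (by positivity)]; nlinarith [mul_pos hN hN]

lemma tendsto_cutoff (t : ℝ) : Tendsto (fun n : ℕ => cutoff (n + 1) t) atTop (𝓝 t) := by
  have h1 : Tendsto (fun n : ℕ => (n : ℝ) + 1) atTop atTop :=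
    tendsto_atTop_add_const_right _ _ tendsto_natCast_atTop_atTop
  have h2 : Tendsto (fun n : ℕ => t / (1 + t / ((n : ℝ) + 1))) atTop (𝓝 (t / (1 + 0))) :=
    tendsto_const_nhds.div (tendsto_const_nhds.add (tendsto_const_nhds.div_atTop h1)) (by simp)
  rw [add_zero, div_one] at h2
  refine h2.congr fun n => ?_
  have : (n : ℝ) + 1 ≠ 0 := by positivity
  unfold cutoff
  field_simp

lemma norm_sq_eq_re_im (x : 𝕜) : ‖x‖ ^ 2 = RCLike.re x ^ 2 + RCLike.im x ^ 2 := by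
  rw [← RCLike.normSq_eq_def', RCLike.normSq_apply]; ring

/-- Computed from `re² + im²`, which treats both fields at once. The constant `4` is not optimal;
only linear growth in `‖x‖` matters. -/
lemma hasFDerivAt_norm_sq (x : 𝕜) :
    ∃ L : 𝕜 →L[ℝ] ℝ, HasFDerivAt (fun y : 𝕜 => ‖y‖ ^ 2) L x ∧ ‖L‖ ≤ 4 * ‖x‖ := by
  have h1 : HasFDerivAt (fun y : 𝕜 => RCLike.re y) (RCLike.reCLM : 𝕜 →L[ℝ] ℝ) x :=
    (RCLike.reCLM : 𝕜 →L[ℝ] ℝ).hasFDerivAt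
  have h2 : HasFDerivAt (fun y : 𝕜 => RCLike.im y) (RCLike.imCLM : 𝕜 →L[ℝ] ℝ) x :=
    (RCLike.imCLM : 𝕜 →L[ℝ] ℝ).hasFDerivAt
  have h3 := (h1.pow 2).add (h2.pow 2)
  refine ⟨_, h3.congr_of_eventuallyEq (Eventually.of_forall fun y => by
    simp [norm_sq_eq_re_im]), ?_⟩
  refine ContinuousLinearMap.opNorm_le_bound _ (by positivity) fun y => ?_
  have a1 := RCLike.abs_re_le_norm x
  have a2 := RCLike.abs_im_le_norm x
  have a3 := RCLike.abs_re_le_norm y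
  have a4 := RCLike.abs_im_le_norm y
  have e : ‖(RCLike.re x) * (RCLike.re y) + (RCLike.im x) * RCLike.im y‖ ≤ 2 * (‖x‖ * ‖y‖) := by
    refine (norm_add_le _ _).trans ?_
    rw [norm_mul, norm_mul]
    simp only [Real.norm_eq_abs]
    have := mul_le_mul a1 a3 (abs_nonneg _) (norm_nonneg _)
    have := mul_le_mul a2 a4 (abs_nonneg _) (norm_nonneg _)
    linarith
  have e2 : ‖(2 : ℝ) * ((RCLike.re x) * (RCLike.re y) + (RCLike.im x) * RCLike.im y)‖
      ≤ 2 * (2 * (‖x‖ * ‖y‖)) := by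
    rw [norm_mul]; simp only [Real.norm_ofNat]; linarith
  refine le_trans (le_of_eq ?_) (e2.trans (le_of_eq (by ring)))
  congr 1
  simp
  ring

/-- The inductive step for moments. The Sobolev inequality is applied to `(1 + w)^((k+1)/2)`, with
`w` a bounded truncation of `‖x‖²`. The mean of this function is at most the `k`-th moment `J`,
because `k + 1 ≤ 2k`, and so is its squared gradient up to a constant. Hence its second moment is
bounded uniformly in the truncation, which Fatou's lemma removes. -/
lemma integrable_moment_succ {ν : Measure 𝕜} [IsProbabilityMeasure ν] (hν : LogSobolev ν) {k : ℕ}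
    (hk : 1 ≤ k) (h : Integrable (fun x => (1 + ‖x‖ ^ 2) ^ k) ν) :
    Integrable (fun x => (1 + ‖x‖ ^ 2) ^ (k + 1)) ν := by
  obtain ⟨c, hc, hls⟩ := hν
  set J := ∫ x, (1 + ‖x‖ ^ 2) ^ k ∂ν with hJ
  have bound : ∀ N : ℝ, 0 < N → ∫ x, (1 + cutoff N (‖x‖ ^ 2)) ^ (k + 1) ∂ν
      ≤ J ^ 2 + 2 * c * ((2 * (k + 1)) ^ 2 * J) := by
    intro N hN
    let f : 𝕜 → ℝ := fun x => √(1 + cutoff N (‖x‖ ^ 2)) ^ (k + 1)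
    have hw0 : ∀ x : 𝕜, 0 ≤ cutoff N (‖x‖ ^ 2) := fun x => cutoff_nonneg hN (by positivity)
    have hs1 : ∀ x : 𝕜, 1 ≤ √(1 + cutoff N (‖x‖ ^ 2)) := fun x =>
      Real.one_le_sqrt.2 (by linarith [hw0 x])
    have hf1 : ∀ x, 1 ≤ f x := fun x => one_le_pow₀ (hs1 x)
    have hsq : ∀ x, f x ^ 2 = (1 + cutoff N (‖x‖ ^ 2)) ^ (k + 1) := by
      intro x
      simp only [f]
      rw [← pow_mul, mul_comm, pow_mul, Real.sq_sqrt (by linarith [hw0 x])]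
    have hfle : ∀ x, f x ≤ (1 + ‖x‖ ^ 2) ^ k := by
      intro x
      calc f x ≤ √(1 + cutoff N (‖x‖ ^ 2)) ^ (2 * k) := pow_le_pow_right₀ (hs1 x) (by omega)
        _ = (1 + cutoff N (‖x‖ ^ 2)) ^ k := by
          rw [pow_mul, Real.sq_sqrt (by linarith [hw0 x])]
        _ ≤ (1 + ‖x‖ ^ 2) ^ k := by
          have := cutoff_le hN (sq_nonneg ‖x‖)
          have := hw0 x
          gcongr
    have hderiv : ∀ x : 𝕜, ∃ L : 𝕜 →L[ℝ] ℝ, HasFDerivAt f L x ∧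
        ‖L‖ ^ 2 ≤ (2 * (k + 1)) ^ 2 * (1 + ‖x‖ ^ 2) ^ k := by
      intro x
      obtain ⟨L, hL, hLn⟩ := hasFDerivAt_norm_sq x
      set t := ‖x‖ ^ 2 with ht
      have ht0 : 0 ≤ t := by positivity
      have hNt : N + t ≠ 0 := by positivity
      have hw : HasDerivAt (cutoff N) (N ^ 2 / (N + t) ^ 2) t := by
        have h1 := ((hasDerivAt_id t).const_mul N).div ((hasDerivAt_id t).const_add N) hNt
        refine h1.congr_deriv ?_
        simp only [id]
        field_simp
        ring
      have hpos : 0 < 1 + cutoff N t := by linarith [hw0 x]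
      have hH := ((hw.const_add 1).sqrt hpos.ne').pow (k + 1)
      have hF := hH.comp_hasFDerivAt x hL
      refine ⟨_, hF, ?_⟩
      rw [norm_smul]
      set s := √(1 + cutoff N t) with hs
      have hs1' : 1 ≤ s := hs1 x
      have hd1 : N ^ 2 / (N + t) ^ 2 ≤ 1 := by
        rw [div_le_one (by positivity)]
        exact pow_le_pow_left₀ hN.le (by linarith) 2
      have hd0 : 0 ≤ N ^ 2 / (N + t) ^ 2 := by positivity
      -- The derivative of the square root contributes `1/(2s)`, which cancels one factor of `s^k`.
      -- The squared gradient then carries `s^(2(k-1)) ‖x‖²`, and `‖x‖² ≤ 1 + ‖x‖²` restores the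
      -- power `k`.
      obtain ⟨l, rfl⟩ : ∃ l, k = l + 1 := ⟨k - 1, by omega⟩
      have hn : ‖(((l + 1 + 1 : ℕ) : ℝ) * s ^ (l + 1 + 1 - 1) *
          (N ^ 2 / (N + t) ^ 2 / (2 * s)))‖ ≤ ((l + 1 + 1 : ℕ) : ℝ) / 2 * s ^ l := by
        rw [Real.norm_of_nonneg (by positivity)]
        simp only [Nat.add_sub_cancel]
        rw [pow_succ]
        calc ((l + 1 + 1 : ℕ) : ℝ) * (s ^ l * s) * (N ^ 2 / (N + t) ^ 2 / (2 * s))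
            = ((l + 1 + 1 : ℕ) : ℝ) / 2 * s ^ l * (N ^ 2 / (N + t) ^ 2) := by
              field_simp
          _ ≤ ((l + 1 + 1 : ℕ) : ℝ) / 2 * s ^ l * 1 := by gcongr
          _ = _ := by ring
      have hss : (s ^ l) ^ 2 ≤ (1 + t) ^ l := by
        rw [← pow_mul, mul_comm, pow_mul, hs, Real.sq_sqrt hpos.le]
        have := cutoff_le hN ht0
        gcongr
      calc _ ≤ (((l + 1 + 1 : ℕ) : ℝ) / 2 * s ^ l * (4 * ‖x‖)) ^ 2 := by
            gcongr
        _ = (2 * ((l + 1 : ℕ) + 1 : ℝ)) ^ 2 * ((s ^ l) ^ 2 * t) := by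
            rw [ht]; push_cast; ring
        _ ≤ (2 * ((l + 1 : ℕ) + 1 : ℝ)) ^ 2 * ((1 + t) ^ l * (1 + t)) := by
            gcongr; linarith
        _ = _ := by rw [← pow_succ]
    choose L hL hLn using hderiv
    have hdiff : Differentiable ℝ f := fun x => (hL x).differentiableAt
    have hfd : ∀ x, fderiv ℝ f x = L x := fun x => (hL x).fderiv
    have hfb : ∀ x, ‖f x‖ ≤ √(1 + N) ^ (k + 1) := by
      intro x
      rw [Real.norm_of_nonneg (by linarith [hf1 x])]
      have := cutoff_le_left hN (sq_nonneg ‖x‖)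
      simp only [f]
      gcongr
    have hmem : MemLp f 2 ν :=
      MemLp.of_bound hdiff.continuous.aestronglyMeasurable _ (Eventually.of_forall hfb)
    have hgrad : Integrable (fun x => ‖fderiv ℝ f x‖ ^ 2) ν := by
      refine (h.const_mul ((2 * (k + 1)) ^ 2 : ℝ)).mono'
        ((measurable_fderiv ℝ f).norm.pow_const 2).aestronglyMeasurable
        (Eventually.of_forall fun x => ?_)
      rw [Real.norm_of_nonneg (by positivity), hfd]
      exact hLn x
    obtain ⟨hI, hle⟩ := hls f hdiff hmem hgrad
    have h1 := sq_integral_add_le_entropy hmem hf1 hI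
    have h2 : ∫ x, ‖fderiv ℝ f x‖ ^ 2 ∂ν ≤ (2 * (k + 1)) ^ 2 * J := by
      rw [hJ, ← integral_const_mul]
      refine integral_mono hgrad (h.const_mul _) fun x => ?_
      simp only [hfd]; exact hLn x
    have h3 : ∫ x, f x ∂ν ≤ J := integral_mono (hmem.integrable (by norm_num)) h hfle
    have h4 : 0 ≤ ∫ x, f x ∂ν := integral_nonneg fun x => by
      simpa using (zero_le_one.trans (hf1 x))
    simp_rw [hsq] at h1 hle
    calc _ ≤ _ := h1
      _ ≤ J ^ 2 + 2 * c * ((2 * (k + 1)) ^ 2 * J) := by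
        refine add_le_add (pow_le_pow_left₀ h4 h3 2) (hle.trans ?_)
        gcongr
  set K := J ^ 2 + 2 * c * ((2 * (k + 1)) ^ 2 * J) with hK
  refine ⟨by fun_prop, ?_⟩
  have hlim : ∀ x : 𝕜, Tendsto (fun n : ℕ => ENNReal.ofReal
      ((1 + cutoff (n + 1) (‖x‖ ^ 2)) ^ (k + 1))) atTop
      (𝓝 (ENNReal.ofReal ((1 + ‖x‖ ^ 2) ^ (k + 1)))) := fun x =>
    ENNReal.tendsto_ofReal ((tendsto_const_nhds.add (tendsto_cutoff _)).pow _)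
  have hmeas : ∀ n : ℕ, Measurable (fun x : 𝕜 => (1 + cutoff (n + 1) (‖x‖ ^ 2)) ^ (k + 1)) := by
    intro n; unfold cutoff; fun_prop
  have hpos : ∀ (n : ℕ) (x : 𝕜), 0 ≤ cutoff (n + 1) (‖x‖ ^ 2) := fun n x =>
    cutoff_nonneg (by positivity) (by positivity)
  have hN : ∀ n : ℕ, ∫⁻ x, ENNReal.ofReal ((1 + cutoff (n + 1) (‖x‖ ^ 2)) ^ (k + 1)) ∂ν
      ≤ ENNReal.ofReal K := by
    intro n
    rw [← ofReal_integral_eq_lintegral_ofReal]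
    · exact ENNReal.ofReal_le_ofReal (bound (n + 1) (by positivity))
    · refine Integrable.of_bound (hmeas n).aestronglyMeasurable ((1 + (n + 1)) ^ (k + 1))
        (Eventually.of_forall fun x => ?_)
      have h0 := hpos n x
      rw [Real.norm_of_nonneg (by positivity)]
      have := cutoff_le_left (N := (n : ℝ) + 1) (by positivity) (sq_nonneg ‖x‖)
      gcongr
    · exact Eventually.of_forall fun x => by have := hpos n x; positivity
  unfold HasFiniteIntegral
  calc ∫⁻ x, ‖(1 + ‖x‖ ^ 2) ^ (k + 1)‖ₑ ∂ν
      = ∫⁻ x, liminf (fun n : ℕ => ENNReal.ofReal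
          ((1 + cutoff (n + 1) (‖x‖ ^ 2)) ^ (k + 1))) atTop ∂ν := by
        refine lintegral_congr fun x => ?_
        rw [(hlim x).liminf_eq, Real.enorm_eq_ofReal (by positivity)]
    _ ≤ liminf (fun n : ℕ => ∫⁻ x, ENNReal.ofReal
          ((1 + cutoff (n + 1) (‖x‖ ^ 2)) ^ (k + 1)) ∂ν) atTop :=
        lintegral_liminf_le fun n => (hmeas n).ennreal_ofReal
    _ ≤ ENNReal.ofReal K := by
        refine liminf_le_of_le (by isBoundedDefault) fun b hb => ?_
        obtain ⟨n, hn⟩ := hb.exists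
        exact hn.trans (hN n)
    _ < ⊤ := ENNReal.ofReal_lt_top

/-- A measure satisfying a logarithmic Sobolev inequality and with finite second moment has finite
moments of all orders. -/
lemma LogSobolev.memLp {ν : Measure 𝕜} [IsProbabilityMeasure ν] (hν : LogSobolev ν)
    (h2 : Integrable (fun x => ‖x‖ ^ 2) ν) (p : NNReal) : MemLp (fun x : 𝕜 => x) p ν := by
  have hk : ∀ k : ℕ, 1 ≤ k → Integrable (fun x : 𝕜 => (1 + ‖x‖ ^ 2) ^ k) ν := by
    intro k hk
    induction k, hk using Nat.le_induction with
    | base => simpa using (integrable_const (1 : ℝ)).add h2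
    | succ k hk ih => exact integrable_moment_succ hν hk ih
  obtain ⟨k, hkp⟩ := exists_nat_ge p
  have hm : MemLp (fun x : 𝕜 => x) ((2 * (k + 1) : ℕ) : ENNReal) ν := by
    have hi : Integrable (fun x : 𝕜 => ‖x‖ ^ (2 * (k + 1))) ν := by
      refine (hk (k + 1) (by omega)).mono' (by fun_prop) (Eventually.of_forall fun x => ?_)
      rw [Real.norm_of_nonneg (by positivity), pow_mul]
      gcongr; linarith
    rw [← integrable_norm_rpow_iff (by fun_prop) (by simp) (ENNReal.natCast_ne_top _),
      ENNReal.toReal_natCast]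
    simpa only [Real.rpow_natCast] using hi
  refine hm.mono_exponent ?_
  have : (p : ENNReal) ≤ (k : ENNReal) := by exact_mod_cast hkp
  refine this.trans ?_
  exact_mod_cast (by omega : k ≤ 2 * (k + 1))

end Moments

/-! ### Functions with moments of all orders -/

section AllMoments

variable {Ω : Type*} [MeasurableSpace Ω] {P : Measure Ω} [IsProbabilityMeasure P]

/-- All moments of `f` are finite. -/
def AllMoments (f : Ω → ℝ) (P : Measure Ω) : Prop :=
  AEStronglyMeasurable f P ∧ ∀ k : ℕ, Integrable (fun ω => |f ω| ^ k) P

lemma AllMoments.integrable {f : Ω → ℝ} (hf : AllMoments f P) : Integrable f P := by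
  have := hf.2 1
  simp only [pow_one] at this
  exact (integrable_norm_iff hf.1).1 this

lemma AllMoments.of_abs_le {f g : Ω → ℝ} (hg : AllMoments g P) (hf : AEStronglyMeasurable f P)
    (h : ∀ ω, |f ω| ≤ |g ω|) : AllMoments f P := by
  refine ⟨hf, fun k => (hg.2 k).mono' (hf.norm.pow k) (Eventually.of_forall fun ω => ?_)⟩
  rw [Real.norm_of_nonneg (by positivity)]
  exact pow_le_pow_left₀ (abs_nonneg _) (h ω) k

lemma AllMoments.const (c : ℝ) : AllMoments (fun _ => c) P :=
  ⟨aestronglyMeasurable_const, fun _ => integrable_const _⟩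

lemma AllMoments.abs {f : Ω → ℝ} (hf : AllMoments f P) : AllMoments (fun ω => |f ω|) P :=
  hf.of_abs_le hf.1.norm fun ω => by simp

lemma AllMoments.add {f g : Ω → ℝ} (hf : AllMoments f P) (hg : AllMoments g P) :
    AllMoments (fun ω => f ω + g ω) P := by
  refine ⟨hf.1.add hg.1, fun k => ?_⟩
  refine (((hf.2 k).add (hg.2 k)).const_mul (2 ^ (k - 1))).mono' ((hf.1.add hg.1).norm.pow k)
    (Eventually.of_forall fun ω => ?_)
  rw [Real.norm_of_nonneg (by positivity)]
  refine (pow_le_pow_left₀ (abs_nonneg _) (abs_add_le _ _) k).trans ?_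
  exact add_pow_le (abs_nonneg _) (abs_nonneg _) k

lemma AllMoments.mul {f g : Ω → ℝ} (hf : AllMoments f P) (hg : AllMoments g P) :
    AllMoments (fun ω => f ω * g ω) P := by
  refine ⟨hf.1.mul hg.1, fun k => ?_⟩
  refine ((hf.2 (k * 2)).add (hg.2 (k * 2))).mono' ((hf.1.mul hg.1).norm.pow k)
    (Eventually.of_forall fun ω => ?_)
  rw [Real.norm_of_nonneg (by positivity), abs_mul, mul_pow]
  simp only [Pi.add_apply, pow_mul]
  nlinarith [sq_nonneg (|f ω| ^ k - |g ω| ^ k), sq_nonneg (|f ω| ^ k), sq_nonneg (|g ω| ^ k)]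

lemma AllMoments.const_mul {f : Ω → ℝ} (hf : AllMoments f P) (c : ℝ) :
    AllMoments (fun ω => c * f ω) P := (AllMoments.const c).mul hf

lemma AllMoments.sub {f g : Ω → ℝ} (hf : AllMoments f P) (hg : AllMoments g P) :
    AllMoments (fun ω => f ω - g ω) P := by
  have := hf.add (hg.const_mul (-1))
  simpa [sub_eq_add_neg] using this

lemma AllMoments.pow {f : Ω → ℝ} (hf : AllMoments f P) (k : ℕ) :
    AllMoments (fun ω => f ω ^ k) P := by
  induction k with
  | zero => simpa using AllMoments.const (P := P) 1
  | succ k ih => simpa [pow_succ] using ih.mul hf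

lemma AllMoments.sum {κ : Type*} {f : κ → Ω → ℝ} (s : Finset κ) (hf : ∀ i ∈ s, AllMoments (f i) P) :
    AllMoments (fun ω => ∑ i ∈ s, f i ω) P := by
  classical
  induction s using Finset.induction_on with
  | empty => simpa using AllMoments.const (P := P) 0
  | insert i s hi ih =>
    simp only [Finset.sum_insert hi]
    exact (hf i (by simp)).add (ih fun j hj => hf j (by simp [hj]))

lemma AllMoments.of_comp {ν : Measure ℝ} {X : Ω → ℝ} (hX : HasLaw X ν P) {f : ℝ → ℝ}
    (hf : AllMoments f ν) : AllMoments (fun ω => f (X ω)) P := by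
  have hm := hX.map_eq
  subst hm
  exact ⟨hf.1.comp_aemeasurable hX.aemeasurable, fun k => (hf.2 k).comp_aemeasurable hX.aemeasurable⟩

/-- The variance of `|f|` is nonnegative. -/
lemma integral_abs_le_sqrt {f : Ω → ℝ} (hf : AllMoments f P) {K : ℝ}
    (h : ∫ ω, f ω ^ 2 ∂P ≤ K) : ∫ ω, |f ω| ∂P ≤ √K := by
  refine Real.le_sqrt_of_sq_le (le_trans ?_ h)
  set e := ∫ ω, |f ω| ∂P with he
  have h0 : 0 ≤ ∫ ω, (|f ω| - e) ^ 2 ∂P := integral_nonneg fun ω => by positivity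
  have e1 : ∀ ω, (|f ω| - e) ^ 2 = f ω ^ 2 - 2 * e * |f ω| + e ^ 2 := fun ω => by
    rw [sub_sq, sq_abs]; ring
  simp_rw [e1] at h0
  rw [integral_add ((hf.pow 2).sub (hf.abs.const_mul _)).integrable (integrable_const _),
    integral_sub (hf.pow 2).integrable (hf.abs.const_mul _).integrable, integral_const_mul,
    ← he] at h0
  simp at h0
  nlinarith

end AllMoments

/-! ### Characters -/

/-- The character `u ↦ e^{iu}`. -/
noncomputable def cis (u : ℝ) : ℂ := Complex.exp (u * Complex.I)

lemma norm_cis (u : ℝ) : ‖cis u‖ = 1 := Complex.norm_exp_ofReal_mul_I u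

lemma cis_add (u v : ℝ) : cis (u + v) = cis u * cis v := by
  unfold cis; push_cast; rw [add_mul, Complex.exp_add]

@[simp] lemma cis_zero : cis 0 = 1 := by simp [cis]

lemma continuous_cis : Continuous cis := by unfold cis; fun_prop

lemma norm_cis_sub_one_le (u : ℝ) : ‖cis u - 1‖ ≤ |u| := by
  unfold cis; rw [mul_comm]; exact Real.norm_exp_I_mul_ofReal_sub_one_le

/-- Taylor's formula for `|u| ≤ 1`, the triangle inequality and `|u| ≤ u²` otherwise. A bound valid
for all `u` spares any truncation later on. -/
lemma norm_cis_sub_le (u : ℝ) : ‖cis u - 1 - u * Complex.I‖ ≤ 2 * u ^ 2 := by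
  by_cases h : |u| ≤ 1
  · have := Complex.norm_exp_sub_one_sub_id_le (x := u * Complex.I) (by simpa using h)
    simp at this
    unfold cis
    nlinarith [sq_nonneg u]
  · push Not at h
    have h1 := norm_sub_le (cis u - 1) (u * Complex.I)
    have h2 := norm_cis_sub_one_le u
    simp only [norm_mul, Complex.norm_I, mul_one, Complex.norm_real, Real.norm_eq_abs] at h1
    have : |u| ≤ u ^ 2 := by rw [← sq_abs]; nlinarith
    linarith

lemma hasDerivAt_cis_mul (q s : ℝ) :
    HasDerivAt (fun s : ℝ => cis (s * q)) (q * Complex.I * cis (s * q)) s := by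
  unfold cis
  have h1 : HasDerivAt (fun s : ℝ => ((s * q : ℝ) : ℂ) * Complex.I) (q * Complex.I) s := by
    have : HasDerivAt (fun s : ℝ => ((s * q : ℝ) : ℂ)) (q : ℂ) s := by
      have := ((hasDerivAt_id s).mul_const q).ofReal_comp
      simpa using this
    exact this.mul_const _
  have := h1.cexp
  rwa [mul_comm] at this

/-! ### One step of the leave-one-out argument -/

/-- A standardised real law with moments of all orders. -/
structure StdLaw (ν : Measure ℝ) : Prop where
  isProbabilityMeasure : IsProbabilityMeasure ν
  moments : AllMoments (fun x : ℝ => x) ν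
  mean : ∫ x, x ∂ν = 0
  var : ∫ x, x ^ 2 ∂ν = 1

/-- Covariance of `x` and `x² - 1`. -/
noncomputable def skew (ν : Measure ℝ) : ℝ := ∫ x, x * (x ^ 2 - 1) ∂ν

/-- Variance of `x²`. -/
noncomputable def sqVar (ν : Measure ℝ) : ℝ := ∫ x, (x ^ 2 - 1) ^ 2 ∂ν

lemma sqVar_nonneg (ν : Measure ℝ) : 0 ≤ sqVar ν := integral_nonneg fun x => by positivity

/-- The function of one variable in the error bound of the leave-one-out argument. -/
noncomputable def stepFun (ν : Measure ℝ) (x : ℝ) : ℝ :=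
  4 * (8 * (1 + |x| + |x ^ 2 - 1|) ^ 3 + 2 * (2 + 3 * |skew ν| + sqVar ν) *
    (1 + |x| + |x ^ 2 - 1|))

/-- The constant in the error bound of the leave-one-out argument. -/
noncomputable def stepConst (ν : Measure ℝ) : ℝ := ∫ x, stepFun ν x ∂ν

lemma stepFun_nonneg (ν : Measure ℝ) (x : ℝ) : 0 ≤ stepFun ν x := by
  have := sqVar_nonneg ν
  unfold stepFun; positivity

lemma stepConst_nonneg (ν : Measure ℝ) : 0 ≤ stepConst ν := integral_nonneg (stepFun_nonneg ν)

/-- All three factors are bounded by a function of `x` times a power of `|L| + |b|`, so the total is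
cubic in `|L| + |b|`. The shape of the result, a function of `x` times a function of `(L, b)`, lets
the expectation factorise under independence. -/
lemma step_pointwise {x L b m v : ℝ} (hv : 0 ≤ v) :
    2 * |x * L + b * (x ^ 2 - 1)| * (2 * x * L + b * (x ^ 2 - 1)) ^ 2 +
      |2 * L ^ 2 + 3 * m * b * L + v * b ^ 2| * |2 * x * L + b * (x ^ 2 - 1)| ≤
    4 * (8 * (1 + |x| + |x ^ 2 - 1|) ^ 3 + 2 * (2 + 3 * |m| + v) * (1 + |x| + |x ^ 2 - 1|)) *
      (|L| ^ 3 + |b| ^ 3) := by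
  set U := 1 + |x| + |x ^ 2 - 1| with hU
  set T := |L| + |b| with hT
  set K := 2 + 3 * |m| + v with hK
  have x0 := abs_nonneg x
  have y0 := abs_nonneg (x ^ 2 - 1)
  have l0 := abs_nonneg L
  have b0 := abs_nonneg b
  have m0 := abs_nonneg m
  have hq : |x * L + b * (x ^ 2 - 1)| ≤ U * T := by
    refine (abs_add_le _ _).trans ?_
    rw [abs_mul, abs_mul, hU, hT]
    nlinarith [mul_nonneg x0 b0, mul_nonneg y0 l0]
  have hD : |2 * x * L + b * (x ^ 2 - 1)| ≤ 2 * (U * T) := by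
    refine (abs_add_le _ _).trans ?_
    rw [abs_mul, abs_mul, abs_mul, abs_two, hU, hT]
    nlinarith [mul_nonneg x0 b0, mul_nonneg y0 l0, mul_nonneg y0 b0]
  have hW : |2 * L ^ 2 + 3 * m * b * L + v * b ^ 2| ≤ K * T ^ 2 := by
    refine (abs_add_le _ _).trans ((add_le_add_left (abs_add_le _ _) _).trans ?_)
    rw [abs_mul, abs_mul, abs_mul, abs_mul, abs_mul, abs_pow, abs_pow, abs_of_nonneg hv, abs_two,
      abs_of_pos (by norm_num : (0 : ℝ) < 3), hK, hT]
    have h1 := mul_nonneg l0 b0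
    have h2 := mul_nonneg m0 (sq_nonneg |L|)
    have h3 := mul_nonneg m0 (sq_nonneg |b|)
    have h4 := mul_nonneg hv (sq_nonneg |L|)
    have h5 := mul_nonneg hv h1
    have h6 := mul_nonneg m0 h1
    nlinarith [sq_nonneg |b|]
  have hT3 : T ^ 3 ≤ 4 * (|L| ^ 3 + |b| ^ 3) := by
    rw [hT]
    nlinarith [mul_nonneg (add_nonneg l0 b0) (sq_nonneg (|L| - |b|))]
  have hU0 : 0 ≤ U := by positivity
  have hT0 : 0 ≤ T := by positivity
  have hK0 : 0 ≤ K := by positivity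
  calc _ ≤ 2 * (U * T) * (2 * (U * T)) ^ 2 + K * T ^ 2 * (2 * (U * T)) := by
        refine add_le_add ?_ ?_
        · rw [← sq_abs (2 * x * L + b * (x ^ 2 - 1))]
          gcongr
        · gcongr
    _ = (8 * U ^ 3 + 2 * K * U) * T ^ 3 := by ring
    _ ≤ (8 * U ^ 3 + 2 * K * U) * (4 * (|L| ^ 3 + |b| ^ 3)) := by gcongr
    _ = _ := by ring

section Step

variable {Ω : Type*} [MeasurableSpace Ω] {P : Measure Ω} [IsProbabilityMeasure P]
variable {ν : Measure ℝ}

lemma StdLaw.poly (hν : StdLaw ν) : AllMoments (fun x : ℝ => x ^ 2 - 1) ν := by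
  have := hν.isProbabilityMeasure
  exact (hν.moments.pow 2).sub (AllMoments.const 1)

lemma StdLaw.stepFun_moments (hν : StdLaw ν) : AllMoments (stepFun ν) ν := by
  have := hν.isProbabilityMeasure
  have hU : AllMoments (fun x : ℝ => 1 + |x| + |x ^ 2 - 1|) ν :=
    ((AllMoments.const 1).add hν.moments.abs).add hν.poly.abs
  exact (((hU.pow 3).const_mul 8).add (hU.const_mul _)).const_mul 4

lemma integral_centred_mul {X L R : Ω → ℝ} (hX : HasLaw X ν P) (hL : Measurable L)
    (hR : Measurable R) (hind : IndepFun X (fun ω => (L ω, R ω)) P) {f : ℝ → ℝ} (hf : Measurable f)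
    (h0 : ∫ x, f x ∂ν = 0) {h : ℝ × ℝ → ℂ} (hh : Measurable h) :
    ∫ ω, (f (X ω) : ℂ) * h (L ω, R ω) ∂P = 0 := by
  rw [hind.integral_fun_comp_mul_comp (f := fun x => (f x : ℂ)) hX.aemeasurable
    (hL.prodMk hR).aemeasurable (by fun_prop) (by fun_prop)]
  have : ∫ ω, (f (X ω) : ℂ) ∂P = 0 := by
    rw [integral_complex_ofReal]
    have h1 : ∫ ω, f (X ω) ∂P = ∫ x, f x ∂ν := by
      rw [← hX.map_eq, integral_map hX.aemeasurable (by fun_prop)]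
    rw [h1, h0]; simp
  rw [this, zero_mul]

lemma integrable_mul_of_norm_one {f : Ω → ℝ} (hf : AllMoments f P) {g : Ω → ℂ} (hg : Measurable g)
    (h1 : ∀ ω, ‖g ω‖ ≤ 1) : Integrable (fun ω => (f ω : ℂ) * g ω) P := by
  refine hf.integrable.norm.mono' ?_ (Eventually.of_forall fun ω => ?_)
  · exact (Complex.continuous_ofReal.comp_aestronglyMeasurable hf.1).mul hg.aestronglyMeasurable
  · rw [norm_mul, Complex.norm_real]
    exact mul_le_of_le_one_right (norm_nonneg _) (h1 ω)

/-- One variable `X` is taken out of a quadratic form `R + D`, where `D = 2XL + b(X² - 1)` carries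
all its dependence on `X`. Expand `e^{itD}` to first order in the expectation of `(XL + b(X² - 1))
e^{it(R + D)}`: the constant term vanishes because `X` and `X² - 1` are centred, and the linear term
has conditional mean `it(2L² + 3 skew b L + sqVar b²) e^{itR}`. There `e^{itR}` is replaced by the
full exponential at the price of another factor `|tD|`. Both errors are of order `t²` and cubic in
`(L, b)`. -/
lemma norm_step_le (hν : StdLaw ν) {X L R : Ω → ℝ} (hX : HasLaw X ν P) (hL : Measurable L)
    (hR : Measurable R) (hXm : Measurable X) (hLm : AllMoments L P)
    (hind : IndepFun X (fun ω => (L ω, R ω)) P) (b t : ℝ) :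
    ‖∫ ω, ((X ω * L ω + b * (X ω ^ 2 - 1) : ℝ) : ℂ) *
        cis (t * (R ω + (2 * X ω * L ω + b * (X ω ^ 2 - 1)))) ∂P -
      t * Complex.I * ∫ ω, ((2 * L ω ^ 2 + 3 * skew ν * b * L ω + sqVar ν * b ^ 2 : ℝ) : ℂ) *
        cis (t * (R ω + (2 * X ω * L ω + b * (X ω ^ 2 - 1)))) ∂P‖
    ≤ t ^ 2 * (stepConst ν * (∫ ω, |L ω| ^ 3 ∂P + |b| ^ 3)) := by
  have hpν := hν.isProbabilityMeasure
  set m := skew ν with hm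
  set v := sqVar ν with hv
  have hcm : Measurable cis := continuous_cis.measurable
  have mX : AllMoments X P := AllMoments.of_comp hX hν.moments
  have mY : AllMoments (fun ω => X ω ^ 2 - 1) P := AllMoments.of_comp hX hν.poly
  have mq : AllMoments (fun ω => X ω * L ω + b * (X ω ^ 2 - 1)) P :=
    (mX.mul hLm).add (mY.const_mul b)
  have mW : AllMoments (fun ω => 2 * L ω ^ 2 + 3 * m * b * L ω + v * b ^ 2) P :=
    (((hLm.pow 2).const_mul 2).add (hLm.const_mul _)).add (AllMoments.const _)
  have n1 : ∀ u, ‖cis u‖ ≤ 1 := fun u => (norm_cis u).le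
  set E : Ω → ℂ := fun ω => cis (t * (R ω + (2 * X ω * L ω + b * (X ω ^ 2 - 1)))) with hE
  have hEm : Measurable E := by fun_prop
  have iq := integrable_mul_of_norm_one mq hEm fun ω => n1 _
  have iW := integrable_mul_of_norm_one mW hEm fun ω => n1 _
  -- The terms of mean zero in the expansion: `c1` and `c2` come from order zero, while `c3`, `c4`,
  -- `c5` come from order one, with `X² - 1`, `X(X² - 1)` and `(X² - 1)²` centred. Subtracting them
  -- leaves only the Taylor remainders.
  let c1 : Ω → ℂ := fun ω => (X ω : ℂ) * ((L ω : ℂ) * cis (t * R ω))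
  let c2 : Ω → ℂ := fun ω => ((X ω ^ 2 - 1 : ℝ) : ℂ) * ((b : ℂ) * cis (t * R ω))
  let c3 : Ω → ℂ := fun ω => ((X ω ^ 2 - 1 : ℝ) : ℂ) *
    ((t * Complex.I) * ((2 * L ω ^ 2 : ℝ) : ℂ) * cis (t * R ω))
  let c4 : Ω → ℂ := fun ω => ((X ω * (X ω ^ 2 - 1) - m : ℝ) : ℂ) *
    ((t * Complex.I) * ((3 * b * L ω : ℝ) : ℂ) * cis (t * R ω))
  let c5 : Ω → ℂ := fun ω => (((X ω ^ 2 - 1) ^ 2 - v : ℝ) : ℂ) *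
    ((t * Complex.I) * ((b ^ 2 : ℝ) : ℂ) * cis (t * R ω))
  have z1 : ∫ ω, c1 ω ∂P = 0 := integral_centred_mul hX hL hR hind (f := fun x => x)
    (by fun_prop) hν.mean (h := fun p => (p.1 : ℂ) * cis (t * p.2)) (by fun_prop)
  have y0 : ∫ x, (x ^ 2 - 1) ∂ν = 0 := by
    rw [integral_sub (hν.moments.pow 2).integrable (integrable_const _), hν.var]; simp
  have z2 : ∫ ω, c2 ω ∂P = 0 := integral_centred_mul hX hL hR hind (f := fun x => x ^ 2 - 1)
    (by fun_prop) y0 (h := fun p => (b : ℂ) * cis (t * p.2)) (by fun_prop)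
  have z3 : ∫ ω, c3 ω ∂P = 0 := integral_centred_mul hX hL hR hind (f := fun x => x ^ 2 - 1)
    (by fun_prop) y0
    (h := fun p => (t * Complex.I) * ((2 * p.1 ^ 2 : ℝ) : ℂ) * cis (t * p.2)) (by fun_prop)
  have z4 : ∫ ω, c4 ω ∂P = 0 := integral_centred_mul hX hL hR hind
    (f := fun x => x * (x ^ 2 - 1) - m) (by fun_prop) (by
      rw [integral_sub (hν.moments.mul hν.poly).integrable (integrable_const _), hm]; simp [skew])
    (h := fun p => (t * Complex.I) * ((3 * b * p.1 : ℝ) : ℂ) * cis (t * p.2)) (by fun_prop)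
  have z5 : ∫ ω, c5 ω ∂P = 0 := integral_centred_mul hX hL hR hind
    (f := fun x => (x ^ 2 - 1) ^ 2 - v) (by fun_prop) (by
      rw [integral_sub (hν.poly.pow 2).integrable (integrable_const _), hv]; simp [sqVar])
    (h := fun p => (t * Complex.I) * ((b ^ 2 : ℝ) : ℂ) * cis (t * p.2)) (by fun_prop)
  have hcR : Measurable (fun ω => cis (t * R ω)) := by fun_prop
  have i1 : Integrable c1 P := by
    have := integrable_mul_of_norm_one (mX.mul hLm) hcR fun ω => n1 _
    refine this.congr (Eventually.of_forall fun ω => ?_)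
    simp only [c1]; push_cast; ring
  have i2 : Integrable c2 P := by
    have := (integrable_mul_of_norm_one mY hcR fun ω => n1 _).const_mul (b : ℂ)
    refine this.congr (Eventually.of_forall fun ω => ?_)
    simp only [c2]; ring
  have i3 : Integrable c3 P := by
    have := (integrable_mul_of_norm_one (mY.mul ((hLm.pow 2).const_mul 2)) hcR
      fun ω => n1 _).const_mul (t * Complex.I)
    refine this.congr (Eventually.of_forall fun ω => ?_)
    simp only [c3]; push_cast; ring
  have i4 : Integrable c4 P := by
    have := (integrable_mul_of_norm_one (((mX.mul mY).sub (AllMoments.const m)).mul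
      (hLm.const_mul (3 * b))) hcR fun ω => n1 _).const_mul (t * Complex.I)
    refine this.congr (Eventually.of_forall fun ω => ?_)
    simp only [c4]; push_cast; ring
  have i5 : Integrable c5 P := by
    have := (integrable_mul_of_norm_one (((mY.pow 2).sub (AllMoments.const v)).mul
      (AllMoments.const (b ^ 2))) hcR fun ω => n1 _).const_mul (t * Complex.I)
    refine this.congr (Eventually.of_forall fun ω => ?_)
    simp only [c5]; push_cast; ring
  have eq : ∫ ω, ((X ω * L ω + b * (X ω ^ 2 - 1) : ℝ) : ℂ) * E ω ∂P -
      t * Complex.I * ∫ ω, ((2 * L ω ^ 2 + 3 * m * b * L ω + v * b ^ 2 : ℝ) : ℂ) * E ω ∂P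
      = ∫ ω, (((X ω * L ω + b * (X ω ^ 2 - 1) : ℝ) : ℂ) * E ω -
      t * Complex.I * (((2 * L ω ^ 2 + 3 * m * b * L ω + v * b ^ 2 : ℝ) : ℂ) * E ω) -
      (c1 ω + c2 ω + c3 ω + c4 ω + c5 ω)) ∂P := by
    have i12 := i1.add i2
    have i123 := i12.add i3
    have i1234 := i123.add i4
    have s5 : ∫ ω, (c1 ω + c2 ω + c3 ω + c4 ω + c5 ω) ∂P = 0 := by
      rw [integral_add (f := fun ω => c1 ω + c2 ω + c3 ω + c4 ω) i1234 i5,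
        integral_add (f := fun ω => c1 ω + c2 ω + c3 ω) i123 i4,
        integral_add (f := fun ω => c1 ω + c2 ω) i12 i3, integral_add i1 i2, z1, z2, z3, z4, z5]
      simp
    have iW' := iW.const_mul (t * Complex.I)
    have e1 := integral_sub (iq.sub iW') (i1234.add i5)
    have e2 := integral_sub iq iW'
    rw [integral_const_mul] at e2
    rw [← e2]
    simp only [Pi.add_apply, Pi.sub_apply] at e1
    rw [e1, s5, sub_zero]
  rw [eq]
  have mS : AllMoments (fun ω => stepFun ν (X ω)) P := AllMoments.of_comp hX hν.stepFun_moments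
  have mL3 : AllMoments (fun ω => |L ω| ^ 3 + |b| ^ 3) P := (hLm.abs.pow 3).add (AllMoments.const _)
  have hbound : ∀ ω, ‖((X ω * L ω + b * (X ω ^ 2 - 1) : ℝ) : ℂ) * E ω -
      t * Complex.I * (((2 * L ω ^ 2 + 3 * m * b * L ω + v * b ^ 2 : ℝ) : ℂ) * E ω) -
      (c1 ω + c2 ω + c3 ω + c4 ω + c5 ω)‖ ≤
      t ^ 2 * (stepFun ν (X ω) * (|L ω| ^ 3 + |b| ^ 3)) := by
    intro ω
    set q := X ω * L ω + b * (X ω ^ 2 - 1) with hq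
    set D := 2 * X ω * L ω + b * (X ω ^ 2 - 1) with hD
    set W := 2 * L ω ^ 2 + 3 * m * b * L ω + v * b ^ 2 with hW
    have hEs : E ω = cis (t * R ω) * cis (t * D) := by
      simp only [hE]; rw [← cis_add, ← mul_add]
    have e : ((q : ℝ) : ℂ) * E ω - t * Complex.I * ((W : ℂ) * E ω) -
        (c1 ω + c2 ω + c3 ω + c4 ω + c5 ω) =
        q * cis (t * R ω) * (cis (t * D) - 1 - ((t * D : ℝ) : ℂ) * Complex.I) -
        t * Complex.I * W * cis (t * R ω) * (cis (t * D) - 1) := by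
      rw [hEs]
      simp only [c1, c2, c3, c4, c5, hq, hD, hW]
      push_cast
      ring
    rw [e]
    refine (norm_sub_le _ _).trans ?_
    simp only [norm_mul, norm_cis, Complex.norm_real, Complex.norm_I, mul_one, Real.norm_eq_abs]
    have b1 := norm_cis_sub_le (t * D)
    have b2 := norm_cis_sub_one_le (t * D)
    have b3 := step_pointwise (x := X ω) (L := L ω) (b := b) (m := m) (sqVar_nonneg ν)
    calc _ ≤ |q| * (2 * (t * D) ^ 2) + |t| * |W| * |t * D| := by gcongr
      _ = t ^ 2 * (2 * |q| * D ^ 2 + |W| * |D|) := by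
          rw [abs_mul, ← sq_abs t, mul_pow, ← sq_abs t]; ring
      _ ≤ _ := by
          refine mul_le_mul_of_nonneg_left ?_ (sq_nonneg t)
          exact b3
  refine (norm_integral_le_integral_norm _).trans ?_
  refine (integral_mono_of_nonneg (Eventually.of_forall fun ω => norm_nonneg _)
    ((mS.mul mL3).const_mul (t ^ 2)).integrable (Eventually.of_forall hbound)).trans ?_
  rw [integral_const_mul]
  refine mul_le_mul_of_nonneg_left (le_of_eq ?_) (sq_nonneg t)
  have := hind.integral_fun_comp_mul_comp (f := stepFun ν)
    (g := fun p : ℝ × ℝ => |p.1| ^ 3 + |b| ^ 3) hX.aemeasurable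
    (hL.prodMk hR).aemeasurable (by unfold stepFun; fun_prop) (by fun_prop)
  rw [this]
  congr 1
  · unfold stepConst
    have h1 := integral_map (f := stepFun ν) hX.aemeasurable (by unfold stepFun; fun_prop)
    rw [hX.map_eq] at h1
    exact h1.symm
  · rw [integral_add (hLm.abs.pow 3).integrable (integrable_const _)]
    simp

end Step

/-! ### Linear and quadratic forms in independent variables -/

section Forms

variable {Ω : Type*} [MeasurableSpace Ω] {P : Measure Ω} [IsProbabilityMeasure P]
  {ν : Measure ℝ} {ι : Type*} [Fintype ι] [DecidableEq ι]

/-- A family of independent random variables with law `ν`. -/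
structure StdFamily (ν : Measure ℝ) (x : ι → Ω → ℝ) (P : Measure Ω) : Prop where
  std : StdLaw ν
  law : ∀ i, HasLaw (x i) ν P
  meas : ∀ i, Measurable (x i)
  indep : iIndepFun x P

/-- The linear form `∑ c_j x_j`. -/
def linForm (c : ι → ℝ) (S : Finset ι) (x : ι → ℝ) : ℝ := ∑ j ∈ S, c j * x j

/-- The centred quadratic form `∑ B_jk x_j x_k - ∑ B_jj`. -/
def quadForm (B : ι → ι → ℝ) (S : Finset ι) (x : ι → ℝ) : ℝ :=
  ∑ j ∈ S, ∑ k ∈ S, B j k * (x j * x k) - ∑ j ∈ S, B j j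

lemma linForm_insert (c : ι → ℝ) {S : Finset ι} {i : ι} (hi : i ∉ S) (x : ι → ℝ) :
    linForm c (insert i S) x = c i * x i + linForm c S x := by
  simp [linForm, Finset.sum_insert hi]

lemma quadForm_insert {B : ι → ι → ℝ} (hB : ∀ i j, B i j = B j i) {S : Finset ι} {i : ι}
    (hi : i ∉ S) (x : ι → ℝ) :
    quadForm B (insert i S) x =
      quadForm B S x + (2 * x i * linForm (B i) S x + B i i * (x i ^ 2 - 1)) := by
  simp only [quadForm, linForm, Finset.sum_insert hi, Finset.sum_add_distrib]
  have : ∑ j ∈ S, B j i * (x j * x i) = x i * ∑ j ∈ S, B i j * x j := by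
    rw [Finset.mul_sum]; exact Finset.sum_congr rfl fun j _ => by rw [hB]; ring
  have h2 : ∑ j ∈ S, B i j * (x i * x j) = x i * ∑ j ∈ S, B i j * x j := by
    rw [Finset.mul_sum]; exact Finset.sum_congr rfl fun j _ => by ring
  rw [this, h2]; ring

lemma linForm_congr (c : ι → ℝ) {S : Finset ι} {a b : ι → ℝ} (h : ∀ j ∈ S, a j = b j) :
    linForm c S a = linForm c S b := Finset.sum_congr rfl fun j hj => by rw [h j hj]

lemma quadForm_congr (B : ι → ι → ℝ) {S : Finset ι} {a b : ι → ℝ} (h : ∀ j ∈ S, a j = b j) :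
    quadForm B S a = quadForm B S b := by
  unfold quadForm
  congr 1
  exact Finset.sum_congr rfl fun j hj => Finset.sum_congr rfl fun k hk => by rw [h j hj, h k hk]

lemma measurable_linForm (c : ι → ℝ) (S : Finset ι) : Measurable (linForm c S) := by
  unfold linForm; fun_prop

lemma measurable_quadForm (B : ι → ι → ℝ) (S : Finset ι) : Measurable (quadForm B S) := by
  unfold quadForm; fun_prop

variable {x : ι → Ω → ℝ}

namespace StdFamily

lemma measurable_fun (hx : StdFamily ν x P) : Measurable (fun ω i => x i ω) :=
  measurable_pi_lambda _ hx.meas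

/-- That `F` depends on the coordinates in `S` only is expressed by the invariance `hS`. Extending a
tuple on `S` by zero turns `F` into a function of these coordinates, to which independence of
disjoint subfamilies applies. -/
lemma indepFun (hx : StdFamily ν x P) {S : Finset ι} {i : ι} (hi : i ∉ S) {β : Type*}
    [MeasurableSpace β] {F : (ι → ℝ) → β} (hF : Measurable F)
    (hS : ∀ a b : ι → ℝ, (∀ j ∈ S, a j = b j) → F a = F b) :
    IndepFun (x i) (fun ω => F fun j => x j ω) P := by
  have h := hx.indep.indepFun_finset {i} S (by simpa using hi) hx.meas
  let ext : (S → ℝ) → ι → ℝ := fun y j => if h : j ∈ S then y ⟨j, h⟩ else 0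
  have hext : Measurable ext := by
    refine measurable_pi_lambda _ fun j => ?_
    by_cases hj : j ∈ S
    · simp only [ext, hj, dite_true]; exact measurable_pi_apply _
    · simp only [ext, hj, dite_false]; exact measurable_const
  have hev : Measurable (fun y : ({i} : Finset ι) → ℝ => y ⟨i, by simp⟩) := measurable_pi_apply _
  have h2 := h.comp hev (hF.comp hext)
  convert! h2 using 1
  funext ω
  refine hS _ _ fun j hj => ?_
  simp [ext, hj]

lemma moments (hx : StdFamily ν x P) (i : ι) : AllMoments (x i) P :=
  AllMoments.of_comp (hx.law i) hx.std.moments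

lemma integral_comp (hx : StdFamily ν x P) (i : ι) {f : ℝ → ℝ} (hf : Measurable f) :
    ∫ ω, f (x i ω) ∂P = ∫ t, f t ∂ν := by
  have h1 := integral_map (f := f) (hx.law i).aemeasurable hf.aestronglyMeasurable
  rw [(hx.law i).map_eq] at h1
  exact h1.symm

lemma linForm_moments (hx : StdFamily ν x P) (c : ι → ℝ) (S : Finset ι) :
    AllMoments (fun ω => linForm c S fun j => x j ω) P :=
  AllMoments.sum S fun i _ => (hx.moments i).const_mul (c i)

lemma quadForm_moments (hx : StdFamily ν x P) (B : ι → ι → ℝ) (S : Finset ι) :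
    AllMoments (fun ω => quadForm B S fun j => x j ω) P :=
  (AllMoments.sum S fun i _ => AllMoments.sum S fun j _ =>
    ((hx.moments i).mul (hx.moments j)).const_mul _).sub (AllMoments.const _)

lemma integral_mul (hx : StdFamily ν x P) {S : Finset ι} {i : ι} (hi : i ∉ S)
    {f : ℝ → ℝ} (hf : Measurable f) {F : (ι → ℝ) → ℝ} (hF : Measurable F)
    (hS : ∀ a b : ι → ℝ, (∀ j ∈ S, a j = b j) → F a = F b) :
    ∫ ω, f (x i ω) * F (fun j => x j ω) ∂P = (∫ t, f t ∂ν) * ∫ ω, F (fun j => x j ω) ∂P := by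
  have h := (hx.indepFun hi hF hS).integral_fun_comp_mul_comp (f := f) (g := fun y : ℝ => y)
    (hx.law i).aemeasurable (hF.comp hx.measurable_fun).aemeasurable
    hf.aestronglyMeasurable (by fun_prop)
  rw [h, hx.integral_comp i hf]

lemma integral_linForm_sq (hx : StdFamily ν x P) (c : ι → ℝ) (S : Finset ι) :
    ∫ ω, linForm c S (fun j => x j ω) ^ 2 ∂P = ∑ j ∈ S, c j ^ 2 := by
  induction S using Finset.induction_on with
  | empty => simp [linForm]
  | insert i S hi ih =>
    have hL := hx.linForm_moments c S
    have e : ∀ ω, linForm c (insert i S) (fun j => x j ω) ^ 2 =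
        c i ^ 2 * x i ω ^ 2 + 2 * c i * (x i ω * linForm c S fun j => x j ω) +
          (linForm c S fun j => x j ω) ^ 2 := fun ω => by rw [linForm_insert c hi]; ring
    simp_rw [e]
    have i1 := ((hx.moments i).pow 2).const_mul (c i ^ 2)
    have i2 := ((hx.moments i).mul hL).const_mul (2 * c i)
    rw [integral_add (i1.add i2).integrable (hL.pow 2).integrable,
      integral_add i1.integrable i2.integrable, integral_const_mul, integral_const_mul, ih,
      hx.integral_mul hi (f := fun t => t) measurable_id (measurable_linForm c S)
        (fun a b h => linForm_congr c h),
      hx.integral_comp i (f := fun t => t ^ 2) (by fun_prop), hx.std.mean, hx.std.var,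
      Finset.sum_insert hi]
    ring

/-- Expand `(c_i x_i + L)⁴` when one variable is added. The terms in `x_i L³` and `x_i³ L` vanish,
since both `x_i` and `L` are centred, and `6 c_i² ∑ c_j²` fits into the square of the new sum thanks
to the `3` in the constant. -/
lemma integral_linForm_four_le (hx : StdFamily ν x P) (c : ι → ℝ) (S : Finset ι) :
    ∫ ω, linForm c S (fun j => x j ω) ^ 4 ∂P ≤ (3 + ∫ t, t ^ 4 ∂ν) * (∑ j ∈ S, c j ^ 2) ^ 2 := by
  have hm4 : 0 ≤ ∫ t, t ^ 4 ∂ν := integral_nonneg fun t => by positivity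
  induction S using Finset.induction_on with
  | empty => simp [linForm]
  | insert i S hi ih =>
    have hL := hx.linForm_moments c S
    have e : ∀ ω, linForm c (insert i S) (fun j => x j ω) ^ 4 =
        c i ^ 4 * x i ω ^ 4 + 4 * c i ^ 3 * (x i ω ^ 3 * linForm c S fun j => x j ω) +
        6 * c i ^ 2 * (x i ω ^ 2 * (linForm c S fun j => x j ω) ^ 2) +
        4 * c i * (x i ω * (linForm c S fun j => x j ω) ^ 3) +
          (linForm c S fun j => x j ω) ^ 4 := fun ω => by rw [linForm_insert c hi]; ring
    simp_rw [e]
    have i1 := ((hx.moments i).pow 4).const_mul (c i ^ 4)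
    have i2 := (((hx.moments i).pow 3).mul hL).const_mul (4 * c i ^ 3)
    have i3 := (((hx.moments i).pow 2).mul (hL.pow 2)).const_mul (6 * c i ^ 2)
    have i4 := ((hx.moments i).mul (hL.pow 3)).const_mul (4 * c i)
    have z : ∫ ω, linForm c S (fun j => x j ω) ∂P = 0 := by
      unfold linForm
      rw [integral_finsetSum S fun j _ => ((hx.moments j).const_mul _).integrable]
      refine Finset.sum_eq_zero fun j _ => ?_
      rw [integral_const_mul, hx.integral_comp j (f := fun t => t) measurable_id, hx.std.mean,
        mul_zero]
    have mL := measurable_linForm c S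
    rw [integral_add (((i1.add i2).add i3).add i4).integrable (hL.pow 4).integrable,
      integral_add ((i1.add i2).add i3).integrable i4.integrable,
      integral_add (i1.add i2).integrable i3.integrable,
      integral_add i1.integrable i2.integrable, integral_const_mul, integral_const_mul,
      integral_const_mul, integral_const_mul,
      hx.integral_mul hi (f := fun t => t ^ 3) (by fun_prop) mL (fun a b h => linForm_congr c h),
      hx.integral_mul hi (f := fun t => t ^ 2) (F := fun y => linForm c S y ^ 2) (by fun_prop)
        (mL.pow_const 2) (fun a b h => by rw [linForm_congr c h]),
      hx.integral_mul hi (f := fun t => t) (F := fun y => linForm c S y ^ 3) measurable_id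
        (mL.pow_const 3) (fun a b h => by rw [linForm_congr c h]),
      hx.integral_comp i (f := fun t => t ^ 4) (by fun_prop), hx.std.mean, hx.std.var,
      hx.integral_linForm_sq, z, Finset.sum_insert hi]
    have s0 : 0 ≤ ∑ j ∈ S, c j ^ 2 := Finset.sum_nonneg fun j _ => by positivity
    have := mul_nonneg hm4 (mul_nonneg (sq_nonneg (c i)) s0)
    nlinarith [sq_nonneg (c i), sq_nonneg (c i ^ 2)]

/-- Interpolation between the second and the fourth moment at the scale `β`, by `|l|³ ≤ β l² + β⁻¹
l⁴`. The factor `β` gained over the second moment is what makes the accumulated third order errors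
small. -/
lemma integral_abs_linForm_cube_le (hx : StdFamily ν x P) (c : ι → ℝ) (S : Finset ι) {β : ℝ}
    (hβ : 0 < β) (hc : ∑ j ∈ S, c j ^ 2 ≤ β ^ 2) :
    ∫ ω, |linForm c S (fun j => x j ω)| ^ 3 ∂P ≤
      (4 + ∫ t, t ^ 4 ∂ν) * (β * ∑ j ∈ S, c j ^ 2) := by
  have hL := hx.linForm_moments c S
  have s0 : 0 ≤ ∑ j ∈ S, c j ^ 2 := Finset.sum_nonneg fun j _ => by positivity
  have hm4 : 0 ≤ ∫ t, t ^ 4 ∂ν := integral_nonneg fun t => by positivity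
  have h1 : ∀ ω, |linForm c S (fun j => x j ω)| ^ 3 ≤ β * linForm c S (fun j => x j ω) ^ 2 +
      β⁻¹ * linForm c S (fun j => x j ω) ^ 4 := by
    intro ω
    set l := linForm c S (fun j => x j ω)
    have : |l| ≤ β + β⁻¹ * l ^ 2 := by
      rw [← sq_abs l]
      have e : β * (β⁻¹ * |l| ^ 2) = |l| ^ 2 := by field_simp
      have h0 : 0 ≤ β⁻¹ * |l| ^ 2 := by positivity
      nlinarith [abs_nonneg l, sq_nonneg (β - |l|), sq_nonneg (β + β⁻¹ * |l| ^ 2 - |l|)]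
    calc |l| ^ 3 = |l| * l ^ 2 := by rw [← sq_abs l]; ring
      _ ≤ (β + β⁻¹ * l ^ 2) * l ^ 2 := by gcongr
      _ = _ := by ring
  have i1 := (hL.pow 2).const_mul β
  have i2 := (hL.pow 4).const_mul β⁻¹
  refine (integral_mono (hL.abs.pow 3).integrable (i1.add i2).integrable h1).trans ?_
  rw [integral_add i1.integrable i2.integrable, integral_const_mul, integral_const_mul,
    hx.integral_linForm_sq]
  have h4 := hx.integral_linForm_four_le c S
  have h5 : β⁻¹ * ∫ ω, linForm c S (fun j => x j ω) ^ 4 ∂P ≤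
      (3 + ∫ t, t ^ 4 ∂ν) * (β * ∑ j ∈ S, c j ^ 2) := by
    rw [inv_mul_le_iff₀ hβ]
    refine h4.trans ?_
    have : (∑ j ∈ S, c j ^ 2) ^ 2 ≤ β ^ 2 * ∑ j ∈ S, c j ^ 2 := by
      rw [sq]; gcongr
    calc _ ≤ (3 + ∫ t, t ^ 4 ∂ν) * (β ^ 2 * ∑ j ∈ S, c j ^ 2) := by gcongr
      _ = _ := by ring
  linarith

/-- When a variable is added, the products of the increment with the old form have mean zero, and
the square of the increment `2 x_i L + B_ii (x_i² - 1)` is at most `8 x_i² L² + 2 B_ii² (x_i² -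
1)²`. -/
lemma integral_quadForm_sq_le (hx : StdFamily ν x P) {B : ι → ι → ℝ} (hB : ∀ i j, B i j = B j i)
    (S : Finset ι) :
    ∫ ω, quadForm B S (fun j => x j ω) ^ 2 ∂P ≤
      (4 + 2 * sqVar ν) * ∑ j ∈ S, ∑ k ∈ S, B j k ^ 2 := by
  have hpν := hx.std.isProbabilityMeasure
  have hv := sqVar_nonneg ν
  induction S using Finset.induction_on with
  | empty => simp [quadForm]
  | insert i S hi ih =>
    have hL := hx.linForm_moments (B i) S
    have hQ := hx.quadForm_moments B S
    have hX := hx.moments i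
    have hY : AllMoments (fun ω => x i ω ^ 2 - 1) P := (hX.pow 2).sub (AllMoments.const 1)
    have mL := measurable_linForm (B i) S
    have mQ := measurable_quadForm B S
    have hle : ∀ ω, quadForm B (insert i S) (fun j => x j ω) ^ 2 ≤
        quadForm B S (fun j => x j ω) ^ 2 +
        4 * (x i ω * (quadForm B S (fun j => x j ω) * linForm (B i) S (fun j => x j ω))) +
        2 * B i i * ((x i ω ^ 2 - 1) * quadForm B S (fun j => x j ω)) +
        8 * (x i ω ^ 2 * linForm (B i) S (fun j => x j ω) ^ 2) +
        2 * B i i ^ 2 * (x i ω ^ 2 - 1) ^ 2 := by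
      intro ω
      rw [quadForm_insert hB hi]
      set q := quadForm B S fun j => x j ω
      set l := linForm (B i) S fun j => x j ω
      nlinarith [sq_nonneg (2 * x i ω * l - B i i * (x i ω ^ 2 - 1))]
    have i1 := hQ.pow 2
    have i2 := (hX.mul (hQ.mul hL)).const_mul 4
    have i3 := (hY.mul hQ).const_mul (2 * B i i)
    have i4 := ((hX.pow 2).mul (hL.pow 2)).const_mul 8
    have i5 := (hY.pow 2).const_mul (2 * B i i ^ 2)
    refine (integral_mono ((hx.quadForm_moments B (insert i S)).pow 2).integrable
      ((((i1.add i2).add i3).add i4).add i5).integrable hle).trans ?_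
    have y0 : ∫ t, (t ^ 2 - 1) ∂ν = 0 := by
      rw [integral_sub (hx.std.moments.pow 2).integrable (integrable_const _), hx.std.var]; simp
    rw [integral_add (((i1.add i2).add i3).add i4).integrable i5.integrable,
      integral_add ((i1.add i2).add i3).integrable i4.integrable,
      integral_add (i1.add i2).integrable i3.integrable,
      integral_add i1.integrable i2.integrable, integral_const_mul, integral_const_mul,
      integral_const_mul, integral_const_mul,
      hx.integral_mul hi (f := fun t => t) (F := fun y => quadForm B S y * linForm (B i) S y)
        measurable_id (mQ.mul mL) (fun a b h => by rw [quadForm_congr B h, linForm_congr _ h]),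
      hx.integral_mul hi (f := fun t => t ^ 2 - 1) (by fun_prop) mQ
        (fun a b h => quadForm_congr B h),
      hx.integral_mul hi (f := fun t => t ^ 2) (F := fun y => linForm (B i) S y ^ 2)
        (by fun_prop) (mL.pow_const 2) (fun a b h => by rw [linForm_congr _ h]),
      hx.integral_comp i (f := fun t => (t ^ 2 - 1) ^ 2) (by fun_prop), hx.std.mean, hx.std.var, y0,
      hx.integral_linForm_sq, ← sqVar]
    have e : ∑ j ∈ insert i S, ∑ k ∈ insert i S, B j k ^ 2 =
        B i i ^ 2 + 2 * ∑ k ∈ S, B i k ^ 2 + ∑ j ∈ S, ∑ k ∈ S, B j k ^ 2 := by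
      simp only [Finset.sum_insert hi, Finset.sum_add_distrib]
      have : ∑ j ∈ S, B j i ^ 2 = ∑ j ∈ S, B i j ^ 2 :=
        Finset.sum_congr rfl fun j _ => by rw [hB]
      rw [this]; ring
    rw [e]
    have s0 : 0 ≤ ∑ j ∈ S, B i j ^ 2 := Finset.sum_nonneg fun j _ => by positivity
    nlinarith [mul_nonneg hv s0, sq_nonneg (B i i), mul_nonneg hv (sq_nonneg (B i i))]

end StdFamily

end Forms

/-! ### Normal approximation of quadratic forms -/

section QuadraticCLT

variable {Ω : Type*} [MeasurableSpace Ω] {P : Measure Ω} [IsProbabilityMeasure P]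
  {ν : Measure ℝ} {ι : Type*} [Fintype ι] [DecidableEq ι]

/-- `β` bounds the operator norm of the matrix `B`. -/
def OpBound (B : ι → ι → ℝ) (β : ℝ) : Prop :=
  ∀ v : ι → ℝ, ∑ i, (∑ j, B i j * v j) ^ 2 ≤ β ^ 2 * ∑ j, v j ^ 2

/-- The matrix `B` with its diagonal removed. -/
def offDiag (B : ι → ι → ℝ) (i j : ι) : ℝ := if j = i then 0 else B i j

lemma OpBound.sum_sq_le {B : ι → ι → ℝ} {β : ℝ} (hB : OpBound B β) (j : ι) :
    ∑ i, B i j ^ 2 ≤ β ^ 2 := by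
  simpa [Pi.single_apply] using hB (Pi.single j 1)

lemma OpBound.abs_le {B : ι → ι → ℝ} {β : ℝ} (hβ : 0 ≤ β) (hB : OpBound B β) (i j : ι) :
    |B i j| ≤ β := by
  refine abs_le_of_sq_le_sq ((Finset.single_le_sum (f := fun i => B i j ^ 2)
    (fun _ _ => sq_nonneg _) (Finset.mem_univ i)).trans (hB.sum_sq_le j)) hβ

/-- The diagonal entries are bounded by `β`, so the diagonal part has norm at most `β` and removing
it at most doubles the bound. -/
lemma OpBound.offDiag {B : ι → ι → ℝ} {β : ℝ} (hβ : 0 ≤ β) (hB : OpBound B β) :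
    OpBound (offDiag B) (2 * β) := by
  intro v
  have e : ∀ i, ∑ j, SpikedModel.offDiag B i j * v j = ∑ j, B i j * v j - B i i * v i := by
    intro i
    have h1 := Finset.add_sum_erase Finset.univ (fun j => B i j * v j) (Finset.mem_univ i)
    have h2 := Finset.add_sum_erase Finset.univ (fun j => SpikedModel.offDiag B i j * v j)
      (Finset.mem_univ i)
    have h3 : ∑ j ∈ Finset.univ.erase i, SpikedModel.offDiag B i j * v j =
        ∑ j ∈ Finset.univ.erase i, B i j * v j :=
      Finset.sum_congr rfl fun j hj => by
        simp [SpikedModel.offDiag, (Finset.mem_erase.1 hj).1]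
    have h4 : SpikedModel.offDiag B i i = 0 := by simp [SpikedModel.offDiag]
    rw [h4] at h2
    linarith
  have h1 : ∀ i, (∑ j, SpikedModel.offDiag B i j * v j) ^ 2 ≤
      2 * (∑ j, B i j * v j) ^ 2 + 2 * (β ^ 2 * v i ^ 2) := by
    intro i
    rw [e]
    have h2 : (B i i * v i) ^ 2 ≤ β ^ 2 * v i ^ 2 := by
      rw [mul_pow]
      have := sq_le_sq' (_root_.abs_le.1 (hB.abs_le hβ i i)).1
        (_root_.abs_le.1 (hB.abs_le hβ i i)).2
      gcongr
    nlinarith [sq_nonneg (∑ j, B i j * v j + B i i * v i)]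
  refine (Finset.sum_le_sum fun i _ => h1 i).trans ?_
  rw [Finset.sum_add_distrib, ← Finset.mul_sum, ← Finset.mul_sum, ← Finset.mul_sum]
  have := hB v
  linarith

/-- The variance of the quadratic form with matrix `B`. -/
noncomputable def quadVar (ν : Measure ℝ) (B : ι → ι → ℝ) : ℝ :=
  2 * ∑ i, ∑ j, B i j ^ 2 + (sqVar ν - 2) * ∑ i, B i i ^ 2

lemma sum_erase_sq (B : ι → ι → ℝ) (i : ι) :
    ∑ j ∈ Finset.univ.erase i, B i j ^ 2 = ∑ j, B i j ^ 2 - B i i ^ 2 := by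
  have := Finset.add_sum_erase Finset.univ (fun j => B i j ^ 2) (Finset.mem_univ i)
  linarith

/-- The sum of the means of the conditional variances. The factor `sqVar ν - 2` may be negative, so
nonnegativity is visible only in this form. -/
lemma quadVar_eq (B : ι → ι → ℝ) :
    quadVar ν B = ∑ i, (2 * ∑ j ∈ Finset.univ.erase i, B i j ^ 2 + sqVar ν * B i i ^ 2) := by
  simp_rw [sum_erase_sq]
  unfold quadVar
  simp only [Finset.sum_add_distrib, ← Finset.mul_sum, Finset.sum_sub_distrib]
  ring

lemma quadVar_nonneg (B : ι → ι → ℝ) : 0 ≤ quadVar ν B := by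
  rw [quadVar_eq]
  have := sqVar_nonneg ν
  positivity

variable {x : ι → Ω → ℝ}

namespace StdFamily

/-- Concentration of the sum of the conditional variances. -/
lemma integral_abs_sum_sub_quadVar_le (hx : StdFamily ν x P) {B : ι → ι → ℝ}
    (hB : ∀ i j, B i j = B j i) {β : ℝ} (hβ : 0 ≤ β) (hop : OpBound B β) :
    ∫ ω, |∑ i, (2 * linForm (B i) (Finset.univ.erase i) (fun j => x j ω) ^ 2 +
      3 * skew ν * B i i * linForm (B i) (Finset.univ.erase i) (fun j => x j ω) +
      sqVar ν * B i i ^ 2) - quadVar ν B| ∂P ≤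
    (2 * √((4 + 2 * sqVar ν) * 4) + 6 * |skew ν|) * (β * √(∑ i, ∑ j, B i j ^ 2)) := by
  have hv := sqVar_nonneg ν
  set F := ∑ i, ∑ j, B i j ^ 2 with hF
  have hF0 : 0 ≤ F := Finset.sum_nonneg fun i _ => Finset.sum_nonneg fun j _ => sq_nonneg _
  have hopo := hop.offDiag hβ
  set D := offDiag B with hD
  have hDs : ∀ i j, D i j = D j i := by
    intro i j; simp only [hD, offDiag, hB i j, eq_comm]
  have hDF : ∑ i, ∑ j, D i j ^ 2 ≤ F := by
    refine Finset.sum_le_sum fun i _ => Finset.sum_le_sum fun j _ => ?_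
    simp only [hD, offDiag]
    split_ifs
    · simpa using sq_nonneg _
    · exact le_rfl
  have hlin : ∀ i (y : ι → ℝ), linForm (B i) (Finset.univ.erase i) y = ∑ j, D i j * y j := by
    intro i y
    rw [← Finset.add_sum_erase Finset.univ (fun j => D i j * y j) (Finset.mem_univ i)]
    have h4 : D i i = 0 := by simp [hD, offDiag]
    rw [h4, zero_mul, zero_add]
    exact Finset.sum_congr rfl fun j hj => by simp [hD, offDiag, (Finset.mem_erase.1 hj).1]
  -- The squares of the linear forms add up to the quadratic form of `C = DᵀD`, whose trace belongs
  -- to the variance. One factor `D` is estimated in operator norm, the other in Hilbert-Schmidt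
  -- norm, so `C` has Hilbert-Schmidt norm at most `2β√F`. The terms with `skew` give a linear form
  -- with coefficients `D diag(B)`, bounded in the same way.
  let C : ι → ι → ℝ := fun j k => ∑ i, D i j * D i k
  have hCs : ∀ j k, C j k = C k j := fun j k => Finset.sum_congr rfl fun i _ => mul_comm _ _
  have hCF : ∑ j, ∑ k, C j k ^ 2 ≤ 4 * β ^ 2 * F := by
    rw [Finset.sum_comm]
    have h1 : ∀ k, ∑ j, C j k ^ 2 ≤ (2 * β) ^ 2 * ∑ i, D i k ^ 2 := by
      intro k
      refine le_trans (le_of_eq ?_) (hopo fun i => D i k)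
      exact Finset.sum_congr rfl fun j _ => by
        congr 1; exact Finset.sum_congr rfl fun i _ => by rw [hDs]
    refine (Finset.sum_le_sum fun k _ => h1 k).trans ?_
    rw [← Finset.mul_sum, Finset.sum_comm]
    calc _ ≤ (2 * β) ^ 2 * F := by gcongr
      _ = _ := by ring
  let d : ι → ℝ := fun j => ∑ i, D j i * B i i
  have hdF : ∑ j, d j ^ 2 ≤ 4 * β ^ 2 * F := by
    refine (hopo fun i => B i i).trans ?_
    have : ∑ i, B i i ^ 2 ≤ F := Finset.sum_le_sum fun i _ =>
      Finset.single_le_sum (f := fun j => B i j ^ 2) (fun _ _ => sq_nonneg _) (Finset.mem_univ i)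
    calc _ ≤ (2 * β) ^ 2 * F := by gcongr
      _ = _ := by ring
  have e : ∀ ω, ∑ i, (2 * linForm (B i) (Finset.univ.erase i) (fun j => x j ω) ^ 2 +
      3 * skew ν * B i i * linForm (B i) (Finset.univ.erase i) (fun j => x j ω) +
      sqVar ν * B i i ^ 2) - quadVar ν B =
      2 * quadForm C Finset.univ (fun j => x j ω) +
        3 * skew ν * linForm d Finset.univ (fun j => x j ω) := by
    intro ω
    have e1 : ∑ i, linForm (B i) (Finset.univ.erase i) (fun j => x j ω) ^ 2 =
        ∑ j, ∑ k, C j k * (x j ω * x k ω) := by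
      simp_rw [hlin, sq, Finset.sum_mul_sum, C, Finset.sum_mul]
      rw [Finset.sum_comm]
      refine Finset.sum_congr rfl fun j _ => ?_
      rw [Finset.sum_comm]
      exact Finset.sum_congr rfl fun k _ => Finset.sum_congr rfl fun i _ => by ring
    have e2 : ∑ i, B i i * linForm (B i) (Finset.univ.erase i) (fun j => x j ω) =
        linForm d Finset.univ (fun j => x j ω) := by
      simp_rw [hlin, linForm, d, Finset.mul_sum, Finset.sum_mul]
      rw [Finset.sum_comm]
      exact Finset.sum_congr rfl fun j _ => Finset.sum_congr rfl fun i _ => by rw [hDs]; ring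
    have e3 : ∑ j, C j j = ∑ i, ∑ j ∈ Finset.univ.erase i, B i j ^ 2 := by
      simp only [C]
      rw [Finset.sum_comm]
      refine Finset.sum_congr rfl fun i _ => ?_
      rw [← Finset.add_sum_erase Finset.univ (fun j => D i j * D i j) (Finset.mem_univ i)]
      have h4 : D i i = 0 := by simp [hD, offDiag]
      rw [h4, zero_mul, zero_add]
      exact Finset.sum_congr rfl fun j hj => by
        simp [hD, offDiag, (Finset.mem_erase.1 hj).1, sq]
    rw [quadVar_eq]
    simp only [Finset.sum_add_distrib, ← Finset.mul_sum, mul_assoc]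
    rw [e1, e2, quadForm, e3]
    ring
  simp_rw [e]
  have mQ := hx.quadForm_moments C Finset.univ
  have mL := hx.linForm_moments d Finset.univ
  have b1 : ∫ ω, |quadForm C Finset.univ (fun j => x j ω)| ∂P ≤
      √((4 + 2 * sqVar ν) * 4) * (β * √F) := by
    refine (integral_abs_le_sqrt mQ ((hx.integral_quadForm_sq_le hCs _).trans
      (mul_le_mul_of_nonneg_left hCF (by positivity)))).trans (le_of_eq ?_)
    rw [show (4 + 2 * sqVar ν) * (4 * β ^ 2 * F) = ((4 + 2 * sqVar ν) * 4) * (β ^ 2 * F) by ring,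
      Real.sqrt_mul (by positivity) (β ^ 2 * F), Real.sqrt_mul (sq_nonneg β), Real.sqrt_sq hβ]
  have b2 : ∫ ω, |linForm d Finset.univ (fun j => x j ω)| ∂P ≤ 2 * (β * √F) := by
    refine (integral_abs_le_sqrt mL ((hx.integral_linForm_sq d _).le.trans hdF)).trans
      (le_of_eq ?_)
    rw [show 4 * β ^ 2 * F = (2 * β) ^ 2 * F by ring, Real.sqrt_mul (by positivity),
      Real.sqrt_sq (by positivity)]
    ring
  have i1 := (mQ.abs.const_mul 2)
  have i2 := (mL.abs.const_mul (3 * |skew ν|))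
  refine (integral_mono ((mQ.const_mul 2).add (mL.const_mul (3 * skew ν))).abs.integrable
    (i1.add i2).integrable fun ω => ?_).trans ?_
  · refine (abs_add_le _ _).trans (le_of_eq ?_)
    simp only [abs_mul, abs_two, abs_of_pos (by norm_num : (0 : ℝ) < 3)]
  rw [integral_add i1.integrable i2.integrable, integral_const_mul, integral_const_mul]
  calc _ ≤ 2 * (√((4 + 2 * sqVar ν) * 4) * (β * √F)) + 3 * |skew ν| * (2 * (β * √F)) := by
        gcongr
    _ = _ := by ring

/-- The constant in the normal approximation of quadratic forms. -/
noncomputable def cltConst (ν : Measure ℝ) : ℝ :=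
  stepConst ν * (5 + ∫ t, t ^ 4 ∂ν) + (2 * √((4 + 2 * sqVar ν) * 4) + 6 * |skew ν|)

/-- The approximate differential equation `φ'(t) = -tVφ(t)` for the characteristic function of the
form, stated without the factor `i` of the derivative. Summing `norm_step_le` over the variables
replaces the form by the sum of the conditional variances, and concentration replaces that sum by
`V`. -/
lemma norm_deriv_le (hx : StdFamily ν x P) {B : ι → ι → ℝ} (hB : ∀ i j, B i j = B j i) {β : ℝ}
    (hβ : 0 < β) (hop : OpBound B β) {t : ℝ} (ht0 : 0 ≤ t) (ht1 : t ≤ 1) :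
    ‖∫ ω, (quadForm B Finset.univ (fun j => x j ω) : ℂ) *
        cis (t * quadForm B Finset.univ fun j => x j ω) ∂P -
      t * Complex.I * (quadVar ν B *
        ∫ ω, cis (t * quadForm B Finset.univ fun j => x j ω) ∂P)‖ ≤
    cltConst ν * (β * ∑ i, ∑ j, B i j ^ 2 + β * √(∑ i, ∑ j, B i j ^ 2)) := by
  have hm4 : 0 ≤ ∫ t, t ^ 4 ∂ν := integral_nonneg fun t => by positivity
  have hsc := stepConst_nonneg ν
  have hcm : Measurable cis := continuous_cis.measurable
  have n1 : ∀ u, ‖cis u‖ ≤ 1 := fun u => (norm_cis u).le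
  set F := ∑ i, ∑ j, B i j ^ 2 with hF
  have hF0 : 0 ≤ F := Finset.sum_nonneg fun i _ => Finset.sum_nonneg fun j _ => sq_nonneg _
  set Q : Ω → ℝ := fun ω => quadForm B Finset.univ (fun j => x j ω) with hQ
  set E : Ω → ℂ := fun ω => cis (t * Q ω) with hE
  have hQm : Measurable Q := (measurable_quadForm B _).comp hx.measurable_fun
  have hEm : Measurable E := by fun_prop
  let L : ι → Ω → ℝ := fun i ω => linForm (B i) (Finset.univ.erase i) (fun j => x j ω)
  -- A cross term `2 B_ij x_i x_j` is shared equally between its two variables, so the `q i` add up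
  -- to the form. The increment due to `x_i` alone contains `x_i L_i` twice.
  let q : ι → Ω → ℝ := fun i ω => x i ω * L i ω + B i i * (x i ω ^ 2 - 1)
  let W : ι → Ω → ℝ := fun i ω =>
    2 * L i ω ^ 2 + 3 * skew ν * B i i * L i ω + sqVar ν * B i i ^ 2
  have mL : ∀ i, AllMoments (L i) P := fun i => hx.linForm_moments _ _
  have mq : ∀ i, AllMoments (q i) P := fun i => ((hx.moments i).mul (mL i)).add
    ((((hx.moments i).pow 2).sub (AllMoments.const 1)).const_mul _)
  have mW : ∀ i, AllMoments (W i) P := fun i =>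
    ((((mL i).pow 2).const_mul 2).add ((mL i).const_mul _)).add (AllMoments.const _)
  have hQi : ∀ i ω, Q ω = quadForm B (Finset.univ.erase i) (fun j => x j ω) +
      (2 * x i ω * L i ω + B i i * (x i ω ^ 2 - 1)) := by
    intro i ω
    simp only [hQ]
    rw [← quadForm_insert hB (Finset.notMem_erase i _), Finset.insert_erase (Finset.mem_univ i)]
  have hQsum : ∀ ω, Q ω = ∑ i, q i ω := by
    intro ω
    have h1 : ∀ i, q i ω = ∑ j, B i j * (x i ω * x j ω) - B i i := by
      intro i
      rw [← Finset.add_sum_erase Finset.univ (fun j => B i j * (x i ω * x j ω))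
        (Finset.mem_univ i)]
      have : x i ω * L i ω = ∑ j ∈ Finset.univ.erase i, B i j * (x i ω * x j ω) := by
        simp only [L, linForm, Finset.mul_sum]
        exact Finset.sum_congr rfl fun j _ => by ring
      simp only [q, this]; ring
    simp_rw [h1, Finset.sum_sub_distrib]
    rfl
  have iq : ∀ i, Integrable (fun ω => (q i ω : ℂ) * E ω) P := fun i =>
    integrable_mul_of_norm_one (mq i) hEm fun ω => n1 _
  have iW : ∀ i, Integrable (fun ω => (W i ω : ℂ) * E ω) P := fun i =>
    integrable_mul_of_norm_one (mW i) hEm fun ω => n1 _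
  have hstep : ∀ i, ‖∫ ω, (q i ω : ℂ) * E ω ∂P - t * Complex.I * ∫ ω, (W i ω : ℂ) * E ω ∂P‖ ≤
      stepConst ν * ((5 + ∫ t, t ^ 4 ∂ν) * (β * ∑ j, B i j ^ 2)) := by
    intro i
    have hi := Finset.notMem_erase i Finset.univ
    have hind := hx.indepFun hi
      (F := fun y => (linForm (B i) (Finset.univ.erase i) y, quadForm B (Finset.univ.erase i) y))
      ((measurable_linForm _ _).prodMk (measurable_quadForm _ _))
      (fun a b h => by rw [linForm_congr _ h, quadForm_congr B h])
    have h := norm_step_le hx.std (hx.law i) ((measurable_linForm _ _).comp hx.measurable_fun)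
      ((measurable_quadForm _ _).comp hx.measurable_fun) (hx.meas i) (mL i) hind (B i i) t
    simp only [hE, hQi i]
    refine h.trans ?_
    have hrow : ∑ j, B i j ^ 2 ≤ β ^ 2 := by
      refine le_trans (le_of_eq ?_) (hop.sum_sq_le i)
      exact Finset.sum_congr rfl fun j _ => by rw [hB]
    have hse : ∑ j ∈ Finset.univ.erase i, B i j ^ 2 ≤ ∑ j, B i j ^ 2 :=
      Finset.sum_le_sum_of_subset_of_nonneg (Finset.erase_subset _ _) fun _ _ _ => sq_nonneg _
    have h3 := hx.integral_abs_linForm_cube_le (B i) (Finset.univ.erase i) hβ (hse.trans hrow)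
    have h4 : |B i i| ^ 3 ≤ β * ∑ j, B i j ^ 2 := by
      have a1 := hop.abs_le hβ.le i i
      have a2 : B i i ^ 2 ≤ ∑ j, B i j ^ 2 :=
        Finset.single_le_sum (f := fun j => B i j ^ 2) (fun _ _ => sq_nonneg _) (Finset.mem_univ i)
      calc |B i i| ^ 3 = |B i i| * B i i ^ 2 := by rw [← sq_abs (B i i)]; ring
        _ ≤ _ := by gcongr
    have h5 : (4 + ∫ t, t ^ 4 ∂ν) * (β * ∑ j ∈ Finset.univ.erase i, B i j ^ 2) ≤
        (4 + ∫ t, t ^ 4 ∂ν) * (β * ∑ j, B i j ^ 2) := by gcongr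
    have ht2 : t ^ 2 ≤ 1 := pow_le_one₀ ht0 ht1
    have h7 : ∫ ω, |L i ω| ^ 3 ∂P + |B i i| ^ 3 ≤
        (5 + ∫ t, t ^ 4 ∂ν) * (β * ∑ j, B i j ^ 2) := by
      have := h3.trans h5
      simp only [L]
      linarith
    have h8 : 0 ≤ ∫ ω, |L i ω| ^ 3 ∂P + |B i i| ^ 3 :=
      add_nonneg (integral_nonneg fun ω => by positivity) (by positivity)
    change t ^ 2 * (stepConst ν * (∫ ω, |L i ω| ^ 3 ∂P + |B i i| ^ 3)) ≤ _
    calc _ ≤ 1 * (stepConst ν * (∫ ω, |L i ω| ^ 3 ∂P + |B i i| ^ 3)) := by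
          gcongr
      _ ≤ _ := by rw [one_mul]; gcongr
  have hconc := hx.integral_abs_sum_sub_quadVar_le hB hβ.le hop
  have hWV : ‖∑ i, ∫ ω, (W i ω : ℂ) * E ω ∂P - quadVar ν B * ∫ ω, E ω ∂P‖ ≤
      (2 * √((4 + 2 * sqVar ν) * 4) + 6 * |skew ν|) * (β * √F) := by
    have mD : AllMoments (fun ω => ∑ i, W i ω - quadVar ν B) P :=
      (AllMoments.sum _ fun i _ => mW i).sub (AllMoments.const _)
    have iE : Integrable E P := by
      refine Integrable.of_bound hEm.aestronglyMeasurable 1 (Eventually.of_forall fun ω => n1 _)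
    rw [← integral_finsetSum _ fun i _ => iW i, ← integral_const_mul, ← integral_sub
      (integrable_finsetSum _ fun i _ => iW i) (iE.const_mul _)]
    refine (norm_integral_le_integral_norm _).trans (le_trans (le_of_eq ?_) hconc)
    refine integral_congr_ae (Eventually.of_forall fun ω => ?_)
    simp only
    rw [← Finset.sum_mul, ← sub_mul, norm_mul, norm_cis, mul_one, ← Complex.ofReal_sum,
      ← Complex.ofReal_sub, Complex.norm_real, Real.norm_eq_abs]
  have e : ∫ ω, (Q ω : ℂ) * E ω ∂P - t * Complex.I * (quadVar ν B * ∫ ω, E ω ∂P) =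
      ∑ i, (∫ ω, (q i ω : ℂ) * E ω ∂P - t * Complex.I * ∫ ω, (W i ω : ℂ) * E ω ∂P) +
      t * Complex.I * (∑ i, ∫ ω, (W i ω : ℂ) * E ω ∂P - quadVar ν B * ∫ ω, E ω ∂P) := by
    rw [Finset.sum_sub_distrib, ← Finset.mul_sum, ← integral_finsetSum _ fun i _ => iq i]
    have : ∫ ω, ∑ i, (q i ω : ℂ) * E ω ∂P = ∫ ω, (Q ω : ℂ) * E ω ∂P := by
      congr 1; funext ω; rw [← Finset.sum_mul, hQsum]; push_cast; rfl
    rw [this]; ring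
  rw [e]
  refine (norm_add_le _ _).trans ?_
  have h1 : ‖∑ i, (∫ ω, (q i ω : ℂ) * E ω ∂P - t * Complex.I * ∫ ω, (W i ω : ℂ) * E ω ∂P)‖ ≤
      stepConst ν * (5 + ∫ t, t ^ 4 ∂ν) * (β * F) := by
    refine (norm_sum_le _ _).trans ((Finset.sum_le_sum fun i _ => hstep i).trans (le_of_eq ?_))
    rw [← Finset.mul_sum, ← Finset.mul_sum, ← Finset.mul_sum, mul_assoc]
  have h2 : ‖t * Complex.I * (∑ i, ∫ ω, (W i ω : ℂ) * E ω ∂P - quadVar ν B * ∫ ω, E ω ∂P)‖ ≤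
      (2 * √((4 + 2 * sqVar ν) * 4) + 6 * |skew ν|) * (β * √F) := by
    rw [norm_mul, norm_mul, Complex.norm_I, mul_one, Complex.norm_real, Real.norm_of_nonneg ht0]
    exact (mul_le_of_le_one_left (norm_nonneg _) ht1).trans hWV
  refine (add_le_add h1 h2).trans ?_
  unfold cltConst
  have p1 : 0 ≤ stepConst ν * (5 + ∫ t, t ^ 4 ∂ν) * (β * √F) := by positivity
  have p2 : 0 ≤ (2 * √((4 + 2 * sqVar ν) * 4) + 6 * |skew ν|) * (β * F) := by positivity
  linarith

/-- Normal approximation of a centred quadratic form in independent variables. -/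
theorem norm_charFun_quadForm_sub_le (hx : StdFamily ν x P) {B : ι → ι → ℝ}
    (hB : ∀ i j, B i j = B j i) {β : ℝ} (hβ : 0 < β) (hop : OpBound B β) :
    ‖∫ ω, cis (quadForm B Finset.univ fun j => x j ω) ∂P - Complex.exp (-(quadVar ν B / 2 : ℝ))‖ ≤
    cltConst ν * (β * ∑ i, ∑ j, B i j ^ 2 + β * √(∑ i, ∑ j, B i j ^ 2)) := by
  set Q : Ω → ℝ := fun ω => quadForm B Finset.univ (fun j => x j ω) with hQ
  set V := quadVar ν B with hV
  have hV0 : 0 ≤ V := quadVar_nonneg B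
  set K := cltConst ν * (β * ∑ i, ∑ j, B i j ^ 2 + β * √(∑ i, ∑ j, B i j ^ 2)) with hK
  have hQm : Measurable Q := (measurable_quadForm B _).comp hx.measurable_fun
  have mQ : AllMoments Q P := hx.quadForm_moments B _
  have hcm : Measurable cis := continuous_cis.measurable
  let φ : ℝ → ℂ := fun s => ∫ ω, cis (s * Q ω) ∂P
  have hφ : ∀ s, HasDerivAt φ (∫ ω, (Q ω : ℂ) * Complex.I * cis (s * Q ω) ∂P) s := by
    intro s
    refine (hasDerivAt_integral_of_dominated_loc_of_deriv_le (μ := P) (bound := fun ω => |Q ω|)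
      (F := fun s ω => cis (s * Q ω)) (F' := fun s ω => (Q ω : ℂ) * Complex.I * cis (s * Q ω))
      (s := Set.univ) Filter.univ_mem (Eventually.of_forall fun s => ?_) ?_ ?_ ?_ ?_ ?_).2
    · exact Measurable.aestronglyMeasurable (by fun_prop)
    · exact Integrable.of_bound (Measurable.aestronglyMeasurable (by fun_prop)) 1
        (Eventually.of_forall fun ω => (norm_cis _).le)
    · exact Measurable.aestronglyMeasurable (by fun_prop)
    · refine Eventually.of_forall fun ω s _ => ?_
      rw [norm_mul, norm_mul, norm_cis, Complex.norm_I, Complex.norm_real]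
      simp
    · exact mQ.abs.integrable
    · exact Eventually.of_forall fun ω s _ => hasDerivAt_cis_mul _ _
  -- The integrating factor of `φ' = -sVφ`. On `[0, 1]` it is at most `exp (V/2)`, and the final
  -- multiplication by `exp (-V/2)` cancels this loss, so that the error does not depend on `V`.
  let ψ : ℝ → ℂ := fun s => φ s * Complex.exp ((V * s ^ 2 / 2 : ℝ) : ℂ)
  have hψ : ∀ s, HasDerivAt ψ ((∫ ω, (Q ω : ℂ) * Complex.I * cis (s * Q ω) ∂P) *
      Complex.exp ((V * s ^ 2 / 2 : ℝ) : ℂ) +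
      φ s * (Complex.exp ((V * s ^ 2 / 2 : ℝ) : ℂ) * ((V * s : ℝ) : ℂ))) s := by
    intro s
    have h1 : HasDerivAt (fun s : ℝ => ((V * s ^ 2 / 2 : ℝ) : ℂ)) ((V * s : ℝ) : ℂ) s := by
      have : HasDerivAt (fun s : ℝ => V * s ^ 2 / 2) (V * s) s := by
        refine ((((hasDerivAt_id s).pow 2).const_mul V).div_const 2).congr_deriv ?_
        simp; ring
      exact this.ofReal_comp
    exact (hφ s).mul h1.cexp
  have hb : ∀ s ∈ Set.Icc (0 : ℝ) 1, ‖(∫ ω, (Q ω : ℂ) * Complex.I * cis (s * Q ω) ∂P) *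
      Complex.exp ((V * s ^ 2 / 2 : ℝ) : ℂ) +
      φ s * (Complex.exp ((V * s ^ 2 / 2 : ℝ) : ℂ) * ((V * s : ℝ) : ℂ))‖ ≤
      Real.exp (V / 2) * K := by
    intro s hs
    have e : (∫ ω, (Q ω : ℂ) * Complex.I * cis (s * Q ω) ∂P) *
      Complex.exp ((V * s ^ 2 / 2 : ℝ) : ℂ) +
      φ s * (Complex.exp ((V * s ^ 2 / 2 : ℝ) : ℂ) * ((V * s : ℝ) : ℂ)) =
      Complex.exp ((V * s ^ 2 / 2 : ℝ) : ℂ) * (Complex.I * (∫ ω, (Q ω : ℂ) * cis (s * Q ω) ∂P -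
        s * Complex.I * (V * φ s))) := by
      have : ∫ ω, (Q ω : ℂ) * Complex.I * cis (s * Q ω) ∂P =
          Complex.I * ∫ ω, (Q ω : ℂ) * cis (s * Q ω) ∂P := by
        rw [← integral_const_mul]; congr 1; funext ω; ring
      rw [this]; push_cast
      linear_combination (φ s * s * V * Complex.exp (V * s ^ 2 / 2)) * Complex.I_mul_I
    rw [e, norm_mul, norm_mul, Complex.norm_I, one_mul, Complex.norm_exp, Complex.ofReal_re]
    have := hx.norm_deriv_le hB hβ hop hs.1 hs.2
    have h2 : s ^ 2 ≤ 1 := pow_le_one₀ hs.1 hs.2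
    have h3 : V * s ^ 2 / 2 ≤ V / 2 := by nlinarith
    gcongr
  have hmv := (convex_Icc (0 : ℝ) 1).norm_image_sub_le_of_norm_hasDerivWithin_le
    (f := ψ) (fun s _ => (hψ s).hasDerivWithinAt) hb (x := 0) (y := 1) (by simp) (by simp)
  have e0 : ψ 0 = 1 := by simp [ψ, φ]
  have e1 : ψ 1 = φ 1 * Complex.exp ((V / 2 : ℝ) : ℂ) := by simp [ψ]
  have e2 : φ 1 = ∫ ω, cis (Q ω) ∂P := by simp [φ]
  rw [e0, e1, e2] at hmv
  simp only [sub_zero, norm_one, mul_one] at hmv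
  have e3 : ∫ ω, cis (Q ω) ∂P - Complex.exp (-(V / 2 : ℝ)) =
      ((∫ ω, cis (Q ω) ∂P) * Complex.exp ((V / 2 : ℝ) : ℂ) - 1) *
        Complex.exp (-((V / 2 : ℝ) : ℂ)) := by
    rw [sub_mul, mul_assoc, ← Complex.exp_add]; simp
  rw [e3, norm_mul, Complex.norm_exp]
  calc _ ≤ Real.exp (V / 2) * K * Real.exp (-(V / 2)) := by
        refine mul_le_mul hmv (le_of_eq ?_) (Real.exp_pos _).le ((norm_nonneg _).trans hmv)
        rw [Complex.neg_re, Complex.ofReal_re]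
    _ = K := by rw [mul_right_comm, ← Real.exp_add]; simp

end StdFamily

end QuadraticCLT

/-! ### Entries as combinations of real variables -/

section Decomposition

open ComplexConjugate

variable {𝕜 : Type*} [RCLike 𝕜]

open Classical in
/-- The constant `2` in the real case and `1` in the complex case. -/
noncomputable def tauConst (𝕜 : Type*) [RCLike 𝕜] : ℝ := if IsRealCase 𝕜 then 2 else 1

/-- The law `ν` is that of `∑ x_b e_b` where the `x_b` are independent with law `ν₀`. -/
structure RealDecomposition (ν : Measure 𝕜) (ν₀ : Measure ℝ) (e : Bool → 𝕜) : Prop where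
  std : StdLaw ν₀
  map_eq : (Measure.pi fun _ : Bool => ν₀).map (fun x => ∑ b, (x b : 𝕜) * e b) = ν
  sum_sq : ∑ b, ‖e b‖ ^ 2 = 1
  pair : ∀ z : 𝕜, 2 * ∑ b, ∑ b', RCLike.re (conj (e b) * z * e b') ^ 2 = tauConst 𝕜 * ‖z‖ ^ 2
  diag : (sqVar ν₀ - 2) * ∑ b, ‖e b‖ ^ 4 = kappa4 ν

lemma im_eq_zero_of_real (h : IsRealCase 𝕜) (z : 𝕜) : RCLike.im z = 0 := by
  have := RCLike.mul_im_I_ax z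
  rw [show (RCLike.I : 𝕜) = 0 from h] at this
  simpa using this.symm

lemma re_eq_of_real (h : IsRealCase 𝕜) (z : 𝕜) : ((RCLike.re z : ℝ) : 𝕜) = z := by
  have := RCLike.re_add_im z
  rwa [im_eq_zero_of_real h z, RCLike.ofReal_zero, zero_mul, add_zero] at this

/-- From `I² = -1` and `re I = 0` one gets `(im I)² = 1`. The sign is fixed by the axiom `im z * im
I = im z` at `z = I`. -/
lemma im_I_of_complex (h : ¬ IsRealCase 𝕜) : RCLike.im (RCLike.I : 𝕜) = 1 := by
  rcases RCLike.I_mul_I_ax (K := 𝕜) with h0 | h0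
  · exact absurd h0 h
  · have := congrArg RCLike.re h0
    simp only [RCLike.mul_re, RCLike.I_re, map_neg, RCLike.one_re] at this
    have h1 := RCLike.mul_im_I_ax (RCLike.I : 𝕜)
    nlinarith

lemma sqVar_eq {ν : Measure ℝ} (hν : StdLaw ν) : sqVar ν = ∫ x, x ^ 4 ∂ν - 1 := by
  have := hν.isProbabilityMeasure
  unfold sqVar
  have e : ∀ x : ℝ, (x ^ 2 - 1) ^ 2 = x ^ 4 - 2 * x ^ 2 + 1 := fun x => by ring
  simp_rw [e]
  have i1 := hν.moments.pow 4
  have i2 := (hν.moments.pow 2).const_mul 2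
  rw [integral_add (i1.sub i2).integrable (integrable_const _),
    integral_sub i1.integrable i2.integrable, integral_const_mul, hν.var]
  simp; ring

lemma EntryLaw.allMoments {ν : Measure 𝕜} (hν : EntryLaw ν) (L : 𝕜 → ℝ) (hL : Continuous L)
    (hle : ∀ z, |L z| ≤ ‖z‖) : AllMoments L ν := by
  have := hν.isProbabilityMeasure
  have h2 : Integrable (fun x : 𝕜 => ‖x‖ ^ 2) ν := by
    by_contra h
    have := integral_undef h
    rw [hν.variance_one] at this
    norm_num at this
  refine ⟨hL.aestronglyMeasurable, fun k => ?_⟩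
  have hm := hν.logSobolev.memLp h2 (k : NNReal)
  have hi : Integrable (fun x : 𝕜 => ‖x‖ ^ k) ν := by
    have := hm.integrable_norm_pow'
    simpa using this
  refine hi.mono' (hL.aestronglyMeasurable.norm.pow k) (Eventually.of_forall fun z => ?_)
  rw [Real.norm_of_nonneg (by positivity)]
  exact pow_le_pow_left₀ (abs_nonneg _) (hle z) k

lemma EntryLaw.integral_re {ν : Measure 𝕜} (hν : EntryLaw ν) : ∫ z, RCLike.re z ∂ν = 0 := by
  by_cases hi : Integrable (fun z : 𝕜 => z) ν
  · have := (RCLike.reCLM : 𝕜 →L[ℝ] ℝ).integral_comp_comm hi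
    simp only [RCLike.reCLM_apply] at this
    rw [this, hν.centred, map_zero]
  · exfalso
    have := hν.isProbabilityMeasure
    exact hi ((integrable_norm_iff (by fun_prop)).1
      (hν.allMoments (fun z => ‖z‖) continuous_norm (fun z => by simp)).integrable)

/-- The second basis element is `0`, so one of the two real variables is idle. This keeps the same
index type `Bool` in both cases. -/
lemma EntryLaw.exists_decomposition_real {ν : Measure 𝕜} (hν : EntryLaw ν) (h : IsRealCase 𝕜) :
    ∃ ν₀ e, RealDecomposition ν ν₀ e := by
  have hp := hν.isProbabilityMeasure
  have hre : Measurable (fun z : 𝕜 => RCLike.re z) := RCLike.continuous_re.measurable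
  have hp' : IsProbabilityMeasure (ν.map fun z : 𝕜 => RCLike.re z) :=
    Measure.isProbabilityMeasure_map hre.aemeasurable
  have hn : ∀ z : 𝕜, ‖z‖ ^ 2 = RCLike.re z ^ 2 := fun z => by
    rw [norm_sq_eq_re_im, im_eq_zero_of_real h]; ring
  have hn4 : ∀ z : 𝕜, ‖z‖ ^ 4 = RCLike.re z ^ 4 := fun z => by
    rw [show 4 = 2 * 2 from rfl, pow_mul, hn, pow_mul]
  have hstd : StdLaw (ν.map fun z : 𝕜 => RCLike.re z) := by
    refine ⟨hp', ?_, ?_, ?_⟩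
    · refine ⟨by fun_prop, fun k => ?_⟩
      rw [integrable_map_measure (by fun_prop) hre.aemeasurable]
      exact (hν.allMoments _ RCLike.continuous_re RCLike.abs_re_le_norm).2 k
    · rw [integral_map hre.aemeasurable (by fun_prop)]; exact hν.integral_re
    · rw [integral_map hre.aemeasurable (by fun_prop)]
      simp_rw [← hn]; exact hν.variance_one
  refine ⟨ν.map fun z => RCLike.re z, fun b => if b then 0 else 1, hstd, ?_, by simp, ?_, ?_⟩
  · have e : (fun x : Bool → ℝ => ∑ b, (x b : 𝕜) * (if b then (0 : 𝕜) else 1)) =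
        (fun t : ℝ => (t : 𝕜)) ∘ fun x : Bool → ℝ => x false := by
      funext x; simp
    rw [e, ← Measure.map_map RCLike.continuous_ofReal.measurable (measurable_pi_apply _),
      (measurePreserving_eval (fun _ : Bool => ν.map fun z : 𝕜 => RCLike.re z) false).map_eq,
      Measure.map_map RCLike.continuous_ofReal.measurable hre]
    have : ((fun t : ℝ => (t : 𝕜)) ∘ fun z : 𝕜 => RCLike.re z) = id := by
      funext z; exact re_eq_of_real h z
    rw [this, Measure.map_id]
  · intro z
    simp [tauConst, h, hn]
  · rw [sqVar_eq hstd, integral_map hre.aemeasurable (by fun_prop)]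
    simp only [kappa4, h, if_true, hn4]
    simp; ring

/-- Here `e` is `(1, i)/√2` and `ν₀` is the law of `√2 re`, which has unit variance because the real
and imaginary parts share the variance equally. Independence of these parts gives `E|z|⁴ = 2 E(re
z)⁴ + 1/2`, hence `κ₄(ν)` is half the real fourth cumulant of `ν₀`. -/
lemma EntryLaw.exists_decomposition_complex {ν : Measure 𝕜} (hν : EntryLaw ν)
    (h : ¬ IsRealCase 𝕜) : ∃ ν₀ e, RealDecomposition ν ν₀ e := by
  have hp := hν.isProbabilityMeasure
  obtain ⟨hind, hid⟩ := hν.re_im h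
  have hI := im_I_of_complex h
  have hcre : Continuous (fun z : 𝕜 => RCLike.re z) := RCLike.continuous_re
  have hcim : Continuous (fun z : 𝕜 => RCLike.im z) := RCLike.continuous_im
  have mre : AllMoments (fun z : 𝕜 => RCLike.re z) ν :=
    hν.allMoments _ hcre RCLike.abs_re_le_norm
  have mim : AllMoments (fun z : 𝕜 => RCLike.im z) ν :=
    hν.allMoments _ hcim RCLike.abs_im_le_norm
  have hre : Measurable (fun z : 𝕜 => √2 * RCLike.re z) := (hcre.const_mul _).measurable
  have him : Measurable (fun z : 𝕜 => √2 * RCLike.im z) := (hcim.const_mul _).measurable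
  set ν₀ := ν.map fun z : 𝕜 => √2 * RCLike.re z with hν₀
  have hν₀' : ν₀ = ν.map fun z : 𝕜 => √2 * RCLike.im z :=
    (hid.comp (u := fun t => √2 * t) (by fun_prop)).map_eq
  have hp' : IsProbabilityMeasure ν₀ := Measure.isProbabilityMeasure_map hre.aemeasurable
  have h2 : √2 ^ 2 = (2 : ℝ) := Real.sq_sqrt (by norm_num)
  have hsq : ∫ z : 𝕜, RCLike.re z ^ 2 ∂ν = ∫ z : 𝕜, RCLike.im z ^ 2 ∂ν :=
    (hid.comp (u := fun t => t ^ 2) (by fun_prop)).integral_eq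
  have hv := hν.variance_one
  simp_rw [norm_sq_eq_re_im] at hv
  rw [integral_add (mre.pow 2).integrable (mim.pow 2).integrable] at hv
  have hstd : StdLaw ν₀ := by
    refine ⟨hp', ?_, ?_, ?_⟩
    · refine ⟨by fun_prop, fun k => ?_⟩
      rw [hν₀, integrable_map_measure (by fun_prop) hre.aemeasurable]
      exact (mre.const_mul √2).2 k
    · rw [hν₀, integral_map hre.aemeasurable (by fun_prop), integral_const_mul, hν.integral_re,
        mul_zero]
    · rw [hν₀, integral_map hre.aemeasurable (by fun_prop)]
      simp_rw [mul_pow, h2]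
      rw [integral_const_mul]; linarith
  let e : Bool → 𝕜 := fun b => if b then (((√2)⁻¹ : ℝ) : 𝕜) * RCLike.I else (((√2)⁻¹ : ℝ) : 𝕜)
  have hI1 : ‖(RCLike.I : 𝕜)‖ = 1 := RCLike.norm_I_of_ne_zero h
  have hne : ∀ b, ‖e b‖ = (√2)⁻¹ := by
    intro b; cases b <;> simp [e, hI1]
  have hinv : ((√2)⁻¹) ^ 2 = (1 / 2 : ℝ) := by rw [inv_pow, h2]; norm_num
  refine ⟨ν₀, e, hstd, ?_, ?_, ?_, ?_⟩
  · let φ : 𝕜 → Bool → ℝ := fun z b => if b then √2 * RCLike.im z else √2 * RCLike.re z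
    have hφ : Measurable φ := measurable_pi_lambda _ fun b => by
      cases b
      · exact hre
      · exact him
    have hmap : (Measure.pi fun _ : Bool => ν₀) = ν.map φ := by
      symm
      refine (Measure.pi_eq fun s hs => ?_).symm
      rw [Measure.map_apply hφ (MeasurableSet.univ_pi hs)]
      have e1 : φ ⁻¹' Set.univ.pi s = (fun z : 𝕜 => RCLike.re z) ⁻¹' ((fun t => √2 * t) ⁻¹' s false) ∩
          (fun z : 𝕜 => RCLike.im z) ⁻¹' ((fun t => √2 * t) ⁻¹' s true) := by
        ext z; simp [φ]
      have hmul : Measurable (fun t : ℝ => √2 * t) := by fun_prop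
      rw [e1, hind.measure_inter_preimage_eq_mul _ _ (hmul (hs _)) (hmul (hs _)),
        Fintype.prod_bool, mul_comm]
      congr 1
      · rw [hν₀', Measure.map_apply him (hs _)]; rfl
      · rw [hν₀, Measure.map_apply hre (hs _)]; rfl
    have hψ : Measurable (fun x : Bool → ℝ => ∑ b, (x b : 𝕜) * e b) := by
      refine Continuous.measurable ?_
      refine continuous_finsetSum _ fun b _ => ?_
      exact (RCLike.continuous_ofReal.comp (continuous_apply b)).mul continuous_const
    rw [hmap, Measure.map_map hψ hφ]
    have : ((fun x : Bool → ℝ => ∑ b, (x b : 𝕜) * e b) ∘ φ) = id := by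
      funext z
      have h0 : √2 ≠ 0 := by positivity
      have hc : ((√2 : ℝ) : 𝕜) * (((√2)⁻¹ : ℝ) : 𝕜) = 1 := by
        rw [← RCLike.ofReal_mul, mul_inv_cancel₀ h0, RCLike.ofReal_one]
      simp only [Function.comp_apply, φ, e, Fintype.sum_bool, if_true, RCLike.ofReal_mul, id,
        Bool.false_eq_true, if_false]
      conv_rhs => rw [← RCLike.re_add_im z]
      linear_combination ((RCLike.im z : ℝ) * RCLike.I + (RCLike.re z : ℝ) : 𝕜) * hc
    rw [this, Measure.map_id]
  · simp only [hne, hinv]; norm_num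
  · intro z
    have hc : ∀ w : 𝕜, RCLike.re ((((√2)⁻¹ : ℝ) : 𝕜) * w) = (√2)⁻¹ * RCLike.re w :=
      fun w => RCLike.re_ofReal_mul _ _
    have hc2 : ∀ w : 𝕜, RCLike.re (w * (((√2)⁻¹ : ℝ) : 𝕜)) = (√2)⁻¹ * RCLike.re w :=
      fun w => by rw [mul_comm, hc]
    have h1 : RCLike.re (conj (e false) * z * e false) = 1 / 2 * RCLike.re z := by
      simp only [e, Bool.false_eq_true, if_false, RCLike.conj_ofReal, hc2, hc]
      rw [← hinv]; ring
    have h2 : RCLike.re (conj (e false) * z * e true) = - (1 / 2 * RCLike.im z) := by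
      simp only [e, Bool.false_eq_true, if_false, if_true, RCLike.conj_ofReal]
      rw [show (((√2)⁻¹ : ℝ) : 𝕜) * z * ((((√2)⁻¹ : ℝ) : 𝕜) * RCLike.I) =
        (((√2)⁻¹ : ℝ) : 𝕜) * ((((√2)⁻¹ : ℝ) : 𝕜) * (z * RCLike.I)) by ring, hc, hc, RCLike.mul_re]
      simp only [RCLike.I_re, hI]
      rw [← hinv]; ring
    have h3 : RCLike.re (conj (e true) * z * e false) = 1 / 2 * RCLike.im z := by
      simp only [e, Bool.false_eq_true, if_false, if_true, map_mul, RCLike.conj_ofReal,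
        RCLike.conj_I]
      rw [show (((√2)⁻¹ : ℝ) : 𝕜) * -RCLike.I * z * (((√2)⁻¹ : ℝ) : 𝕜) =
        (((√2)⁻¹ : ℝ) : 𝕜) * ((((√2)⁻¹ : ℝ) : 𝕜) * -(z * RCLike.I)) by ring, hc, hc, map_neg,
        RCLike.mul_re]
      simp only [RCLike.I_re, hI]
      rw [← hinv]; ring
    have h4 : RCLike.re (conj (e true) * z * e true) = 1 / 2 * RCLike.re z := by
      have hII : (RCLike.I : 𝕜) * RCLike.I = -1 := (RCLike.I_mul_I_ax).resolve_left h
      simp only [e, if_true, map_mul, RCLike.conj_ofReal, RCLike.conj_I]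
      rw [show (((√2)⁻¹ : ℝ) : 𝕜) * -RCLike.I * z * ((((√2)⁻¹ : ℝ) : 𝕜) * RCLike.I) =
        (((√2)⁻¹ : ℝ) : 𝕜) * ((((√2)⁻¹ : ℝ) : 𝕜) * (-(RCLike.I * RCLike.I) * z)) by ring, hc, hc,
        hII]
      rw [neg_neg, one_mul, ← hinv]; ring
    simp only [Fintype.sum_bool, h1, h2, h3, h4, tauConst, h, if_false, norm_sq_eq_re_im]
    ring
  · rw [sqVar_eq hstd]
    have hm : ∫ x, x ^ 4 ∂ν₀ = 4 * ∫ z : 𝕜, RCLike.re z ^ 4 ∂ν := by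
      rw [hν₀, integral_map hre.aemeasurable (by fun_prop), ← integral_const_mul]
      congr 1; funext z
      rw [mul_pow, show √2 ^ 4 = (√2 ^ 2) ^ 2 by ring, h2]; norm_num
    have h4 : ∫ z : 𝕜, RCLike.re z ^ 4 ∂ν = ∫ z : 𝕜, RCLike.im z ^ 4 ∂ν :=
      (hid.comp (u := fun t => t ^ 4) (by fun_prop)).integral_eq
    have hprod : ∫ z : 𝕜, RCLike.re z ^ 2 * RCLike.im z ^ 2 ∂ν = 1 / 4 := by
      rw [hind.integral_fun_comp_mul_comp (f := fun t : ℝ => t ^ 2) (g := fun t : ℝ => t ^ 2)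
        hcre.aemeasurable hcim.aemeasurable (by fun_prop) (by fun_prop), ← hsq]
      have : ∫ z : 𝕜, RCLike.re z ^ 2 ∂ν = 1 / 2 := by linarith
      rw [this]; norm_num
    have hk : ∫ z : 𝕜, ‖z‖ ^ 4 ∂ν = 2 * ∫ z : 𝕜, RCLike.re z ^ 4 ∂ν + 1 / 2 := by
      have e1 : ∀ z : 𝕜, ‖z‖ ^ 4 = RCLike.re z ^ 4 + 2 * (RCLike.re z ^ 2 * RCLike.im z ^ 2) +
          RCLike.im z ^ 4 := fun z => by
        rw [show 4 = 2 * 2 from rfl, pow_mul, norm_sq_eq_re_im]; ring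
      simp_rw [e1]
      have i1 := mre.pow 4
      have i2 := ((mre.pow 2).mul (mim.pow 2)).const_mul 2
      rw [integral_add (i1.add i2).integrable (mim.pow 4).integrable,
        integral_add i1.integrable i2.integrable, integral_const_mul, hprod, ← h4]
      ring
    simp only [kappa4, h, if_false, hk, hm, hne, Fintype.sum_bool,
      show ((√2)⁻¹ : ℝ) ^ 4 = (((√2)⁻¹) ^ 2) ^ 2 by ring, hinv]
    ring

lemma EntryLaw.exists_decomposition {ν : Measure 𝕜} (hν : EntryLaw ν) :
    ∃ ν₀ e, RealDecomposition ν ν₀ e := by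
  by_cases h : IsRealCase 𝕜
  · exact hν.exists_decomposition_real h
  · exact hν.exists_decomposition_complex h

end Decomposition

/-! ### Hermitian forms in independent entries -/

section HermitianForms

open ComplexConjugate

variable {𝕜 : Type*} [RCLike 𝕜] {Ω : Type*} [MeasurableSpace Ω] {P : Measure Ω}
  [IsProbabilityMeasure P] {ι : Type*} [Fintype ι] [DecidableEq ι]

/-- The centred Hermitian form `∑ M_ij conj(g_i) g_j - tr M`. -/
noncomputable def hermForm (M : ι → ι → 𝕜) (g : ι → 𝕜) : ℝ :=
  ∑ i, ∑ j, RCLike.re (conj (g i) * M i j * g j) - ∑ i, RCLike.re (M i i)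

/-- `β` bounds the operator norm of the matrix `M`. -/
def HermBound (M : ι → ι → 𝕜) (β : ℝ) : Prop :=
  ∀ v : ι → 𝕜, ∑ i, ‖∑ j, M i j * v j‖ ^ 2 ≤ β ^ 2 * ∑ j, ‖v j‖ ^ 2

/-- The entries built from an array of real variables. -/
noncomputable def entry (e : Bool → 𝕜) (x : ι × Bool → ℝ) (i : ι) : 𝕜 := ∑ b, (x (i, b) : 𝕜) * e b

/-- The matrix of the Hermitian form `M` in the real variables. -/
noncomputable def realMatrix (e : Bool → 𝕜) (M : ι → ι → 𝕜) (p q : ι × Bool) : ℝ :=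
  RCLike.re (conj (e p.2) * M p.1 q.1 * e q.2)

/-- The variance of a Hermitian form. -/
noncomputable def hermVar (κ : ℝ) (M : ι → ι → 𝕜) : ℝ :=
  tauConst 𝕜 * ∑ i, ∑ j, ‖M i j‖ ^ 2 + κ * ∑ i, RCLike.re (M i i) ^ 2

lemma realMatrix_symm (e : Bool → 𝕜) {M : ι → ι → 𝕜} (hM : ∀ i j, M j i = conj (M i j))
    (p q : ι × Bool) : realMatrix e M p q = realMatrix e M q p := by
  unfold realMatrix
  rw [hM p.1 q.1, ← RCLike.conj_re]
  congr 1
  simp only [map_mul, RCLike.conj_conj]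
  ring

variable {ν : Measure 𝕜} {ν₀ : Measure ℝ} {e : Bool → 𝕜}

lemma re_conj_mul_self_mul (a m : 𝕜) : RCLike.re (conj a * m * a) = ‖a‖ ^ 2 * RCLike.re m := by
  rw [mul_right_comm, RCLike.conj_mul, ← RCLike.ofReal_pow, RCLike.re_ofReal_mul]

lemma quadForm_realMatrix (hd : RealDecomposition ν ν₀ e) (M : ι → ι → 𝕜) (x : ι × Bool → ℝ) :
    quadForm (realMatrix e M) Finset.univ x = hermForm M (entry e x) := by
  unfold quadForm hermForm
  congr 1
  · simp_rw [Fintype.sum_prod_type]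
    refine Finset.sum_congr rfl fun i _ => ?_
    rw [Finset.sum_comm]
    refine Finset.sum_congr rfl fun j _ => ?_
    simp only [entry, map_sum, Finset.sum_mul, Finset.mul_sum, map_mul, RCLike.conj_ofReal]
    rw [Finset.sum_comm]
    refine Finset.sum_congr rfl fun b _ => Finset.sum_congr rfl fun b' _ => ?_
    rw [show (x (i, b') : 𝕜) * conj (e b') * M i j * ((x (j, b) : 𝕜) * e b) =
      ((x (i, b') : ℝ) : 𝕜) * (((x (j, b) : ℝ) : 𝕜) * (conj (e b') * M i j * e b)) by ring,
      RCLike.re_ofReal_mul, RCLike.re_ofReal_mul]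
    simp only [realMatrix]; ring
  · rw [Fintype.sum_prod_type]
    refine Finset.sum_congr rfl fun i _ => ?_
    simp only [realMatrix, re_conj_mul_self_mul]
    rw [← Finset.sum_mul, hd.sum_sq, one_mul]

lemma two_mul_sum_realMatrix_sq (hd : RealDecomposition ν ν₀ e) (M : ι → ι → 𝕜) :
    2 * ∑ p, ∑ q, realMatrix e M p q ^ 2 = tauConst 𝕜 * ∑ i, ∑ j, ‖M i j‖ ^ 2 := by
  simp_rw [Fintype.sum_prod_type, Finset.mul_sum]
  refine Finset.sum_congr rfl fun i _ => ?_
  simp_rw [← Finset.mul_sum]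
  rw [Finset.sum_comm, Finset.mul_sum, Finset.mul_sum]
  refine Finset.sum_congr rfl fun j _ => ?_
  exact hd.pair (M i j)

lemma quadVar_realMatrix (hd : RealDecomposition ν ν₀ e) (M : ι → ι → 𝕜) :
    quadVar ν₀ (realMatrix e M) = hermVar (kappa4 ν) M := by
  unfold quadVar hermVar
  rw [two_mul_sum_realMatrix_sq hd, ← hd.diag]
  congr 1
  rw [mul_assoc]
  congr 1
  rw [Fintype.sum_prod_type, Finset.sum_mul_sum, Finset.sum_comm]
  refine Finset.sum_congr rfl fun b _ => Finset.sum_congr rfl fun i _ => ?_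
  simp only [realMatrix, re_conj_mul_self_mul]; ring

/-- The map from real coordinates to entries, and its adjoint, are contractions since `∑ ‖e_b‖² =
1`, so the operator bound passes over unchanged. -/
lemma opBound_realMatrix (hd : RealDecomposition ν ν₀ e) {M : ι → ι → 𝕜} {β : ℝ}
    (hM : HermBound M β) : OpBound (realMatrix e M) β := by
  intro v
  have h1 : ∀ p : ι × Bool, ∑ q, realMatrix e M p q * v q =
      RCLike.re (conj (e p.2) * ∑ j, M p.1 j * entry e v j) := by
    intro p
    rw [Fintype.sum_prod_type, Finset.mul_sum, map_sum]
    refine Finset.sum_congr rfl fun j _ => ?_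
    simp only [entry, Finset.mul_sum, map_sum]
    refine Finset.sum_congr rfl fun b _ => ?_
    rw [show conj (e p.2) * (M p.1 j * ((v (j, b) : 𝕜) * e b)) =
      ((v (j, b) : ℝ) : 𝕜) * (conj (e p.2) * M p.1 j * e b) by ring, RCLike.re_ofReal_mul]
    simp only [realMatrix]; ring
  simp_rw [h1]
  have h2 : ∀ p : ι × Bool, RCLike.re (conj (e p.2) * ∑ j, M p.1 j * entry e v j) ^ 2 ≤
      ‖e p.2‖ ^ 2 * ‖∑ j, M p.1 j * entry e v j‖ ^ 2 := by
    intro p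
    rw [← mul_pow, ← sq_abs]
    refine pow_le_pow_left₀ (abs_nonneg _) ((RCLike.abs_re_le_norm _).trans (le_of_eq ?_)) 2
    rw [norm_mul, RCLike.norm_conj]
  have h3 : ∀ j, ‖entry e v j‖ ^ 2 ≤ ∑ b, v (j, b) ^ 2 := by
    intro j
    have : ‖entry e v j‖ ≤ ∑ b, |v (j, b)| * ‖e b‖ := by
      refine (norm_sum_le _ _).trans (Finset.sum_le_sum fun b _ => ?_)
      rw [norm_mul, RCLike.norm_ofReal]
    refine (pow_le_pow_left₀ (norm_nonneg _) this 2).trans ?_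
    refine (Finset.sum_mul_sq_le_sq_mul_sq _ _ _).trans ?_
    rw [hd.sum_sq, mul_one]
    simp
  refine (Finset.sum_le_sum fun p _ => h2 p).trans ?_
  rw [Fintype.sum_prod_type]
  simp_rw [← Finset.sum_mul, hd.sum_sq, one_mul]
  refine (hM _).trans ?_
  rw [Fintype.sum_prod_type]
  gcongr with j
  exact h3 j

lemma tauConst_pos : 0 < tauConst 𝕜 := by unfold tauConst; split_ifs <;> norm_num

variable {x : ι × Bool → Ω → ℝ}

theorem norm_charFun_hermForm_sub_le (hd : RealDecomposition ν ν₀ e) (hx : StdFamily ν₀ x P)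
    {M : ι → ι → 𝕜} (hM : ∀ i j, M j i = conj (M i j)) {β : ℝ} (hβ : 0 < β) (hop : HermBound M β) :
    ‖∫ ω, cis (hermForm M (entry e fun p => x p ω)) ∂P -
      Complex.exp (-(hermVar (kappa4 ν) M / 2 : ℝ))‖ ≤
    StdFamily.cltConst ν₀ * (β * (tauConst 𝕜 / 2 * ∑ i, ∑ j, ‖M i j‖ ^ 2) +
      β * √(tauConst 𝕜 / 2 * ∑ i, ∑ j, ‖M i j‖ ^ 2)) := by
  have h := hx.norm_charFun_quadForm_sub_le (realMatrix_symm e hM) hβ (opBound_realMatrix hd hop)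
  simp only [quadForm_realMatrix hd, quadVar_realMatrix hd] at h
  have e1 : ∑ p, ∑ q, realMatrix e M p q ^ 2 = tauConst 𝕜 / 2 * ∑ i, ∑ j, ‖M i j‖ ^ 2 := by
    linarith [two_mul_sum_realMatrix_sq hd M]
  rwa [e1] at h

theorem integral_hermForm_sq_le (hd : RealDecomposition ν ν₀ e) (hx : StdFamily ν₀ x P)
    {M : ι → ι → 𝕜} (hM : ∀ i j, M j i = conj (M i j)) :
    ∫ ω, hermForm M (entry e fun p => x p ω) ^ 2 ∂P ≤
    (4 + 2 * sqVar ν₀) * (tauConst 𝕜 / 2 * ∑ i, ∑ j, ‖M i j‖ ^ 2) := by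
  have h := hx.integral_quadForm_sq_le (realMatrix_symm e hM) Finset.univ
  simp only [quadForm_realMatrix hd] at h
  have e1 : ∑ p, ∑ q, realMatrix e M p q ^ 2 = tauConst 𝕜 / 2 * ∑ i, ∑ j, ‖M i j‖ ^ 2 := by
    linarith [two_mul_sum_realMatrix_sq hd M]
  rwa [e1] at h

lemma hermForm_moments (hd : RealDecomposition ν ν₀ e) (hx : StdFamily ν₀ x P) (M : ι → ι → 𝕜) :
    AllMoments (fun ω => hermForm M (entry e fun p => x p ω)) P := by
  have h := hx.quadForm_moments (realMatrix e M) Finset.univ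
  simpa only [quadForm_realMatrix hd] using h

end HermitianForms

/-! ### Fluctuations of sesquilinear forms -/

section Fluctuations

open ComplexConjugate

variable {𝕜 : Type*} [RCLike 𝕜] {r n q : ℕ}

/-- The centred sesquilinear form `g_s^* B g_t - δ_st tr B`. -/
noncomputable def fluct (B : Matrix (Fin n) (Fin n) 𝕜) (g : Fin r → Fin n → 𝕜) (s t : Fin r) : 𝕜 :=
  ∑ a, ∑ b, conj (g s a) * B a b * g t b - if s = t then B.trace else 0

/-- The matrix `∑ C_j ⊗ A_j`. -/
noncomputable def tensorSum (C : Fin q → Fin r → Fin r → 𝕜)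
    (A : Fin q → Matrix (Fin n) (Fin n) 𝕜) (p p' : Fin r × Fin n) : 𝕜 :=
  ∑ j, C j p.1 p'.1 * A j p.2 p'.2

/-- The Cramér-Wold device: a real linear functional of all fluctuation matrices is one Hermitian
form, with kernel `∑ C_j ⊗ A_j`. The central limit theorem for a single form therefore yields the
joint one. -/
lemma hermForm_tensorSum (C : Fin q → Fin r → Fin r → 𝕜) (A : Fin q → Matrix (Fin n) (Fin n) 𝕜)
    (g : Fin r → Fin n → 𝕜) :
    hermForm (tensorSum C A) (fun p => g p.1 p.2) =
      ∑ j, ∑ s, ∑ t, RCLike.re (C j s t * fluct (A j) g s t) := by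
  have e1 : ∀ j, ∑ s, ∑ t, RCLike.re (C j s t * fluct (A j) g s t) =
      ∑ s, ∑ t, ∑ a, ∑ b, RCLike.re (conj (g s a) * (C j s t * A j a b) * g t b) -
        ∑ s, ∑ a, RCLike.re (C j s s * A j a a) := by
    intro j
    rw [← Finset.sum_sub_distrib]
    refine Finset.sum_congr rfl fun s _ => ?_
    have e2 : ∑ a, RCLike.re (C j s s * A j a a) =
        ∑ t, if s = t then RCLike.re (C j s t * (A j).trace) else 0 := by
      rw [Finset.sum_ite_eq, if_pos (Finset.mem_univ _), Matrix.trace, Finset.mul_sum, map_sum]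
      rfl
    rw [e2, ← Finset.sum_sub_distrib]
    refine Finset.sum_congr rfl fun t _ => ?_
    rw [fluct, mul_sub, map_sub]
    congr 1
    · rw [Finset.mul_sum, map_sum]
      refine Finset.sum_congr rfl fun a _ => ?_
      rw [Finset.mul_sum, map_sum]
      exact Finset.sum_congr rfl fun b _ => by congr 1; ring
    · split_ifs <;> simp
  simp_rw [e1, Finset.sum_sub_distrib]
  unfold hermForm tensorSum
  congr 1
  · simp_rw [Fintype.sum_prod_type, Finset.mul_sum, Finset.sum_mul, map_sum]
    conv_rhs => rw [Finset.sum_comm]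
    refine Finset.sum_congr rfl fun s _ => ?_
    conv_lhs => rw [Finset.sum_comm]
    conv_rhs => rw [Finset.sum_comm]
    refine Finset.sum_congr rfl fun t _ => ?_
    conv_rhs => rw [Finset.sum_comm]
    refine Finset.sum_congr rfl fun a _ => ?_
    conv_rhs => rw [Finset.sum_comm]
  · simp_rw [Fintype.sum_prod_type, map_sum]
    conv_rhs => rw [Finset.sum_comm]
    refine Finset.sum_congr rfl fun s _ => ?_
    rw [Finset.sum_comm]

lemma tensorSum_herm {C : Fin q → Fin r → Fin r → 𝕜} {A : Fin q → Matrix (Fin n) (Fin n) 𝕜}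
    (hC : ∀ j s t, C j t s = conj (C j s t)) (hA : ∀ j, (A j).IsHermitian) (p p' : Fin r × Fin n) :
    tensorSum C A p' p = conj (tensorSum C A p p') := by
  unfold tensorSum
  rw [map_sum]
  refine Finset.sum_congr rfl fun j _ => ?_
  rw [map_mul, ← hC]
  congr 1
  exact ((hA j).apply _ _).symm

/-- Cauchy-Schwarz over the pairs `(j, t)`; the factor `q` arises because each `A_j` is applied to
the whole vector. -/
lemma hermBound_tensorSum {C : Fin q → Fin r → Fin r → 𝕜} {A : Fin q → Matrix (Fin n) (Fin n) 𝕜}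
    {β K : ℝ} (hA : ∀ j, HermBound (A j) β)
    (hK : q * (∑ j, ∑ s, ∑ t, ‖C j s t‖ ^ 2) * β ^ 2 ≤ K ^ 2) : HermBound (tensorSum C A) K := by
  intro v
  have h1 : ∀ p : Fin r × Fin n, ‖∑ p', tensorSum C A p p' * v p'‖ ^ 2 ≤
      (∑ x : Fin q × Fin r, ‖C x.1 p.1 x.2‖ ^ 2) *
        ∑ x : Fin q × Fin r, ‖∑ b, A x.1 p.2 b * v (x.2, b)‖ ^ 2 := by
    intro p
    have e : ∑ p', tensorSum C A p p' * v p' =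
        ∑ x : Fin q × Fin r, C x.1 p.1 x.2 * ∑ b, A x.1 p.2 b * v (x.2, b) := by
      simp only [tensorSum, Fintype.sum_prod_type, Finset.sum_mul, Finset.mul_sum]
      conv_rhs => rw [Finset.sum_comm]
      refine Finset.sum_congr rfl fun t _ => ?_
      rw [Finset.sum_comm]
      exact Finset.sum_congr rfl fun j _ => Finset.sum_congr rfl fun b _ => by ring
    rw [e]
    refine (pow_le_pow_left₀ (norm_nonneg _) (norm_sum_le _ _) 2).trans ?_
    simp_rw [norm_mul]
    exact Finset.sum_mul_sq_le_sq_mul_sq _ _ _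
  refine (Finset.sum_le_sum fun p _ => h1 p).trans ?_
  rw [Fintype.sum_prod_type]
  simp_rw [← Finset.mul_sum]
  rw [← Finset.sum_mul]
  have h2 : ∑ a, ∑ x : Fin q × Fin r, ‖∑ b, A x.1 a b * v (x.2, b)‖ ^ 2 ≤
      q * (β ^ 2 * ∑ p, ‖v p‖ ^ 2) := by
    rw [Finset.sum_comm, Fintype.sum_prod_type, Fintype.sum_prod_type]
    have : ∀ j : Fin q, ∑ t, ∑ a, ‖∑ b, A j a b * v (t, b)‖ ^ 2 ≤
        β ^ 2 * ∑ t, ∑ b, ‖v (t, b)‖ ^ 2 := by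
      intro j
      rw [Finset.mul_sum]
      exact Finset.sum_le_sum fun t _ => hA j fun b => v (t, b)
    refine (Finset.sum_le_sum fun j _ => this j).trans ?_
    simp
  have h3 : ∑ s, ∑ x : Fin q × Fin r, ‖C x.1 s x.2‖ ^ 2 = ∑ j, ∑ s, ∑ t, ‖C j s t‖ ^ 2 := by
    simp_rw [Fintype.sum_prod_type]
    rw [Finset.sum_comm]
  rw [h3]
  have h4 : 0 ≤ ∑ j, ∑ s, ∑ t, ‖C j s t‖ ^ 2 := by positivity
  have h5 : 0 ≤ ∑ p, ‖v p‖ ^ 2 := by positivity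
  calc _ ≤ (∑ j, ∑ s, ∑ t, ‖C j s t‖ ^ 2) * (q * (β ^ 2 * ∑ p, ‖v p‖ ^ 2)) := by gcongr
    _ = q * (∑ j, ∑ s, ∑ t, ‖C j s t‖ ^ 2) * β ^ 2 * ∑ p, ‖v p‖ ^ 2 := by ring
    _ ≤ _ := by gcongr

/-- At most one of the `C_j` has a nonzero entry at any given place. -/
def DisjointSupports (C : Fin q → Fin r → Fin r → 𝕜) : Prop :=
  ∀ s t j j', j ≠ j' → C j s t = 0 ∨ C j' s t = 0

lemma norm_sq_sum_of_disjoint {f : Fin q → 𝕜} (hf : ∀ j j', j ≠ j' → f j = 0 ∨ f j' = 0) :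
    ‖∑ j, f j‖ ^ 2 = ∑ j, ‖f j‖ ^ 2 := by
  by_cases h : ∃ j, f j ≠ 0
  · obtain ⟨j, hj⟩ := h
    have h0 : ∀ j', j' ≠ j → f j' = 0 := fun j' hj' => (hf j' j hj').resolve_right hj
    rw [Finset.sum_eq_single j (fun j' _ h => h0 j' h) (by simp),
      Finset.sum_eq_single j (fun j' _ h => by simp [h0 j' h]) (by simp)]
  · push Not at h
    simp [h]

lemma re_sq_sum_of_disjoint {f : Fin q → 𝕜} (hf : ∀ j j', j ≠ j' → f j = 0 ∨ f j' = 0) :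
    RCLike.re (∑ j, f j) ^ 2 = ∑ j, RCLike.re (f j) ^ 2 := by
  by_cases h : ∃ j, f j ≠ 0
  · obtain ⟨j, hj⟩ := h
    have h0 : ∀ j', j' ≠ j → f j' = 0 := fun j' hj' => (hf j' j hj').resolve_right hj
    rw [Finset.sum_eq_single j (fun j' _ h => h0 j' h) (by simp),
      Finset.sum_eq_single j (fun j' _ h => by simp [h0 j' h]) (by simp)]
  · push Not at h
    simp [h]

lemma conj_eq_re_of_herm {z : 𝕜} (h : z = conj z) : ((RCLike.re z : ℝ) : 𝕜) = z :=
  RCLike.conj_eq_iff_re.1 h.symm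

/-- Disjoint supports remove the cross terms between different `j` from both sums. This is the
source of the independence of the limiting blocks. -/
lemma hermVar_tensorSum {C : Fin q → Fin r → Fin r → 𝕜} {A : Fin q → Matrix (Fin n) (Fin n) 𝕜}
    (hC : ∀ j s t, C j t s = conj (C j s t)) (hd : DisjointSupports C) (κ : ℝ) :
    hermVar κ (tensorSum C A) = ∑ j,
      (tauConst 𝕜 * ((∑ a, ∑ b, ‖A j a b‖ ^ 2) * ∑ s, ∑ t, ‖C j s t‖ ^ 2) +
        κ * ((∑ a, RCLike.re (A j a a) ^ 2) * ∑ s, RCLike.re (C j s s) ^ 2)) := by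
  unfold hermVar
  rw [Finset.sum_add_distrib, ← Finset.mul_sum, ← Finset.mul_sum]
  congr 2
  · have h1 : ∀ p p' : Fin r × Fin n, ‖tensorSum C A p p'‖ ^ 2 =
        ∑ j, ‖C j p.1 p'.1‖ ^ 2 * ‖A j p.2 p'.2‖ ^ 2 := by
      intro p p'
      unfold tensorSum
      rw [norm_sq_sum_of_disjoint fun j j' h => by
        rcases hd p.1 p'.1 j j' h with h | h <;> simp [h]]
      simp_rw [norm_mul, mul_pow]
    simp_rw [h1, Fintype.sum_prod_type, Finset.sum_mul, Finset.mul_sum]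
    conv_rhs => rw [Finset.sum_comm]; enter [2, a]; rw [Finset.sum_comm]
    conv_lhs => rw [Finset.sum_comm]
    refine Finset.sum_congr rfl fun a _ => ?_
    conv_rhs => rw [Finset.sum_comm]; enter [2, j]; rw [Finset.sum_comm]
    conv_lhs => enter [2, s, 2, t]; rw [Finset.sum_comm]
    conv_lhs => enter [2, s]; rw [Finset.sum_comm]
    conv_lhs => rw [Finset.sum_comm]
    refine Finset.sum_congr rfl fun j _ => ?_
    refine Finset.sum_congr rfl fun s _ => ?_
    rw [Finset.sum_comm]
    exact Finset.sum_congr rfl fun b _ => Finset.sum_congr rfl fun t _ => by ring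
  · have h1 : ∀ p : Fin r × Fin n, RCLike.re (tensorSum C A p p) ^ 2 =
        ∑ j, RCLike.re (C j p.1 p.1) ^ 2 * RCLike.re (A j p.2 p.2) ^ 2 := by
      intro p
      unfold tensorSum
      rw [re_sq_sum_of_disjoint fun j j' h => by
        rcases hd p.1 p.1 j j' h with h | h <;> simp [h]]
      refine Finset.sum_congr rfl fun j _ => ?_
      rw [← mul_pow, ← RCLike.re_ofReal_mul, conj_eq_re_of_herm (hC j p.1 p.1)]
    simp_rw [h1, Fintype.sum_prod_type, Finset.sum_mul, Finset.mul_sum]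
    conv_rhs => rw [Finset.sum_comm]
    conv_lhs => rw [Finset.sum_comm]
    refine Finset.sum_congr rfl fun a _ => ?_
    conv_rhs => enter [2, j]
    rw [Finset.sum_comm]
    exact Finset.sum_congr rfl fun b _ => Finset.sum_congr rfl fun t _ => by ring

lemma fluct_conj {B : Matrix (Fin n) (Fin n) 𝕜} (hB : B.IsHermitian) (g : Fin r → Fin n → 𝕜)
    (s t : Fin r) : fluct B g t s = conj (fluct B g s t) := by
  have htr : conj B.trace = B.trace := by
    have := Matrix.trace_conjTranspose B
    rw [hB.eq] at this; exact this.symm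
  unfold fluct
  rw [map_sub, map_sum]
  congr 1
  · rw [Finset.sum_comm]
    refine Finset.sum_congr rfl fun a _ => ?_
    rw [map_sum]
    refine Finset.sum_congr rfl fun b _ => ?_
    have : B b a = conj (B a b) := (hB.apply b a).symm
    rw [this]
    simp only [map_mul, RCLike.conj_conj]; ring
  · simp only [eq_comm (a := t)]
    split_ifs <;> simp [htr]

variable {Ω : Type*} [MeasurableSpace Ω] {P : Measure Ω} [IsProbabilityMeasure P]
  {ν : Measure 𝕜} {ν₀ : Measure ℝ} {e : Bool → 𝕜}

/-- The array of entries. -/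
noncomputable def entries (e : Bool → 𝕜) (x : (Fin r × Fin n) × Bool → Ω → ℝ) (ω : Ω) (s : Fin r)
    (a : Fin n) : 𝕜 := entry e (fun p => x p ω) (s, a)

/-- The constant in the second moment bound for the fluctuations. -/
noncomputable def fluctConst (𝕜 : Type*) [RCLike 𝕜] (ν₀ : Measure ℝ) : ℝ :=
  (4 + 2 * sqVar ν₀) * tauConst 𝕜

lemma fluctConst_nonneg (ν₀ : Measure ℝ) : 0 ≤ fluctConst 𝕜 ν₀ := by
  have := sqVar_nonneg ν₀
  have := tauConst_pos (𝕜 := 𝕜)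
  unfold fluctConst; positivity

/-- The variable is a Hermitian form with kernel `C ⊗ B`, where `C` has `c/2` at `(s, t)` and its
conjugate at `(t, s)`; for `s = t` the two contributions add up. The bound for forms then applies,
as the squared norm of `C` is at most `1`. -/
lemma integral_re_mul_fluct_sq_le (hd : RealDecomposition ν ν₀ e)
    {x : (Fin r × Fin n) × Bool → Ω → ℝ} (hx : StdFamily ν₀ x P) {B : Matrix (Fin n) (Fin n) 𝕜}
    (hB : B.IsHermitian) (s t : Fin r) {c : 𝕜} (hc : ‖c‖ ≤ 1) :
    AllMoments (fun ω => RCLike.re (c * fluct B (entries e x ω) s t)) P ∧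
    ∫ ω, RCLike.re (c * fluct B (entries e x ω) s t) ^ 2 ∂P ≤
      fluctConst 𝕜 ν₀ / 2 * ∑ a, ∑ b, ‖B a b‖ ^ 2 := by
  let C : Fin 1 → Fin r → Fin r → 𝕜 := fun _ s' t' =>
    (if s' = s ∧ t' = t then c / 2 else 0) + (if s' = t ∧ t' = s then conj c / 2 else 0)
  have hC : ∀ j s' t', C j t' s' = conj (C j s' t') := by
    intro j s' t'
    simp only [C, map_add, apply_ite conj, map_zero, map_div₀, RCLike.conj_conj, map_ofNat]
    rw [add_comm]
    simp only [and_comm]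
  let A : Fin 1 → Matrix (Fin n) (Fin n) 𝕜 := fun _ => B
  have hform : ∀ ω, hermForm (tensorSum C A) (entry e fun p => x p ω) =
      RCLike.re (c * fluct B (entries e x ω) s t) := by
    intro ω
    have h := hermForm_tensorSum C A (entries e x ω)
    refine Eq.trans (by rfl) (h.trans ?_)
    simp only [Fin.sum_univ_one, C, A, add_mul, map_add, Finset.sum_add_distrib, ite_mul, zero_mul,
      apply_ite RCLike.re, map_zero, ite_and]
    simp only [Finset.sum_ite_irrel, Finset.sum_const_zero, Finset.sum_ite_eq', Finset.mem_univ,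
      if_true]
    rw [fluct_conj hB _ s t]
    have e1 : conj c / 2 * conj (fluct B (entries e x ω) s t) =
        conj (c / 2 * fluct B (entries e x ω) s t) := by
      rw [map_mul, map_div₀, map_ofNat]
    rw [e1, RCLike.conj_re, ← map_add]
    congr 1; ring
  have hCn : ∑ s', ∑ t', ‖C 0 s' t'‖ ^ 2 ≤ 1 := by
    have h1 : ∀ s' t', ‖C 0 s' t'‖ ^ 2 ≤ (if s' = s then if t' = t then (1 / 2 : ℝ) else 0 else 0) +
        if s' = t then if t' = s then (1 / 2 : ℝ) else 0 else 0 := by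
      intro s' t'
      have ha : ‖c / 2‖ ≤ 1 / 2 := by rw [norm_div, RCLike.norm_ofNat]; linarith
      have hb : ‖conj c / 2‖ ≤ 1 / 2 := by rw [norm_div, RCLike.norm_ofNat, RCLike.norm_conj]; linarith
      have h2 : ‖C 0 s' t'‖ ≤ ‖if s' = s ∧ t' = t then c / 2 else 0‖ +
        ‖if s' = t ∧ t' = s then conj c / 2 else 0‖ := norm_add_le _ _
      have h3 : ‖if s' = s ∧ t' = t then c / 2 else 0‖ ≤
          (if s' = s then if t' = t then (1 / 2 : ℝ) else 0 else 0) := by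
        rw [← ite_and]
        by_cases h : s' = s ∧ t' = t
        · rw [if_pos h, if_pos h]; exact ha
        · rw [if_neg h, if_neg h, norm_zero]
      have h4 : ‖if s' = t ∧ t' = s then conj c / 2 else 0‖ ≤
          (if s' = t then if t' = s then (1 / 2 : ℝ) else 0 else 0) := by
        rw [← ite_and]
        by_cases h : s' = t ∧ t' = s
        · rw [if_pos h, if_pos h]; exact hb
        · rw [if_neg h, if_neg h, norm_zero]
      have h5 := h2.trans (add_le_add h3 h4)
      refine (pow_le_pow_left₀ (norm_nonneg _) h5 2).trans ?_
      split_ifs <;> norm_num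
    refine (Finset.sum_le_sum fun s' _ => Finset.sum_le_sum fun t' _ => h1 s' t').trans ?_
    simp only [Finset.sum_add_distrib, Finset.sum_ite_irrel, Finset.sum_const_zero,
      Finset.sum_ite_eq', Finset.mem_univ, if_true]
    norm_num
  constructor
  · simpa only [hform] using hermForm_moments hd hx (tensorSum C A)
  · have h := integral_hermForm_sq_le hd hx (M := tensorSum C A)
      (tensorSum_herm hC fun _ => hB)
    simp_rw [hform] at h
    refine h.trans ?_
    have hF : ∑ p, ∑ p', ‖tensorSum C A p p'‖ ^ 2 ≤ ∑ a, ∑ b, ‖B a b‖ ^ 2 := by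
      have e1 : ∑ p, ∑ p', ‖tensorSum C A p p'‖ ^ 2 =
          (∑ s', ∑ t', ‖C 0 s' t'‖ ^ 2) * ∑ a, ∑ b, ‖B a b‖ ^ 2 := by
        simp only [tensorSum, Fin.sum_univ_one, A, norm_mul, mul_pow, Fintype.sum_prod_type,
          Finset.sum_mul]
        refine Finset.sum_congr rfl fun s' _ => ?_
        rw [Finset.sum_comm]
        refine Finset.sum_congr rfl fun t' _ => ?_
        simp only [Finset.mul_sum]
      rw [e1]
      exact mul_le_of_le_one_left (by positivity) hCn
    have hv := sqVar_nonneg ν₀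
    have := tauConst_pos (𝕜 := 𝕜)
    calc _ ≤ (4 + 2 * sqVar ν₀) * (tauConst 𝕜 / 2 * ∑ a, ∑ b, ‖B a b‖ ^ 2) := by gcongr
      _ = _ := by unfold fluctConst; ring

/-- In the real case `I = 0` and the second square vanishes. -/
lemma norm_sq_eq_re_mul (z : 𝕜) :
    ‖z‖ ^ 2 = RCLike.re (1 * z) ^ 2 + RCLike.re (RCLike.I * z) ^ 2 := by
  rw [norm_sq_eq_re_im, one_mul, RCLike.mul_re, RCLike.I_re, zero_mul, zero_sub, neg_sq]
  congr 2
  rw [mul_comm]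
  exact (RCLike.mul_im_I_ax z).symm

/-- Second moment bound for the fluctuations. -/
theorem integral_norm_fluct_sq_le (hd : RealDecomposition ν ν₀ e)
    {x : (Fin r × Fin n) × Bool → Ω → ℝ} (hx : StdFamily ν₀ x P) {B : Matrix (Fin n) (Fin n) 𝕜}
    (hB : B.IsHermitian) (s t : Fin r) :
    Integrable (fun ω => ‖fluct B (entries e x ω) s t‖ ^ 2) P ∧
    ∫ ω, ‖fluct B (entries e x ω) s t‖ ^ 2 ∂P ≤ fluctConst 𝕜 ν₀ * ∑ a, ∑ b, ‖B a b‖ ^ 2 := by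
  obtain ⟨m1, b1⟩ := integral_re_mul_fluct_sq_le hd hx hB s t (c := 1) (by simp)
  obtain ⟨m2, b2⟩ := integral_re_mul_fluct_sq_le hd hx hB s t (c := (RCLike.I : 𝕜)) (by
    by_cases h : (RCLike.I : 𝕜) = 0
    · simp [h]
    · exact (RCLike.norm_I_of_ne_zero h).le)
  have key : ∀ ω, ‖fluct B (entries e x ω) s t‖ ^ 2 =
      RCLike.re (1 * fluct B (entries e x ω) s t) ^ 2 +
        RCLike.re (RCLike.I * fluct B (entries e x ω) s t) ^ 2 := fun ω => norm_sq_eq_re_mul _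
  simp_rw [key]
  have i1 := (m1.pow 2).integrable
  have i2 := (m2.pow 2).integrable
  refine ⟨i1.add i2, ?_⟩
  rw [integral_add i1 i2]
  linarith

/-- The fluctuations are asymptotically normal. -/
theorem tendsto_charFun_fluct (hd : RealDecomposition ν ν₀ e)
    {x : (n : ℕ) → (Fin r × Fin n) × Bool → Ω → ℝ} (hx : ∀ n, StdFamily ν₀ (x n) P)
    {A : (n : ℕ) → Fin q → Matrix (Fin n) (Fin n) 𝕜} (hA : ∀ n j, (A n j).IsHermitian)
    {β : ℝ} (hβ : ∀ᶠ n in atTop, ∀ j, HermBound (A n j) β) {σ l : Fin q → ℝ}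
    (hσ : ∀ j, Tendsto (fun n : ℕ => (n : ℝ)⁻¹ * ∑ a, ∑ b, ‖A n j a b‖ ^ 2) atTop (𝓝 (σ j)))
    (hl : ∀ j, Tendsto (fun n : ℕ => (n : ℝ)⁻¹ * ∑ a, RCLike.re (A n j a a) ^ 2) atTop (𝓝 (l j)))
    {C : Fin q → Fin r → Fin r → 𝕜} (hC : ∀ j s t, C j t s = conj (C j s t))
    (hCd : DisjointSupports C) :
    Tendsto (fun n : ℕ => ∫ ω, cis (∑ j, ∑ s, ∑ t, RCLike.re (C j s t *
      ((((√(n : ℝ))⁻¹ : ℝ) : 𝕜) * fluct (A n j) (entries e (x n) ω) s t))) ∂P) atTop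
      (𝓝 (Complex.exp (-((∑ j, (tauConst 𝕜 * (σ j * ∑ s, ∑ t, ‖C j s t‖ ^ 2) +
        kappa4 ν * (l j * ∑ s, RCLike.re (C j s s) ^ 2))) / 2 : ℝ)))) := by
  -- The factor `n^{-1/2}` is moved into the coefficients. The kernel then has bounded
  -- Hilbert-Schmidt norm and operator norm `O(n^{-1/2})`, which makes the error of the normal
  -- approximation vanish.
  let D : ℕ → Fin q → Fin r → Fin r → 𝕜 := fun n j s t => (((√(n : ℝ))⁻¹ : ℝ) : 𝕜) * C j s t
  let M : (n : ℕ) → Fin r × Fin n → Fin r × Fin n → 𝕜 := fun n => tensorSum (D n) (A n)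
  have hD : ∀ n j s t, D n j t s = conj (D n j s t) := by
    intro n j s t
    simp only [D, map_mul, RCLike.conj_ofReal, ← hC]
  have hDd : ∀ n, DisjointSupports (D n) := by
    intro n s t j j' h
    rcases hCd s t j j' h with h | h <;> simp [D, h]
  have hinv : ∀ n : ℕ, ((√(n : ℝ))⁻¹) ^ 2 = (n : ℝ)⁻¹ := fun n => by
    rw [inv_pow, Real.sq_sqrt (Nat.cast_nonneg n)]
  have hDn : ∀ (n : ℕ) j s t, ‖D n j s t‖ ^ 2 = (n : ℝ)⁻¹ * ‖C j s t‖ ^ 2 := by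
    intro n j s t
    rw [norm_mul, RCLike.norm_ofReal, mul_pow, sq_abs, hinv]
  have hDr : ∀ (n : ℕ) j s, RCLike.re (D n j s s) ^ 2 = (n : ℝ)⁻¹ * RCLike.re (C j s s) ^ 2 := by
    intro n j s
    rw [RCLike.re_ofReal_mul, mul_pow, hinv]
  have hform : ∀ (n : ℕ) ω, ∑ j, ∑ s, ∑ t, RCLike.re (C j s t *
      ((((√(n : ℝ))⁻¹ : ℝ) : 𝕜) * fluct (A n j) (entries e (x n) ω) s t)) =
      hermForm (M n) (entry e fun p => x n p ω) := by
    intro n ω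
    refine Eq.trans ?_ (hermForm_tensorSum (D n) (A n) (entries e (x n) ω)).symm
    refine Finset.sum_congr rfl fun j _ => Finset.sum_congr rfl fun s _ =>
      Finset.sum_congr rfl fun t _ => ?_
    congr 1
    simp only [D]; ring
  simp_rw [hform]
  set S : ℝ := ∑ j, ∑ s, ∑ t, ‖C j s t‖ ^ 2 with hS
  have hS0 : 0 ≤ S := by positivity
  -- The summand `1` only ensures positivity, which the normal approximation requires of the
  -- operator bound.
  let K : ℝ := √(q * S) * |β| + 1
  have hK0 : 0 < K := by positivity
  have hop : ∀ᶠ n : ℕ in atTop, HermBound (M n) (K * (√(n : ℝ))⁻¹) := by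
    filter_upwards [hβ] with n hn
    refine hermBound_tensorSum hn ?_
    simp_rw [hDn, ← Finset.mul_sum]
    rw [mul_pow, hinv, ← hS]
    have h1 : q * S * β ^ 2 ≤ K ^ 2 := by
      calc q * S * β ^ 2 = (√(q * S) * |β|) ^ 2 := by
            rw [mul_pow, Real.sq_sqrt (by positivity), sq_abs]
        _ ≤ K ^ 2 := by
            refine pow_le_pow_left₀ (by positivity) ?_ 2
            simp only [K]; linarith
    calc _ = (q * S * β ^ 2) * (n : ℝ)⁻¹ := by ring
      _ ≤ _ := by gcongr
  have hvar : ∀ n : ℕ, hermVar (kappa4 ν) (M n) = ∑ j,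
      (tauConst 𝕜 * (((n : ℝ)⁻¹ * ∑ a, ∑ b, ‖A n j a b‖ ^ 2) * ∑ s, ∑ t, ‖C j s t‖ ^ 2) +
        kappa4 ν * (((n : ℝ)⁻¹ * ∑ a, RCLike.re (A n j a a) ^ 2) *
          ∑ s, RCLike.re (C j s s) ^ 2)) := by
    intro n
    simp only [M]
    rw [hermVar_tensorSum (hD n) (hDd n)]
    simp_rw [hDn, hDr, ← Finset.mul_sum]
    refine Finset.sum_congr rfl fun j _ => by ring
  have hvlim : Tendsto (fun n : ℕ => hermVar (kappa4 ν) (M n)) atTop (𝓝 (∑ j,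
      (tauConst 𝕜 * (σ j * ∑ s, ∑ t, ‖C j s t‖ ^ 2) +
        kappa4 ν * (l j * ∑ s, RCLike.re (C j s s) ^ 2)))) := by
    simp_rw [hvar]
    exact tendsto_finsetSum _ fun j _ => (((hσ j).mul_const _).const_mul _).add
      (((hl j).mul_const _).const_mul _)
  have hexp : Tendsto (fun n : ℕ => Complex.exp (-(hermVar (kappa4 ν) (M n) / 2 : ℝ))) atTop
      (𝓝 (Complex.exp (-((∑ j, (tauConst 𝕜 * (σ j * ∑ s, ∑ t, ‖C j s t‖ ^ 2) +
        kappa4 ν * (l j * ∑ s, RCLike.re (C j s s) ^ 2))) / 2 : ℝ)))) := by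
    have hc : Continuous fun u : ℝ => Complex.exp (-(u / 2 : ℝ)) := by fun_prop
    exact (hc.tendsto _).comp hvlim
  have hF : ∀ n : ℕ, ∑ p, ∑ p', ‖M n p p'‖ ^ 2 = ∑ j,
      (((n : ℝ)⁻¹ * ∑ a, ∑ b, ‖A n j a b‖ ^ 2) * ∑ s, ∑ t, ‖C j s t‖ ^ 2) := by
    intro n
    -- For `κ = 0` the variance is a multiple of the Hilbert-Schmidt norm, so the variance formula
    -- computes that norm too.
    have h1 := hermVar_tensorSum (A := A n) (hD n) (hDd n) 0
    unfold hermVar at h1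
    simp only [zero_mul, add_zero, ← Finset.mul_sum] at h1
    have h2 := mul_left_cancel₀ (tauConst_pos (𝕜 := 𝕜)).ne' h1
    simp only [M]
    rw [h2]
    simp_rw [hDn, ← Finset.mul_sum]
    exact Finset.sum_congr rfl fun j _ => by ring
  have hFlim : Tendsto (fun n : ℕ => ∑ p, ∑ p', ‖M n p p'‖ ^ 2) atTop
      (𝓝 (∑ j, (σ j * ∑ s, ∑ t, ‖C j s t‖ ^ 2))) := by
    simp_rw [hF]
    exact tendsto_finsetSum _ fun j _ => (hσ j).mul_const _
  have hb0 : Tendsto (fun n : ℕ => K * (√(n : ℝ))⁻¹) atTop (𝓝 0) := by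
    have : Tendsto (fun n : ℕ => (√(n : ℝ))⁻¹) atTop (𝓝 0) :=
      tendsto_inv_atTop_zero.comp (Real.tendsto_sqrt_atTop.comp tendsto_natCast_atTop_atTop)
    simpa using this.const_mul K
  have hbound : Tendsto (fun n : ℕ => StdFamily.cltConst ν₀ *
      (K * (√(n : ℝ))⁻¹ * (tauConst 𝕜 / 2 * ∑ p, ∑ p', ‖M n p p'‖ ^ 2) +
        K * (√(n : ℝ))⁻¹ * √(tauConst 𝕜 / 2 * ∑ p, ∑ p', ‖M n p p'‖ ^ 2))) atTop (𝓝 0) := by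
    have h1 := hFlim.const_mul (tauConst 𝕜 / 2)
    have h2 := (Real.continuous_sqrt.tendsto _).comp h1
    simpa using ((hb0.mul h1).add (hb0.mul h2)).const_mul (StdFamily.cltConst ν₀)
  have hdiff : Tendsto (fun n => ∫ ω, cis (hermForm (M n) (entry e fun p => x n p ω)) ∂P -
      Complex.exp (-(hermVar (kappa4 ν) (M n) / 2 : ℝ))) atTop (𝓝 0) := by
    refine squeeze_zero_norm' ?_ hbound
    filter_upwards [hop, eventually_gt_atTop 0] with n hn hn0
    refine norm_charFun_hermForm_sub_le hd (hx n) (tensorSum_herm (hD n) (hA n)) ?_ hn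
    have : (0 : ℝ) < n := by exact_mod_cast hn0
    positivity
  simpa using hdiff.add hexp

end Fluctuations

/-! ### Ordered eigenvalues -/

section Eigenvalues

open Matrix

variable {𝕜 : Type*} [RCLike 𝕜] {m : ℕ}

/-- The squared Euclidean norm. -/
noncomputable def nsq {ι : Type*} [Fintype ι] (v : ι → 𝕜) : ℝ := ∑ i, ‖v i‖ ^ 2

/-- The real quadratic form `re (v^* B v)`. -/
noncomputable def qf {ι : Type*} [Fintype ι] (B : Matrix ι ι 𝕜) (v : ι → 𝕜) : ℝ :=
  RCLike.re (star v ⬝ᵥ B *ᵥ v)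

lemma nsq_nonneg {ι : Type*} [Fintype ι] (v : ι → 𝕜) : 0 ≤ nsq v := by unfold nsq; positivity

lemma nsq_eq_zero {ι : Type*} [Fintype ι] {v : ι → 𝕜} : nsq v = 0 ↔ v = 0 := by
  unfold nsq
  rw [Finset.sum_eq_zero_iff_of_nonneg fun i _ => by positivity]
  simp [funext_iff]

lemma nsq_pos {ι : Type*} [Fintype ι] {v : ι → 𝕜} (h : v ≠ 0) : 0 < nsq v :=
  lt_of_le_of_ne (nsq_nonneg v) fun h' => h (nsq_eq_zero.1 h'.symm)

lemma star_dotProduct_self {ι : Type*} [Fintype ι] (v : ι → 𝕜) :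
    star v ⬝ᵥ v = ((nsq v : ℝ) : 𝕜) := by
  unfold nsq dotProduct
  push_cast
  exact Finset.sum_congr rfl fun i _ => by
    rw [Pi.star_apply, RCLike.star_def, RCLike.conj_mul]

lemma star_mulVec_dotProduct {ι κ : Type*} [Fintype ι] [Fintype κ] (B : Matrix ι κ 𝕜)
    (v : κ → 𝕜) (w : ι → 𝕜) : star (B *ᵥ v) ⬝ᵥ w = star v ⬝ᵥ (Bᴴ *ᵥ w) := by
  rw [star_mulVec, dotProduct_mulVec]

lemma re_star_dotProduct_comm {ι : Type*} [Fintype ι] (v w : ι → 𝕜) :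
    RCLike.re (star v ⬝ᵥ w) = RCLike.re (star w ⬝ᵥ v) := by
  rw [star_dotProduct, RCLike.star_def, RCLike.conj_re]

/-- A Hermitian matrix is diagonal, with increasing entries, in an orthonormal basis. -/
lemma exists_spectral {B : Matrix (Fin m) (Fin m) 𝕜} (hB : B.IsHermitian) :
    ∃ U : Matrix (Fin m) (Fin m) 𝕜, Uᴴ * U = 1 ∧ U * Uᴴ = 1 ∧
      B = U * diagonal (fun l : Fin m => ((eig B (l + 1) : ℝ) : 𝕜)) * Uᴴ := by
  let f : Fin (Fintype.card (Fin m)) ≃ Fin m := Fintype.equivOfCardEq (Fintype.card_fin _)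
  -- The order of `eigenvalues₀` is decreasing; the reversal makes column `l` carry the `(l + 1)`-st
  -- smallest eigenvalue.
  let σ : Fin m ≃ Fin m :=
    (Fin.revPerm.trans (finCongr (Fintype.card_fin m).symm)).trans f
  have hσ : ∀ l : Fin m, eig B (l + 1) = hB.eigenvalues (σ l) := by
    intro l
    have h : B.IsHermitian ∧ 1 ≤ (l : ℕ) + 1 ∧ (l : ℕ) + 1 ≤ m := ⟨hB, by omega, l.2⟩
    rw [eig, dif_pos h, Matrix.IsHermitian.eigenvalues]
    congr 1
    apply Fin.ext
    simp [σ, f, Fin.rev]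
  let W : Matrix (Fin m) (Fin m) 𝕜 := hB.eigenvectorUnitary
  have hW1 : Wᴴ * W = 1 := Unitary.coe_star_mul_self hB.eigenvectorUnitary
  have hW2 : W * Wᴴ = 1 := Unitary.coe_mul_star_self hB.eigenvectorUnitary
  have hsp : B = W * diagonal (fun l => ((hB.eigenvalues l : ℝ) : 𝕜)) * Wᴴ := hB.spectral_theorem
  refine ⟨W.submatrix id σ, ?_, ?_, ?_⟩
  · rw [conjTranspose_submatrix, submatrix_mul _ _ _ _ _ Function.bijective_id |>.symm, hW1,
      submatrix_one_equiv]
  · rw [conjTranspose_submatrix, submatrix_mul_equiv, hW2, submatrix_one _ Function.injective_id]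
  · have hd : diagonal (fun l : Fin m => ((eig B (l + 1) : ℝ) : 𝕜)) =
        (diagonal (fun l => ((hB.eigenvalues l : ℝ) : 𝕜))).submatrix σ σ := by
      rw [submatrix_diagonal_equiv]
      congr 1; funext l; rw [hσ]; rfl
    rw [hd, conjTranspose_submatrix, submatrix_mul_equiv, submatrix_mul_equiv, ← hsp]
    rfl

lemma eig_mono {B : Matrix (Fin m) (Fin m) 𝕜} (hB : B.IsHermitian) {k l : ℕ} (hk : 1 ≤ k)
    (hkl : k ≤ l) (hl : l ≤ m) : eig B k ≤ eig B l := by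
  rw [eig, eig, dif_pos ⟨hB, hk, hkl.trans hl⟩, dif_pos ⟨hB, hk.trans hkl, hl⟩]
  exact hB.eigenvalues₀_antitone (by simp only [Fin.mk_le_mk]; omega)

lemma nsq_mulVec {ι κ : Type*} [Fintype ι] [Fintype κ] [DecidableEq κ] {U : Matrix ι κ 𝕜}
    (hU : Uᴴ * U = 1) (v : κ → 𝕜) : nsq (U *ᵥ v) = nsq v := by
  have h : ((nsq (U *ᵥ v) : ℝ) : 𝕜) = ((nsq v : ℝ) : 𝕜) := by
    rw [← star_dotProduct_self, ← star_dotProduct_self, star_mulVec_dotProduct, mulVec_mulVec, hU,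
      one_mulVec]
  exact RCLike.ofReal_injective h

lemma qf_conj {ι κ : Type*} [Fintype ι] [Fintype κ] (U : Matrix ι κ 𝕜) (D : Matrix κ κ 𝕜)
    (v : ι → 𝕜) : qf (U * D * Uᴴ) v = qf D (Uᴴ *ᵥ v) := by
  unfold qf
  rw [star_mulVec_dotProduct, conjTranspose_conjTranspose, mulVec_mulVec, mulVec_mulVec]

lemma qf_diagonal {ι : Type*} [Fintype ι] [DecidableEq ι] (d : ι → ℝ) (v : ι → 𝕜) :
    qf (diagonal fun i => (d i : 𝕜)) v = ∑ i, d i * ‖v i‖ ^ 2 := by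
  unfold qf dotProduct
  rw [map_sum]
  refine Finset.sum_congr rfl fun i _ => ?_
  rw [mulVec_diagonal, Pi.star_apply, RCLike.star_def]
  have : (starRingEnd 𝕜) (v i) * ((d i : 𝕜) * v i) = ((d i * ‖v i‖ ^ 2 : ℝ) : 𝕜) := by
    push_cast
    rw [← RCLike.conj_mul]; ring
  rw [this, RCLike.ofReal_re]

lemma qf_neg {ι : Type*} [Fintype ι] (B : Matrix ι ι 𝕜) (v : ι → 𝕜) : qf (-B) v = -qf B v := by
  simp [qf, neg_mulVec]

lemma qf_add {ι : Type*} [Fintype ι] (A B : Matrix ι ι 𝕜) (v : ι → 𝕜) :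
    qf (A + B) v = qf A v + qf B v := by
  simp [qf, add_mulVec]

lemma qf_sub {ι : Type*} [Fintype ι] (A B : Matrix ι ι 𝕜) (v : ι → 𝕜) :
    qf (A - B) v = qf A v - qf B v := by
  simp [qf, sub_mulVec]

lemma qf_smul_one {ι : Type*} [Fintype ι] [DecidableEq ι] (c : ℝ) (v : ι → 𝕜) :
    qf ((c : 𝕜) • (1 : Matrix ι ι 𝕜)) v = c * nsq v := by
  rw [qf, smul_mulVec, one_mulVec, dotProduct_smul, star_dotProduct_self, smul_eq_mul,
    ← RCLike.ofReal_mul, RCLike.ofReal_re]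

/-- The vectors whose coordinates outside `S` vanish, in the basis given by `U`. -/
lemma exists_coord_subspace {U : Matrix (Fin m) (Fin m) 𝕜} (S : Finset (Fin m)) :
    ∃ W : Submodule 𝕜 (Fin m → 𝕜), S.card ≤ Module.finrank 𝕜 W ∧
      ∀ v ∈ W, ∀ i ∉ S, (U *ᵥ v) i = 0 := by
  classical
  let L : (Fin m → 𝕜) →ₗ[𝕜] ({i // i ∈ Sᶜ} → 𝕜) :=
    (LinearMap.funLeft 𝕜 𝕜 (fun i : {i // i ∈ Sᶜ} => (i : Fin m))).comp U.mulVecLin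
  refine ⟨LinearMap.ker L, ?_, fun v hv i hi => ?_⟩
  · have h1 := L.finrank_range_add_finrank_ker
    have h2 := LinearMap.range L |>.finrank_le
    rw [Module.finrank_fintype_fun_eq_card, Fintype.card_coe, Finset.card_compl,
      Fintype.card_fin] at h2
    rw [Module.finrank_fintype_fun_eq_card, Fintype.card_fin] at h1
    have h3 : S.card ≤ m := by simpa using S.card_le_univ
    omega
  · have := congrFun (LinearMap.mem_ker.1 hv) ⟨i, Finset.mem_compl.2 hi⟩
    exact this

lemma exists_ne_zero_mem_inf {ι : Type*} [Fintype ι] {V W : Submodule 𝕜 (ι → 𝕜)}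
    (h : Fintype.card ι < Module.finrank 𝕜 V + Module.finrank 𝕜 W) :
    ∃ v, v ∈ V ∧ v ∈ W ∧ v ≠ 0 := by
  have h1 := Submodule.finrank_sup_add_finrank_inf_eq V W
  have h2 := (V ⊔ W).finrank_le
  rw [Module.finrank_fintype_fun_eq_card] at h2
  have h3 : V ⊓ W ≠ ⊥ := by
    intro h0
    rw [h0, finrank_bot] at h1
    omega
  obtain ⟨v, hv, hv0⟩ := Submodule.exists_mem_ne_zero_of_ne_bot h3
  exact ⟨v, hv.1, hv.2, hv0⟩

lemma card_filter_lt_fin {k : ℕ} (hk : k ≤ m) :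
    (Finset.univ.filter fun l : Fin m => (l : ℕ) < k).card = k := by
  have := Fin.card_filter_val_lt (n := m) (m := k)
  simpa [hk] using this

/-- There is a `k`-dimensional space on which the quadratic form is at most the `k`-th
eigenvalue. -/
lemma exists_subspace_le_eig {B : Matrix (Fin m) (Fin m) 𝕜} (hB : B.IsHermitian) {k : ℕ}
    (hkm : k ≤ m) : ∃ W : Submodule 𝕜 (Fin m → 𝕜), k ≤ Module.finrank 𝕜 W ∧
      ∀ v ∈ W, qf B v ≤ eig B k * nsq v := by
  obtain ⟨U, h1, h2, h3⟩ := exists_spectral hB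
  obtain ⟨W, hW, hW'⟩ := exists_coord_subspace (U := Uᴴ)
    (Finset.univ.filter fun l : Fin m => (l : ℕ) < k)
  rw [card_filter_lt_fin hkm] at hW
  refine ⟨W, hW, fun v hv => ?_⟩
  rw [← nsq_mulVec (U := Uᴴ) (by rw [conjTranspose_conjTranspose]; exact h2) v]
  conv_lhs => rw [h3]
  rw [qf_conj, qf_diagonal, nsq, Finset.mul_sum]
  refine Finset.sum_le_sum fun l _ => ?_
  by_cases hl : (l : ℕ) < k
  · exact mul_le_mul_of_nonneg_right (eig_mono hB (by omega) hl hkm) (by positivity)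
  · rw [hW' v hv l (by simpa using hl)]; simp

/-- There is an `(m + 1 - k)`-dimensional space on which the quadratic form is at least the `k`-th
eigenvalue. -/
lemma exists_subspace_eig_le {B : Matrix (Fin m) (Fin m) 𝕜} (hB : B.IsHermitian) {k : ℕ}
    (hk : 1 ≤ k) (hkm : k ≤ m) : ∃ W : Submodule 𝕜 (Fin m → 𝕜), m + 1 ≤ Module.finrank 𝕜 W + k ∧
      ∀ v ∈ W, eig B k * nsq v ≤ qf B v := by
  obtain ⟨U, h1, h2, h3⟩ := exists_spectral hB
  obtain ⟨W, hW, hW'⟩ := exists_coord_subspace (U := Uᴴ)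
    (Finset.univ.filter fun l : Fin m => (l : ℕ) < k - 1)ᶜ
  rw [Finset.card_compl, card_filter_lt_fin (by omega), Fintype.card_fin] at hW
  refine ⟨W, by omega, fun v hv => ?_⟩
  rw [← nsq_mulVec (U := Uᴴ) (by rw [conjTranspose_conjTranspose]; exact h2) v]
  conv_rhs => rw [h3]
  rw [qf_conj, qf_diagonal, nsq, Finset.mul_sum]
  refine Finset.sum_le_sum fun l _ => ?_
  by_cases hl : (l : ℕ) < k - 1
  · rw [hW' v hv l (by simp; omega)]; simp
  · exact mul_le_mul_of_nonneg_right (eig_mono hB hk (by omega) l.2) (by positivity)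

/-- One half of the Courant-Fischer principle: a space of codimension at most `k - 1` meets a
`k`-dimensional space on which the form is at most the `k`-th eigenvalue. The dimension hypothesis
excludes `k = 0`. -/
lemma le_eig {B : Matrix (Fin m) (Fin m) 𝕜} (hB : B.IsHermitian) {k : ℕ}
    (hkm : k ≤ m) {t : ℝ} {V : Submodule 𝕜 (Fin m → 𝕜)} (hV : m + 1 ≤ Module.finrank 𝕜 V + k)
    (ht : ∀ v ∈ V, t * nsq v ≤ qf B v) : t ≤ eig B k := by
  obtain ⟨W, hW, hW'⟩ := exists_subspace_le_eig hB hkm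
  obtain ⟨v, hv, hw, h0⟩ := exists_ne_zero_mem_inf (V := V) (W := W)
    (by rw [Fintype.card_fin]; omega)
  exact le_of_mul_le_mul_right ((ht v hv).trans (hW' v hw)) (nsq_pos h0)

/-- The other half of the Courant-Fischer principle, with the roles of the two spaces exchanged. -/
lemma eig_le {B : Matrix (Fin m) (Fin m) 𝕜} (hB : B.IsHermitian) {k : ℕ} (hk : 1 ≤ k)
    (hkm : k ≤ m) {t : ℝ} {V : Submodule 𝕜 (Fin m → 𝕜)} (hV : k ≤ Module.finrank 𝕜 V)
    (ht : ∀ v ∈ V, qf B v ≤ t * nsq v) : eig B k ≤ t := by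
  obtain ⟨W, hW, hW'⟩ := exists_subspace_eig_le hB hk hkm
  obtain ⟨v, hv, hw, h0⟩ := exists_ne_zero_mem_inf (V := V) (W := W)
    (by rw [Fintype.card_fin]; omega)
  exact le_of_mul_le_mul_right ((hW' v hw).trans (ht v hv)) (nsq_pos h0)

lemma qf_le_eig_top {B : Matrix (Fin m) (Fin m) 𝕜} (hB : B.IsHermitian) (v : Fin m → 𝕜) :
    qf B v ≤ eig B m * nsq v := by
  rcases Nat.eq_zero_or_pos m with rfl | hm
  · simp [qf, nsq, dotProduct]
  obtain ⟨W, hW, hW'⟩ := exists_subspace_le_eig hB le_rfl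
  have : W = ⊤ := Submodule.eq_top_of_finrank_eq (le_antisymm W.finrank_le (by simpa using hW))
  exact hW' v (by rw [this]; trivial)

lemma eig_neg {B : Matrix (Fin m) (Fin m) 𝕜} (hB : B.IsHermitian) {k : ℕ} (hk : 1 ≤ k)
    (hkm : k ≤ m) : eig (-B) k = -eig B (m + 1 - k) := by
  apply le_antisymm
  · obtain ⟨W, hW, hW'⟩ := exists_subspace_eig_le hB (k := m + 1 - k) (by omega) (by omega)
    refine eig_le hB.neg hk hkm (V := W) (by omega) fun v hv => ?_
    have := hW' v hv
    rw [qf_neg]; linarith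
  · obtain ⟨W, hW, hW'⟩ := exists_subspace_le_eig hB (k := m + 1 - k) (by omega)
    refine le_eig hB.neg hkm (V := W) (by omega) fun v hv => ?_
    have := hW' v hv
    rw [qf_neg]; linarith

lemma abs_qf_le {ι : Type*} [Fintype ι] (B : Matrix ι ι 𝕜) (v : ι → 𝕜) :
    |qf B v| ≤ (∑ i, ∑ j, ‖B i j‖) * nsq v := by
  have h1 : ∀ i j, ‖star (v i) * (B i j * v j)‖ ≤ ‖B i j‖ * nsq v := by
    intro i j
    rw [norm_mul, norm_mul, norm_star]
    have hn : ∀ i, ‖v i‖ ≤ √(nsq v) := fun i => Real.le_sqrt_of_sq_le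
      (Finset.single_le_sum (f := fun i => ‖v i‖ ^ 2) (fun _ _ => by positivity)
        (Finset.mem_univ i))
    calc ‖v i‖ * (‖B i j‖ * ‖v j‖) = ‖B i j‖ * (‖v i‖ * ‖v j‖) := by ring
      _ ≤ ‖B i j‖ * (√(nsq v) * √(nsq v)) := by gcongr <;> exact hn _
      _ = _ := by rw [Real.mul_self_sqrt (nsq_nonneg v)]
  refine (RCLike.abs_re_le_norm _).trans ?_
  simp only [dotProduct, mulVec, Pi.star_apply, Finset.mul_sum, Finset.sum_mul]
  exact (norm_sum_le _ _).trans (Finset.sum_le_sum fun i _ => (norm_sum_le _ _).trans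
    (Finset.sum_le_sum fun j _ => h1 i j))

/-- Eigenvalues are Lipschitz functions of Hermitian matrices. -/
lemma abs_eig_sub_le {A B : Matrix (Fin m) (Fin m) 𝕜} (hA : A.IsHermitian) (hB : B.IsHermitian)
    (k : ℕ) : |eig A k - eig B k| ≤ ∑ i, ∑ j, ‖A i j - B i j‖ := by
  by_cases hk : 1 ≤ k ∧ k ≤ m
  · have key : ∀ {A B : Matrix (Fin m) (Fin m) 𝕜}, A.IsHermitian → B.IsHermitian →
        eig A k ≤ eig B k + ∑ i, ∑ j, ‖A i j - B i j‖ := by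
      intro A B hA hB
      obtain ⟨W, hW, hW'⟩ := exists_subspace_le_eig hB hk.2
      refine eig_le hA hk.1 hk.2 hW fun v hv => ?_
      have h1 := hW' v hv
      have h2 := (le_abs_self _).trans (abs_qf_le (A - B) v)
      rw [qf_sub] at h2
      simp only [Matrix.sub_apply] at h2
      linarith
    have h1 := key hA hB
    have h2 := key hB hA
    simp_rw [norm_sub_rev (B _ _)] at h2
    rw [_root_.abs_le]
    constructor <;> linarith
  · have h0 : ∀ A : Matrix (Fin m) (Fin m) 𝕜, eig A k = 0 := fun A =>
      dif_neg fun h => hk h.2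
    rw [h0, h0, sub_zero, abs_zero]
    positivity

lemma isHermitian_symmetrize (A : Matrix (Fin m) (Fin m) 𝕜) :
    ((2⁻¹ : 𝕜) • (A + Aᴴ)).IsHermitian := by
  unfold IsHermitian
  rw [conjTranspose_smul, conjTranspose_add, conjTranspose_conjTranspose, add_comm]
  congr 1
  rw [RCLike.star_def, map_inv₀, map_ofNat]

lemma symmetrize_eq {A : Matrix (Fin m) (Fin m) 𝕜} (hA : A.IsHermitian) :
    (2⁻¹ : 𝕜) • (A + Aᴴ) = A := by
  rw [hA.eq, ← two_smul 𝕜 A, smul_smul, inv_mul_cancel₀ two_ne_zero, one_smul]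

/-- Since `eig` is `0` on matrices that are not Hermitian, it is not continuous on all matrices.
Composing with the symmetrisation extends it continuously from the Hermitian ones, where it is
Lipschitz. -/
lemma continuous_eig_symmetrize (k : ℕ) :
    Continuous fun A : Matrix (Fin m) (Fin m) 𝕜 => eig ((2⁻¹ : 𝕜) • (A + Aᴴ)) k := by
  rw [continuous_iff_continuousAt]
  intro A
  rw [ContinuousAt, tendsto_iff_norm_sub_tendsto_zero]
  have h : Continuous fun B : Matrix (Fin m) (Fin m) 𝕜 => ∑ i, ∑ j,
      ‖((2⁻¹ : 𝕜) • (B + Bᴴ)) i j - ((2⁻¹ : 𝕜) • (A + Aᴴ)) i j‖ := by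
    simp only [Matrix.smul_apply, Matrix.add_apply, conjTranspose_apply]
    fun_prop
  have h' := h.tendsto A
  simp only [sub_self, norm_zero, Finset.sum_const_zero] at h'
  exact squeeze_zero (fun _ => norm_nonneg _)
    (fun B => abs_eig_sub_le (isHermitian_symmetrize B) (isHermitian_symmetrize A) k) h'

/-- Eigenvalues of a continuously varying Hermitian matrix are continuous. -/
lemma continuous_eig_comp {α : Type*} [TopologicalSpace α] {A : α → Matrix (Fin m) (Fin m) 𝕜}
    (hA : ∀ x, (A x).IsHermitian) (hc : Continuous A) (k : ℕ) :
    Continuous fun x => eig (A x) k := by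
  have := (continuous_eig_symmetrize k).comp hc
  simpa only [Function.comp_def, symmetrize_eq (hA _)] using this

lemma measurable_eig_comp {α : Type*} [MeasurableSpace α] {A : α → Matrix (Fin m) (Fin m) 𝕜}
    (hA : ∀ x, (A x).IsHermitian) (hc : ∀ i j, Measurable fun x => A x i j) (k : ℕ) :
    Measurable fun x => eig (A x) k := by
  have h1 : Measurable fun x => (fun i j => A x i j : Fin m → Fin m → 𝕜) :=
    measurable_pi_lambda _ fun i => measurable_pi_lambda _ fun j => hc i j
  have h2 : Continuous fun f : Fin m → Fin m → 𝕜 =>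
      eig ((2⁻¹ : 𝕜) • (Matrix.of f + (Matrix.of f)ᴴ)) k :=
    (continuous_eig_symmetrize (𝕜 := 𝕜) (m := m) k).comp continuous_id
  have := h2.measurable.comp h1
  have e : (fun x => eig (A x) k) =
      (fun f : Fin m → Fin m → 𝕜 => eig ((2⁻¹ : 𝕜) • (Matrix.of f + (Matrix.of f)ᴴ)) k) ∘
        fun x => (fun i j => A x i j : Fin m → Fin m → 𝕜) := by
    funext x
    exact congrArg (fun M => eig M k) (symmetrize_eq (hA x)).symm
  rw [e]; exact this

end Eigenvalues

/-! ### Resolvents -/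

section Resolvent

open Matrix

variable {𝕜 : Type*} [RCLike 𝕜] {n : ℕ}

lemma integral_spectralMeasure (X : Matrix (Fin n) (Fin n) 𝕜) (f : ℝ → ℝ) :
    ∫ x, f x ∂(spectralMeasure X) = (n : ℝ)⁻¹ * ∑ l : Fin n, f (eig X (l + 1)) := by
  unfold spectralMeasure
  rw [integral_smul_measure, integral_finsetSum_measure fun l _ => integrable_dirac (by simp)]
  simp

/-- All eigenvalues of `X` are at distance at least `η` from `z`. -/
def SpectralGap (X : Matrix (Fin n) (Fin n) 𝕜) (z η : ℝ) : Prop :=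
  ∀ l : Fin n, η ≤ |z - eig X (l + 1)|

lemma isHermitian_resolv {X : Matrix (Fin n) (Fin n) 𝕜} (hX : X.IsHermitian) (z : ℝ) :
    (resolv X z).IsHermitian := by
  refine IsHermitian.inv ?_
  refine IsHermitian.sub ?_ hX
  unfold IsHermitian
  rw [conjTranspose_smul, conjTranspose_one, RCLike.star_def, RCLike.conj_ofReal]

lemma conj_mul_diagonal {U : Matrix (Fin n) (Fin n) 𝕜} (h1 : Uᴴ * U = 1) (d d' : Fin n → 𝕜) :
    U * diagonal d * Uᴴ * (U * diagonal d' * Uᴴ) = U * diagonal (fun l => d l * d' l) * Uᴴ := by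
  calc _ = U * diagonal d * (Uᴴ * U) * diagonal d' * Uᴴ := by simp only [Matrix.mul_assoc]
    _ = _ := by rw [h1, Matrix.mul_one, Matrix.mul_assoc U, diagonal_mul_diagonal]

lemma resolv_spectral {X : Matrix (Fin n) (Fin n) 𝕜} {z : ℝ}
    (hz : ∀ l : Fin n, z - eig X (l + 1) ≠ 0) {U : Matrix (Fin n) (Fin n) 𝕜}
    (h1 : Uᴴ * U = 1) (h2 : U * Uᴴ = 1)
    (h3 : X = U * diagonal (fun l : Fin n => ((eig X (l + 1) : ℝ) : 𝕜)) * Uᴴ) :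
    ((z : 𝕜) • (1 : Matrix (Fin n) (Fin n) 𝕜) - X) =
      U * diagonal (fun l : Fin n => ((z - eig X (l + 1) : ℝ) : 𝕜)) * Uᴴ ∧
    resolv X z = U * diagonal (fun l : Fin n => (((z - eig X (l + 1))⁻¹ : ℝ) : 𝕜)) * Uᴴ := by
  have e1 : ((z : 𝕜) • (1 : Matrix (Fin n) (Fin n) 𝕜) - X) =
      U * diagonal (fun l : Fin n => ((z - eig X (l + 1) : ℝ) : 𝕜)) * Uᴴ := by
    conv_lhs => rw [h3, ← h2]
    have : diagonal (fun l : Fin n => ((z - eig X (l + 1) : ℝ) : 𝕜)) =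
        (z : 𝕜) • (1 : Matrix (Fin n) (Fin n) 𝕜) -
          diagonal (fun l : Fin n => ((eig X (l + 1) : ℝ) : 𝕜)) := by
      rw [smul_one_eq_diagonal, diagonal_sub]
      push_cast; rfl
    rw [this, Matrix.mul_sub, Matrix.sub_mul, Matrix.mul_smul, Matrix.mul_one, Matrix.smul_mul]
  refine ⟨e1, ?_⟩
  rw [resolv, e1]
  refine Matrix.inv_eq_left_inv ?_
  rw [conj_mul_diagonal h1]
  have : (fun l : Fin n => (((z - eig X (l + 1))⁻¹ : ℝ) : 𝕜) * ((z - eig X (l + 1) : ℝ) : 𝕜)) =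
      fun _ => 1 := by
    funext l
    rw [← RCLike.ofReal_mul, inv_mul_cancel₀ (hz l), RCLike.ofReal_one]
  rw [this, diagonal_one, Matrix.mul_one, h2]

lemma SpectralGap.ne_zero {X : Matrix (Fin n) (Fin n) 𝕜} {z η : ℝ} (h : SpectralGap X z η)
    (hη : 0 < η) (l : Fin n) : z - eig X (l + 1) ≠ 0 := by
  have := h l
  intro h0
  rw [h0, abs_zero] at this
  linarith

section
variable {X : Matrix (Fin n) (Fin n) 𝕜} (hX : X.IsHermitian) {z η : ℝ} (h : SpectralGap X z η)
  (hη : 0 < η)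
include hX h hη

lemma SpectralGap.resolv_mul : resolv X z * ((z : 𝕜) • (1 : Matrix (Fin n) (Fin n) 𝕜) - X) = 1 ∧
    ((z : 𝕜) • (1 : Matrix (Fin n) (Fin n) 𝕜) - X) * resolv X z = 1 := by
  obtain ⟨U, h1, h2, h3⟩ := exists_spectral hX
  obtain ⟨e1, e2⟩ := resolv_spectral (h.ne_zero hη) h1 h2 h3
  have hc : resolv X z * ((z : 𝕜) • (1 : Matrix (Fin n) (Fin n) 𝕜) - X) = 1 := by
    rw [e1, e2, conj_mul_diagonal h1]
    have : (fun l : Fin n => (((z - eig X (l + 1))⁻¹ : ℝ) : 𝕜) * ((z - eig X (l + 1) : ℝ) : 𝕜)) =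
        fun _ => 1 := by
      funext l
      rw [← RCLike.ofReal_mul, inv_mul_cancel₀ (h.ne_zero hη l), RCLike.ofReal_one]
    rw [this, diagonal_one, Matrix.mul_one, h2]
  exact ⟨hc, mul_eq_one_comm.1 hc⟩

lemma SpectralGap.nsq_resolv_mulVec_le (v : Fin n → 𝕜) :
    nsq (resolv X z *ᵥ v) ≤ (η⁻¹) ^ 2 * nsq v := by
  obtain ⟨U, h1, h2, h3⟩ := exists_spectral hX
  obtain ⟨e1, e2⟩ := resolv_spectral (h.ne_zero hη) h1 h2 h3
  rw [e2, ← mulVec_mulVec, ← mulVec_mulVec, nsq_mulVec h1,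
    ← nsq_mulVec (U := Uᴴ) (by rw [conjTranspose_conjTranspose]; exact h2) v]
  unfold nsq
  rw [Finset.mul_sum]
  refine Finset.sum_le_sum fun l _ => ?_
  rw [mulVec_diagonal, norm_mul, mul_pow, RCLike.norm_ofReal, abs_inv]
  have := h l
  gcongr

lemma SpectralGap.trace_resolv :
    (resolv X z).trace = ((n * cauchyG (spectralMeasure X) z : ℝ) : 𝕜) := by
  obtain ⟨U, h1, h2, h3⟩ := exists_spectral hX
  obtain ⟨e1, e2⟩ := resolv_spectral (h.ne_zero hη) h1 h2 h3
  rw [e2, trace_mul_comm, ← Matrix.mul_assoc, h1, Matrix.one_mul, trace_diagonal, cauchyG,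
    integral_spectralMeasure, ← RCLike.ofReal_sum]
  congr 1
  rcases Nat.eq_zero_or_pos n with rfl | hn
  · simp
  · have : (n : ℝ) ≠ 0 := by positivity
    rw [← mul_assoc, mul_inv_cancel₀ this, one_mul]
    simp

lemma SpectralGap.sum_norm_resolv : ∑ i, ∑ j, ‖resolv X z i j‖ ^ 2 =
    n * ∫ x, 1 / (z - x) ^ 2 ∂(spectralMeasure X) := by
  obtain ⟨U, h1, h2, h3⟩ := exists_spectral hX
  obtain ⟨e1, e2⟩ := resolv_spectral (h.ne_zero hη) h1 h2 h3
  have hT : (resolv X z * (resolv X z)ᴴ).trace =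
      ((∑ i, ∑ j, ‖resolv X z i j‖ ^ 2 : ℝ) : 𝕜) := by
    simp only [trace, diag, Matrix.mul_apply, conjTranspose_apply]
    push_cast
    exact Finset.sum_congr rfl fun i _ => Finset.sum_congr rfl fun j _ => by
      rw [RCLike.star_def, RCLike.mul_conj]
  have hT' : (resolv X z * (resolv X z)ᴴ).trace =
      ((n * ∫ x, 1 / (z - x) ^ 2 ∂(spectralMeasure X) : ℝ) : 𝕜) := by
    rw [(isHermitian_resolv hX z).eq, e2, conj_mul_diagonal h1, trace_mul_comm, ← Matrix.mul_assoc,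
      h1, Matrix.one_mul, trace_diagonal, integral_spectralMeasure]
    simp_rw [← RCLike.ofReal_mul]
    rw [← RCLike.ofReal_sum]
    congr 1
    rcases Nat.eq_zero_or_pos n with rfl | hn
    · simp
    · have : (n : ℝ) ≠ 0 := by positivity
      rw [← mul_assoc, mul_inv_cancel₀ this, one_mul]
      refine Finset.sum_congr rfl fun l _ => ?_
      rw [one_div, sq, mul_inv]
  exact RCLike.ofReal_injective (hT.symm.trans hT')

lemma SpectralGap.abs_cauchyG_le : |cauchyG (spectralMeasure X) z| ≤ η⁻¹ := by
  rw [cauchyG, integral_spectralMeasure, abs_mul]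
  rcases Nat.eq_zero_or_pos n with rfl | hn
  · rw [Finset.univ_eq_empty, Finset.sum_empty, abs_zero, mul_zero]; positivity
  have hn' : (0 : ℝ) < n := by exact_mod_cast hn
  have h1 : |∑ l : Fin n, 1 / (z - eig X (l + 1))| ≤ n * η⁻¹ := by
    refine (Finset.abs_sum_le_sum_abs _ _).trans ?_
    refine (Finset.sum_le_sum fun l _ => ?_ : _ ≤ ∑ _l : Fin n, η⁻¹).trans (by simp)
    rw [one_div, abs_inv]
    exact inv_anti₀ hη (h l)
  calc _ ≤ |(n : ℝ)⁻¹| * (n * η⁻¹) := by gcongr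
    _ = η⁻¹ := by rw [abs_of_pos (by positivity), ← mul_assoc, inv_mul_cancel₀ hn'.ne', one_mul]

end

/-- An exact second order expansion. The remainder has `R(z)` on both sides, so after compression by
`U` it is controlled by the norms of the columns of `R(z)U` and the operator norm of `R(w)`. -/
lemma resolv_sub {X : Matrix (Fin n) (Fin n) 𝕜} (hX : X.IsHermitian) {z w η : ℝ} (hη : 0 < η)
    (hz : SpectralGap X z η) (hw : SpectralGap X w η) :
    resolv X w = resolv X z - ((w - z : ℝ) : 𝕜) • (resolv X z * resolv X z) +
      (((w - z) ^ 2 : ℝ) : 𝕜) • (resolv X z * resolv X w * resolv X z) := by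
  obtain ⟨U, h1, h2, h3⟩ := exists_spectral hX
  obtain ⟨-, e1⟩ := resolv_spectral (hz.ne_zero hη) h1 h2 h3
  obtain ⟨-, e2⟩ := resolv_spectral (hw.ne_zero hη) h1 h2 h3
  rw [e1, e2, conj_mul_diagonal h1, conj_mul_diagonal h1, conj_mul_diagonal h1]
  have hs : ∀ (c : 𝕜) (d : Fin n → 𝕜), c • (U * diagonal d * Uᴴ) =
      U * diagonal (fun l => c * d l) * Uᴴ := by
    intro c d
    rw [← Matrix.smul_mul, ← Matrix.mul_smul, ← diagonal_smul]
    rfl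
  rw [hs, hs, ← Matrix.sub_mul, ← Matrix.mul_sub, diagonal_sub, ← Matrix.add_mul, ← Matrix.mul_add,
    diagonal_add]
  refine congrArg (fun d => U * diagonal d * Uᴴ) (funext fun l => ?_)
  have hz' := hz.ne_zero hη l
  have hw' := hw.ne_zero hη l
  norm_cast
  field_simp
  ring

/-- The resolvent, minus its normalised trace in the orthonormalised model. -/
noncomputable def centredResolv (mod : Model) (X : Matrix (Fin n) (Fin n) 𝕜) (z : ℝ) :
    Matrix (Fin n) (Fin n) 𝕜 :=
  match mod with
  | .iid => resolv X z
  | .orthonormalised => resolv X z - ((cauchyG (spectralMeasure X) z : ℝ) : 𝕜) • 1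

lemma isHermitian_centredResolv (mod : Model) {X : Matrix (Fin n) (Fin n) 𝕜} (hX : X.IsHermitian)
    (z : ℝ) : (centredResolv mod X z).IsHermitian := by
  cases mod
  · exact isHermitian_resolv hX z
  · refine (isHermitian_resolv hX z).sub ?_
    unfold IsHermitian
    rw [conjTranspose_smul, conjTranspose_one, RCLike.star_def, RCLike.conj_ofReal]

lemma nsq_sub_le {ι : Type*} [Fintype ι] (v w : ι → 𝕜) : nsq (v - w) ≤ 2 * nsq v + 2 * nsq w := by
  unfold nsq
  rw [Finset.mul_sum, Finset.mul_sum, ← Finset.sum_add_distrib]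
  refine Finset.sum_le_sum fun i _ => ?_
  have h1 : ‖(v - w) i‖ ≤ ‖v i‖ + ‖w i‖ := norm_sub_le _ _
  nlinarith [norm_nonneg ((v - w) i), sq_nonneg (‖v i‖ - ‖w i‖)]

lemma nsq_smul {ι : Type*} [Fintype ι] (c : 𝕜) (v : ι → 𝕜) : nsq (c • v) = ‖c‖ ^ 2 * nsq v := by
  unfold nsq
  simp [Finset.mul_sum, mul_pow]

lemma SpectralGap.hermBound_centred (mod : Model) {X : Matrix (Fin n) (Fin n) 𝕜}
    (hX : X.IsHermitian) {z η : ℝ} (h : SpectralGap X z η) (hη : 0 < η) :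
    HermBound (centredResolv mod X z) (2 * η⁻¹) := by
  intro v
  change nsq (centredResolv mod X z *ᵥ v) ≤ (2 * η⁻¹) ^ 2 * nsq v
  have h1 := h.nsq_resolv_mulVec_le hX hη v
  have h0 := nsq_nonneg v
  cases mod
  · change nsq (resolv X z *ᵥ v) ≤ _
    nlinarith [mul_nonneg (sq_nonneg η⁻¹) h0]
  · change nsq ((resolv X z - ((cauchyG (spectralMeasure X) z : ℝ) : 𝕜) • 1) *ᵥ v) ≤ _
    rw [sub_mulVec, smul_mulVec, one_mulVec]
    refine (nsq_sub_le _ _).trans ?_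
    rw [nsq_smul, RCLike.norm_ofReal]
    have h2 := h.abs_cauchyG_le hX hη
    have h3 : |cauchyG (spectralMeasure X) z| ^ 2 * nsq v ≤ (η⁻¹) ^ 2 * nsq v := by gcongr
    nlinarith

lemma SpectralGap.diagAverage_eq (mod : Model) {X : Matrix (Fin n) (Fin n) 𝕜}
    (hX : X.IsHermitian) {z η : ℝ} (h : SpectralGap X z η) (hη : 0 < η) :
    (n : ℝ)⁻¹ * ∑ i, RCLike.re (centredResolv mod X z i i) ^ 2 = diagAverage mod X z := by
  cases mod
  · rfl
  · simp only [centredResolv, diagAverage]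
    congr 1
    refine Finset.sum_congr rfl fun i _ => ?_
    congr 1
    rw [h.trace_resolv hX hη, RCLike.ofReal_re, ← mul_assoc,
      inv_mul_cancel₀ (by have := i.pos; positivity), one_mul,
      Matrix.sub_apply, map_sub, Matrix.smul_apply, Matrix.one_apply_eq, smul_eq_mul, mul_one,
      RCLike.ofReal_re]

/-- Removing the mean of the diagonal lowers the normalised Hilbert-Schmidt norm by the square of
that mean, which is `G`. -/
lemma SpectralGap.sum_norm_centredResolv (mod : Model) {X : Matrix (Fin n) (Fin n) 𝕜}
    (hX : X.IsHermitian) {z η : ℝ} (h : SpectralGap X z η) (hη : 0 < η) :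
    ∑ i, ∑ j, ‖centredResolv mod X z i j‖ ^ 2 =
      n * (∫ x, 1 / (z - x) ^ 2 ∂(spectralMeasure X) - match mod with
        | .iid => 0
        | .orthonormalised => cauchyG (spectralMeasure X) z ^ 2) := by
  cases mod
  · simp only [sub_zero]; exact h.sum_norm_resolv hX hη
  · rw [mul_sub, ← h.sum_norm_resolv hX hη]
    set g := cauchyG (spectralMeasure X) z with hg
    have h1 : ∀ i j, ‖centredResolv .orthonormalised X z i j‖ ^ 2 = ‖resolv X z i j‖ ^ 2 +
        if i = j then g ^ 2 - 2 * g * RCLike.re (resolv X z i j) else 0 := by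
      intro i j
      simp only [centredResolv, Matrix.sub_apply, Matrix.smul_apply, Matrix.one_apply, ← hg]
      by_cases hij : i = j
      · rw [if_pos hij, if_pos hij, smul_eq_mul, mul_one, norm_sq_eq_re_im, norm_sq_eq_re_im,
          map_sub, map_sub, RCLike.ofReal_re, RCLike.ofReal_im]
        ring
      · rw [if_neg hij, if_neg hij]; simp
    simp_rw [h1, Finset.sum_add_distrib, Finset.sum_ite_eq, Finset.mem_univ, if_true]
    have h2 : ∑ i, RCLike.re (resolv X z i i) = n * g := by
      have := congrArg RCLike.re (h.trace_resolv hX hη)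
      rw [RCLike.ofReal_re, trace, map_sum] at this
      exact this
    rw [Finset.sum_sub_distrib, ← Finset.mul_sum, h2]
    simp; ring

end Resolvent

/-! ### Counting eigenvalues of finite rank perturbations -/

section Counting

open Matrix

variable {𝕜 : Type*} [RCLike 𝕜] {n r : ℕ}

lemma finrank_comap_ge {E F : Type*} [AddCommGroup E] [Module 𝕜 E] [FiniteDimensional 𝕜 E]
    [AddCommGroup F] [Module 𝕜 F] [FiniteDimensional 𝕜 F] (L : E →ₗ[𝕜] F) (S : Submodule 𝕜 F) :
    Module.finrank 𝕜 E + Module.finrank 𝕜 S ≤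
      Module.finrank 𝕜 (S.comap L) + Module.finrank 𝕜 F := by
  have h1 := (S.mkQ.comp L).finrank_range_add_finrank_ker
  rw [LinearMap.ker_comp, Submodule.ker_mkQ] at h1
  have h2 := (LinearMap.range (S.mkQ.comp L)).finrank_le
  have h3 := S.finrank_quotient_add_finrank
  omega

lemma qf_mulVec {ι κ : Type*} [Fintype ι] [Fintype κ] (M : Matrix ι ι 𝕜) (B : Matrix ι κ 𝕜)
    (w : κ → 𝕜) : qf M (B *ᵥ w) = qf (Bᴴ * M * B) w := by
  have := qf_conj Bᴴ M w
  rw [conjTranspose_conjTranspose] at this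
  exact this.symm

/-- The matrix `U^* (z - X)⁻¹ U`. -/
noncomputable def compress (X : Matrix (Fin n) (Fin n) 𝕜) (U : Matrix (Fin n) (Fin r) 𝕜) (z : ℝ) :
    Matrix (Fin r) (Fin r) 𝕜 := Uᴴ * resolv X z * U

/-- The diagonal matrix with entries `θ`. -/
noncomputable def diagMat (𝕜 : Type*) [RCLike 𝕜] (θ : Fin r → ℝ) : Matrix (Fin r) (Fin r) 𝕜 :=
  diagonal fun s => (θ s : 𝕜)

lemma isHermitian_diagMat (θ : Fin r → ℝ) : (diagMat 𝕜 θ).IsHermitian := by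
  unfold IsHermitian diagMat
  rw [diagonal_conjTranspose]
  congr 1
  funext s
  simp

lemma isHermitian_compress {X : Matrix (Fin n) (Fin n) 𝕜} (hX : X.IsHermitian)
    (U : Matrix (Fin n) (Fin r) 𝕜) (z : ℝ) : (compress X U z).IsHermitian :=
  isHermitian_conjTranspose_mul_mul _ (isHermitian_resolv hX z)

lemma isHermitian_add_conj {X : Matrix (Fin n) (Fin n) 𝕜} (hX : X.IsHermitian)
    (U : Matrix (Fin n) (Fin r) 𝕜) (θ : Fin r → ℝ) : (X + U * diagMat 𝕜 θ * Uᴴ).IsHermitian :=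
  hX.add (isHermitian_mul_mul_conjTranspose _ (isHermitian_diagMat θ))

section
variable {X : Matrix (Fin n) (Fin n) 𝕜} (hX : X.IsHermitian) {U : Matrix (Fin n) (Fin r) 𝕜}
  {θ : Fin r → ℝ} {z η : ℝ} (hgap : SpectralGap X z η) (hη : 0 < η)
include hX hgap hη

/-- For `v = (z - X)⁻¹Uw` one has `(z - X)v = Uw` and `U^*v = K(z)w`. The form of the perturbed
matrix minus `z` thus becomes one in `w` only, and an `n`-dimensional question becomes
`r`-dimensional. -/
lemma qf_resolv_mulVec (w : Fin r → 𝕜) :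
    qf (X + U * diagMat 𝕜 θ * Uᴴ) ((resolv X z * U) *ᵥ w) - z * nsq ((resolv X z * U) *ᵥ w) =
      qf (compress X U z * diagMat 𝕜 θ * compress X U z) w - qf (compress X U z) w := by
  rw [← qf_smul_one (𝕜 := 𝕜), ← qf_sub, ← qf_sub, qf_mulVec]
  congr 1
  rw [conjTranspose_mul, (isHermitian_resolv hX z).eq]
  have h1 := (hgap.resolv_mul hX hη).1
  have e : X + U * diagMat 𝕜 θ * Uᴴ - (z : 𝕜) • (1 : Matrix (Fin n) (Fin n) 𝕜) =
      U * diagMat 𝕜 θ * Uᴴ - ((z : 𝕜) • (1 : Matrix (Fin n) (Fin n) 𝕜) - X) := by abel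
  rw [e, Matrix.mul_sub, Matrix.sub_mul]
  unfold compress
  congr 1
  · simp only [Matrix.mul_assoc]
  · rw [Matrix.mul_assoc Uᴴ, h1, Matrix.mul_one, Matrix.mul_assoc]

/-- A lower bound for the eigenvalues of a finite rank perturbation. -/
lemma le_eig_perturbation {W : Submodule 𝕜 (Fin r → 𝕜)} {d : ℕ} (hd : 1 ≤ d)
    (hW : d ≤ Module.finrank 𝕜 W) (hpos : ∀ w ∈ W, w ≠ 0 →
      0 < qf (compress X U z * diagMat 𝕜 θ * compress X U z) w - qf (compress X U z) w) :
    z ≤ eig (X + U * diagMat 𝕜 θ * Uᴴ) (n + 1 - d) := by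
  let L : W →ₗ[𝕜] (Fin n → 𝕜) := (resolv X z * U).mulVecLin.domRestrict W
  -- A vector of the kernel would make the form vanish, against positivity. The image therefore has
  -- the full dimension of `W` and can serve as test space.
  have hL : Function.Injective L := by
    rw [← LinearMap.ker_eq_bot, LinearMap.ker_eq_bot']
    intro w hw
    by_contra h0
    have h1 := hpos w w.2 fun h => h0 (Subtype.ext h)
    have h2 : (resolv X z * U) *ᵥ (w : Fin r → 𝕜) = 0 := hw
    rw [← qf_resolv_mulVec hX hgap hη, h2] at h1
    simp [qf, nsq] at h1
  have hr := LinearMap.finrank_range_of_inj hL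
  have hn := (LinearMap.range L).finrank_le
  rw [Module.finrank_fintype_fun_eq_card, Fintype.card_fin] at hn
  refine le_eig (isHermitian_add_conj hX U θ) (by omega) (V := LinearMap.range L) (by omega) ?_
  rintro _ ⟨w, rfl⟩
  by_cases h0 : (w : Fin r → 𝕜) = 0
  · have : w = 0 := Subtype.ext h0
    rw [this, map_zero]; simp [qf, nsq]
  · have h1 := hpos w w.2 h0
    rw [← qf_resolv_mulVec hX hgap hη] at h1
    exact (sub_pos.1 h1).le

/-- Under the constraint `U^*v = K(z)w`, the form `v^*(z - X)v` is smallest at `y = (z - X)⁻¹Uw`,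
with value `w^*K(z)w`. Indeed `u = v - y` satisfies `U^*u = 0`, hence is orthogonal to `(z - X)y =
Uw`, and `z - X` is nonnegative because `z` is above the spectrum of `X`. -/
lemma qf_compress_le (htop : eig X n ≤ z) {v : Fin n → 𝕜} {w : Fin r → 𝕜}
    (hv : Uᴴ *ᵥ v = compress X U z *ᵥ w) : qf (compress X U z) w ≤ z * nsq v - qf X v := by
  set A : Matrix (Fin n) (Fin n) 𝕜 := (z : 𝕜) • (1 : Matrix (Fin n) (Fin n) 𝕜) - X with hA
  obtain ⟨h1, h2⟩ := hgap.resolv_mul hX hη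
  set y : Fin n → 𝕜 := (resolv X z * U) *ᵥ w with hy
  have hAy : A *ᵥ y = U *ᵥ w := by
    rw [hy, mulVec_mulVec, ← Matrix.mul_assoc, h2, Matrix.one_mul]
  set u := v - y with hu
  have hUu : Uᴴ *ᵥ u = 0 := by
    rw [hu, mulVec_sub, hv, hy, mulVec_mulVec, ← Matrix.mul_assoc]
    exact sub_self _
  have hqA : ∀ x, qf A x = z * nsq x - qf X x := fun x => by rw [hA, qf_sub, qf_smul_one]
  rw [← hqA]
  have hvu : v = y + u := by rw [hu]; abel
  have hAH : Aᴴ = A := by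
    have : (((z : 𝕜) • (1 : Matrix (Fin n) (Fin n) 𝕜))).IsHermitian := by
      unfold IsHermitian
      rw [conjTranspose_smul, conjTranspose_one, RCLike.star_def, RCLike.conj_ofReal]
    exact (this.sub hX).eq
  have c1 : star u ⬝ᵥ (A *ᵥ y) = 0 := by
    rw [hAy]
    have := star_mulVec_dotProduct Uᴴ u w
    rw [hUu, conjTranspose_conjTranspose] at this
    rw [← this]; simp
  have c2 : RCLike.re (star y ⬝ᵥ (A *ᵥ u)) = 0 := by
    rw [re_star_dotProduct_comm, star_mulVec_dotProduct, hAH, c1, map_zero]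
  have c3 : qf A v = qf A y + qf A u := by
    rw [hvu]
    unfold qf
    rw [star_add, mulVec_add, add_dotProduct, dotProduct_add, dotProduct_add, map_add, map_add,
      map_add, c1, c2, map_zero]
    ring
  have c4 : qf A y = qf (compress X U z) w := by
    rw [hy, qf_mulVec]
    congr 1
    rw [conjTranspose_mul, (isHermitian_resolv hX z).eq, Matrix.mul_assoc Uᴴ, h1, Matrix.mul_one,
      ← Matrix.mul_assoc]
    rfl
  have c5 : 0 ≤ qf A u := by
    rw [hqA]
    have := qf_le_eig_top hX u
    have := mul_le_mul_of_nonneg_right htop (nsq_nonneg u)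
    linarith
  linarith

/-- An upper bound for the eigenvalues of a finite rank perturbation. -/
lemma eig_perturbation_le (htop : eig X n ≤ z) {W : Submodule 𝕜 (Fin r → 𝕜)} {d : ℕ} (hd : d < n)
    (hW : r ≤ Module.finrank 𝕜 W + d) (hpos : ∀ w ∈ W, w ≠ 0 →
      0 < qf (compress X U z) w - qf (compress X U z * diagMat 𝕜 θ * compress X U z) w) :
    eig (X + U * diagMat 𝕜 θ * Uᴴ) (n - d) ≤ z := by
  have hK := (isHermitian_compress hX U z).eq
  have hq : ∀ w, qf (compress X U z * diagMat 𝕜 θ * compress X U z) w =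
      qf (diagMat 𝕜 θ) (compress X U z *ᵥ w) := by
    intro w; rw [qf_mulVec, hK]
  let L : W →ₗ[𝕜] (Fin r → 𝕜) := (compress X U z).mulVecLin.domRestrict W
  have hL : Function.Injective L := by
    rw [← LinearMap.ker_eq_bot, LinearMap.ker_eq_bot']
    intro w hw
    by_contra h0
    have h1 := hpos w w.2 fun h => h0 (Subtype.ext h)
    have h2 : compress X U z *ᵥ (w : Fin r → 𝕜) = 0 := hw
    rw [hq, qf, h2] at h1
    simp [qf] at h1
  have hr := LinearMap.finrank_range_of_inj hL
  -- The test space consists of the `v` with `U^*v` in `K(W)`. Positivity on `W` makes `K` injective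
  -- there, so the codimension is at most `r - dim W`.
  have hc := finrank_comap_ge (Uᴴ : Matrix (Fin r) (Fin n) 𝕜).mulVecLin (LinearMap.range L)
  rw [Module.finrank_fintype_fun_eq_card, Module.finrank_fintype_fun_eq_card, Fintype.card_fin,
    Fintype.card_fin] at hc
  refine eig_le (isHermitian_add_conj hX U θ) (by omega) (by omega)
    (V := (LinearMap.range L).comap (Uᴴ : Matrix (Fin r) (Fin n) 𝕜).mulVecLin) (by omega) ?_
  rintro v ⟨w, hw⟩
  have hw' : Uᴴ *ᵥ v = compress X U z *ᵥ (w : Fin r → 𝕜) := hw.symm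
  have h1 := qf_compress_le hX hgap hη htop hw'
  have h2 : qf (U * diagMat 𝕜 θ * Uᴴ) v =
      qf (compress X U z * diagMat 𝕜 θ * compress X U z) w := by
    rw [hq, ← hw', qf_mulVec, conjTranspose_conjTranspose]
  rw [qf_add, h2]
  by_cases h0 : (w : Fin r → 𝕜) = 0
  · rw [h0] at h1 ⊢
    simp only [qf, mulVec_zero, star_zero, dotProduct_zero, map_zero] at h1 ⊢
    linarith
  · have := hpos w w.2 h0
    linarith

end

/-! ### Positivity of perturbed quadratic forms -/

lemma norm_mulVec_le {ι κ : Type*} [Fintype ι] [Fintype κ] (E : Matrix ι κ 𝕜) (w : κ → 𝕜) (i : ι) :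
    ‖(E *ᵥ w) i‖ ≤ (∑ i, ∑ j, ‖E i j‖) * √(nsq w) := by
  have hn : ∀ j, ‖w j‖ ≤ √(nsq w) := fun j => Real.le_sqrt_of_sq_le
    (Finset.single_le_sum (f := fun j => ‖w j‖ ^ 2) (fun _ _ => by positivity)
      (Finset.mem_univ j))
  calc ‖(E *ᵥ w) i‖ ≤ ∑ j, ‖E i j * w j‖ := norm_sum_le _ _
    _ ≤ ∑ j, ‖E i j‖ * √(nsq w) := Finset.sum_le_sum fun j _ => by
        rw [norm_mul]; exact mul_le_mul_of_nonneg_left (hn j) (norm_nonneg _)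
    _ = (∑ j, ‖E i j‖) * √(nsq w) := by rw [Finset.sum_mul]
    _ ≤ _ := mul_le_mul_of_nonneg_right (Finset.single_le_sum (f := fun i => ∑ j, ‖E i j‖)
        (fun _ _ => by positivity) (Finset.mem_univ i)) (Real.sqrt_nonneg _)

lemma norm_star_dotProduct_mulVec_le {ι : Type*} [Fintype ι] (E : Matrix ι ι 𝕜)
    (v w : ι → 𝕜) : ‖star v ⬝ᵥ E *ᵥ w‖ ≤ (∑ i, ∑ j, ‖E i j‖) * (√(nsq v) * √(nsq w)) := by
  have hn : ∀ (w : ι → 𝕜) j, ‖w j‖ ≤ √(nsq w) := fun w j => Real.le_sqrt_of_sq_le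
    (Finset.single_le_sum (f := fun j => ‖w j‖ ^ 2) (fun _ _ => by positivity)
      (Finset.mem_univ j))
  simp only [dotProduct, mulVec, Pi.star_apply, Finset.mul_sum, Finset.sum_mul]
  refine (norm_sum_le _ _).trans (Finset.sum_le_sum fun i _ => (norm_sum_le _ _).trans
    (Finset.sum_le_sum fun j _ => ?_))
  rw [norm_mul, norm_mul, norm_star]
  calc ‖v i‖ * (‖E i j‖ * ‖w j‖) = ‖E i j‖ * (‖v i‖ * ‖w j‖) := by ring
    _ ≤ _ := by gcongr <;> exact hn _ _

lemma exists_pos_le_of_pos {ι : Type*} [Finite ι] (p : ι → ℝ) :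
    ∃ c > 0, ∀ s, 0 < p s → c ≤ p s := by
  cases nonempty_fintype ι
  classical
  by_cases h : (Finset.univ.filter fun s => 0 < p s).Nonempty
  · obtain ⟨s, hs, hs'⟩ := Finset.exists_min_image _ p h
    exact ⟨p s, (Finset.mem_filter.1 hs).2, fun t ht => hs' t (by simpa using ht)⟩
  · exact ⟨1, one_pos, fun s hs => absurd ⟨s, by simpa using hs⟩ h⟩

/-- Here `x` and `y` stand for the norms of the components off and on the degenerate block, and `c`,
`ε` for the coercivity constants of orders zero and one. The mixed term `C x y` of order one is
absorbed by half of `ε y²`; the price `h C²/(2ε) x²` is small against `c x²`. -/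
lemma form_pos_of_bounds {c ε h x y C T A₁ A₂ A₃ : ℝ} (hε : 0 < ε) (h0 : 0 < h) (h1 : h ≤ 1)
    (hxy : 0 < x ^ 2 + y ^ 2) (hD : h * (C ^ 2 / (2 * ε) + C + T) < c) (hT : h * T < ε / 2)
    (hT0 : 0 ≤ T) (t1 : c * x ^ 2 ≤ A₁) (t2 : ε * y ^ 2 - C * (x * y) - C * x ^ 2 ≤ A₂)
    (t3 : -(T * (x ^ 2 + y ^ 2)) ≤ A₃) : 0 < A₁ + h * A₂ + h ^ 2 * A₃ := by
  have hamgm : C * (x * y) ≤ ε / 2 * y ^ 2 + C ^ 2 / (2 * ε) * x ^ 2 := by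
    have h1 : 0 ≤ (ε * y - C * x) ^ 2 / (2 * ε) := by positivity
    have h2 : (ε * y - C * x) ^ 2 / (2 * ε) = ε / 2 * y ^ 2 +
        C ^ 2 / (2 * ε) * x ^ 2 - C * (x * y) := by
      field_simp; ring
    linarith
  have s2 : h * (ε / 2 * y ^ 2 - (C ^ 2 / (2 * ε) + C) * x ^ 2) ≤ h * A₂ :=
    mul_le_mul_of_nonneg_left (by linarith) h0.le
  have s3 := mul_le_mul_of_nonneg_left t3 (sq_nonneg h)
  have s4 : h ^ 2 * (T * (x ^ 2 + y ^ 2)) ≤ h * (T * (x ^ 2 + y ^ 2)) :=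
    mul_le_mul_of_nonneg_right (by nlinarith) (by positivity)
  have key : 0 < x ^ 2 * (c - h * (C ^ 2 / (2 * ε) + C + T)) + h * y ^ 2 * (ε / 2 - h * T) := by
    rcases eq_or_lt_of_le (sq_nonneg x) with h1 | h1
    · rw [← h1] at hxy ⊢
      have h2 : 0 < y ^ 2 := by linarith
      have := mul_pos (mul_pos h0 h2) (sub_pos.2 hT)
      linarith
    · have h2 := mul_pos h1 (sub_pos.2 hD)
      have h3 := mul_nonneg (mul_nonneg h0.le (sq_nonneg y)) (sub_pos.2 hT).le
      linarith
  have s5 : h ^ 2 * (T * y ^ 2) = h * y ^ 2 * (h * T) := by ring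
  have s6 : h ^ 2 * (T * x ^ 2) ≤ h * (T * x ^ 2) :=
    mul_le_mul_of_nonneg_right (by nlinarith) (by positivity)
  linarith

open ComplexConjugate in
/-- A small perturbation of a quadratic form which is positive semidefinite on a subspace is
positive definite there, if the first order term is positive definite on the kernel. -/
lemma exists_forall_form_pos (p q t : Fin r → ℝ) (I : Finset (Fin r))
    (hI : ∀ s ∈ I, p s = 0 ∧ q s = 1) (M : ℝ) {ε : ℝ} (hε : 0 < ε) :
    ∃ h₀ > 0, ∀ h, 0 < h → h ≤ h₀ → ∀ E : Matrix (Fin r) (Fin r) 𝕜, (∑ i, ∑ j, ‖E i j‖) ≤ M →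
      ∀ w : Fin r → 𝕜, w ≠ 0 → (∀ s ∉ I, w s ≠ 0 → 0 < p s) →
      ε * nsq (fun s => if s ∈ I then w s else 0) ≤ qf E (fun s => if s ∈ I then w s else 0) →
      0 < ∑ s, p s * ‖w s‖ ^ 2 + h * ∑ s, q s * RCLike.re (conj (w s) * (E *ᵥ w) s) +
        h ^ 2 * ∑ s, t s * ‖(E *ᵥ w) s‖ ^ 2 := by
  obtain ⟨c, hc, hcp⟩ := exists_pos_le_of_pos p
  set B : ℝ := ∑ s, |q s| with hB
  set T : ℝ := ∑ s, |t s| with hT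
  have hB0 : 0 ≤ B := by positivity
  have hT0 : 0 ≤ T := by positivity
  by_cases hM : 0 ≤ M
  swap
  · refine ⟨1, one_pos, fun h _ _ E hE => absurd (le_trans (by positivity) hE) hM⟩
  set D : ℝ := (M * (1 + B)) ^ 2 / (2 * ε) + M * (1 + B) + T * M ^ 2 with hD
  have hD0 : 0 ≤ D := by positivity
  -- Three requirements on `h`: `h ≤ 1`, so that `h² ≤ h`; the losses in the nondegenerate direction
  -- stay below `c`; the second order loss in the degenerate direction stays below `ε/2`.
  refine ⟨min 1 (min (c / (D + 1)) (ε / (2 * (T * M ^ 2 + 1)))), by positivity, ?_⟩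
  intro h h0 hh E hE w hw hwp hwI
  have hh1 : h ≤ 1 := hh.trans (min_le_left _ _)
  have hh2 : h * D < c := by
    have : h ≤ c / (D + 1) := hh.trans ((min_le_right _ _).trans (min_le_left _ _))
    rw [le_div_iff₀ (by positivity)] at this
    nlinarith
  have hh3 : h * (T * M ^ 2) < ε / 2 := by
    have : h ≤ ε / (2 * (T * M ^ 2 + 1)) := hh.trans ((min_le_right _ _).trans (min_le_right _ _))
    rw [le_div_iff₀ (by positivity)] at this
    nlinarith
  set b : Fin r → 𝕜 := fun s => if s ∈ I then w s else 0 with hb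
  set a : Fin r → 𝕜 := fun s => if s ∈ I then 0 else w s with ha
  have hab : w = a + b := by
    funext s; simp only [ha, hb, Pi.add_apply]; split_ifs <;> simp
  have hnab : nsq w = nsq a + nsq b := by
    unfold nsq
    rw [← Finset.sum_add_distrib]
    refine Finset.sum_congr rfl fun s _ => ?_
    simp only [ha, hb]; split_ifs <;> simp
  set x := √(nsq a) with hx
  set y := √(nsq b) with hy
  have hx2 : x ^ 2 = nsq a := Real.sq_sqrt (nsq_nonneg a)
  have hy2 : y ^ 2 = nsq b := Real.sq_sqrt (nsq_nonneg b)
  have hx0 : 0 ≤ x := Real.sqrt_nonneg _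
  have hy0 : 0 ≤ y := Real.sqrt_nonneg _
  have hwxy : √(nsq w) ≤ x + y := by
    rw [Real.sqrt_le_left (by positivity), hnab, ← hx2, ← hy2]
    nlinarith [mul_nonneg hx0 hy0]
  have hEw : ∀ s, ‖(E *ᵥ w) s‖ ≤ M * √(nsq w) := fun s =>
    (norm_mulVec_le E w s).trans (mul_le_mul_of_nonneg_right hE (Real.sqrt_nonneg _))
  -- zeroth order
  have t1 : c * x ^ 2 ≤ ∑ s, p s * ‖w s‖ ^ 2 := by
    rw [hx2, nsq, Finset.mul_sum]
    refine Finset.sum_le_sum fun s _ => ?_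
    simp only [ha]
    by_cases hs : s ∈ I
    · rw [if_pos hs, (hI s hs).1]; simp
    · rw [if_neg hs]
      by_cases h0 : w s = 0
      · simp [h0]
      · exact mul_le_mul_of_nonneg_right (hcp s (hwp s hs h0)) (by positivity)
  -- first order
  have t2 : ε * y ^ 2 - M * (y * x) - B * (x * (M * (x + y))) ≤
      ∑ s, q s * RCLike.re (conj (w s) * (E *ᵥ w) s) := by
    have e1 : ∀ s, q s * RCLike.re (conj (w s) * (E *ᵥ w) s) =
        RCLike.re (star (b s) * (E *ᵥ w) s) + q s * RCLike.re (conj (a s) * (E *ᵥ w) s) := by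
      intro s
      simp only [ha, hb]
      by_cases hs : s ∈ I
      · simp [hs, (hI s hs).2]
      · simp [hs]
    have e2 : ∑ s, RCLike.re (star (b s) * (E *ᵥ w) s) =
        qf E b + RCLike.re (star b ⬝ᵥ E *ᵥ a) := by
      rw [← map_sum]
      change RCLike.re (star b ⬝ᵥ E *ᵥ w) = _
      conv_lhs => rw [hab, mulVec_add, dotProduct_add, map_add]
      rw [qf]; ring
    have e3 : -(M * (y * x)) ≤ RCLike.re (star b ⬝ᵥ E *ᵥ a) := by
      have h1 := (RCLike.abs_re_le_norm _).trans (norm_star_dotProduct_mulVec_le E b a)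
      have h2 : (∑ i, ∑ j, ‖E i j‖) * (y * x) ≤ M * (y * x) := by gcongr
      linarith [neg_abs_le (RCLike.re (star b ⬝ᵥ E *ᵥ a))]
    have e4 : -(B * (x * (M * (x + y)))) ≤ ∑ s, q s * RCLike.re (conj (a s) * (E *ᵥ w) s) := by
      rw [hB, Finset.sum_mul, ← Finset.sum_neg_distrib]
      refine Finset.sum_le_sum fun s _ => ?_
      have h1 : |RCLike.re (conj (a s) * (E *ᵥ w) s)| ≤ x * (M * (x + y)) := by
        refine (RCLike.abs_re_le_norm _).trans ?_
        rw [norm_mul, RCLike.norm_conj]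
        have h2 : ‖a s‖ ≤ x := Real.le_sqrt_of_sq_le
          (Finset.single_le_sum (f := fun j => ‖a j‖ ^ 2) (fun _ _ => by positivity)
            (Finset.mem_univ s))
        have h3 := (hEw s).trans (mul_le_mul_of_nonneg_left hwxy hM)
        exact mul_le_mul h2 h3 (norm_nonneg _) hx0
      have h4 : |q s * RCLike.re (conj (a s) * (E *ᵥ w) s)| ≤ |q s| * (x * (M * (x + y))) := by
        rw [abs_mul]; gcongr
      linarith [neg_abs_le (q s * RCLike.re (conj (a s) * (E *ᵥ w) s))]
    simp_rw [e1, Finset.sum_add_distrib]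
    rw [e2]
    have : ε * y ^ 2 ≤ qf E b := by rw [hy2]; exact hwI
    linarith
  -- second order
  have t3 : -(T * M ^ 2 * (x ^ 2 + y ^ 2)) ≤ ∑ s, t s * ‖(E *ᵥ w) s‖ ^ 2 := by
    have hsq : M ^ 2 * (x ^ 2 + y ^ 2) = (M * √(nsq w)) ^ 2 := by
      rw [mul_pow, Real.sq_sqrt (nsq_nonneg w), hnab, hx2, hy2]
    rw [mul_assoc, hsq, hT, Finset.sum_mul, ← Finset.sum_neg_distrib]
    refine Finset.sum_le_sum fun s _ => ?_
    have h1 : ‖(E *ᵥ w) s‖ ^ 2 ≤ (M * √(nsq w)) ^ 2 :=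
      pow_le_pow_left₀ (norm_nonneg _) (hEw s) 2
    have h4 : |t s * ‖(E *ᵥ w) s‖ ^ 2| ≤ |t s| * (M * √(nsq w)) ^ 2 := by
      rw [abs_mul, abs_of_nonneg (by positivity : (0 : ℝ) ≤ ‖(E *ᵥ w) s‖ ^ 2)]; gcongr
    linarith [neg_abs_le (t s * ‖(E *ᵥ w) s‖ ^ 2)]
  have hxy : 0 < x ^ 2 + y ^ 2 := by rw [hx2, hy2, ← hnab]; exact nsq_pos hw
  refine form_pos_of_bounds hε h0 hh1 hxy hh2 hh3 (by positivity) t1 ?_ t3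
  refine le_trans ?_ t2
  have : M * (1 + B) * (x * y) + M * (1 + B) * x ^ 2 =
    M * (y * x) + B * (x * (M * (x + y))) + M * x ^ 2 := by ring
  have := mul_nonneg hM (sq_nonneg x)
  linarith

end Counting

/-! ### Fluctuations of the outliers, deterministic part -/

section Outliers

open Matrix

variable {𝕜 : Type*} [RCLike 𝕜] {n r k : ℕ}

open ComplexConjugate in
-- For `g = 1/α` the coefficients of order zero are `(θ_s - α)/α²`. Their sign tells on which side
-- of `α` the coefficient `θ_s` lies, and where they vanish the first order coefficient `2gθ_s - 1`
-- equals `1`.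
lemma qf_compress_expand {K E : Matrix (Fin r) (Fin r) 𝕜} (hE : E.IsHermitian) {g h : ℝ}
    (hK : K = (g : 𝕜) • (1 : Matrix (Fin r) (Fin r) 𝕜) + (h : 𝕜) • E) (θ : Fin r → ℝ)
    (w : Fin r → 𝕜) : qf (K * diagMat 𝕜 θ * K) w - qf K w =
      ∑ s, (g ^ 2 * θ s - g) * ‖w s‖ ^ 2 +
        h * ∑ s, (2 * g * θ s - 1) * RCLike.re (conj (w s) * (E *ᵥ w) s) +
        h ^ 2 * ∑ s, θ s * ‖(E *ᵥ w) s‖ ^ 2 := by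
  have hKH : Kᴴ = K := by
    rw [hK, conjTranspose_add, conjTranspose_smul, conjTranspose_smul, conjTranspose_one, hE.eq,
      RCLike.star_def, RCLike.conj_ofReal, RCLike.conj_ofReal]
  have hKw : ∀ s, (K *ᵥ w) s = g * w s + h * (E *ᵥ w) s := by
    intro s
    rw [hK, add_mulVec, smul_mulVec, smul_mulVec, one_mulVec]
    simp only [Pi.add_apply, Pi.smul_apply, smul_eq_mul]
  have h1 : qf (K * diagMat 𝕜 θ * K) w = ∑ s, θ s * ‖(K *ᵥ w) s‖ ^ 2 := by
    have := qf_mulVec (diagMat 𝕜 θ) K w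
    rw [hKH] at this
    rw [← this, diagMat, qf_diagonal]
  have h2 : ∀ s, ‖(K *ᵥ w) s‖ ^ 2 = g ^ 2 * ‖w s‖ ^ 2 +
      2 * g * h * RCLike.re (conj (w s) * (E *ᵥ w) s) + h ^ 2 * ‖(E *ᵥ w) s‖ ^ 2 := by
    intro s
    rw [hKw]
    simp only [norm_sq_eq_re_im, map_add, RCLike.mul_re, RCLike.mul_im, RCLike.ofReal_re,
      RCLike.ofReal_im, RCLike.conj_re, RCLike.conj_im]
    ring
  have h3 : qf K w = ∑ s, (g * ‖w s‖ ^ 2 + h * RCLike.re (conj (w s) * (E *ᵥ w) s)) := by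
    unfold qf dotProduct
    rw [map_sum]
    refine Finset.sum_congr rfl fun s _ => ?_
    rw [hKw, Pi.star_apply, RCLike.star_def]
    simp only [norm_sq_eq_re_im, map_add, RCLike.mul_re, RCLike.mul_im, RCLike.ofReal_re,
      RCLike.ofReal_im, RCLike.conj_re, RCLike.conj_im]
    ring
  rw [h1, h3, Finset.mul_sum, Finset.mul_sum, ← Finset.sum_add_distrib, ← Finset.sum_add_distrib,
    ← Finset.sum_sub_distrib]
  exact Finset.sum_congr rfl fun s _ => by rw [h2]; ring

section Restrict

variable {θ : Fin r → ℝ} {α : ℝ} (e : Fin k ≃ {a // θ a = α})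

lemma sum_restrict {M : Type*} [AddCommMonoid M] (f : Fin r → M) :
    ∑ a, (if θ a = α then f a else 0) = ∑ c, f (e c) := by
  classical
  rw [← Finset.sum_filter, Finset.sum_subtype (p := fun a => θ a = α) _ (by simp),
    ← Equiv.sum_comp e]

lemma nsq_restrict (w : Fin r → 𝕜) :
    nsq (fun a => if θ a = α then w a else 0) = nsq fun c => w (e c) := by
  unfold nsq
  rw [← sum_restrict e fun a => ‖w a‖ ^ 2]
  exact Finset.sum_congr rfl fun a _ => by split_ifs with h <;> simp [h]

lemma qf_restrict (E : Matrix (Fin r) (Fin r) 𝕜) (w : Fin r → 𝕜) :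
    qf E (fun a => if θ a = α then w a else 0) =
      qf (E.submatrix (fun c => (e c : Fin r)) fun c => (e c : Fin r)) fun c => w (e c) := by
  unfold qf
  congr 1
  simp only [dotProduct, mulVec, Pi.star_apply, submatrix_apply]
  rw [← sum_restrict e fun a => star (w a) * ∑ c, E a (e c) * w (e c)]
  refine Finset.sum_congr rfl fun a _ => ?_
  rw [← sum_restrict e fun b => E a b * w b]
  split_ifs
  · congr 1
    exact Finset.sum_congr rfl fun b _ => by split_ifs <;> simp
  · simp

/-- The vectors supported in `J ∪ {θ = α}` with restriction to `{θ = α}` in a given subspace. -/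
lemma exists_support_subspace (J : Finset (Fin r)) (hJ : ∀ a ∈ J, θ a ≠ α)
    (V : Submodule 𝕜 (Fin k → 𝕜)) : ∃ W : Submodule 𝕜 (Fin r → 𝕜),
      Module.finrank 𝕜 W = J.card + Module.finrank 𝕜 V ∧
      ∀ w ∈ W, (∀ a, θ a ≠ α → w a ≠ 0 → a ∈ J) ∧ (fun c => w (e c)) ∈ V := by
  classical
  let L : (({a // a ∈ J} → 𝕜) × V) →ₗ[𝕜] (Fin r → 𝕜) :=
    { toFun := fun x a => if h : a ∈ J then x.1 ⟨a, h⟩ else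
        if h : θ a = α then (x.2 : Fin k → 𝕜) (e.symm ⟨a, h⟩) else 0
      map_add' := fun x y => by
        funext a
        simp only [Pi.add_apply]
        split_ifs <;> simp
      map_smul' := fun c x => by
        funext a
        simp only [Pi.smul_apply, RingHom.id_apply]
        split_ifs <;> simp }
  have hL2 : ∀ x, (fun c => L x (e c)) = (x.2 : Fin k → 𝕜) := by
    intro x
    funext c
    have h1 : (e c : Fin r) ∉ J := fun h => hJ _ h (e c).2
    simp only [L, LinearMap.coe_mk, AddHom.coe_mk]
    rw [dif_neg h1, dif_pos (e c).2]
    simp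
  have hL1 : ∀ x (a : {a // a ∈ J}), L x a = x.1 a := by
    intro x a
    simp only [L, LinearMap.coe_mk, AddHom.coe_mk]
    rw [dif_pos a.2]
  have hinj : Function.Injective L := by
    intro x y hxy
    refine Prod.ext (funext fun a => ?_) (Subtype.ext ?_)
    · rw [← hL1, ← hL1, hxy]
    · rw [← hL2, ← hL2, hxy]
  refine ⟨LinearMap.range L, ?_, ?_⟩
  · rw [LinearMap.finrank_range_of_inj hinj, Module.finrank_prod,
      Module.finrank_fintype_fun_eq_card, Fintype.card_coe]
  · rintro _ ⟨x, rfl⟩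
    refine ⟨fun a ha h0 => ?_, by rw [hL2]; exact x.2.2⟩
    by_contra hJ'
    apply h0
    simp only [L, LinearMap.coe_mk, AddHom.coe_mk]
    rw [dif_neg hJ', dif_neg ha]

end Restrict

/-- Cauchy-Schwarz. The column `a` of `R(z)U` has as squared norm the diagonal entry of `U^*R(z)²U`,
and `R(ζ)` has operator norm at most `1/η`. -/
lemma norm_compress_sandwich_le {X : Matrix (Fin n) (Fin n) 𝕜} (hX : X.IsHermitian) {z ζ η : ℝ}
    (hη : 0 < η) (hζ : SpectralGap X ζ η) (U : Matrix (Fin n) (Fin r) 𝕜) {C : ℝ}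
    (hC : ∀ a, ‖(Uᴴ * resolv X z * resolv X z * U) a a‖ ≤ C) (a b : Fin r) :
    ‖(Uᴴ * (resolv X z * resolv X ζ * resolv X z) * U) a b‖ ≤ η⁻¹ * C := by
  set y : Fin r → Fin n → 𝕜 := fun a => (resolv X z * U).col a with hy
  have hR := (isHermitian_resolv hX z).eq
  have hn : ∀ a, nsq (y a) ≤ C := by
    intro a
    have h1 : ((nsq (y a) : ℝ) : 𝕜) = (Uᴴ * resolv X z * resolv X z * U) a a := by
      rw [← star_dotProduct_self]
      have : Uᴴ * resolv X z * resolv X z * U = (resolv X z * U)ᴴ * (resolv X z * U) := by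
        rw [conjTranspose_mul, hR]; simp only [Matrix.mul_assoc]
      rw [this, Matrix.mul_apply]
      rfl
    have h2 := hC a
    rw [← h1, RCLike.norm_ofReal, abs_of_nonneg (nsq_nonneg _)] at h2
    exact h2
  have h1 : (Uᴴ * (resolv X z * resolv X ζ * resolv X z) * U) a b =
      star (y a) ⬝ᵥ resolv X ζ *ᵥ y b := by
    have : Uᴴ * (resolv X z * resolv X ζ * resolv X z) * U =
        (resolv X z * U)ᴴ * (resolv X ζ * (resolv X z * U)) := by
      rw [conjTranspose_mul, hR]; simp only [Matrix.mul_assoc]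
    rw [this, Matrix.mul_apply]
    rfl
  rw [h1]
  have hC0 : 0 ≤ C := (nsq_nonneg _).trans (hn a)
  have h2 : ‖star (y a) ⬝ᵥ resolv X ζ *ᵥ y b‖ ≤ ∑ i, ‖y a i‖ * ‖(resolv X ζ *ᵥ y b) i‖ := by
    refine (norm_sum_le _ _).trans (Finset.sum_le_sum fun i _ => ?_)
    rw [norm_mul, Pi.star_apply, norm_star]
  have h3 := Finset.sum_mul_sq_le_sq_mul_sq Finset.univ (fun i => ‖y a i‖)
    fun i => ‖(resolv X ζ *ᵥ y b) i‖
  have h4 : (∑ i, ‖y a i‖ ^ 2) * ∑ i, ‖(resolv X ζ *ᵥ y b) i‖ ^ 2 ≤ (η⁻¹ * C) ^ 2 := by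
    calc _ ≤ C * ((η⁻¹) ^ 2 * C) := by
          refine mul_le_mul (hn a) ?_ (by positivity) hC0
          exact (hζ.nsq_resolv_mulVec_le hX hη (y b)).trans
            (mul_le_mul_of_nonneg_left (hn b) (by positivity))
      _ = _ := by ring
  exact h2.trans (abs_le_of_sq_le_sq' (h3.trans h4) (by positivity)).2

section Asymptotics

variable {ι : Type*} {F : Filter ι} {N : ι → ℕ} {X : (i : ι) → Matrix (Fin (N i)) (Fin (N i)) 𝕜}
  {U : (i : ι) → Matrix (Fin (N i)) (Fin r) 𝕜} {θ : Fin r → ℝ} {α ρ η s : ℝ}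

/-- The rescaled matrix `√n (U^* (z - X)⁻¹ U - 1 / α)`. -/
noncomputable def rescaled (X : Matrix (Fin n) (Fin n) 𝕜) (U : Matrix (Fin n) (Fin r) 𝕜)
    (α z : ℝ) : Matrix (Fin r) (Fin r) 𝕜 :=
  ((√(n : ℝ) : ℝ) : 𝕜) • (compress X U z - ((α⁻¹ : ℝ) : 𝕜) • 1)

lemma isHermitian_rescaled {X : Matrix (Fin n) (Fin n) 𝕜} (hX : X.IsHermitian)
    (U : Matrix (Fin n) (Fin r) 𝕜) (α z : ℝ) : (rescaled X U α z).IsHermitian := by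
  unfold rescaled IsHermitian
  rw [conjTranspose_smul, conjTranspose_sub, (isHermitian_compress hX U z).eq, conjTranspose_smul,
    conjTranspose_one, RCLike.star_def, RCLike.conj_ofReal, RCLike.conj_ofReal]

lemma compress_eq_rescaled (hn : 0 < n) (X : Matrix (Fin n) (Fin n) 𝕜)
    (U : Matrix (Fin n) (Fin r) 𝕜) (α z : ℝ) : compress X U z =
      ((α⁻¹ : ℝ) : 𝕜) • (1 : Matrix (Fin r) (Fin r) 𝕜) +
        (((√(n : ℝ))⁻¹ : ℝ) : 𝕜) • rescaled X U α z := by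
  have h : (√(n : ℝ)) ≠ 0 := by positivity
  rw [rescaled, smul_smul, ← RCLike.ofReal_mul, inv_mul_cancel₀ h, RCLike.ofReal_one, one_smul]
  abel

lemma spectralGap_of_top_le {X : Matrix (Fin n) (Fin n) 𝕜} (hX : X.IsHermitian) {z η : ℝ}
    (h : eig X n ≤ z - η) : SpectralGap X z η := by
  intro l
  have := eig_mono hX (k := l + 1) (l := n) (by omega) l.2 le_rfl
  exact le_trans (by linarith) (le_abs_self _)

lemma tendsto_inv_sqrt (hN : Tendsto N F atTop) :
    Tendsto (fun i => (√(N i : ℝ))⁻¹) F (𝓝 0) :=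
  tendsto_inv_atTop_zero.comp (Real.tendsto_sqrt_atTop.comp
    (tendsto_natCast_atTop_atTop.comp hN))

lemma tendsto_of_bdd_mul {f g : ι → ℝ} {B : ℝ} (hf : ∀ᶠ i in F, |f i| ≤ B)
    (hg : Tendsto g F (𝓝 0)) : Tendsto (fun i => f i * g i) F (𝓝 0) := by
  have h := (hg.norm.const_mul B)
  rw [norm_zero, mul_zero] at h
  refine squeeze_zero_norm' ?_ h
  filter_upwards [hf] with i hi
  rw [norm_mul]
  exact mul_le_mul_of_nonneg_right hi (norm_nonneg _)

section
variable (hN : Tendsto N F atTop) (hX : ∀ i, (X i).IsHermitian) (hη : 0 < η)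
  (htop : ∀ᶠ i in F, eig (X i) (N i) ≤ ρ - η)
include hN hX hη htop

lemma eventually_top_le {x : ι → ℝ} {B : ℝ} (hx : ∀ᶠ i in F, |x i| ≤ B) :
    ∀ᶠ i in F, eig (X i) (N i) ≤ (ρ + x i * (√(N i : ℝ))⁻¹) - η / 2 := by
  have h0 := tendsto_of_bdd_mul hx (tendsto_inv_sqrt hN)
  have h1 : ∀ᶠ i in F, -(η / 2) < x i * (√(N i : ℝ))⁻¹ :=
    h0.eventually (lt_mem_nhds (by linarith))
  filter_upwards [htop, h1] with i h2 h3
  linarith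

/-- First order expansion in the spectral parameter: `√n (K(ρ + x/√n) - K(ρ)) = -x U^*R(ρ)²U +
O(x²/√n)`, with `U^*R(ρ)²U → s`. The shift `x` may vary, as only its boundedness matters; this is
needed because it will be an eigenvalue of a block up to `ε`. -/
lemma tendsto_rescaled_sub (hS : ∀ a b, Tendsto (fun i => ((U i)ᴴ * resolv (X i) ρ *
      resolv (X i) ρ * U i) a b) F (𝓝 (if a = b then (s : 𝕜) else 0)))
    {x : ι → ℝ} {B : ℝ} (hx : ∀ᶠ i in F, |x i| ≤ B) (a b : Fin r) :
    Tendsto (fun i => rescaled (X i) (U i) α (ρ + x i * (√(N i : ℝ))⁻¹) a b -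
      (rescaled (X i) (U i) α ρ a b - if a = b then ((x i * s : ℝ) : 𝕜) else 0)) F (𝓝 0) := by
  set S : ι → Matrix (Fin r) (Fin r) 𝕜 := fun i => (U i)ᴴ * resolv (X i) ρ * resolv (X i) ρ * U i
    with hSdef
  have hinv := tendsto_inv_sqrt (F := F) hN
  have htop' := eventually_top_le hN hX hη htop hx
  have hSb : ∀ᶠ i in F, ∀ a, ‖S i a a‖ ≤ |s| + 1 := by
    rw [eventually_all]
    intro a
    have h := (hS a a).norm
    rw [if_pos rfl, RCLike.norm_ofReal] at h
    exact h.eventually (ge_mem_nhds (by linarith))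
  have h1 : Tendsto (fun i => x i * ‖S i a b - if a = b then (s : 𝕜) else 0‖) F (𝓝 0) := by
    refine tendsto_of_bdd_mul hx ?_
    have := (hS a b).sub_const (if a = b then (s : 𝕜) else 0)
    rw [sub_self] at this
    simpa using this.norm
  have h2 : Tendsto (fun i => |x i * ‖S i a b - if a = b then (s : 𝕜) else 0‖| +
      B ^ 2 * (√(N i : ℝ))⁻¹ * ((η / 2)⁻¹ * (|s| + 1))) F (𝓝 0) := by
    have h3 := (hinv.const_mul (B ^ 2)).mul_const ((η / 2)⁻¹ * (|s| + 1))
    simpa using h1.abs.add h3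
  refine squeeze_zero_norm' ?_ h2
  filter_upwards [htop, htop', hSb, hx, hN.eventually_gt_atTop 0] with i t1 t2 t3 t4 t5
  set u := (√(N i : ℝ))⁻¹ with hu
  have hsq : √(N i : ℝ) * u = 1 := mul_inv_cancel₀ (by positivity)
  have hu0 : 0 ≤ u := by positivity
  have hη2 : 0 < η / 2 := by positivity
  have g1 : SpectralGap (X i) ρ (η / 2) := spectralGap_of_top_le (hX i) (by linarith)
  have g2 := spectralGap_of_top_le (hX i) t2
  have hexp := resolv_sub (hX i) hη2 g1 g2
  have hsand := norm_compress_sandwich_le (z := ρ) (hX i) hη2 g2 (U i) t3 a b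
  set Y := (U i)ᴴ * (resolv (X i) ρ * resolv (X i) (ρ + x i * u) * resolv (X i) ρ) * U i with hY
  have hc : compress (X i) (U i) (ρ + x i * u) = compress (X i) (U i) ρ -
      ((x i * u : ℝ) : 𝕜) • S i + (((x i * u) ^ 2 : ℝ) : 𝕜) • Y := by
    unfold compress
    rw [hexp, Matrix.mul_add, Matrix.mul_sub, Matrix.add_mul, Matrix.sub_mul, Matrix.mul_smul,
      Matrix.mul_smul, Matrix.smul_mul, Matrix.smul_mul, add_sub_cancel_left, hY, hSdef]
    simp only [Matrix.mul_assoc]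
  have hsq' : ((√(N i : ℝ) : ℝ) : 𝕜) * (u : 𝕜) = 1 := by
    rw [← RCLike.ofReal_mul, hsq, RCLike.ofReal_one]
  have hdiff : rescaled (X i) (U i) α (ρ + x i * u) a b -
      (rescaled (X i) (U i) α ρ a b - if a = b then ((x i * s : ℝ) : 𝕜) else 0) =
      -((x i : 𝕜) * (S i a b - if a = b then (s : 𝕜) else 0)) +
        ((x i ^ 2 * u : ℝ) : 𝕜) * Y a b := by
    unfold rescaled
    rw [hc]
    simp only [Matrix.smul_apply, Matrix.sub_apply, Matrix.add_apply, smul_eq_mul]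
    push_cast
    have e1 : ((√(N i : ℝ) : ℝ) : 𝕜) * ((x i : 𝕜) * u * S i a b) = x i * S i a b := by
      linear_combination (x i : 𝕜) * S i a b * hsq'
    have e2 : ((√(N i : ℝ) : ℝ) : 𝕜) * (((x i : 𝕜) * u) ^ 2 * Y a b) = x i ^ 2 * u * Y a b := by
      linear_combination (x i : 𝕜) ^ 2 * u * Y a b * hsq'
    split_ifs <;> linear_combination -e1 + e2
  rw [hdiff]
  refine (norm_add_le _ _).trans (add_le_add ?_ ?_)
  · rw [norm_neg, norm_mul, RCLike.norm_ofReal, abs_mul, abs_norm]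
  · rw [norm_mul, RCLike.norm_ofReal, abs_of_nonneg (by positivity)]
    have h5 : x i ^ 2 ≤ B ^ 2 := by
      rw [← sq_abs]; exact pow_le_pow_left₀ (abs_nonneg _) t4 2
    gcongr

end

end Asymptotics

end Outliers

/-! ### Upper and lower bounds for the rescaled outliers -/

section OutlierLimit

open Matrix

variable {𝕜 : Type*} [RCLike 𝕜] {r k : ℕ}

lemma abs_eig_le {m : ℕ} {A : Matrix (Fin m) (Fin m) 𝕜} (hA : A.IsHermitian) (j : ℕ) :
    |eig A j| ≤ ∑ a, ∑ b, ‖A a b‖ := by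
  by_cases hj : 1 ≤ j ∧ j ≤ m
  · have hf : Module.finrank 𝕜 (⊤ : Submodule 𝕜 (Fin m → 𝕜)) = m := by simp
    rw [_root_.abs_le]
    refine ⟨le_eig hA hj.2 (V := ⊤) (by omega) fun v _ => ?_,
      eig_le hA hj.1 hj.2 (V := ⊤) (by omega) fun v _ => ?_⟩
    · linarith [(_root_.abs_le.1 (abs_qf_le A v)).1]
    · linarith [(_root_.abs_le.1 (abs_qf_le A v)).2]
  · rw [eig, dif_neg fun h => hj h.2, abs_zero]
    positivity

variable {ι : Type*} {F : Filter ι} {N : ι → ℕ} {X : (i : ι) → Matrix (Fin (N i)) (Fin (N i)) 𝕜}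
  {U : (i : ι) → Matrix (Fin (N i)) (Fin r) 𝕜} {θ : Fin r → ℝ} {α ρ η s : ℝ}

/-- The block of `R / s` on the indices with `θ = α`. -/
noncomputable def block (e : Fin k ≃ {a : Fin r // θ a = α}) (s : ℝ)
    (R : Matrix (Fin r) (Fin r) 𝕜) : Matrix (Fin k) (Fin k) 𝕜 :=
  ((s⁻¹ : ℝ) : 𝕜) • R.submatrix (fun c => (e c : Fin r)) fun c => (e c : Fin r)

lemma isHermitian_block (e : Fin k ≃ {a : Fin r // θ a = α}) (s : ℝ)
    {R : Matrix (Fin r) (Fin r) 𝕜} (hR : R.IsHermitian) : (block e s R).IsHermitian := by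
  unfold block IsHermitian
  rw [conjTranspose_smul, RCLike.star_def, RCLike.conj_ofReal, (hR.submatrix _).eq]

lemma card_lt_add_card_eq_add_card_gt (e : Fin k ≃ {a : Fin r // θ a = α}) :
    (Finset.univ.filter fun a => θ a < α).card + k +
      (Finset.univ.filter fun a => α < θ a).card = r := by
  have h1 : (Finset.univ.filter fun a => θ a = α).card = k := by
    rw [← Fintype.card_subtype, ← Fintype.card_congr e, Fintype.card_fin]
  rw [← h1, ← Finset.card_union_of_disjoint, ← Finset.card_union_of_disjoint]
  · have : Finset.univ.filter (fun a => θ a < α) ∪ Finset.univ.filter (fun a => θ a = α) ∪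
        Finset.univ.filter (fun a => α < θ a) = Finset.univ := by
      ext a
      simp only [Finset.mem_union, Finset.mem_filter, Finset.mem_univ, true_and, iff_true]
      rcases lt_trichotomy (θ a) α with h | h | h <;> simp [h]
    rw [this, Finset.card_univ, Fintype.card_fin]
  · rw [Finset.disjoint_left]
    intro a
    simp only [Finset.mem_union, Finset.mem_filter, Finset.mem_univ, true_and]
    rintro (h | h) <;> linarith
  · rw [Finset.disjoint_left]
    intro a
    simp only [Finset.mem_filter, Finset.mem_univ, true_and]
    intro h h'; linarith

section
variable (hN : Tendsto N F atTop) (hX : ∀ i, (X i).IsHermitian) (hη : 0 < η) (hs : 0 < s)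
  (htop : ∀ᶠ i in F, eig (X i) (N i) ≤ ρ - η)
  (hR : ∃ M, ∀ᶠ i in F, ∀ a b, ‖rescaled (X i) (U i) α ρ a b‖ ≤ M)
  (hS : ∀ a b, Tendsto (fun i => ((U i)ᴴ * resolv (X i) ρ * resolv (X i) ρ * U i) a b) F
    (𝓝 (if a = b then (s : 𝕜) else 0)))
include hN hX hη hs htop hR hS

/-- The two inputs of the positivity argument: boundedness of the whole rescaled matrix at `ρ +
x/√n`, and the fact that its form on the block `θ = α` is `s` times that of `block - x`, up to an
error `sε`. -/
lemma eventually_rescaled_bound (e : Fin k ≃ {a : Fin r // θ a = α}) {x : ι → ℝ} {B : ℝ}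
    (hx : ∀ᶠ i in F, |x i| ≤ B) {ε : ℝ} (hε : 0 < ε) :
    ∃ M, ∀ᶠ i in F,
      (∑ a, ∑ b, ‖rescaled (X i) (U i) α (ρ + x i * (√(N i : ℝ))⁻¹) a b‖ ≤ M) ∧
      ∀ v : Fin k → 𝕜, |qf ((rescaled (X i) (U i) α (ρ + x i * (√(N i : ℝ))⁻¹)).submatrix
          (fun c => (e c : Fin r)) fun c => (e c : Fin r)) v -
        s * (qf (block e s (rescaled (X i) (U i) α ρ)) v - x i * nsq v)| ≤ s * ε * nsq v := by
  obtain ⟨M, hM⟩ := hR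
  have hD := tendsto_rescaled_sub (α := α) (s := s) hN hX hη htop hS hx
  have h1 : ∀ᶠ i in F, ∀ a b, ‖rescaled (X i) (U i) α (ρ + x i * (√(N i : ℝ))⁻¹) a b -
      (rescaled (X i) (U i) α ρ a b - if a = b then ((x i * s : ℝ) : 𝕜) else 0)‖ ≤ 1 := by
    rw [eventually_all]; intro a
    rw [eventually_all]; intro b
    have := (hD a b).norm
    rw [norm_zero] at this
    exact this.eventually (ge_mem_nhds one_pos)
  have h2 : ∀ᶠ i in F, ∑ c, ∑ d, ‖rescaled (X i) (U i) α (ρ + x i * (√(N i : ℝ))⁻¹) (e c) (e d) -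
      (rescaled (X i) (U i) α ρ (e c) (e d) -
        if (e c : Fin r) = e d then ((x i * s : ℝ) : 𝕜) else 0)‖ ≤ s * ε := by
    have : Tendsto (fun i => ∑ c, ∑ d,
        ‖rescaled (X i) (U i) α (ρ + x i * (√(N i : ℝ))⁻¹) (e c) (e d) -
        (rescaled (X i) (U i) α ρ (e c) (e d) -
        if (e c : Fin r) = e d then ((x i * s : ℝ) : 𝕜) else 0)‖) F (𝓝 0) := by
      have := tendsto_finsetSum Finset.univ fun c _ => tendsto_finsetSum Finset.univ fun d _ =>
        (hD (e c) (e d)).norm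
      simpa only [norm_zero, Finset.sum_const_zero] using this
    exact this.eventually (ge_mem_nhds (by positivity))
  refine ⟨∑ _a : Fin r, ∑ _b : Fin r, (1 + (M + B * s)), ?_⟩
  filter_upwards [hM, h1, h2, hx] with i t1 t2 t3 t4
  have hB : 0 ≤ B := (abs_nonneg _).trans t4
  constructor
  · refine Finset.sum_le_sum fun a _ => Finset.sum_le_sum fun b _ => ?_
    have e1 : ‖(if a = b then ((x i * s : ℝ) : 𝕜) else 0)‖ ≤ B * s := by
      split_ifs
      · rw [RCLike.norm_ofReal, abs_mul, abs_of_pos hs]; gcongr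
      · rw [norm_zero]; positivity
    have e2 := norm_add_le (rescaled (X i) (U i) α (ρ + x i * (√(N i : ℝ))⁻¹) a b -
      (rescaled (X i) (U i) α ρ a b - if a = b then ((x i * s : ℝ) : 𝕜) else 0))
      (rescaled (X i) (U i) α ρ a b - if a = b then ((x i * s : ℝ) : 𝕜) else 0)
    rw [sub_add_cancel] at e2
    have e3 := norm_sub_le (rescaled (X i) (U i) α ρ a b)
      (if a = b then ((x i * s : ℝ) : 𝕜) else 0)
    linarith [t2 a b, t1 a b]
  · intro v
    set E := (rescaled (X i) (U i) α (ρ + x i * (√(N i : ℝ))⁻¹)).submatrix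
      (fun c => (e c : Fin r)) fun c => (e c : Fin r) with hE
    set R := (rescaled (X i) (U i) α ρ).submatrix
      (fun c => (e c : Fin r)) fun c => (e c : Fin r) with hRdef
    have e1 : qf (block e s (rescaled (X i) (U i) α ρ)) v = s⁻¹ * qf R v := by
      rw [block, qf, smul_mulVec, dotProduct_smul, smul_eq_mul, RCLike.re_ofReal_mul]; rfl
    have e2 : s * (qf (block e s (rescaled (X i) (U i) α ρ)) v - x i * nsq v) =
        qf (R - ((x i * s : ℝ) : 𝕜) • 1) v := by
      rw [e1, qf_sub, qf_smul_one, mul_sub, ← mul_assoc, mul_inv_cancel₀ hs.ne', one_mul]; ring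
    rw [e2, ← qf_sub]
    refine (abs_qf_le _ v).trans (mul_le_mul_of_nonneg_right (le_trans (le_of_eq ?_) t3)
      (nsq_nonneg v))
    refine Finset.sum_congr rfl fun c _ => Finset.sum_congr rfl fun d _ => ?_
    simp only [hE, hRdef, Matrix.sub_apply, submatrix_apply, Matrix.smul_apply, Matrix.one_apply,
      smul_eq_mul, mul_ite, mul_one, mul_zero]
    congr 3
    simp only [Subtype.coe_inj, EmbeddingLike.apply_eq_iff_eq]

variable (hα : 0 < α)
include hα

/-- Count at `z = ρ + x/√n`, with `x` smaller by `ε` than the `d`-th largest eigenvalue of the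
block. The test vectors live on the indices with `θ > α`, where the form is positive at order zero,
and on the top `d` eigenvectors of the block, where it is positive at order one. They span a space
of dimension `#{θ > α} + d`. -/
lemma eventually_le_outlier (e : Fin k ≃ {a : Fin r // θ a = α}) {d : ℕ} (hd : 1 ≤ d)
    (hdk : d ≤ k) {ε : ℝ} (hε : 0 < ε) :
    ∀ᶠ i in F, eig (block e s (rescaled (X i) (U i) α ρ)) (k + 1 - d) - ε ≤
      √(N i : ℝ) * (eig (X i + U i * diagMat 𝕜 θ * (U i)ᴴ)
        (N i + 1 - ((Finset.univ.filter fun a => α < θ a).card + d)) - ρ) := by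
  set x : ι → ℝ := fun i => eig (block e s (rescaled (X i) (U i) α ρ)) (k + 1 - d) - ε with hxdef
  have hRH : ∀ i, (rescaled (X i) (U i) α ρ).IsHermitian := fun i => isHermitian_rescaled (hX i) _ _ _
  obtain ⟨B, hx⟩ : ∃ B, ∀ᶠ i in F, |x i| ≤ B := by
    obtain ⟨M, hM⟩ := hR
    refine ⟨∑ _c : Fin k, ∑ _d : Fin k, |s⁻¹| * M + ε, ?_⟩
    filter_upwards [hM] with i hi
    refine (abs_sub _ _).trans ?_
    rw [abs_of_pos hε]
    refine add_le_add_left ((abs_eig_le (isHermitian_block e s (hRH i)) _).trans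
      (Finset.sum_le_sum fun c _ => Finset.sum_le_sum fun d _ => ?_)) _
    rw [block, Matrix.smul_apply, smul_eq_mul, norm_mul, RCLike.norm_ofReal]
    exact mul_le_mul_of_nonneg_left (hi _ _) (abs_nonneg _)
  obtain ⟨M, hM⟩ := eventually_rescaled_bound hN hX hη hs htop hR hS e hx (half_pos hε)
  obtain ⟨h₀, hh₀, hpos⟩ := exists_forall_form_pos (𝕜 := 𝕜) (fun a => α⁻¹ ^ 2 * θ a - α⁻¹)
    (fun a => 2 * α⁻¹ * θ a - 1) θ (Finset.univ.filter fun a => θ a = α) (by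
      intro a ha
      have ha' : θ a = α := by simpa using ha
      simp only [ha']
      constructor <;> field_simp <;> ring) M (by positivity : 0 < s * (ε / 2))
  have htop' := eventually_top_le hN hX hη htop hx
  have hsmall := (tendsto_inv_sqrt (F := F) hN).eventually (ge_mem_nhds hh₀)
  filter_upwards [hM, htop', hsmall, hN.eventually_gt_atTop 0] with i t1 t2 t3 t4
  have hN0 : (0 : ℝ) < N i := by exact_mod_cast t4
  obtain ⟨V, hV1, hV2⟩ := exists_subspace_eig_le (isHermitian_block e s (hRH i))
    (k := k + 1 - d) (by omega) (by omega)
  obtain ⟨W, hW1, hW2⟩ := exists_support_subspace (𝕜 := 𝕜) e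
    (Finset.univ.filter fun a => α < θ a) (by
      intro a ha; have : α < θ a := by simpa using ha
      exact this.ne') V
  have hEH := isHermitian_rescaled (hX i) (U i) α (ρ + x i * (√(N i : ℝ))⁻¹)
  have key := le_eig_perturbation (U := U i) (θ := θ) (hX i) (spectralGap_of_top_le (hX i) t2)
    (half_pos hη) (W := W) (d := (Finset.univ.filter fun a => α < θ a).card + d) (by omega)
    (by omega) (by
      intro w hw hw0
      rw [qf_compress_expand hEH (compress_eq_rescaled t4 _ _ α _)]
      obtain ⟨w1, w2⟩ := hW2 w hw
      refine hpos _ (by positivity) t3 _ t1.1 w hw0 ?_ ?_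
      · intro a ha h0
        have := w1 a (by simpa using ha) h0
        have h3 : α < θ a := by simpa using this
        have h4 : α⁻¹ ^ 2 * θ a - α⁻¹ = α⁻¹ ^ 2 * (θ a - α) := by field_simp
        rw [h4]
        exact mul_pos (by positivity) (sub_pos.2 h3)
      · simp only [Finset.mem_filter, Finset.mem_univ, true_and]
        rw [nsq_restrict e, qf_restrict e]
        have h3 := hV2 _ w2
        have h4 := (_root_.abs_le.1 (t1.2 fun c => w (e c))).1
        have h5 : s * (eig (block e s (rescaled (X i) (U i) α ρ)) (k + 1 - d) *
          nsq fun c => w (e c)) ≤ s * qf (block e s (rescaled (X i) (U i) α ρ))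
            fun c => w (e c) := mul_le_mul_of_nonneg_left h3 hs.le
        have h6 : x i * (nsq fun c => w (e c)) =
          eig (block e s (rescaled (X i) (U i) α ρ)) (k + 1 - d) * (nsq fun c => w (e c)) -
            ε * nsq fun c => w (e c) := by simp only [hxdef]; ring
        rw [h6] at h4
        linarith)
  have hsq : 0 < √(N i : ℝ) := by positivity
  have h7 : x i * (√(N i : ℝ))⁻¹ ≤ eig (X i + U i * diagMat 𝕜 θ * (U i)ᴴ)
      (N i + 1 - ((Finset.univ.filter fun a => α < θ a).card + d)) - ρ := by linarith
  have h8 := mul_le_mul_of_nonneg_left h7 hsq.le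
  rwa [mul_comm (x i), ← mul_assoc, mul_inv_cancel₀ hsq.ne', one_mul] at h8

/-- The mirror argument, with `x` larger by `ε`, the indices with `θ < α`, the lowest `k + 1 - d`
eigenvectors of the block and the negated form. Replacing `E` by `-E` and `θ` by `-θ` in the
quadratic term brings that form into the shape required by `exists_forall_form_pos`. -/
lemma eventually_outlier_le (e : Fin k ≃ {a : Fin r // θ a = α}) {d : ℕ} (hd : 1 ≤ d)
    (hdk : d ≤ k) {ε : ℝ} (hε : 0 < ε) :
    ∀ᶠ i in F, √(N i : ℝ) * (eig (X i + U i * diagMat 𝕜 θ * (U i)ᴴ)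
        (N i + 1 - ((Finset.univ.filter fun a => α < θ a).card + d)) - ρ) ≤
      eig (block e s (rescaled (X i) (U i) α ρ)) (k + 1 - d) + ε := by
  set x : ι → ℝ := fun i => eig (block e s (rescaled (X i) (U i) α ρ)) (k + 1 - d) + ε with hxdef
  have hRH : ∀ i, (rescaled (X i) (U i) α ρ).IsHermitian := fun i => isHermitian_rescaled (hX i) _ _ _
  obtain ⟨B, hx⟩ : ∃ B, ∀ᶠ i in F, |x i| ≤ B := by
    obtain ⟨M, hM⟩ := hR
    refine ⟨∑ _c : Fin k, ∑ _d : Fin k, |s⁻¹| * M + ε, ?_⟩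
    filter_upwards [hM] with i hi
    refine (abs_add_le _ _).trans ?_
    rw [abs_of_pos hε]
    refine add_le_add_left ((abs_eig_le (isHermitian_block e s (hRH i)) _).trans
      (Finset.sum_le_sum fun c _ => Finset.sum_le_sum fun d _ => ?_)) _
    rw [block, Matrix.smul_apply, smul_eq_mul, norm_mul, RCLike.norm_ofReal]
    exact mul_le_mul_of_nonneg_left (hi _ _) (abs_nonneg _)
  obtain ⟨M, hM⟩ := eventually_rescaled_bound hN hX hη hs htop hR hS e hx (half_pos hε)
  obtain ⟨h₀, hh₀, hpos⟩ := exists_forall_form_pos (𝕜 := 𝕜) (fun a => α⁻¹ - α⁻¹ ^ 2 * θ a)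
    (fun a => 2 * α⁻¹ * θ a - 1) (fun a => -θ a) (Finset.univ.filter fun a => θ a = α) (by
      intro a ha
      have ha' : θ a = α := by simpa using ha
      simp only [ha']
      constructor <;> field_simp <;> ring) M (by positivity : 0 < s * (ε / 2))
  have htop' := eventually_top_le hN hX hη htop hx
  have hsmall := (tendsto_inv_sqrt (F := F) hN).eventually (ge_mem_nhds hh₀)
  have hcard := card_lt_add_card_eq_add_card_gt e
  filter_upwards [hM, htop', hsmall, hN.eventually_gt_atTop r] with i t1 t2 t3 t4'
  have t4 : 0 < N i := by omega
  have hN0 : (0 : ℝ) < N i := by exact_mod_cast t4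
  obtain ⟨V, hV1, hV2⟩ := exists_subspace_le_eig (isHermitian_block e s (hRH i))
    (k := k + 1 - d) (by omega)
  obtain ⟨W, hW1, hW2⟩ := exists_support_subspace (𝕜 := 𝕜) e
    (Finset.univ.filter fun a => θ a < α) (by
      intro a ha; have : θ a < α := by simpa using ha
      exact this.ne) V
  have hEH := isHermitian_rescaled (hX i) (U i) α (ρ + x i * (√(N i : ℝ))⁻¹)
  have key := eig_perturbation_le (U := U i) (θ := θ) (hX i) (spectralGap_of_top_le (hX i) t2)
    (half_pos hη) (W := W) (d := (Finset.univ.filter fun a => α < θ a).card + d - 1)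
    (by linarith) (by omega) (by omega) (by
      intro w hw hw0
      have hexp := qf_compress_expand hEH (compress_eq_rescaled t4 (X i) (U i) α _) θ w
      obtain ⟨w1, w2⟩ := hW2 w hw
      have hp := hpos _ (by positivity) t3
        (-rescaled (X i) (U i) α (ρ + x i * (√(N i : ℝ))⁻¹))
        (by simpa only [Matrix.neg_apply, norm_neg] using t1.1) w hw0 (by
        intro a ha h0
        have := w1 a (by simpa using ha) h0
        have h3 : θ a < α := by simpa using this
        have h4 : α⁻¹ - α⁻¹ ^ 2 * θ a = α⁻¹ ^ 2 * (α - θ a) := by field_simp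
        simp only [h4]
        exact mul_pos (by positivity) (sub_pos.2 h3)) (by
        simp only [Finset.mem_filter, Finset.mem_univ, true_and]
        rw [nsq_restrict e, qf_restrict e]
        have h3 := hV2 _ w2
        have h4 := (_root_.abs_le.1 (t1.2 fun c => w (e c))).2
        have h5 : s * (qf (block e s (rescaled (X i) (U i) α ρ)) fun c => w (e c)) ≤
          s * (eig (block e s (rescaled (X i) (U i) α ρ)) (k + 1 - d) *
          nsq fun c => w (e c)) := mul_le_mul_of_nonneg_left h3 hs.le
        have h6 : x i * (nsq fun c => w (e c)) =
          eig (block e s (rescaled (X i) (U i) α ρ)) (k + 1 - d) * (nsq fun c => w (e c)) +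
            ε * nsq fun c => w (e c) := by simp only [hxdef]; ring
        rw [h6] at h4
        rw [submatrix_neg, Pi.neg_apply, Pi.neg_apply, qf_neg]
        linarith)
      simp only [neg_mulVec, Pi.neg_apply, norm_neg, mul_neg, map_neg, neg_mul,
        Finset.sum_neg_distrib, sub_mul, Finset.sum_sub_distrib] at hp hexp
      linarith)
  have hsq : 0 < √(N i : ℝ) := by positivity
  have hidx : N i - ((Finset.univ.filter fun a => α < θ a).card + d - 1) =
    N i + 1 - ((Finset.univ.filter fun a => α < θ a).card + d) := by omega
  rw [hidx] at key
  have h7 : eig (X i + U i * diagMat 𝕜 θ * (U i)ᴴ)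
      (N i + 1 - ((Finset.univ.filter fun a => α < θ a).card + d)) - ρ ≤
        x i * (√(N i : ℝ))⁻¹ := by linarith
  have h8 := mul_le_mul_of_nonneg_left h7 hsq.le
  rwa [mul_comm (x i), ← mul_assoc, mul_inv_cancel₀ hsq.ne', one_mul] at h8

/-- The rescaled outliers near `ρ`, for positive `α`, are close to the eigenvalues of the block
`{θ = α}` of the rescaled compressed resolvent. -/
theorem tendsto_outlier (e : Fin k ≃ {a : Fin r // θ a = α}) {d : ℕ} (hd : 1 ≤ d) (hdk : d ≤ k) :
    Tendsto (fun i => √(N i : ℝ) * (eig (X i + U i * diagMat 𝕜 θ * (U i)ᴴ)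
        (N i + 1 - ((Finset.univ.filter fun a => α < θ a).card + d)) - ρ) -
      eig (block e s (rescaled (X i) (U i) α ρ)) (k + 1 - d)) F (𝓝 0) := by
  rw [Metric.tendsto_nhds]
  intro ε hε
  filter_upwards [eventually_le_outlier hN hX hη hs htop hR hS hα e hd hdk (half_pos hε),
    eventually_outlier_le hN hX hη hs htop hR hS hα e hd hdk (half_pos hε)] with i h1 h2
  rw [Real.dist_eq, sub_zero, abs_lt]
  constructor <;> linarith

end

end OutlierLimit

/-! ### Gram-Schmidt orthonormalisation of almost orthonormal families -/

section GramSchmidt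

open Matrix InnerProductSpace

variable {𝕜 : Type*} [RCLike 𝕜] {r : ℕ}

section Limit

variable {ι : Type*} {F : Filter ι} {E : ι → Type*} [∀ i, NormedAddCommGroup (E i)]
  [∀ i, InnerProductSpace 𝕜 (E i)] {v : (i : ι) → Fin r → E i}

lemma tendsto_inner_comb (hv : ∀ a b, Tendsto (fun i => inner 𝕜 (v i a) (v i b)) F
      (𝓝 (if a = b then 1 else 0))) {S S' : ι → Fin r → 𝕜} {b c : Fin r}
    (hS : ∀ a, Tendsto (fun i => S i a) F (𝓝 (if a = b then 1 else 0)))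
    (hS' : ∀ a, Tendsto (fun i => S' i a) F (𝓝 (if a = c then 1 else 0))) :
    Tendsto (fun i => inner 𝕜 (∑ a, S i a • v i a) (∑ a, S' i a • v i a)) F
      (𝓝 (if b = c then 1 else 0)) := by
  simp only [sum_inner, inner_sum, inner_smul_left, inner_smul_right]
  have h : Tendsto (fun i => ∑ a, ∑ a', (S' i a' * ((starRingEnd 𝕜) (S i a) *
      inner 𝕜 (v i a) (v i a')))) F
      (𝓝 (∑ a : Fin r, ∑ a' : Fin r, ((if a' = c then 1 else 0) *
        ((starRingEnd 𝕜) (if a = b then 1 else 0) * (if a = a' then 1 else 0))))) :=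
    tendsto_finsetSum _ fun a _ => tendsto_finsetSum _ fun a' _ =>
      (hS' a').mul (((RCLike.continuous_conj.tendsto _).comp (hS a)).mul (hv a a'))
  have hlim : (∑ a : Fin r, ∑ a' : Fin r, ((if a' = c then 1 else 0) *
      ((starRingEnd 𝕜) (if a = b then 1 else 0) * (if a = a' then 1 else 0)))) =
      (if b = c then 1 else 0 : 𝕜) := by
    simp [apply_ite (starRingEnd 𝕜)]
  rw [hlim] at h
  refine h.congr fun i => ?_
  rw [Finset.sum_comm]
  exact Finset.sum_congr rfl fun a _ => by rw [Finset.mul_sum]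

/-- If the Gram matrices converge to the identity, the transition matrices to the Gram-Schmidt
vectors converge to the identity. -/
lemma exists_gramSchmidt_comb (hv : ∀ a b, Tendsto (fun i => inner 𝕜 (v i a) (v i b)) F
      (𝓝 (if a = b then 1 else 0))) (b : Fin r) :
    ∃ S : ι → Fin r → 𝕜, (∀ i, gramSchmidt 𝕜 (v i) b = ∑ a, S i a • v i a) ∧
      ∀ a, Tendsto (fun i => S i a) F (𝓝 (if a = b then 1 else 0)) := by
  induction b using WellFoundedLT.induction with
  | _ b ih =>
    choose! S hS hSt using ih
    have hself : ∀ a, Tendsto (fun _ : ι => (if a = b then 1 else 0 : 𝕜)) F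
        (𝓝 (if a = b then 1 else 0)) := fun a => tendsto_const_nhds
    refine ⟨fun i a => (if a = b then 1 else 0) - ∑ c ∈ Finset.Iio b,
      (inner 𝕜 (gramSchmidt 𝕜 (v i) c) (v i b) / ((‖gramSchmidt 𝕜 (v i) c‖ ^ 2 : ℝ) : 𝕜)) * S c i a,
      fun i => ?_, fun a => ?_⟩
    · rw [gramSchmidt_def]
      simp only [Submodule.starProjection_singleton, sub_smul, Finset.sum_sub_distrib,
        Finset.sum_smul, ite_smul, one_smul, zero_smul, Finset.sum_ite_eq', Finset.mem_univ, if_true]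
      congr 1
      rw [Finset.sum_comm]
      refine Finset.sum_congr rfl fun c hc => ?_
      conv_lhs => enter [2]; rw [hS c (Finset.mem_Iio.1 hc)]
      rw [Finset.smul_sum]
      exact Finset.sum_congr rfl fun a _ => smul_smul _ _ _
    · have h1 : ∀ c ∈ Finset.Iio b, Tendsto (fun i => inner 𝕜 (gramSchmidt 𝕜 (v i) c) (v i b) /
          ((‖gramSchmidt 𝕜 (v i) c‖ ^ 2 : ℝ) : 𝕜) * S c i a) F (𝓝 0) := by
        intro c hc
        have hcb := Finset.mem_Iio.1 hc
        have e1 := tendsto_inner_comb hv (hSt c hcb) hself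
        have e2 := tendsto_inner_comb hv (hSt c hcb) (hSt c hcb)
        rw [if_neg hcb.ne] at e1
        rw [if_pos rfl] at e2
        have e3 := (e1.div e2 one_ne_zero).mul (hSt c hcb a)
        rw [zero_div, zero_mul] at e3
        refine e3.congr fun i => ?_
        simp only [Pi.div_apply]
        rw [← hS c hcb i, inner_self_eq_norm_sq_to_K]
        simp
      have h2 := (hself a).sub (tendsto_finsetSum _ h1)
      simpa using h2

/-- The norms of the Gram-Schmidt vectors tend to `1`, so normalisation changes the coefficients by
a factor tending to `1`. Orthonormality holds only eventually, since normalising a zero vector gives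
zero. -/
lemma exists_gramSchmidtNormed_comb (hv : ∀ a b, Tendsto (fun i => inner 𝕜 (v i a) (v i b)) F
      (𝓝 (if a = b then 1 else 0))) :
    ∃ T : ι → Matrix (Fin r) (Fin r) 𝕜,
      (∀ i b, gramSchmidtNormed 𝕜 (v i) b = ∑ a, T i a b • v i a) ∧
      (∀ a b, Tendsto (fun i => T i a b) F (𝓝 (if a = b then 1 else 0))) ∧
      ∀ᶠ i in F, Orthonormal 𝕜 (gramSchmidtNormed 𝕜 (v i)) := by
  choose S hS hSt using exists_gramSchmidt_comb hv
  have hnorm : ∀ b, Tendsto (fun i => ‖gramSchmidt 𝕜 (v i) b‖) F (𝓝 1) := by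
    intro b
    have h1 := tendsto_inner_comb hv (hSt b) (hSt b)
    rw [if_pos rfl] at h1
    have h2 := (Real.continuous_sqrt.tendsto _).comp ((RCLike.continuous_re.tendsto _).comp h1)
    simp only [RCLike.one_re, Real.sqrt_one] at h2
    refine h2.congr fun i => ?_
    simp only [Function.comp_apply]
    rw [← hS b i, inner_self_eq_norm_sq, Real.sqrt_sq (norm_nonneg _)]
  refine ⟨fun i => Matrix.of fun a b => (‖gramSchmidt 𝕜 (v i) b‖ : 𝕜)⁻¹ * S b i a,
    fun i b => ?_, fun a b => ?_, ?_⟩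
  · rw [gramSchmidtNormed]
    conv_lhs => enter [2]; rw [hS b i]
    rw [Finset.smul_sum]
    exact Finset.sum_congr rfl fun a _ => smul_smul _ _ _
  · have h1 : Tendsto (fun i => (‖gramSchmidt 𝕜 (v i) b‖ : 𝕜)⁻¹) F (𝓝 1) := by
      have := ((RCLike.continuous_ofReal (K := 𝕜)).tendsto _).comp (hnorm b)
      rw [RCLike.ofReal_one] at this
      simpa using this.inv₀ one_ne_zero
    simpa using h1.mul (hSt b a)
  · have h1 : ∀ᶠ i in F, ∀ b, gramSchmidt 𝕜 (v i) b ≠ 0 := by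
      rw [eventually_all]
      intro b
      filter_upwards [(hnorm b).eventually (lt_mem_nhds one_pos)] with i hi
      exact norm_pos_iff.1 hi
    filter_upwards [h1] with i hi
    have h2 : ∀ b, gramSchmidtNormed 𝕜 (v i) b ≠ 0 := by
      intro b h0
      rw [gramSchmidtNormed, smul_eq_zero, inv_eq_zero, RCLike.ofReal_eq_zero, norm_eq_zero] at h0
      exact hi b (h0.elim id id)
    refine ⟨fun b => gramSchmidtNormed_unit_length' (h2 b), fun a b hab => ?_⟩
    simp only [gramSchmidtNormed, inner_smul_left, inner_smul_right,
      gramSchmidt_orthogonal 𝕜 _ hab, mul_zero]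

end Limit

section Measurability

variable {Ω : Type*} [MeasurableSpace Ω] {n : ℕ}

lemma measurable_gramSchmidt {v : Ω → Fin r → EuclideanSpace 𝕜 (Fin n)}
    (hv : ∀ s, Measurable fun ω => v ω s) (b : Fin r) :
    Measurable fun ω => gramSchmidt 𝕜 (v ω) b := by
  induction b using WellFoundedLT.induction with
  | _ b ih =>
    simp_rw [gramSchmidt_def 𝕜 _ b, Submodule.starProjection_singleton]
    refine (hv b).sub (Finset.measurable_fun_sum _ fun c hc => ?_)
    have h1 := ih c (Finset.mem_Iio.1 hc)
    have h2 : Measurable fun ω => ((‖gramSchmidt 𝕜 (v ω) c‖ ^ 2 : ℝ) : 𝕜) :=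
      RCLike.continuous_ofReal.measurable.comp (h1.norm.pow_const 2)
    have h3 : Measurable fun ω => inner 𝕜 (gramSchmidt 𝕜 (v ω) c) (v ω b) := h1.inner (hv b)
    exact (h3.div h2).smul h1

lemma measurable_vecs (mod : Model) {g : Ω → Fin r → Fin n → 𝕜}
    (hg : ∀ s a, Measurable fun ω => g ω s a) (s : Fin r) :
    Measurable fun ω => vecs mod (g ω) s := by
  have hv : ∀ s, Measurable fun ω => (WithLp.toLp 2 (fun i => (((√(n : ℝ))⁻¹ : ℝ) : 𝕜) * g ω s i) :
      EuclideanSpace 𝕜 (Fin n)) := by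
    intro s
    refine (WithLp.measurable_toLp 2 _).comp ?_
    exact measurable_pi_lambda _ fun i => (hg s i).const_mul _
  cases mod
  · exact hv s
  · have h1 := measurable_gramSchmidt hv s
    simp only [vecs, gramSchmidtNormed]
    have h2 : Measurable fun ω => (‖gramSchmidt 𝕜 (fun s => (WithLp.toLp 2
        (fun i => (((√(n : ℝ))⁻¹ : ℝ) : 𝕜) * g ω s i) : EuclideanSpace 𝕜 (Fin n))) s‖ : 𝕜) :=
      RCLike.continuous_ofReal.measurable.comp h1.norm
    exact h2.inv.smul h1

lemma isHermitian_perturbed {A : Matrix (Fin n) (Fin n) 𝕜} (hA : A.IsHermitian) (θ : Fin r → ℝ)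
    (u : Fin r → EuclideanSpace 𝕜 (Fin n)) : (perturbed A θ u).IsHermitian := by
  refine hA.add ?_
  unfold Matrix.IsHermitian
  rw [conjTranspose_sum]
  refine Finset.sum_congr rfl fun s _ => ?_
  rw [conjTranspose_smul, RCLike.star_def, RCLike.conj_ofReal, conjTranspose_vecMulVec, star_star]

lemma measurable_gam {q : ℕ} (mod : Model) {A : Matrix (Fin n) (Fin n) 𝕜} (hA : A.IsHermitian)
    (θ : Fin r → ℝ) {g : Ω → Fin r → Fin n → 𝕜} (hg : ∀ s a, Measurable fun ω => g ω s a)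
    (α ρ : Fin q → ℝ) (k : Fin q → ℕ) (j : Fin q) (i : Fin (k j)) :
    Measurable fun ω => gam (perturbed A θ (vecs mod (g ω))) α ρ k j i := by
  have hent : ∀ a b, Measurable fun ω => perturbed A θ (vecs mod (g ω)) a b := by
    intro a b
    simp only [perturbed, Matrix.add_apply, Matrix.sum_apply, Matrix.smul_apply, vecMulVec_apply,
      Pi.star_apply, smul_eq_mul]
    have hc : ∀ s c, Measurable fun ω => vecs mod (g ω) s c := fun s c =>
      (measurable_pi_apply c).comp ((WithLp.measurable_ofLp 2 _).comp (measurable_vecs mod hg s))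
    refine (Finset.measurable_fun_sum _ fun s _ => ?_).const_add _
    exact ((hc s a).mul (continuous_star.measurable.comp (hc s b))).const_mul _
  have heig := fun l => measurable_eig_comp (fun ω => isHermitian_perturbed hA θ (vecs mod (g ω)))
    hent l
  unfold gam
  by_cases h : α j < 0
  · simp only [h, if_true]
    exact ((heig _).sub_const _).const_mul _
  · simp only [h, if_false]
    exact ((heig _).sub_const _).const_mul _

end Measurability

end GramSchmidt

/-! ### The outliers in terms of the fluctuations -/

section Reduction

open Matrix

variable {𝕜 : Type*} [RCLike 𝕜] {n r k : ℕ}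

/-- The matrix with columns `g_s / √n`. -/
noncomputable def vmat (g : Fin r → Fin n → 𝕜) : Matrix (Fin n) (Fin r) 𝕜 :=
  Matrix.of fun a s => (((√(n : ℝ))⁻¹ : ℝ) : 𝕜) * g s a

/-- The matrix whose columns are the perturbing vectors. -/
noncomputable def umat (mod : Model) (g : Fin r → Fin n → 𝕜) : Matrix (Fin n) (Fin r) 𝕜 :=
  Matrix.of fun a s => vecs mod g s a

/-- The rescaled fluctuations of the (centred) resolvent. -/
noncomputable def qmat (mod : Model) (X : Matrix (Fin n) (Fin n) 𝕜) (z : ℝ)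
    (g : Fin r → Fin n → 𝕜) : Matrix (Fin r) (Fin r) 𝕜 :=
  Matrix.of fun s t => (((√(n : ℝ))⁻¹ : ℝ) : 𝕜) * fluct (centredResolv mod X z) g s t

lemma perturbed_eq (mod : Model) (A : Matrix (Fin n) (Fin n) 𝕜) (θ : Fin r → ℝ)
    (g : Fin r → Fin n → 𝕜) :
    perturbed A θ (vecs mod g) = A + umat mod g * diagMat 𝕜 θ * (umat mod g)ᴴ := by
  unfold perturbed
  congr 1
  ext a b
  rw [Matrix.sum_apply, diagMat, Matrix.mul_apply]
  refine Finset.sum_congr rfl fun s _ => ?_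
  rw [mul_diagonal, conjTranspose_apply, Matrix.smul_apply, vecMulVec_apply, smul_eq_mul]
  simp only [umat, of_apply, Pi.star_apply]
  ring

lemma isHermitian_qmat (mod : Model) {X : Matrix (Fin n) (Fin n) 𝕜} (hX : X.IsHermitian) (z : ℝ)
    (g : Fin r → Fin n → 𝕜) : (qmat mod X z g).IsHermitian := by
  ext s t
  rw [conjTranspose_apply]
  simp only [qmat, of_apply]
  rw [fluct_conj (isHermitian_centredResolv mod hX z) g s t, RCLike.star_def, map_mul,
    RCLike.conj_conj, RCLike.conj_ofReal]

lemma vmat_conj_mul_apply (g : Fin r → Fin n → 𝕜) (B : Matrix (Fin n) (Fin n) 𝕜) (s t : Fin r) :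
    ((vmat g)ᴴ * B * vmat g) s t =
      (((n : ℝ)⁻¹ : ℝ) : 𝕜) * (fluct B g s t + if s = t then B.trace else 0) := by
  have h : (((√(n : ℝ))⁻¹ : ℝ) : 𝕜) * (((√(n : ℝ))⁻¹ : ℝ) : 𝕜) = (((n : ℝ)⁻¹ : ℝ) : 𝕜) := by
    rw [← RCLike.ofReal_mul, ← mul_inv, Real.mul_self_sqrt (Nat.cast_nonneg n)]
  rw [fluct, sub_add_cancel, Matrix.mul_assoc, Matrix.mul_apply, ← h, Finset.mul_sum]
  refine Finset.sum_congr rfl fun a _ => ?_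
  rw [Matrix.mul_apply, Finset.mul_sum, Finset.mul_sum]
  refine Finset.sum_congr rfl fun b _ => ?_
  simp only [conjTranspose_apply, vmat, of_apply, RCLike.star_def, map_mul, RCLike.conj_ofReal]
  ring

section
variable {ι : Type*} {F : Filter ι} {M T : ι → Matrix (Fin r) (Fin r) 𝕜} {s : 𝕜}

lemma tendsto_conj_mul_of_tendsto_one
    (hT : ∀ a b, Tendsto (fun i => T i a b) F (𝓝 (if a = b then 1 else 0)))
    (hM : ∀ a b, Tendsto (fun i => M i a b) F (𝓝 (if a = b then s else 0))) (a b : Fin r) :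
    Tendsto (fun i => ((T i)ᴴ * M i * T i) a b) F (𝓝 (if a = b then s else 0)) := by
  have h : Tendsto (fun i => ∑ d, (∑ c, star (T i c a) * M i c d) * T i d b) F
      (𝓝 (∑ d : Fin r, (∑ c : Fin r, star (if c = a then 1 else 0) *
        (if c = d then s else 0)) * (if d = b then 1 else 0))) :=
    tendsto_finsetSum _ fun d _ => (tendsto_finsetSum _ fun c _ =>
      ((continuous_star.tendsto _).comp (hT c a)).mul (hM c d)).mul (hT d b)
  have hlim : (∑ d : Fin r, (∑ c : Fin r, star (if c = a then 1 else 0) *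
        (if c = d then s else 0)) * (if d = b then 1 else 0)) = (if a = b then s else 0 : 𝕜) := by
    by_cases h : a = b
    · subst h; simp [apply_ite star]
    · simp [apply_ite star, h, Ne.symm h]
  rw [hlim] at h
  refine h.congr fun i => ?_
  simp only [Matrix.mul_apply, conjTranspose_apply]

/-- Used for the fluctuation matrices, which are merely bounded along the filter and need not
converge. -/
lemma tendsto_conj_mul_sub_of_bdd {B : ℝ}
    (hT : ∀ a b, Tendsto (fun i => T i a b) F (𝓝 (if a = b then 1 else 0)))
    (hM : ∀ᶠ i in F, ∀ a b, ‖M i a b‖ ≤ B) (a b : Fin r) :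
    Tendsto (fun i => ((T i)ᴴ * M i * T i) a b - M i a b) F (𝓝 0) := by
  have h1 : ∀ c d, Tendsto (fun i => star (T i c a) * T i d b -
      (if c = a then 1 else 0) * if d = b then 1 else 0) F (𝓝 0) := by
    intro c d
    have := (((continuous_star.tendsto _).comp (hT c a)).mul (hT d b)).sub_const
      ((if c = a then 1 else 0) * if d = b then 1 else 0)
    have h0 : star (if c = a then 1 else 0 : 𝕜) * (if d = b then 1 else 0) -
        (if c = a then 1 else 0) * (if d = b then 1 else 0) = 0 := by
      simp [apply_ite star]
    rw [h0] at this
    exact this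
  have h2 : Tendsto (fun i => ∑ c, ∑ d, (star (T i c a) * T i d b -
      (if c = a then 1 else 0) * if d = b then 1 else 0) * M i c d) F (𝓝 0) := by
    have : ∀ c d, Tendsto (fun i => (star (T i c a) * T i d b -
        (if c = a then 1 else 0) * if d = b then 1 else 0) * M i c d) F (𝓝 0) := by
      intro c d
      have h3 := (h1 c d).norm.mul_const B
      rw [norm_zero, zero_mul] at h3
      refine squeeze_zero_norm' ?_ h3
      filter_upwards [hM] with i hi
      rw [norm_mul]
      exact mul_le_mul_of_nonneg_left (hi c d) (norm_nonneg _)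
    have := tendsto_finsetSum Finset.univ fun c _ => tendsto_finsetSum Finset.univ fun d _ =>
      this c d
    simpa only [Finset.sum_const_zero] using this
  refine h2.congr fun i => ?_
  simp only [sub_mul, Finset.sum_sub_distrib]
  congr 1
  · simp only [Matrix.mul_apply, conjTranspose_apply, Finset.sum_mul]
    rw [Finset.sum_comm]
    exact Finset.sum_congr rfl fun c _ => Finset.sum_congr rfl fun d _ => by ring
  · simp

end

section
variable {ι : Type*} {F : Filter ι} {N : ι → ℕ} (mod : Model)
  {X : (n : ℕ) → Matrix (Fin n) (Fin n) 𝕜} {g : (i : ι) → Fin r → Fin (N i) → 𝕜}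
  {θ : Fin r → ℝ} {α ρ η s : ℝ}

lemma inner_scaled (g : Fin r → Fin n → 𝕜) (a b : Fin r) :
    inner 𝕜 (WithLp.toLp 2 (fun i => (((√(n : ℝ))⁻¹ : ℝ) : 𝕜) * g a i) : EuclideanSpace 𝕜 (Fin n))
      (WithLp.toLp 2 (fun i => (((√(n : ℝ))⁻¹ : ℝ) : 𝕜) * g b i)) =
      ((vmat g)ᴴ * (1 : Matrix (Fin n) (Fin n) 𝕜) * vmat g) a b := by
  rw [EuclideanSpace.inner_toLp_toLp, Matrix.mul_one, Matrix.mul_apply, dotProduct]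
  exact Finset.sum_congr rfl fun i _ => by
    simp only [conjTranspose_apply, vmat, of_apply, Pi.star_apply]; ring

/-- In both models `U = VT` with `V` made of the vectors `g_s/√n` and `T → 1`. The hypothesis `h1`
is the law of large numbers for the Gram matrix of these vectors. -/
lemma exists_transition (hN : Tendsto N F atTop)
    (h1 : ∀ a b, Tendsto (fun i => (((N i : ℝ)⁻¹ : ℝ) : 𝕜) * fluct 1 (g i) a b) F (𝓝 0)) :
    ∃ T : ι → Matrix (Fin r) (Fin r) 𝕜,
      (∀ a b, Tendsto (fun i => T i a b) F (𝓝 (if a = b then 1 else 0))) ∧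
      (∀ i, umat mod (g i) = vmat (g i) * T i) ∧
      (mod = .iid → ∀ i, T i = 1) ∧
      (mod = .orthonormalised → ∀ᶠ i in F, (umat mod (g i))ᴴ * umat mod (g i) = 1) := by
  cases mod
  · refine ⟨fun _ => 1, fun a b => ?_, fun i => ?_, fun _ _ => rfl, by simp⟩
    · simp only [Matrix.one_apply]; exact tendsto_const_nhds
    · rw [Matrix.mul_one]; rfl
  · have hv : ∀ a b, Tendsto (fun i => inner 𝕜
        (WithLp.toLp 2 (fun j => (((√(N i : ℝ))⁻¹ : ℝ) : 𝕜) * g i a j) :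
          EuclideanSpace 𝕜 (Fin (N i)))
        (WithLp.toLp 2 (fun j => (((√(N i : ℝ))⁻¹ : ℝ) : 𝕜) * g i b j))) F
          (𝓝 (if a = b then 1 else 0)) := by
      intro a b
      have h2 := (h1 a b).add_const (if a = b then (1 : 𝕜) else 0)
      rw [zero_add] at h2
      refine h2.congr' ?_
      filter_upwards [hN.eventually_gt_atTop 0] with i hi
      rw [inner_scaled, vmat_conj_mul_apply, mul_add]
      congr 1
      have : ((N i : ℝ)) ≠ 0 := by positivity
      split_ifs
      · rw [trace_one, Fintype.card_fin, ← RCLike.ofReal_natCast (K := 𝕜), ← RCLike.ofReal_mul,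
          inv_mul_cancel₀ this, RCLike.ofReal_one]
      · rw [mul_zero]
    obtain ⟨T, hT1, hT2, hT3⟩ := exists_gramSchmidtNormed_comb hv
    refine ⟨T, hT2, fun i => ?_, by simp, fun _ => ?_⟩
    · ext a b
      simp only [umat, of_apply, vecs]
      rw [hT1 i b, Matrix.mul_apply, WithLp.ofLp_sum, Finset.sum_apply]
      refine Finset.sum_congr rfl fun c _ => ?_
      simp only [WithLp.ofLp_smul, Pi.smul_apply, smul_eq_mul, vmat, of_apply]
      ring
    · filter_upwards [hT3] with i hi
      ext a b
      have h4 := orthonormal_iff_ite.1 hi a b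
      rw [EuclideanSpace.inner_eq_star_dotProduct] at h4
      rw [Matrix.one_apply, ← h4, Matrix.mul_apply, dotProduct]
      refine Finset.sum_congr rfl fun c _ => ?_
      simp only [conjTranspose_apply, umat, of_apply, vecs, Pi.star_apply]
      ring

/-- No invertibility is needed: otherwise both inverses are zero by convention. -/
lemma resolv_neg (A : Matrix (Fin n) (Fin n) 𝕜) (z : ℝ) : resolv (-A) (-z) = -resolv A z := by
  unfold resolv
  have : ((-z : ℝ) : 𝕜) • (1 : Matrix (Fin n) (Fin n) 𝕜) - -A =
      -((z : 𝕜) • (1 : Matrix (Fin n) (Fin n) 𝕜) - A) := by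
    push_cast
    rw [neg_smul]; abel
  rw [this]
  set B := (z : 𝕜) • (1 : Matrix (Fin n) (Fin n) 𝕜) - A
  by_cases h : IsUnit B.det
  · exact Matrix.inv_eq_left_inv (by rw [neg_mul_neg, Matrix.nonsing_inv_mul _ h])
  · rw [Matrix.nonsing_inv_apply_not_isUnit _ h, Matrix.nonsing_inv_apply_not_isUnit, neg_zero]
    rw [Matrix.det_neg]
    exact fun h' => h (isUnit_of_mul_isUnit_right h')

lemma trace_resolv_sq {X : Matrix (Fin n) (Fin n) 𝕜} (hX : X.IsHermitian) {z η : ℝ}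
    (h : SpectralGap X z η) (hη : 0 < η) : (resolv X z * resolv X z).trace =
      ((n * ∫ x, 1 / (z - x) ^ 2 ∂(spectralMeasure X) : ℝ) : 𝕜) := by
  rw [← h.sum_norm_resolv hX hη]
  have : resolv X z * resolv X z = resolv X z * (resolv X z)ᴴ := by
    rw [(isHermitian_resolv hX z).eq]
  rw [this]
  simp only [trace, diag, Matrix.mul_apply, conjTranspose_apply]
  push_cast
  exact Finset.sum_congr rfl fun i _ => Finset.sum_congr rfl fun j _ => by
    rw [RCLike.star_def, RCLike.mul_conj]

lemma sqrt_mul_inv_eq (hn : 0 < n) : √(n : ℝ) * (n : ℝ)⁻¹ = (√(n : ℝ))⁻¹ := by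
  have h : (0 : ℝ) < n := by exact_mod_cast hn
  rw [eq_comm, inv_eq_iff_eq_inv, mul_inv, inv_inv]
  have h2 := Real.mul_self_sqrt h.le
  have h3 : √(n : ℝ) ≠ 0 := by positivity
  field_simp
  linarith

/-- When `U^*U = 1`, a multiple `G` of the identity in the resolvent contributes exactly `G` to `K`,
so only the trace-free part fluctuates. In the i.i.d. model the norms of the vectors fluctuate as
well, and the resolvent has to be kept whole. In both cases the deterministic remainder is
`√n(G_n(ρ) - 1/α)`, which the assumption on the rate makes negligible. -/
lemma rescaled_eq {X : Matrix (Fin n) (Fin n) 𝕜} (hX : X.IsHermitian) (hn : 0 < n)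
    (hgap : SpectralGap X ρ η) (hη : 0 < η) {g : Fin r → Fin n → 𝕜}
    {T : Matrix (Fin r) (Fin r) 𝕜} (hT : umat mod g = vmat g * T) (hiid : mod = .iid → T = 1)
    (horth : mod = .orthonormalised → (umat mod g)ᴴ * umat mod g = 1) :
    rescaled X (umat mod g) α ρ = Tᴴ * qmat mod X ρ g * T +
      ((√(n : ℝ) * (cauchyG (spectralMeasure X) ρ - α⁻¹) : ℝ) : 𝕜) • 1 := by
  have htr := hgap.trace_resolv hX hη
  have hn' : (n : ℝ) ≠ 0 := by positivity
  have hsn := sqrt_mul_inv_eq hn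
  set G := cauchyG (spectralMeasure X) ρ with hG
  cases mod
  · have hT1 := hiid rfl
    rw [hT1, Matrix.mul_one] at hT
    rw [hT1, conjTranspose_one, Matrix.one_mul, Matrix.mul_one, rescaled, compress, hT]
    ext a b
    simp only [Matrix.smul_apply, Matrix.sub_apply, Matrix.add_apply, Matrix.one_apply, smul_eq_mul,
      qmat, of_apply, centredResolv]
    rw [vmat_conj_mul_apply, htr, ← hsn]
    have e : (((n : ℝ)⁻¹ : ℝ) : 𝕜) * ((n * G : ℝ) : 𝕜) = (G : 𝕜) := by
      rw [← RCLike.ofReal_mul, ← mul_assoc, inv_mul_cancel₀ hn', one_mul]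
    rw [mul_add, mul_ite, e]
    push_cast
    split_ifs <;> ring
  · have hU := horth rfl
    have hc : compress X (umat .orthonormalised g) ρ =
        Tᴴ * ((vmat g)ᴴ * centredResolv .orthonormalised X ρ * vmat g) * T + (G : 𝕜) • 1 := by
      have e1 : resolv X ρ = centredResolv .orthonormalised X ρ + (G : 𝕜) • 1 := by
        simp only [centredResolv, ← hG, sub_add_cancel]
      unfold compress
      conv_lhs => rw [e1, Matrix.mul_add, Matrix.add_mul, Matrix.mul_smul, Matrix.smul_mul,
        Matrix.mul_one, hU]
      congr 1
      rw [hT, conjTranspose_mul]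
      simp only [Matrix.mul_assoc]
    have htr0 : (centredResolv .orthonormalised X ρ).trace = 0 := by
      simp only [centredResolv]
      rw [trace_sub, htr, trace_smul, trace_one, Fintype.card_fin, smul_eq_mul, ← hG]
      push_cast; ring
    have hq : ((√(n : ℝ) : ℝ) : 𝕜) • ((vmat g)ᴴ * centredResolv .orthonormalised X ρ * vmat g) =
        qmat .orthonormalised X ρ g := by
      ext a b
      rw [Matrix.smul_apply, vmat_conj_mul_apply, htr0, ite_self, add_zero, smul_eq_mul, ← mul_assoc,
        ← RCLike.ofReal_mul, hsn]
      rfl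
    rw [rescaled, hc, ← hq, Matrix.mul_smul, Matrix.smul_mul, add_sub_assoc, smul_add, ← sub_smul,
      smul_smul, ← RCLike.ofReal_sub, ← RCLike.ofReal_mul]

variable (hN : Tendsto N F atTop) (hX : ∀ n, (X n).IsHermitian) (hη : 0 < η)
  (hgap : ∀ᶠ i in F, SpectralGap (X (N i)) ρ η)
  (hG : Tendsto (fun i => √(N i : ℝ) * (cauchyG (spectralMeasure (X (N i))) ρ - α⁻¹)) F (𝓝 0))
  (hs : Tendsto (fun i => ∫ x, 1 / (ρ - x) ^ 2 ∂(spectralMeasure (X (N i)))) F (𝓝 s))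
  (h1 : ∀ a b, Tendsto (fun i => (((N i : ℝ)⁻¹ : ℝ) : 𝕜) * fluct 1 (g i) a b) F (𝓝 0))
  (h2 : ∀ a b, Tendsto (fun i => (((N i : ℝ)⁻¹ : ℝ) : 𝕜) *
    fluct (resolv (X (N i)) ρ * resolv (X (N i)) ρ) (g i) a b) F (𝓝 0))
  (h3 : ∃ M, ∀ᶠ i in F, ∀ a b, ‖qmat mod (X (N i)) ρ (g i) a b‖ ≤ M)
include hN hX hη hgap hG h1 h3

lemma tendsto_rescaled_sub_qmat (a b : Fin r) :
    Tendsto (fun i => rescaled (X (N i)) (umat mod (g i)) α ρ a b -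
      qmat mod (X (N i)) ρ (g i) a b) F (𝓝 0) := by
  obtain ⟨T, hT1, hT2, hT3, hT4⟩ := exists_transition mod hN h1
  obtain ⟨M, hM⟩ := h3
  have e1 := tendsto_conj_mul_sub_of_bdd hT1 hM a b
  have e2 : Tendsto (fun i => ((√(N i : ℝ) * (cauchyG (spectralMeasure (X (N i))) ρ - α⁻¹) : ℝ) : 𝕜)
      * (1 : Matrix (Fin r) (Fin r) 𝕜) a b) F (𝓝 0) := by
    have := (((RCLike.continuous_ofReal (K := 𝕜)).tendsto _).comp hG).mul_const
      ((1 : Matrix (Fin r) (Fin r) 𝕜) a b)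
    rw [RCLike.ofReal_zero, zero_mul] at this
    exact this
  have e3 := e1.add e2
  rw [add_zero] at e3
  refine e3.congr' ?_
  have horth : ∀ᶠ i in F, mod = .orthonormalised → (umat mod (g i))ᴴ * umat mod (g i) = 1 := by
    by_cases h : mod = .orthonormalised
    · filter_upwards [hT4 h] with i hi _ using hi
    · exact Eventually.of_forall fun i h' => absurd h' h
  filter_upwards [hgap, horth, hN.eventually_gt_atTop 0] with i t1 t2 t3
  rw [rescaled_eq mod (hX _) t3 t1 hη (hT2 i) (fun h => hT3 h i) t2]
  rw [Matrix.add_apply, Matrix.smul_apply, smul_eq_mul]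
  ring

lemma exists_rescaled_bound :
    ∃ M, ∀ᶠ i in F, ∀ a b, ‖rescaled (X (N i)) (umat mod (g i)) α ρ a b‖ ≤ M := by
  have hd := tendsto_rescaled_sub_qmat mod hN hX hη hgap hG h1 h3
  obtain ⟨M, hM⟩ := h3
  have h4 : ∀ᶠ i in F, ∀ a b, ‖rescaled (X (N i)) (umat mod (g i)) α ρ a b -
      qmat mod (X (N i)) ρ (g i) a b‖ ≤ 1 := by
    rw [eventually_all]; intro a
    rw [eventually_all]; intro b
    have := (hd a b).norm
    rw [norm_zero] at this
    exact this.eventually (ge_mem_nhds one_pos)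
  refine ⟨1 + M, ?_⟩
  filter_upwards [hM, h4] with i t1 t2 a b
  have := norm_add_le (rescaled (X (N i)) (umat mod (g i)) α ρ a b -
      qmat mod (X (N i)) ρ (g i) a b) (qmat mod (X (N i)) ρ (g i) a b)
  rw [sub_add_cancel] at this
  linarith [t1 a b, t2 a b]

lemma tendsto_eig_block_sub (e : Fin k ≃ {a : Fin r // θ a = α}) (d : ℕ) :
    Tendsto (fun i => eig (block e s (rescaled (X (N i)) (umat mod (g i)) α ρ)) d -
      eig (block e s (qmat mod (X (N i)) ρ (g i))) d) F (𝓝 0) := by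
  have hd := tendsto_rescaled_sub_qmat mod hN hX hη hgap hG h1 h3
  have h4 : Tendsto (fun i => ∑ c : Fin k, ∑ c' : Fin k, |s⁻¹| *
      ‖rescaled (X (N i)) (umat mod (g i)) α ρ (e c) (e c') -
      qmat mod (X (N i)) ρ (g i) (e c) (e c')‖) F (𝓝 0) := by
    have := tendsto_finsetSum Finset.univ fun c _ => tendsto_finsetSum Finset.univ fun c' _ =>
      ((hd (e c) (e c')).norm.const_mul |s⁻¹|)
    simpa only [norm_zero, mul_zero, Finset.sum_const_zero] using this
  refine squeeze_zero_norm (fun i => ?_) h4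
  refine (abs_eig_sub_le (isHermitian_block e s (isHermitian_rescaled (hX _) _ _ _))
    (isHermitian_block e s (isHermitian_qmat mod (hX _) _ _)) d).trans (le_of_eq ?_)
  refine Finset.sum_congr rfl fun c _ => Finset.sum_congr rfl fun c' _ => ?_
  simp only [block, Matrix.smul_apply, submatrix_apply, smul_eq_mul]
  rw [← mul_sub, norm_mul, RCLike.norm_ofReal]

omit hG h3
include hs h2

lemma tendsto_conj_resolv_sq (a b : Fin r) :
    Tendsto (fun i => ((umat mod (g i))ᴴ * resolv (X (N i)) ρ * resolv (X (N i)) ρ *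
      umat mod (g i)) a b) F (𝓝 (if a = b then (s : 𝕜) else 0)) := by
  obtain ⟨T, hT1, hT2, -, -⟩ := exists_transition mod hN h1
  have hM : ∀ a b, Tendsto (fun i => ((vmat (g i))ᴴ * (resolv (X (N i)) ρ * resolv (X (N i)) ρ) *
      vmat (g i)) a b) F (𝓝 (if a = b then (s : 𝕜) else 0)) := by
    intro a b
    have e1 : Tendsto (fun i => if a = b then ((∫ x, 1 / (ρ - x) ^ 2
        ∂(spectralMeasure (X (N i))) : ℝ) : 𝕜) else 0) F (𝓝 (if a = b then (s : 𝕜) else 0)) := by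
      split_ifs
      · exact ((RCLike.continuous_ofReal (K := 𝕜)).tendsto _).comp hs
      · exact tendsto_const_nhds
    have e2 := (h2 a b).add e1
    rw [zero_add] at e2
    refine e2.congr' ?_
    filter_upwards [hgap, hN.eventually_gt_atTop 0] with i t1 t2
    have hn' : (N i : ℝ) ≠ 0 := by positivity
    rw [vmat_conj_mul_apply, trace_resolv_sq (hX _) t1 hη, mul_add, mul_ite, mul_zero,
      ← RCLike.ofReal_mul, ← mul_assoc, inv_mul_cancel₀ hn', one_mul]
  refine (tendsto_conj_mul_of_tendsto_one hT1 hM a b).congr fun i => ?_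
  rw [hT2 i, conjTranspose_mul]
  simp only [Matrix.mul_assoc]

variable (hs0 : 0 < s)
include hs0 hG h3

/-- The rescaled outliers above the bulk, in terms of the fluctuations. -/
theorem tendsto_outlier_of_pos (htop : ∀ᶠ i in F, eig (X (N i)) (N i) ≤ ρ - η) (hα : 0 < α)
    (e : Fin k ≃ {a : Fin r // θ a = α}) {d : ℕ} (hd : 1 ≤ d) (hdk : d ≤ k) :
    Tendsto (fun i => √(N i : ℝ) * (eig (perturbed (X (N i)) θ (vecs mod (g i)))
        (N i + 1 - ((Finset.univ.filter fun a => α < θ a).card + d)) - ρ) -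
      eig (block e s (qmat mod (X (N i)) ρ (g i))) (k + 1 - d)) F (𝓝 0) := by
  have hR := exists_rescaled_bound mod hN hX hη hgap hG h1 h3
  have hS := tendsto_conj_resolv_sq mod hN hX hη hgap hs h1 h2
  have key := tendsto_outlier (X := fun i => X (N i)) (U := fun i => umat mod (g i)) hN
    (fun i => hX _) hη hs0 htop hR hS hα e hd hdk
  have := key.add (tendsto_eig_block_sub mod hN hX hη hgap hG h1 h3 (s := s) e (k + 1 - d))
  rw [add_zero] at this
  refine this.congr fun i => ?_
  rw [perturbed_eq]
  ring

/-- The rescaled outliers below the bulk, in terms of the fluctuations. -/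
theorem tendsto_outlier_of_neg (hbot : ∀ᶠ i in F, ρ + η ≤ eig (X (N i)) 1) (hα : α < 0)
    (e : Fin k ≃ {a : Fin r // θ a = α}) {d : ℕ} (hd : 1 ≤ d) (hdk : d ≤ k) :
    Tendsto (fun i => √(N i : ℝ) * (eig (perturbed (X (N i)) θ (vecs mod (g i)))
        ((Finset.univ.filter fun a => θ a < α).card + d) - ρ) -
      eig (block e s (qmat mod (X (N i)) ρ (g i))) d) F (𝓝 0) := by
  obtain ⟨M, hM⟩ := exists_rescaled_bound mod hN hX hη hgap hG h1 h3
  have hS := tendsto_conj_resolv_sq mod hN hX hη hgap hs h1 h2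
  -- The reflection `X ↦ -X`, `θ ↦ -θ`, `z ↦ -z` exchanges the two ends of the spectrum and reverses
  -- the order of the eigenvalues, both of the perturbed matrix and of the block.
  have hneg : ∀ i, rescaled (-X (N i)) (umat mod (g i)) (-α) (-ρ) =
      -rescaled (X (N i)) (umat mod (g i)) α ρ := by
    intro i
    unfold rescaled compress
    rw [resolv_neg, ← smul_neg, Matrix.mul_neg, Matrix.neg_mul, inv_neg, RCLike.ofReal_neg, neg_smul]
    congr 1; abel
  let e' : Fin k ≃ {a : Fin r // -θ a = -α} :=
    e.trans (Equiv.subtypeEquivRight fun a => neg_inj.symm)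
  have key := tendsto_outlier (X := fun i => -X (N i)) (U := fun i => umat mod (g i)) (α := -α)
    (ρ := -ρ) (θ := fun a => -θ a) (s := s) (k := k) hN (fun i => (hX _).neg) hη hs0 (by
      filter_upwards [hbot, hN.eventually_gt_atTop 0] with i t1 t2
      rw [eig_neg (hX _) t2 le_rfl, Nat.add_sub_cancel_left]
      linarith) ⟨M, by
      filter_upwards [hM] with i hi a b
      rw [hneg, Matrix.neg_apply, norm_neg]
      exact hi a b⟩ (by
      intro a b
      simp only [resolv_neg, Matrix.mul_neg, Matrix.neg_mul, neg_neg]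
      exact hS a b) (neg_pos.2 hα) e' hd hdk
  have := key.neg.add (tendsto_eig_block_sub mod hN hX hη hgap hG h1 h3 (s := s) e d)
  rw [neg_zero, add_zero] at this
  refine this.congr' ?_
  have hcard := card_lt_add_card_eq_add_card_gt e
  filter_upwards [hN.eventually_gt_atTop r] with i hi
  have hc : (Finset.univ.filter fun a => -α < -θ a) = Finset.univ.filter fun a => θ a < α := by
    ext a; simp
  have hd1 : diagMat 𝕜 (fun a => -θ a) = -diagMat 𝕜 θ := by
    unfold diagMat
    ext a b
    simp [diagonal_apply]
    split_ifs <;> simp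
  have hX1 : -X (N i) + umat mod (g i) * diagMat 𝕜 (fun a => -θ a) * (umat mod (g i))ᴴ =
      -(X (N i) + umat mod (g i) * diagMat 𝕜 θ * (umat mod (g i))ᴴ) := by
    rw [hd1, Matrix.mul_neg, Matrix.neg_mul]; abel
  have hb : block e' s (rescaled (-X (N i)) (umat mod (g i)) (-α) (-ρ)) =
      -block e s (rescaled (X (N i)) (umat mod (g i)) α ρ) := by
    rw [hneg]
    unfold block
    rw [submatrix_neg]
    exact smul_neg _ _
  rw [hc, hX1, hb, eig_neg (isHermitian_add_conj (hX _) _ _) (by omega) (by omega),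
    eig_neg (isHermitian_block e s (isHermitian_rescaled (hX _) _ _ _)) (by omega) (by omega),
    perturbed_eq]
  have i1 : N i + 1 - (N i + 1 - ((Finset.univ.filter fun a => θ a < α).card + d)) =
    (Finset.univ.filter fun a => θ a < α).card + d := by omega
  have i2 : k + 1 - (k + 1 - d) = d := by omega
  rw [i1, i2]
  ring

end

end Reduction

/-! ### The Cauchy-Stieltjes transform outside the support -/

section Stieltjes

variable {μ : Measure ℝ} [IsProbabilityMeasure μ] {a b z : ℝ}

lemma abs_inv_sub_le {δ x : ℝ} (hδ : 0 < δ) (h : δ ≤ |z - x|) : |1 / (z - x)| ≤ 1 / δ := by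
  rw [abs_div, abs_one]
  exact one_div_le_one_div_of_le hδ h

lemma exists_gap (hz : z ∉ Set.Icc a b) : ∃ δ > 0, ∀ x ∈ Set.Icc a b, δ ≤ |z - x| := by
  rw [Set.mem_Icc, not_and_or, not_le, not_le] at hz
  rcases hz with hz | hz
  · exact ⟨a - z, by linarith, fun x hx => by
      rw [abs_sub_comm]; exact (by linarith [hx.1] : a - z ≤ x - z).trans (le_abs_self _)⟩
  · exact ⟨z - b, by linarith, fun x hx =>
      (by linarith [hx.2] : z - b ≤ z - x).trans (le_abs_self _)⟩

variable (hμ : ∀ᵐ x ∂μ, x ∈ Set.Icc a b)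
include hμ

lemma integrable_inv_sub_pow (hz : z ∉ Set.Icc a b) (p : ℕ) :
    Integrable (fun x => (1 / (z - x)) ^ p) μ := by
  obtain ⟨δ, hδ, h⟩ := exists_gap hz
  refine Integrable.of_bound (C := (1 / δ) ^ p) (Measurable.aestronglyMeasurable (by fun_prop)) ?_
  filter_upwards [hμ] with x hx
  rw [norm_pow]
  exact pow_le_pow_left₀ (norm_nonneg _) (abs_inv_sub_le hδ (h x hx)) p

lemma integrable_inv_sub (hz : z ∉ Set.Icc a b) : Integrable (fun x => 1 / (z - x)) μ := by
  simpa using integrable_inv_sub_pow hμ hz 1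

lemma integrable_inv_sub_sq (hz : z ∉ Set.Icc a b) : Integrable (fun x => 1 / (z - x) ^ 2) μ := by
  simpa using integrable_inv_sub_pow hμ hz 2

lemma hasDerivAt_cauchyG (hz : z ∉ Set.Icc a b) :
    HasDerivAt (cauchyG μ) (-∫ x, 1 / (z - x) ^ 2 ∂μ) z := by
  obtain ⟨δ, hδ, h⟩ := exists_gap hz
  have hball : ∀ x ∈ Set.Icc a b, ∀ w ∈ Metric.ball z (δ / 2), δ / 2 ≤ |w - x| := by
    intro x hx w hw
    rw [Metric.mem_ball, Real.dist_eq] at hw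
    have h1 := h x hx
    have h2 := abs_sub_le z w x
    rw [abs_sub_comm z w] at h2
    linarith
  have h2 : 0 < δ / 2 := half_pos hδ
  have key := hasDerivAt_integral_of_dominated_loc_of_deriv_le (μ := μ)
    (F := fun w x => 1 / (w - x)) (F' := fun w x => -(1 / (w - x) ^ 2))
    (bound := fun _ => (1 / (δ / 2)) ^ 2) (Metric.ball_mem_nhds z h2)
    (Eventually.of_forall fun w => Measurable.aestronglyMeasurable (by fun_prop))
    (integrable_inv_sub hμ hz) (Measurable.aestronglyMeasurable (by fun_prop))
    (by
      filter_upwards [hμ] with x hx w hw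
      rw [norm_neg, ← one_div_pow, norm_pow]
      exact pow_le_pow_left₀ (norm_nonneg _) (abs_inv_sub_le h2 (hball x hx w hw)) 2)
    (integrable_const _)
    (by
      filter_upwards [hμ] with x hx w hw
      have h3 : w - x ≠ 0 := by
        intro h0
        have := hball x hx w hw
        rw [h0, abs_zero] at this
        linarith
      have := ((hasDerivAt_id w).sub_const x).inv h3
      simp only [id] at this
      convert! this using 1
      · funext y; simp
      · simp [neg_div])
  have h4 := key.2
  rw [integral_neg] at h4
  exact h4

lemma deriv_cauchyG (hz : z ∉ Set.Icc a b) : deriv (cauchyG μ) z = -∫ x, 1 / (z - x) ^ 2 ∂μ :=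
  (hasDerivAt_cauchyG hμ hz).deriv

/-- The variance of `1/(z - x)` under `μ` is nonnegative. -/
lemma cauchyG_sq_le (hz : z ∉ Set.Icc a b) : cauchyG μ z ^ 2 ≤ ∫ x, 1 / (z - x) ^ 2 ∂μ := by
  have h1 := integrable_inv_sub hμ hz
  have h2 := integrable_inv_sub_sq hμ hz
  set G := cauchyG μ z with hG
  have h3 : 0 ≤ ∫ x, (1 / (z - x) - G) ^ 2 ∂μ := integral_nonneg fun x => sq_nonneg _
  have h4 : ∀ x, (1 / (z - x) - G) ^ 2 = 1 / (z - x) ^ 2 - 2 * G * (1 / (z - x)) + G ^ 2 := by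
    intro x
    rw [sub_sq, one_div_pow]; ring
  simp_rw [h4] at h3
  rw [integral_add (f := fun x => 1 / (z - x) ^ 2 - 2 * G * (1 / (z - x)))
    (h2.sub (h1.const_mul _)) (integrable_const _), integral_sub h2 (h1.const_mul _),
    integral_const_mul, integral_const, probReal_univ, one_smul] at h3
  change 0 ≤ _ - 2 * G * cauchyG μ z + _ at h3
  rw [← hG] at h3
  linarith

lemma integral_le_of_ae_le {f g : ℝ → ℝ} (hf : Integrable f μ) (hg : Integrable g μ)
    (h : ∀ x ∈ Set.Icc a b, f x ≤ g x) : ∫ x, f x ∂μ ≤ ∫ x, g x ∂μ := by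
  refine integral_mono_ae hf hg ?_
  filter_upwards [hμ] with x hx using h x hx

lemma cauchyG_bounds_above (hz : b < z) : cauchyG μ z ≤ 1 / (z - b) ∧ (a ≤ b → 0 < cauchyG μ z) := by
  have hz' : z ∉ Set.Icc a b := fun h => absurd h.2 (not_le.2 hz)
  have hi := integrable_inv_sub hμ hz'
  constructor
  · have := integral_le_of_ae_le hμ hi (integrable_const (1 / (z - b))) fun x hx =>
      one_div_le_one_div_of_le (by linarith) (by linarith [hx.2])
    rw [integral_const, probReal_univ, one_smul] at this
    exact this
  · intro hab
    have := integral_le_of_ae_le hμ (integrable_const (1 / (z - a))) hi fun x hx =>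
      one_div_le_one_div_of_le (by linarith [hx.2]) (by linarith [hx.1])
    have h2 : 1 / (z - a) ≤ cauchyG μ z := by
      rw [integral_const, probReal_univ, one_smul] at this
      exact this
    exact lt_of_lt_of_le (one_div_pos.2 (by linarith)) h2

lemma cauchyG_bounds_below (hz : z < a) :
    -(1 / (a - z)) ≤ cauchyG μ z ∧ (a ≤ b → cauchyG μ z < 0) := by
  have hz' : z ∉ Set.Icc a b := fun h => absurd h.1 (not_le.2 hz)
  have hi := integrable_inv_sub hμ hz'
  have hx' : ∀ x, 1 / (z - x) = -(1 / (x - z)) := fun x => by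
    rw [← neg_sub x z, div_neg]
  constructor
  · have := integral_le_of_ae_le hμ (integrable_const (-(1 / (a - z)))) hi fun x hx => by
      rw [hx']
      exact neg_le_neg (one_div_le_one_div_of_le (by linarith) (by linarith [hx.1]))
    rw [integral_const, probReal_univ, one_smul] at this
    exact this
  · intro hab
    have := integral_le_of_ae_le hμ hi (integrable_const (-(1 / (b - z)))) fun x hx => by
      rw [hx']
      exact neg_le_neg (one_div_le_one_div_of_le (by linarith [hx.1]) (by linarith [hx.2]))
    have h2 : cauchyG μ z ≤ -(1 / (b - z)) := by
      rw [integral_const, probReal_univ, one_smul] at this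
      exact this
    have h3 : 0 < 1 / (b - z) := one_div_pos.2 (by linarith)
    linarith

lemma antitoneOn_cauchyG_above : AntitoneOn (cauchyG μ) (Set.Ioi b) := by
  intro z hz w hw hzw
  refine integral_le_of_ae_le hμ (integrable_inv_sub hμ fun h => absurd h.2 (not_le.2 hw))
    (integrable_inv_sub hμ fun h => absurd h.2 (not_le.2 hz)) fun x hx => ?_
  exact one_div_le_one_div_of_le (by linarith [hx.2, Set.mem_Ioi.1 hz]) (by linarith)

lemma antitoneOn_cauchyG_below : AntitoneOn (cauchyG μ) (Set.Iio a) := by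
  intro z hz w hw hzw
  refine integral_le_of_ae_le hμ (integrable_inv_sub hμ fun h => absurd h.1 (not_le.2 hw))
    (integrable_inv_sub hμ fun h => absurd h.1 (not_le.2 hz)) fun x hx => ?_
  have h1 : w - x < 0 := by linarith [hx.1, Set.mem_Iio.1 hw]
  exact one_div_le_one_div_of_neg_of_le h1 (by linarith)

omit hμ

/-- To be applied to `f = 1/G`. Monotonicity makes the one-sided limit exist, so that `limUnder` has
its intended meaning. The bound `z - b ≤ f z` gives positivity and unboundedness, and the
intermediate value theorem does the rest. -/
lemma exists_eq_of_limUnder_lt {f : ℝ → ℝ} {b α : ℝ} (hm : MonotoneOn f (Set.Ioi b))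
    (hc : ContinuousOn f (Set.Ioi b)) (hf : ∀ z, b < z → z - b ≤ f z)
    (hα : limUnder (𝓝[>] b) f < α) : 0 < α ∧ ∃ z, b < z ∧ f z = α := by
  have hbdd : BddBelow (f '' Set.Ioi b) := by
    refine ⟨0, ?_⟩
    rintro _ ⟨z, hz, rfl⟩
    linarith [hf z hz, Set.mem_Ioi.1 hz]
  have ht := hm.tendsto_nhdsGT hbdd
  have hlim := ht.limUnder_eq
  have ht' : Tendsto f (𝓝[>] b) (𝓝 (limUnder (𝓝[>] b) f)) := by rw [hlim]; exact ht
  obtain ⟨z₁, hz₁, hz₁b⟩ := ((ht'.eventually (gt_mem_nhds hα)).and self_mem_nhdsWithin).exists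
  have hz₁b : b < z₁ := hz₁b
  have hα0 : 0 < α := by linarith [hf z₁ hz₁b]
  refine ⟨hα0, ?_⟩
  set z₂ := max z₁ (b + α) with hz₂
  have h12 : z₁ ≤ z₂ := le_max_left _ _
  have h2 : α ≤ f z₂ := by
    have := hf z₂ (lt_of_lt_of_le hz₁b h12)
    have : b + α ≤ z₂ := le_max_right _ _
    linarith
  have hsub : Set.Icc z₁ z₂ ⊆ Set.Ioi b := fun x hx => lt_of_lt_of_le hz₁b hx.1
  obtain ⟨z, hz, hzα⟩ := intermediate_value_Icc h12 (hc.mono hsub) ⟨hz₁.le, h2⟩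
  exact ⟨z, hsub hz, hzα⟩

lemma exists_eq_of_lt_limUnder {f : ℝ → ℝ} {a α : ℝ} (hm : MonotoneOn f (Set.Iio a))
    (hc : ContinuousOn f (Set.Iio a)) (hf : ∀ z, z < a → f z ≤ z - a)
    (hα : α < limUnder (𝓝[<] a) f) : α < 0 ∧ ∃ z, z < a ∧ f z = α := by
  have hbdd : BddAbove (f '' Set.Iio a) := by
    refine ⟨0, ?_⟩
    rintro _ ⟨z, hz, rfl⟩
    linarith [hf z hz, Set.mem_Iio.1 hz]
  have ht := hm.tendsto_nhdsLT hbdd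
  have hlim := ht.limUnder_eq
  have ht' : Tendsto f (𝓝[<] a) (𝓝 (limUnder (𝓝[<] a) f)) := by rw [hlim]; exact ht
  obtain ⟨z₁, hz₁, hz₁b⟩ := ((ht'.eventually (lt_mem_nhds hα)).and self_mem_nhdsWithin).exists
  have hz₁b : z₁ < a := hz₁b
  have hα0 : α < 0 := by linarith [hf z₁ hz₁b]
  refine ⟨hα0, ?_⟩
  set z₂ := min z₁ (a + α) with hz₂
  have h12 : z₂ ≤ z₁ := min_le_left _ _
  have h2 : f z₂ ≤ α := by
    have := hf z₂ (lt_of_le_of_lt h12 hz₁b)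
    have : z₂ ≤ a + α := min_le_right _ _
    linarith
  have hsub : Set.Icc z₂ z₁ ⊆ Set.Iio a := fun x hx => lt_of_le_of_lt hx.2 hz₁b
  obtain ⟨z, hz, hzα⟩ := intermediate_value_Icc h12 (hc.mono hsub) ⟨h2, hz₁.le⟩
  exact ⟨z, hsub hz, hzα⟩

include hμ

/-- The defining property of `ρ_θ` in the supercritical case. -/
lemma rho_spec (hab : a ≤ b) {α : ℝ} (h : α < thetaLower μ a ∨ thetaUpper μ b < α) :
    (0 < α ∧ b < rho μ a b α ∨ α < 0 ∧ rho μ a b α < a) ∧ cauchyG μ (rho μ a b α) = α⁻¹ := by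
  have hcont : ∀ z, z ∉ Set.Icc a b → ContinuousAt (cauchyG μ) z := fun z hz =>
    (hasDerivAt_cauchyG hμ hz).continuousAt
  have hex : ∃ z ∈ Set.Iio a ∪ Set.Ioi b, cauchyG μ z = 1 / α := by
    rcases h with h | h
    · have hne : ∀ z, z < a → cauchyG μ z < 0 := fun z hz => (cauchyG_bounds_below hμ hz).2 hab
      obtain ⟨-, z, hz, hzα⟩ := exists_eq_of_lt_limUnder (f := fun z => 1 / cauchyG μ z) (by
          intro z hz w hw hzw
          exact one_div_le_one_div_of_neg_of_le (hne z hz)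
            (antitoneOn_cauchyG_below hμ hz hw hzw))
        (fun z hz => (ContinuousAt.div continuousAt_const
          (hcont z fun h => absurd h.1 (not_le.2 hz)) (hne z hz).ne).continuousWithinAt)
        (fun z hz => by
          have h1 := (cauchyG_bounds_below hμ hz).1
          have h2 := one_div_le_one_div_of_neg_of_le (hne z hz) h1
          rw [div_neg, one_div_one_div] at h2
          linarith) h
      exact ⟨z, Or.inl hz, by rw [← hzα, one_div_one_div]⟩
    · have hne : ∀ z, b < z → 0 < cauchyG μ z := fun z hz => (cauchyG_bounds_above hμ hz).2 hab
      obtain ⟨-, z, hz, hzα⟩ := exists_eq_of_limUnder_lt (f := fun z => 1 / cauchyG μ z) (by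
          intro z hz w hw hzw
          exact one_div_le_one_div_of_le (hne w hw)
            (antitoneOn_cauchyG_above hμ hz hw hzw))
        (fun z hz => (ContinuousAt.div continuousAt_const
          (hcont z fun h => absurd h.2 (not_le.2 hz)) (hne z hz).ne').continuousWithinAt)
        (fun z hz => by
          have h1 := (cauchyG_bounds_above hμ hz).1
          have h2 := one_div_le_one_div_of_le (hne z hz) h1
          rw [one_div_one_div] at h2
          exact h2) h
      exact ⟨z, Or.inr hz, by rw [← hzα, one_div_one_div]⟩
  have hmem := Function.invFunOn_mem hex
  have heq := Function.invFunOn_eq hex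
  have hrho : rho μ a b α = Function.invFunOn (cauchyG μ) (Set.Iio a ∪ Set.Ioi b) (1 / α) := by
    rw [rho, if_pos h]
  rw [← hrho] at hmem heq
  refine ⟨?_, by rw [heq, one_div]⟩
  rcases hmem with hm | hm
  · right
    have := (cauchyG_bounds_below hμ hm).2 hab
    rw [heq] at this
    exact ⟨one_div_neg.1 this, hm⟩
  · left
    have := (cauchyG_bounds_above hμ hm).2 hab
    rw [heq] at this
    exact ⟨one_div_pos.1 this, hm⟩

omit hμ [IsProbabilityMeasure μ]

lemma supercritical_of_rho_ne {α : ℝ} (h : rho μ a b α ∉ ({a, b} : Set ℝ)) :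
    α < thetaLower μ a ∨ thetaUpper μ b < α := by
  by_contra h'
  rw [rho, if_neg h'] at h
  split_ifs at h <;> simp at h

end Stieltjes

/-! ### Consequences of the spectral hypothesis -/

section SpectralConsequences

variable {𝕜 : Type*} [RCLike 𝕜] {X : (n : ℕ) → Matrix (Fin n) (Fin n) 𝕜} {μ : Measure ℝ} {a b : ℝ}

lemma SpectralHyp.ae_mem (hX : SpectralHyp X μ a b) : ∀ᵐ x ∂μ, x ∈ Set.Icc a b := by
  filter_upwards [Measure.support_mem_ae (μ := μ)] with x hx
  exact ⟨hX.isLeast.2 hx, hX.isGreatest.2 hx⟩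

lemma SpectralHyp.le (hX : SpectralHyp X μ a b) : a ≤ b := hX.isLeast.2 hX.isGreatest.1

lemma SpectralHyp.eventually_gap (hX : SpectralHyp X μ a b) {z : ℝ} (hz : z ∉ Set.Icc a b) :
    ∃ η > 0, ∀ᶠ n in atTop, SpectralGap (X n) z η ∧ (b < z → eig (X n) n ≤ z - η) ∧
      (z < a → z + η ≤ eig (X n) 1) := by
  have hab := hX.le
  rw [Set.mem_Icc, not_and_or, not_le, not_le] at hz
  rcases hz with hz | hz
  · refine ⟨(a - z) / 2, by linarith, ?_⟩
    filter_upwards [hX.smallest.eventually (lt_mem_nhds (by linarith : z + (a - z) / 2 < a))]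
      with n hn
    refine ⟨fun l => ?_, fun h => by linarith, fun _ => hn.le⟩
    have := eig_mono (hX.hermitian n) le_rfl (by omega : 1 ≤ (l : ℕ) + 1) l.2
    rw [abs_sub_comm]
    exact (by linarith : (a - z) / 2 ≤ eig (X n) (l + 1) - z).trans (le_abs_self _)
  · refine ⟨(z - b) / 2, by linarith, ?_⟩
    filter_upwards [hX.largest.eventually (gt_mem_nhds (by linarith : b < z - (z - b) / 2))]
      with n hn
    exact ⟨spectralGap_of_top_le (hX.hermitian n) hn.le, fun _ => hn.le, fun h => by linarith⟩

/-- The integrand is not a bounded continuous function. It is replaced by a truncation that agrees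
with it at distance at least `min η δ` from `z`, a region which contains the support of `μ` and,
eventually, all eigenvalues. -/
lemma SpectralHyp.tendsto_integral_sq (hX : SpectralHyp X μ a b) {z : ℝ} (hz : z ∉ Set.Icc a b) :
    Tendsto (fun n => ∫ x, 1 / (z - x) ^ 2 ∂(spectralMeasure (X n))) atTop
      (𝓝 (∫ x, 1 / (z - x) ^ 2 ∂μ)) := by
  obtain ⟨η, hη, hgap⟩ := hX.eventually_gap hz
  obtain ⟨δ, hδ, hδ'⟩ := exists_gap hz
  set c := min η δ ^ 2 with hc
  have hc0 : 0 < c := by positivity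
  have hcont : Continuous fun x : ℝ => 1 / max ((z - x) ^ 2) c := by
    refine Continuous.div continuous_const (by fun_prop) fun x => ?_
    exact (lt_of_lt_of_le hc0 (le_max_right _ _)).ne'
  let f : ℝ →ᵇ ℝ := BoundedContinuousFunction.ofNormedAddCommGroup
    (fun x : ℝ => 1 / max ((z - x) ^ 2) c) hcont (1 / c) fun x => by
      have : 0 < max ((z - x) ^ 2) c := lt_of_lt_of_le hc0 (le_max_right _ _)
      rw [Real.norm_of_nonneg (by positivity)]
      exact one_div_le_one_div_of_le hc0 (le_max_right _ _)
  have hf : ∀ x, min η δ ≤ |z - x| → f x = 1 / (z - x) ^ 2 := by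
    intro x hx
    have : c ≤ (z - x) ^ 2 := by
      rw [← sq_abs (z - x)]; exact pow_le_pow_left₀ (by positivity) hx 2
    change 1 / max ((z - x) ^ 2) c = _
    rw [max_eq_left this]
  have h1 := hX.weak f
  have h2 : ∫ x, f x ∂μ = ∫ x, 1 / (z - x) ^ 2 ∂μ := by
    refine integral_congr_ae ?_
    filter_upwards [hX.ae_mem] with x hx
    exact hf x ((min_le_right _ _).trans (hδ' x hx))
  rw [h2] at h1
  refine h1.congr' ?_
  filter_upwards [hgap] with n hn
  rw [integral_spectralMeasure, integral_spectralMeasure]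
  congr 1
  exact Finset.sum_congr rfl fun l _ => hf _ ((min_le_left _ _).trans (hn.1 l))

/-- The limit of the normalised squared Hilbert-Schmidt norm of the centred resolvent. -/
noncomputable def hsLimit (mod : Model) (μ : Measure ℝ) (α z : ℝ) : ℝ :=
  match mod with
  | .iid => ∫ x, 1 / (z - x) ^ 2 ∂μ
  | .orthonormalised => (∫ x, 1 / (z - x) ^ 2 ∂μ) - 1 / α ^ 2

section
variable (mod : Model) (hX : SpectralHyp X μ a b) {z α : ℝ} (hz : z ∉ Set.Icc a b) (hα : α ≠ 0)
  (hG : cauchyG μ z = α⁻¹)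
include hX hz hα hG

lemma SpectralHyp.one_div_sq_le : 1 / α ^ 2 ≤ ∫ x, 1 / (z - x) ^ 2 ∂μ := by
  have := hX.isProbabilityMeasure
  have := cauchyG_sq_le hX.ae_mem hz
  rwa [hG, inv_pow, ← one_div] at this

lemma SpectralHyp.integral_sq_pos : 0 < ∫ x, 1 / (z - x) ^ 2 ∂μ :=
  lt_of_lt_of_le (by positivity) (hX.one_div_sq_le hz hα hG)

lemma SpectralHyp.cConst_sq :
    cConst mod μ α z ^ 2 = hsLimit mod μ α z / (∫ x, 1 / (z - x) ^ 2 ∂μ) ^ 2 := by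
  have hs := hX.integral_sq_pos hz hα hG
  cases mod
  · simp only [cConst, hsLimit]
    rw [Real.sq_sqrt (by positivity), sq, div_mul_eq_div_div, div_self hs.ne']
  · simp only [cConst, hsLimit]
    rw [Real.sq_sqrt]
    exact div_nonneg (sub_nonneg.2 (hX.one_div_sq_le hz hα hG)) (by positivity)

variable (hrate : Tendsto (fun n : ℕ => √(n : ℝ) * (cauchyG (spectralMeasure (X n)) z - cauchyG μ z))
  atTop (𝓝 0))
include hrate

lemma SpectralHyp.tendsto_hs :
    Tendsto (fun n : ℕ => (n : ℝ)⁻¹ * ∑ i, ∑ j, ‖centredResolv mod (X n) z i j‖ ^ 2) atTop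
      (𝓝 (hsLimit mod μ α z)) := by
  obtain ⟨η, hη, hgap⟩ := hX.eventually_gap hz
  have h1 := hX.tendsto_integral_sq hz
  -- Convergence of the transforms themselves comes from dividing the rate hypothesis by `√n`.
  have h2 : Tendsto (fun n => cauchyG (spectralMeasure (X n)) z) atTop (𝓝 α⁻¹) := by
    have h3 := (tendsto_inv_sqrt (F := atTop) (N := fun n : ℕ => n) tendsto_id).mul hrate
    rw [mul_zero] at h3
    have h4 := h3.add_const α⁻¹
    rw [zero_add] at h4
    refine h4.congr' ?_
    filter_upwards [eventually_gt_atTop 0] with n hn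
    have : √(n : ℝ) ≠ 0 := by positivity
    rw [hG, ← mul_assoc, inv_mul_cancel₀ this, one_mul, sub_add_cancel]
  have h5 : ∀ᶠ n : ℕ in atTop, (n : ℝ)⁻¹ * ∑ i, ∑ j, ‖centredResolv mod (X n) z i j‖ ^ 2 =
      ∫ x, 1 / (z - x) ^ 2 ∂(spectralMeasure (X n)) - match mod with
        | .iid => 0
        | .orthonormalised => cauchyG (spectralMeasure (X n)) z ^ 2 := by
    filter_upwards [hgap, eventually_gt_atTop 0] with n hn hn0
    have : (n : ℝ) ≠ 0 := by positivity
    rw [inv_mul_eq_iff_eq_mul₀ this]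
    cases mod <;> exact hn.1.sum_norm_centredResolv _ (hX.hermitian n) hη
  refine Tendsto.congr' (EventuallyEq.symm h5) ?_
  cases mod
  · simpa [hsLimit] using h1
  · have := h1.sub (h2.pow 2)
    simpa [hsLimit] using this

/-- The squares of the diagonal entries are part of the Hilbert-Schmidt norm, hence the upper bound.
It is what keeps the total variance nonnegative when the fourth cumulant is negative. -/
lemma SpectralHyp.diagLimit_mem {l : ℝ} (hl : Tendsto (fun n => diagAverage mod (X n) z) atTop (𝓝 l)) :
    Tendsto (fun n : ℕ => (n : ℝ)⁻¹ * ∑ i, RCLike.re (centredResolv mod (X n) z i i) ^ 2) atTop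
      (𝓝 l) ∧ 0 ≤ l ∧ l ≤ hsLimit mod μ α z := by
  obtain ⟨η, hη, hgap⟩ := hX.eventually_gap hz
  have h1 : Tendsto (fun n : ℕ => (n : ℝ)⁻¹ * ∑ i, RCLike.re (centredResolv mod (X n) z i i) ^ 2)
      atTop (𝓝 l) := by
    refine hl.congr' ?_
    filter_upwards [hgap] with n hn
    exact (hn.1.diagAverage_eq mod (hX.hermitian n) hη).symm
  refine ⟨h1, ge_of_tendsto' h1 fun n => by positivity,
    le_of_tendsto_of_tendsto' h1 (hX.tendsto_hs mod hz hα hG hrate) fun n => ?_⟩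
  refine mul_le_mul_of_nonneg_left (Finset.sum_le_sum fun i _ => ?_) (by positivity)
  refine le_trans ?_ (Finset.single_le_sum (f := fun j => ‖centredResolv mod (X n) z i j‖ ^ 2)
    (fun _ _ => by positivity) (Finset.mem_univ i))
  rw [← sq_abs]
  exact pow_le_pow_left₀ (abs_nonneg _) (RCLike.abs_re_le_norm _) 2

omit hα hrate hG
lemma SpectralHyp.extraVar_eq (l : ℝ → ℝ) (κ : ℝ) :
    extraVar μ l κ z = l z * κ / (∫ x, 1 / (z - x) ^ 2 ∂μ) ^ 2 := by
  have := hX.isProbabilityMeasure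
  rw [extraVar, deriv_cauchyG hX.ae_mem hz, neg_sq]

end

/-- The variance of `‖x‖²` is nonnegative, so the fourth moment is at least `1`. -/
lemma EntryLaw.neg_tauConst_le_kappa4 {ν : Measure 𝕜} (hν : EntryLaw ν) :
    -tauConst 𝕜 ≤ kappa4 ν := by
  have := hν.isProbabilityMeasure
  have h2 : Integrable (fun x : 𝕜 => ‖x‖ ^ 2) ν := by
    by_contra h
    have := hν.variance_one
    rw [integral_undef h] at this
    exact zero_ne_one this
  have h4 : Integrable (fun x : 𝕜 => ‖x‖ ^ 4) ν := by
    have := (hν.logSobolev.memLp h2 4).integrable_norm_pow (by norm_num)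
    simpa using this
  have h1 : 0 ≤ ∫ x, (‖x‖ ^ 2 - 1) ^ 2 ∂ν := integral_nonneg fun x => sq_nonneg _
  have h3 : ∀ x : 𝕜, (‖x‖ ^ 2 - 1) ^ 2 = ‖x‖ ^ 4 - 2 * ‖x‖ ^ 2 + 1 := fun x => by ring
  simp_rw [h3] at h1
  rw [integral_add (f := fun x : 𝕜 => ‖x‖ ^ 4 - 2 * ‖x‖ ^ 2) (h4.sub (h2.const_mul _))
    (integrable_const _), integral_sub h4 (h2.const_mul _), integral_const_mul, integral_const,
    probReal_univ, one_smul, hν.variance_one] at h1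
  unfold kappa4 tauConst
  split_ifs <;> linarith

/-- The limiting variances are nonnegative. -/
lemma SpectralHyp.totalVar_eq (mod : Model) (hX : SpectralHyp X μ a b) {z α : ℝ}
    (hz : z ∉ Set.Icc a b) (hα : α ≠ 0) (hG : cauchyG μ z = α⁻¹) (l : ℝ → ℝ) (κ : ℝ) :
    totalVar 𝕜 mod μ l κ α z =
      (tauConst 𝕜 * hsLimit mod μ α z + κ * l z) / (∫ x, 1 / (z - x) ^ 2 ∂μ) ^ 2 := by
  rw [totalVar, hX.cConst_sq mod hz hα hG, hX.extraVar_eq hz, tauConst]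
  ring

end SpectralConsequences

/-! ### Counting the coefficients -/

section Counting

variable {r q : ℕ} {θ : Fin r → ℝ} {α : Fin q → ℝ}

lemma mult_eq_card (θ : Fin r → ℝ) (t : ℝ) :
    mult θ t = (Finset.univ.filter fun s => θ s = t).card := by
  rw [mult, Nat.card_eq_fintype_card, Fintype.card_subtype]

/-- The hypothesis `h` is met above a supercritical positive `α j`: any larger coefficient is
supercritical too. The rank of an outlier among all eigenvalues is thus a sum of multiplicities. -/
lemma card_gt_eq_sum_mult (hα : StrictMono α) (j : Fin q)
    (h : ∀ s, α j < θ s → θ s ∈ Set.range α) :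
    (Finset.univ.filter fun s => α j < θ s).card = ∑ l ∈ Finset.Ioi j, mult θ (α l) := by
  classical
  have e : (Finset.univ.filter fun s => α j < θ s) =
      (Finset.Ioi j).biUnion fun l => Finset.univ.filter fun s => θ s = α l := by
    ext s
    simp only [Finset.mem_filter, Finset.mem_univ, true_and, Finset.mem_biUnion, Finset.mem_Ioi]
    constructor
    · intro hs
      obtain ⟨l, hl⟩ := h s hs
      exact ⟨l, hα.lt_iff_lt.1 (by rwa [hl]), hl.symm⟩
    · rintro ⟨l, hl, hs⟩
      rw [hs]; exact hα hl
  rw [e, Finset.card_biUnion]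
  · exact Finset.sum_congr rfl fun l _ => (mult_eq_card θ _).symm
  · intro l _ l' _ hl
    rw [Function.onFun, Finset.disjoint_left]
    intro s hs hs'
    simp only [Finset.mem_filter, Finset.mem_univ, true_and] at hs hs'
    exact hl (hα.injective (hs.symm.trans hs'))

lemma card_lt_eq_sum_mult (hα : StrictMono α) (j : Fin q)
    (h : ∀ s, θ s < α j → θ s ∈ Set.range α) :
    (Finset.univ.filter fun s => θ s < α j).card = ∑ l ∈ Finset.Iio j, mult θ (α l) := by
  classical
  have e : (Finset.univ.filter fun s => θ s < α j) =
      (Finset.Iio j).biUnion fun l => Finset.univ.filter fun s => θ s = α l := by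
    ext s
    simp only [Finset.mem_filter, Finset.mem_univ, true_and, Finset.mem_biUnion, Finset.mem_Iio]
    constructor
    · intro hs
      obtain ⟨l, hl⟩ := h s hs
      exact ⟨l, hα.lt_iff_lt.1 (by rwa [hl]), hl.symm⟩
    · rintro ⟨l, hl, hs⟩
      rw [hs]; exact hα hl
  rw [e, Finset.card_biUnion]
  · exact Finset.sum_congr rfl fun l _ => (mult_eq_card θ _).symm
  · intro l _ l' _ hl
    rw [Function.onFun, Finset.disjoint_left]
    intro s hs hs'
    simp only [Finset.mem_filter, Finset.mem_univ, true_and] at hs hs'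
    exact hl (hα.injective (hs.symm.trans hs'))

lemma sum_Iio_add_sum_Ioi (k : Fin q → ℕ) (j : Fin q) :
    ∑ l, k l = ∑ l ∈ Finset.Iio j, k l + k j + ∑ l ∈ Finset.Ioi j, k l := by
  classical
  have h1 : (Finset.univ : Finset (Fin q)) = (insert j (Finset.Iio j)) ∪ Finset.Ioi j := by
    ext l
    simp only [Finset.mem_univ, Finset.mem_union, Finset.mem_insert, Finset.mem_Iio,
      Finset.mem_Ioi, true_iff]
    rcases lt_trichotomy l j with h | h | h <;> simp [h]
  rw [h1, Finset.sum_union, Finset.sum_insert (by simp), add_comm (k j)]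
  rw [Finset.disjoint_left]
  intro l hl hl'
  simp only [Finset.mem_insert, Finset.mem_Iio, Finset.mem_Ioi] at hl hl'
  rcases hl with h | h
  · subst h; exact lt_irrefl _ hl'
  · exact lt_asymm h hl'

end Counting

/-! ### A common probability space -/

section CommonSpace

variable {𝕜 : Type*} [RCLike 𝕜] {ν : Measure 𝕜} {ν₀ : Measure ℝ} {e : Bool → 𝕜} {r : ℕ}

/-- The coordinates that make up the entries of the vectors of length `n`. -/
def commonVar (r n : ℕ) (p : (Fin r × Fin n) × Bool) (ω : (Fin r × ℕ) × Bool → ℝ) : ℝ :=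
  ω ((p.1.1, (p.1.2 : ℕ)), p.2)

lemma commonVar_injective (r n : ℕ) : Function.Injective
    (fun p : (Fin r × Fin n) × Bool => (((p.1.1, (p.1.2 : ℕ)), p.2) : (Fin r × ℕ) × Bool)) := by
  rintro ⟨⟨s, a⟩, b⟩ ⟨⟨s', a'⟩, b'⟩ h
  simpa [Fin.ext_iff] using h

/-- The arrays for different `n` share their variables. This is harmless, as only the law for each
fixed `n` enters the convergence in distribution. -/
lemma stdFamily_commonVar (h : StdLaw ν₀) (n : ℕ) :
    StdFamily ν₀ (commonVar r n) (Measure.infinitePi fun _ => ν₀) := by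
  have := h.isProbabilityMeasure
  refine ⟨h, fun p => ⟨(measurable_pi_apply _).aemeasurable, Measure.infinitePi_map_eval _ _⟩,
    fun p => measurable_pi_apply _, ?_⟩
  have hi : iIndepFun (fun p (ω : (Fin r × ℕ) × Bool → ℝ) => ω p)
      (Measure.infinitePi fun _ => ν₀) :=
    iIndepFun_infinitePi (P := fun _ => ν₀) (X := fun _ ω => ω) fun _ => measurable_id
  exact iIndepFun.precomp (f := fun p (ω : (Fin r × ℕ) × Bool → ℝ) => ω p)
    (commonVar_injective r n) hi

lemma map_entries_commonVar (hd : RealDecomposition ν ν₀ e) (n : ℕ) :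
    (Measure.infinitePi fun _ => ν₀).map
      (fun ω (p : Fin r × Fin n) => entries e (commonVar r n) ω p.1 p.2) =
    Measure.pi fun _ => ν := by
  have := hd.std.isProbabilityMeasure
  have hm : Measurable fun x : Bool → ℝ => ∑ b, (x b : 𝕜) * e b := by
    refine Finset.measurable_fun_sum _ fun b _ => ?_
    exact (RCLike.measurable_ofReal.comp (measurable_pi_apply b)).mul_const _
  have hν : IsProbabilityMeasure ν := by
    rw [← hd.map_eq]; exact Measure.isProbabilityMeasure_map hm.aemeasurable
  have e1 : (fun (ω : (Fin r × ℕ) × Bool → ℝ) (p : Fin r × Fin n) =>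
      entries e (commonVar r n) ω p.1 p.2) =
      (fun (y : Fin r × Fin n → Bool → ℝ) p => ∑ b, (y p b : 𝕜) * e b) ∘
        (MeasurableEquiv.curry (Fin r × Fin n) Bool ℝ) ∘ (fun ω p => ω ((p.1.1, (p.1.2 : ℕ)), p.2)) := by
    funext ω p
    simp [entries, entry, commonVar]
  rw [e1, ← Measure.map_map (by fun_prop) (by fun_prop), ← Measure.map_map (by fun_prop) (by fun_prop),
    Measure.map_infinitePi_infinitePi_of_inj (commonVar_injective r n),
    Measure.infinitePi_map_curry (fun _ _ => ν₀)]
  rw [Measure.infinitePi_map_pi (fun _ => Measure.infinitePi fun _ => ν₀)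
    (f := fun _ (x : Bool → ℝ) => ∑ b, (x b : 𝕜) * e b) fun _ => hm]
  simp_rw [Measure.infinitePi_eq_pi, hd.map_eq]
  exact Measure.infinitePi_eq_pi _

/-- Convergence in distribution of measurable functions of the entries only depends on their law. -/
lemma tendstoInDistribution_of_entries (hd : RealDecomposition ν ν₀ e)
    [IsProbabilityMeasure ν₀]
    {Ω : ℕ → Type*} [∀ n, MeasurableSpace (Ω n)] {P : (n : ℕ) → Measure (Ω n)}
    [∀ n, IsProbabilityMeasure (P n)] {g : (n : ℕ) → Fin r → Fin n → Ω n → 𝕜}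
    (hg_law : ∀ n s i, HasLaw (g n s i) ν (P n))
    (hg_indep : ∀ n, iIndepFun (fun p : Fin r × Fin n => g n p.1 p.2) (P n))
    {E Ω' : Type*} [MeasurableSpace E] [TopologicalSpace E] [OpensMeasurableSpace E]
    [MeasurableSpace Ω'] {μ' : Measure Ω'} [IsProbabilityMeasure μ'] {Z : Ω' → E}
    {φ : (n : ℕ) → (Fin r → Fin n → 𝕜) → E}
    (hφ : ∀ n, Measurable fun y : Fin r × Fin n → 𝕜 => φ n (fun s a => y (s, a)))
    (h : TendstoInDistribution
      (fun n (ω : (Fin r × ℕ) × Bool → ℝ) => φ n (entries e (commonVar r n) ω)) atTop Z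
      (fun _ => Measure.infinitePi fun _ => ν₀) μ') :
    TendstoInDistribution (fun n ω => φ n (fun s a => g n s a ω)) atTop Z P μ' := by
  have hg : ∀ n, AEMeasurable (fun ω (p : Fin r × Fin n) => g n p.1 p.2 ω) (P n) := fun n =>
    aemeasurable_pi_iff.2 fun p => (hg_law n p.1 p.2).aemeasurable
  have hmap : ∀ n, (P n).map (fun ω (p : Fin r × Fin n) => g n p.1 p.2 ω) =
      Measure.pi fun _ => ν := by
    intro n
    rw [(iIndepFun_iff_map_fun_eq_pi_map
      fun p : Fin r × Fin n => (hg_law n p.1 p.2).aemeasurable).1 (hg_indep n)]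
    simp_rw [fun p : Fin r × Fin n => (hg_law n p.1 p.2).map_eq]
  have hem : ∀ n, Measurable (fun (ω : (Fin r × ℕ) × Bool → ℝ) (p : Fin r × Fin n) =>
      entries e (commonVar r n) ω p.1 p.2) := by
    refine fun n => measurable_pi_lambda _ fun p => ?_
    simp only [entries, entry]
    refine Finset.measurable_fun_sum _ fun b _ => ?_
    exact (RCLike.measurable_ofReal.comp (measurable_pi_apply _)).mul_const _
  have hae : ∀ n, AEMeasurable (fun ω => φ n (fun s a => g n s a ω)) (P n) := fun n =>
    (hφ n).comp_aemeasurable (hg n)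
  refine ⟨hae, h.aemeasurable_limit, h.tendsto.congr fun n => Subtype.ext ?_⟩
  change Measure.map _ _ = Measure.map _ _
  have e1 : Measure.map (fun ω => φ n (fun s a => g n s a ω)) (P n) =
      ((P n).map (fun ω (p : Fin r × Fin n) => g n p.1 p.2 ω)).map
        (fun y : Fin r × Fin n → 𝕜 => φ n (fun s a => y (s, a))) :=
    (AEMeasurable.map_map_of_aemeasurable (hφ n).aemeasurable (hg n)).symm
  have e2 : Measure.map (fun (ω : (Fin r × ℕ) × Bool → ℝ) => φ n (entries e (commonVar r n) ω))
      (Measure.infinitePi fun _ => ν₀) = ((Measure.infinitePi fun _ => ν₀).map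
        (fun ω (p : Fin r × Fin n) => entries e (commonVar r n) ω p.1 p.2)).map
        (fun y : Fin r × Fin n → 𝕜 => φ n (fun s a => y (s, a))) :=
    (Measure.map_map (hφ n) (hem n)).symm
  rw [e1, e2, hmap, map_entries_commonVar hd]

end CommonSpace

/-! ### Real coordinates of Hermitian matrices -/

section Coordinates

open Matrix ComplexConjugate

variable {𝕜 : Type*} [RCLike 𝕜] {m : ℕ}

/-- Real coordinates of a Hermitian matrix: the real parts of the entries on and above the diagonal
and, below the diagonal, the imaginary parts of the entries above it. -/
noncomputable def coords (M : Matrix (Fin m) (Fin m) 𝕜) (i j : Fin m) : ℝ :=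
  if i ≤ j then RCLike.re (M i j) else RCLike.im (M j i)

/-- The Hermitian matrix with given real coordinates. -/
noncomputable def hermOf (𝕜 : Type*) [RCLike 𝕜] (z : Fin m → Fin m → ℝ) :
    Matrix (Fin m) (Fin m) 𝕜 :=
  of fun i j => if i = j then (z i i : 𝕜)
    else if i < j then (z i j : 𝕜) + (z j i : 𝕜) * RCLike.I
    else (z j i : 𝕜) - (z i j : 𝕜) * RCLike.I

/-- The Hermitian matrix that represents a linear form in the coordinates. -/
noncomputable def dualHerm (𝕜 : Type*) [RCLike 𝕜] (t : Fin m → Fin m → ℝ) :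
    Matrix (Fin m) (Fin m) 𝕜 :=
  of fun i j => if i = j then (t i i : 𝕜)
    else if i < j then (((t i j / 2 : ℝ) : 𝕜) - ((t j i / 2 : ℝ) : 𝕜) * RCLike.I)
    else (((t j i / 2 : ℝ) : 𝕜) + ((t i j / 2 : ℝ) : 𝕜) * RCLike.I)

open Classical in
/-- The weights of the coordinates in the Hilbert-Schmidt norm of the dual matrix. -/
noncomputable def coordWeight (𝕜 : Type*) [RCLike 𝕜] (i j : Fin m) : ℝ :=
  if i = j then 1 else if i < j then 1 / 2 else if IsRealCase 𝕜 then 0 else 1 / 2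

lemma isHermitian_hermOf (z : Fin m → Fin m → ℝ) : (hermOf 𝕜 z).IsHermitian := by
  refine IsHermitian.ext fun i j => ?_
  simp only [hermOf, of_apply, RCLike.star_def]
  rcases lt_trichotomy i j with h | rfl | h
  · rw [if_neg h.ne', if_neg h.le.not_gt, if_neg h.ne, if_pos h]
    simp
  · simp
  · rw [if_neg h.ne, if_pos h, if_neg h.ne', if_neg h.le.not_gt]
    simp [sub_eq_add_neg]

lemma continuous_hermOf : Continuous (hermOf 𝕜 : (Fin m → Fin m → ℝ) → _) := by
  refine continuous_pi fun i => continuous_pi fun j => ?_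
  have h : ∀ i j, Continuous fun z : Fin m → Fin m → ℝ => ((z i j : ℝ) : 𝕜) := fun i j =>
    (RCLike.continuous_ofReal (K := 𝕜)).comp (by fun_prop)
  simp only [hermOf, of_apply]
  split_ifs
  · exact h i i
  · exact (h i j).add ((h j i).mul continuous_const)
  · exact (h j i).sub ((h i j).mul continuous_const)

lemma hermOf_coords {M : Matrix (Fin m) (Fin m) 𝕜} (hM : M.IsHermitian) :
    hermOf 𝕜 (coords M) = M := by
  have hs : ∀ i j, M i j = conj (M j i) := fun i j => (hM.apply i j).symm
  ext i j
  simp only [hermOf, of_apply, coords]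
  rcases lt_trichotomy i j with h | rfl | h
  · rw [if_neg h.ne, if_pos h, if_pos h.le, if_neg h.not_ge, RCLike.re_add_im]
  · rw [if_pos rfl, if_pos le_rfl]
    exact RCLike.conj_eq_iff_re.1 (hs i i).symm
  · rw [if_neg h.ne', if_neg h.le.not_gt, if_pos h.le, if_neg h.not_ge, hs i j]
    have := congrArg conj (RCLike.re_add_im (M j i))
    rw [map_add, map_mul, RCLike.conj_ofReal, RCLike.conj_ofReal, RCLike.conj_I] at this
    rw [← this, mul_neg, sub_eq_add_neg]

lemma isHermitian_dualHerm (t : Fin m → Fin m → ℝ) (i j : Fin m) :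
    dualHerm 𝕜 t j i = conj (dualHerm 𝕜 t i j) := by
  simp only [dualHerm, of_apply]
  rcases lt_trichotomy i j with h | rfl | h
  · rw [if_neg h.ne', if_neg h.le.not_gt, if_neg h.ne, if_pos h]
    simp [sub_eq_add_neg]
  · simp
  · rw [if_neg h.ne, if_pos h, if_neg h.ne', if_neg h.le.not_gt]
    simp [sub_eq_add_neg]

lemma re_dualHerm_diag (t : Fin m → Fin m → ℝ) (i : Fin m) :
    RCLike.re (dualHerm 𝕜 t i i) = t i i := by
  simp [dualHerm]

/-- The off-diagonal entries of the dual matrix are halved because each pair `(i, j)`, `(j, i)`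
contributes twice to the trace pairing. -/
lemma sum_re_dualHerm_mul (t : Fin m → Fin m → ℝ) {M : Matrix (Fin m) (Fin m) 𝕜}
    (hM : M.IsHermitian) :
    ∑ i, ∑ j, RCLike.re (dualHerm 𝕜 t i j * M i j) = ∑ i, ∑ j, t i j * coords M i j := by
  have hs : ∀ i j, M i j = conj (M j i) := fun i j => (hM.apply i j).symm
  have key : ∀ i j, RCLike.re (dualHerm 𝕜 t i j * M i j) =
      (t i j * coords M i j + t j i * coords M j i) / 2 := by
    have hlt : ∀ i j, i < j → RCLike.re (dualHerm 𝕜 t i j * M i j) =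
      (t i j * coords M i j + t j i * coords M j i) / 2 := by
      intro i j h
      simp only [dualHerm, of_apply, coords]
      rw [if_neg h.ne, if_pos h, if_pos h.le, if_neg h.not_ge, sub_mul, map_sub, mul_assoc,
        RCLike.re_ofReal_mul, RCLike.re_ofReal_mul, RCLike.I_mul_re]
      ring
    intro i j
    rcases lt_trichotomy i j with h | rfl | h
    · exact hlt i j h
    · simp [dualHerm, coords]
    · rw [hs i j, ← RCLike.conj_conj (dualHerm 𝕜 t i j), ← isHermitian_dualHerm, ← map_mul,
        RCLike.conj_re, hlt j i h]
      ring
  simp_rw [key]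
  have hsw := Finset.sum_comm (s := Finset.univ) (t := Finset.univ)
    (f := fun i j => t i j * coords M i j)
  simp_rw [← Finset.sum_div, Finset.sum_add_distrib]
  rw [← hsw]
  ring

/-- In the real case `I = 0`, so the coordinates below the diagonal have weight `0` and drop out. -/
lemma sum_norm_dualHerm_sq (t : Fin m → Fin m → ℝ) :
    ∑ i, ∑ j, ‖dualHerm 𝕜 t i j‖ ^ 2 = ∑ i, ∑ j, coordWeight 𝕜 i j * t i j ^ 2 := by
  have key : ∀ i j, ‖dualHerm 𝕜 t i j‖ ^ 2 =
      (coordWeight 𝕜 i j * t i j ^ 2 + coordWeight 𝕜 j i * t j i ^ 2) / 2 := by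
    have hlt : ∀ i j, i < j → ‖dualHerm 𝕜 t i j‖ ^ 2 =
      (coordWeight 𝕜 i j * t i j ^ 2 + coordWeight 𝕜 j i * t j i ^ 2) / 2 := by
      intro i j h
      simp only [dualHerm, of_apply, coordWeight]
      rw [if_neg h.ne, if_pos h, if_neg h.ne, if_pos h, if_neg h.ne', if_neg h.le.not_gt,
        norm_sq_eq_re_im]
      by_cases hr : IsRealCase 𝕜
      · have hI : (RCLike.I : 𝕜) = 0 := hr
        rw [if_pos hr, hI]
        simp only [mul_zero, sub_zero, RCLike.ofReal_re, RCLike.ofReal_im]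
        ring
      · have hI := im_I_of_complex hr
        rw [if_neg hr, map_sub, map_sub, RCLike.re_ofReal_mul, RCLike.im_ofReal_mul,
          RCLike.ofReal_re, RCLike.ofReal_im, RCLike.I_re, hI]
        ring
    intro i j
    rcases lt_trichotomy i j with h | rfl | h
    · exact hlt i j h
    · simp [dualHerm, coordWeight]
    · rw [isHermitian_dualHerm t j i, RCLike.norm_conj, hlt j i h]
      ring
  simp_rw [key]
  have hsw := Finset.sum_comm (s := Finset.univ) (t := Finset.univ)
    (f := fun i j : Fin m => coordWeight 𝕜 i j * t i j ^ 2)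
  simp_rw [← Finset.sum_div, Finset.sum_add_distrib]
  rw [← hsw]
  ring

/-- The standard deviations of the coordinates of a GOE or GUE matrix. -/
noncomputable def coordDev (𝕜 : Type*) [RCLike 𝕜] (i j : Fin m) : ℝ :=
  √(tauConst 𝕜 * coordWeight 𝕜 i j)

lemma coordWeight_nonneg (i j : Fin m) : 0 ≤ coordWeight 𝕜 i j := by
  unfold coordWeight
  split_ifs <;> norm_num

lemma coordDev_sq (i j : Fin m) : coordDev 𝕜 i j ^ 2 = tauConst 𝕜 * coordWeight 𝕜 i j :=
  Real.sq_sqrt (mul_nonneg tauConst_pos.le (coordWeight_nonneg i j))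

/-- The coordinates of a GOE or GUE matrix are independent, with variances `τ` times the weights of
the dual Hilbert-Schmidt norm. This is why the term `τ ∑ |M_ij|²` of the variance leads to these
ensembles. -/
lemma coords_gaussianMatrix (x : Fin m → Fin m → ℝ) (i j : Fin m) :
    coords (gaussianMatrix 𝕜 x) i j = coordDev 𝕜 i j * x i j := by
  have h2 : √(1 / 2 : ℝ) = 1 / √2 := by rw [Real.sqrt_div zero_le_one, Real.sqrt_one]
  simp only [coords, gaussianMatrix, of_apply, coordDev, coordWeight, tauConst]
  by_cases hr : IsRealCase 𝕜
  · simp only [if_pos hr]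
    rcases lt_trichotomy i j with h | rfl | h
    · simp [h.le, h.ne, h]
    · simp
    · simp [h.not_ge, h.ne', h.ne, h, h.le.not_gt]
  · have hI := im_I_of_complex hr
    simp only [if_neg hr, one_mul]
    rcases lt_trichotomy i j with h | rfl | h
    · simp only [h.le, h.ne, h, if_true, if_false, h2, map_add, RCLike.re_ofReal_mul,
        RCLike.ofReal_re, RCLike.I_re]
      ring
    · simp
    · simp only [h.not_ge, h.ne', h.ne, h, h.le.not_gt, if_true, if_false, h2, map_add,
        RCLike.im_ofReal_mul, RCLike.ofReal_im, hI]
      ring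

lemma coords_smul (c : ℝ) (M : Matrix (Fin m) (Fin m) 𝕜) (i j : Fin m) :
    coords ((c : 𝕜) • M) i j = c * coords M i j := by
  simp only [coords, Matrix.smul_apply, smul_eq_mul, RCLike.re_ofReal_mul, RCLike.im_ofReal_mul]
  split_ifs <;> rfl

lemma coords_sumMatrix (c : ℝ) (x : Fin m → Fin m → ℝ) (y : Fin m → ℝ) (i j : Fin m) :
    coords (sumMatrix 𝕜 c x y) i j = c * coordDev 𝕜 i j * x i j + if i = j then y i else 0 := by
  have h : coords (sumMatrix 𝕜 c x y) i j = coords ((c : 𝕜) • gaussianMatrix 𝕜 x) i j +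
      if i = j then y i else 0 := by
    simp only [coords, sumMatrix, Matrix.add_apply, diagonal_apply]
    rcases eq_or_ne i j with rfl | h
    · simp
    · simp [h, h.symm]
  rw [h, coords_smul, coords_gaussianMatrix, mul_assoc]

lemma coords_replacedMatrix (c : ℝ) (x : Fin m → Fin m → ℝ) (y : Fin m → ℝ) (i j : Fin m) :
    coords (replacedMatrix 𝕜 c x y) i j =
      (if i = j then 0 else c * coordDev 𝕜 i j) * x i j + if i = j then y i else 0 := by
  rcases eq_or_ne i j with rfl | h
  · simp [coords, replacedMatrix]
  · have : coords (replacedMatrix 𝕜 c x y) i j = coords ((c : 𝕜) • gaussianMatrix 𝕜 x) i j := by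
      simp only [coords, replacedMatrix, of_apply, if_neg h, if_neg h.symm, Matrix.smul_apply,
        smul_eq_mul]
    rw [this, coords_smul, coords_gaussianMatrix, if_neg h, if_neg h, mul_assoc, add_zero]

lemma isHermitian_gaussianMatrix (x : Fin m → Fin m → ℝ) : (gaussianMatrix 𝕜 x).IsHermitian := by
  refine IsHermitian.ext fun i j => ?_
  simp only [gaussianMatrix, of_apply, RCLike.star_def]
  split_ifs with h1 h2 h3 h4 h5 h6 h7
  all_goals first
    | (simp [sub_eq_add_neg]; done)
    | (subst_vars; simp [sub_eq_add_neg]; done)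
    | (exfalso; omega)

lemma isHermitian_sumMatrix (c : ℝ) (x : Fin m → Fin m → ℝ) (y : Fin m → ℝ) :
    (sumMatrix 𝕜 c x y).IsHermitian := by
  refine IsHermitian.ext fun i j => ?_
  have := (isHermitian_gaussianMatrix (𝕜 := 𝕜) x).apply i j
  simp only [sumMatrix, Matrix.add_apply, Matrix.smul_apply, smul_eq_mul, diagonal_apply, star_add,
    star_mul', this]
  rcases eq_or_ne i j with rfl | h
  · simp
  · simp [h, h.symm]

lemma isHermitian_replacedMatrix (c : ℝ) (x : Fin m → Fin m → ℝ) (y : Fin m → ℝ) :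
    (replacedMatrix 𝕜 c x y).IsHermitian := by
  refine IsHermitian.ext fun i j => ?_
  have := (isHermitian_gaussianMatrix (𝕜 := 𝕜) x).apply i j
  simp only [replacedMatrix, of_apply]
  rcases eq_or_ne i j with rfl | h
  · simp
  · rw [if_neg h, if_neg h.symm, star_mul', this]
    simp

end Coordinates

/-! ### The Gaussian limit of the coordinates -/

section GaussianLimit

lemma cis_sum {ι : Type*} (s : Finset ι) (f : ι → ℝ) : cis (∑ i ∈ s, f i) = ∏ i ∈ s, cis (f i) := by
  simp only [cis, ← Complex.exp_sum, Complex.ofReal_sum, Finset.sum_mul]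

lemma integral_cis_gaussian (w : ℝ) (hw : 0 ≤ w) (t : ℝ) :
    ∫ x, cis (t * x) ∂gaussianReal 0 w.toNNReal = Complex.exp ((-(t ^ 2 * w) / 2 : ℝ)) := by
  have h := charFun_gaussianReal (μ := 0) (v := w.toNNReal) t
  rw [charFun_apply_real] at h
  simp only [cis, Complex.ofReal_mul]
  rw [h, show ((w.toNNReal : NNReal) : ℂ) = (w : ℂ) from
    congrArg Complex.ofReal (Real.coe_toNNReal w hw)]
  congr 1
  push_cast
  ring

lemma prod_exp_ofReal {ι : Type*} (s : Finset ι) (f : ι → ℝ) :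
    ∏ i ∈ s, Complex.exp (f i) = Complex.exp ((∑ i ∈ s, f i : ℝ)) := by
  rw [← Complex.exp_sum, Complex.ofReal_sum]

lemma integral_cis_limitMeasure {q : ℕ} (k : Fin q → ℕ) (w : Fin q → ℝ) (hw : ∀ j, 0 ≤ w j)
    (a : (j : Fin q) → Fin (k j) → Fin (k j) → ℝ) (b : (j : Fin q) → Fin (k j) → ℝ) :
    ∫ xy, cis ((∑ j, ∑ i, ∑ i', a j i i' * xy.1 j i i') + ∑ j, ∑ i, b j i * xy.2 j i)
      ∂limitMeasure k w =
    Complex.exp ((∑ j, ((∑ i, ∑ i', -(a j i i' ^ 2) / 2) + ∑ i, -(b j i ^ 2 * w j) / 2) : ℝ)) := by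
  simp only [cis_add]
  rw [limitMeasure, integral_prod_mul
    (f := fun x : (j : Fin q) → Fin (k j) → Fin (k j) → ℝ => cis (∑ j, ∑ i, ∑ i', a j i i' * x j i i'))
    (g := fun y : (j : Fin q) → Fin (k j) → ℝ => cis (∑ j, ∑ i, b j i * y j i))]
  simp only [cis_sum]
  rw [integral_fintype_prod_eq_prod
      (f := fun j (x : Fin (k j) → Fin (k j) → ℝ) => ∏ i, ∏ i', cis (a j i i' * x i i')),
    integral_fintype_prod_eq_prod
      (f := fun j (y : Fin (k j) → ℝ) => ∏ i, cis (b j i * y i))]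
  have h1 : ∀ j, ∫ x : Fin (k j) → Fin (k j) → ℝ, ∏ i, ∏ i', cis (a j i i' * x i i')
      ∂(Measure.pi fun _ : Fin (k j) => Measure.pi fun _ : Fin (k j) => gaussianReal 0 1) =
      Complex.exp ((∑ i, ∑ i', -(a j i i' ^ 2) / 2 : ℝ)) := by
    intro j
    rw [integral_fintype_prod_eq_prod
      (f := fun i (x : Fin (k j) → ℝ) => ∏ i', cis (a j i i' * x i'))]
    have : ∀ i, ∫ x : Fin (k j) → ℝ, ∏ i', cis (a j i i' * x i')
        ∂(Measure.pi fun _ : Fin (k j) => gaussianReal 0 1) =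
        Complex.exp ((∑ i', -(a j i i' ^ 2) / 2 : ℝ)) := by
      intro i
      rw [integral_fintype_prod_eq_prod (f := fun i' (x : ℝ) => cis (a j i i' * x)),
        ← prod_exp_ofReal]
      refine Finset.prod_congr rfl fun i' _ => ?_
      have := integral_cis_gaussian 1 zero_le_one (a j i i')
      rwa [Real.toNNReal_one, mul_one] at this
    simp_rw [this, prod_exp_ofReal]
  have h2 : ∀ j, ∫ y : Fin (k j) → ℝ, ∏ i, cis (b j i * y i)
      ∂(Measure.pi fun _ : Fin (k j) => gaussianReal 0 (w j).toNNReal) =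
      Complex.exp ((∑ i, -(b j i ^ 2 * w j) / 2 : ℝ)) := by
    intro j
    rw [integral_fintype_prod_eq_prod (f := fun i (x : ℝ) => cis (b j i * x)), ← prod_exp_ofReal]
    exact Finset.prod_congr rfl fun i _ => integral_cis_gaussian _ (hw j) _
  simp_rw [h1, h2, prod_exp_ofReal]
  rw [← Complex.exp_add, ← Complex.ofReal_add, Finset.sum_add_distrib]

end GaussianLimit

/-! ### Convergence in distribution of eigenvalues -/

section EigenvalueConvergence

open Matrix ComplexConjugate

variable {𝕜 : Type*} [RCLike 𝕜] {q r : ℕ} {k : Fin q → ℕ}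

lemma measurable_coords {Ω : Type*} [MeasurableSpace Ω] {m : ℕ} {W : Ω → Matrix (Fin m) (Fin m) 𝕜}
    (hW : ∀ i i', Measurable fun ω => W ω i i') (i i' : Fin m) :
    Measurable fun ω => coords (W ω) i i' := by
  unfold coords
  split_ifs
  · exact RCLike.measurable_re.comp (hW i i')
  · exact RCLike.measurable_im.comp (hW i' i)

/-- Random Hermitian matrices whose coordinates converge in the sense of characteristic functions
have eigenvalues that converge in distribution. -/
lemma tendstoInDistribution_eig {Ω Ω' : Type*} [MeasurableSpace Ω] [MeasurableSpace Ω']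
    {P : Measure Ω} [IsProbabilityMeasure P] {P' : Measure Ω'} [IsProbabilityMeasure P']
    {W : ℕ → Ω → (j : Fin q) → Matrix (Fin (k j)) (Fin (k j)) 𝕜}
    {W' : Ω' → (j : Fin q) → Matrix (Fin (k j)) (Fin (k j)) 𝕜}
    (hW : ∀ n ω j, (W n ω j).IsHermitian) (hW' : ∀ ω j, (W' ω j).IsHermitian)
    (hm : ∀ n j i i', Measurable fun ω => W n ω j i i')
    (hm' : ∀ j i i', Measurable fun ω => coords (W' ω j) i i')
    (h : ∀ t : (j : Fin q) → Fin (k j) → Fin (k j) → ℝ, Tendsto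
      (fun n => ∫ ω, cis (∑ j, ∑ i, ∑ i', t j i i' * coords (W n ω j) i i') ∂P) atTop
      (𝓝 (∫ ω, cis (∑ j, ∑ i, ∑ i', t j i i' * coords (W' ω j) i i') ∂P'))) :
    TendstoInDistribution (fun n ω (p : (j : Fin q) × Fin (k j)) => eig (W n ω p.1) (p.2 + 1)) atTop
      (fun ω p => eig (W' ω p.1) (p.2 + 1)) (fun _ => P) P' := by
  let Z : ℕ → Ω → EuclideanSpace ℝ ((j : Fin q) × (Fin (k j) × Fin (k j))) :=
    fun n ω => WithLp.toLp 2 fun p => coords (W n ω p.1) p.2.1 p.2.2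
  let Z' : Ω' → EuclideanSpace ℝ ((j : Fin q) × (Fin (k j) × Fin (k j))) :=
    fun ω => WithLp.toLp 2 fun p => coords (W' ω p.1) p.2.1 p.2.2
  -- The eigenvalues as a continuous function of the real coordinates: Lévy's theorem gives
  -- convergence of the coordinates, and the continuous mapping theorem that of the eigenvalues.
  let F : EuclideanSpace ℝ ((j : Fin q) × (Fin (k j) × Fin (k j))) →
      ((j : Fin q) × Fin (k j)) → ℝ := fun z p =>
    eig (hermOf 𝕜 fun i i' => z ⟨p.1, i, i'⟩) (p.2 + 1)
  have hF : Continuous F := by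
    refine continuous_pi fun p => continuous_eig_comp (fun z => isHermitian_hermOf _) ?_ _
    refine continuous_hermOf.comp ?_
    fun_prop
  have hZ : ∀ n, Measurable (Z n) := fun n => (WithLp.measurable_toLp 2 _).comp
    (measurable_pi_lambda _ fun p => measurable_coords (hm n p.1) _ _)
  have hZ' : Measurable Z' := (WithLp.measurable_toLp 2 _).comp
    (measurable_pi_lambda _ fun p => hm' p.1 _ _)
  have hin : ∀ (f : (j : Fin q) → Fin (k j) → Fin (k j) → ℝ) 
      (t : EuclideanSpace ℝ ((j : Fin q) × (Fin (k j) × Fin (k j)))),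
      inner ℝ (WithLp.toLp 2 fun p => f p.1 p.2.1 p.2.2) t =
        ∑ j, ∑ i, ∑ i', t ⟨j, i, i'⟩ * f j i i' := by
    intro f t
    simp only [PiLp.inner_apply, RCLike.inner_apply, conj_trivial]
    rw [Fintype.sum_sigma]
    exact Finset.sum_congr rfl fun j _ => by rw [Fintype.sum_prod_type]
  have hconv : TendstoInDistribution Z atTop Z' (fun _ => P) P' := by
    refine ⟨fun n => (hZ n).aemeasurable, hZ'.aemeasurable, ?_⟩
    refine ProbabilityMeasure.tendsto_iff_tendsto_charFun.2 fun t => ?_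
    have h1 : ∀ n, charFun (P.map (Z n)) t =
        ∫ ω, cis (∑ j, ∑ i, ∑ i', t ⟨j, i, i'⟩ * coords (W n ω j) i i') ∂P := by
      intro n
      rw [charFun_apply, integral_map (hZ n).aemeasurable (by fun_prop)]
      refine integral_congr_ae (ae_of_all _ fun ω => ?_)
      exact congrArg cis (hin (fun j i i' => coords (W n ω j) i i') t)
    have h2 : charFun (P'.map Z') t =
        ∫ ω, cis (∑ j, ∑ i, ∑ i', t ⟨j, i, i'⟩ * coords (W' ω j) i i') ∂P' := by
      rw [charFun_apply, integral_map hZ'.aemeasurable (by fun_prop)]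
      refine integral_congr_ae (ae_of_all _ fun ω => ?_)
      exact congrArg cis (hin (fun j i i' => coords (W' ω j) i i') t)
    simp only [ProbabilityMeasure.coe_mk, h1, h2]
    exact h fun j i i' => t ⟨j, i, i'⟩
  have hfin := hconv.continuous_comp hF
  have e1 : (fun n ω (p : (j : Fin q) × Fin (k j)) => eig (W n ω p.1) (p.2 + 1)) =
      fun n => F ∘ Z n := by
    funext n ω p
    simp only [F, Z, Function.comp]
    congr 1
    exact (hermOf_coords (hW n ω p.1)).symm
  have e2 : (fun ω (p : (j : Fin q) × Fin (k j)) => eig (W' ω p.1) (p.2 + 1)) = F ∘ Z' := by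
    funext ω p
    simp only [F, Z', Function.comp]
    congr 1
    exact (hermOf_coords (hW' ω p.1)).symm
  rw [e1, e2]
  exact hfin

/-- The extension by zero of a matrix on the indices with `θ = α`. -/
noncomputable def extendMat {θ : Fin r → ℝ} {α : ℝ} {m : ℕ} (e : Fin m ≃ {a : Fin r // θ a = α})
    (C : Fin m → Fin m → 𝕜) (s t : Fin r) : 𝕜 :=
  if h : θ s = α ∧ θ t = α then C (e.symm ⟨s, h.1⟩) (e.symm ⟨t, h.2⟩) else 0

lemma sum_eq_sum_comp_equiv {m : ℕ} {p : Fin r → Prop} (e : Fin m ≃ {a : Fin r // p a})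
    {M : Type*} [AddCommMonoid M] {f : Fin r → M} (hf : ∀ a, ¬ p a → f a = 0) :
    ∑ a, f a = ∑ i, f (e i) := by
  classical
  rw [e.sum_comp (fun a : {a // p a} => f a), ← Finset.sum_filter_of_ne (p := p)
    fun a _ h => not_imp_comm.1 (hf a) h]
  exact (Finset.sum_subtype _ (by simp) _)

lemma extendMat_apply {θ : Fin r → ℝ} {α : ℝ} {m : ℕ} (e : Fin m ≃ {a : Fin r // θ a = α})
    (C : Fin m → Fin m → 𝕜) (i j : Fin m) : extendMat e C (e i) (e j) = C i j := by
  rw [extendMat, dif_pos ⟨(e i).2, (e j).2⟩]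
  simp

lemma sum_extendMat {θ : Fin r → ℝ} {α : ℝ} {m : ℕ} (e : Fin m ≃ {a : Fin r // θ a = α})
    (C : Fin m → Fin m → 𝕜) {f : 𝕜 → Fin r → Fin r → ℝ} (hf : ∀ s t, f 0 s t = 0) :
    ∑ s, ∑ t, f (extendMat e C s t) s t = ∑ i, ∑ j, f (C i j) (e i) (e j) := by
  rw [sum_eq_sum_comp_equiv e]
  · refine Finset.sum_congr rfl fun i _ => ?_
    rw [sum_eq_sum_comp_equiv e]
    · simp_rw [extendMat_apply]
    · intro a ha
      rw [extendMat, dif_neg (fun h => ha h.2), hf]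
  · intro a ha
    refine Finset.sum_eq_zero fun t _ => ?_
    rw [extendMat, dif_neg (fun h => ha h.1), hf]

lemma sum_extendMat_diag {θ : Fin r → ℝ} {α : ℝ} {m : ℕ} (e : Fin m ≃ {a : Fin r // θ a = α})
    (C : Fin m → Fin m → 𝕜) {f : 𝕜 → ℝ} (hf : f 0 = 0) :
    ∑ s, f (extendMat e C s s) = ∑ i, f (C i i) := by
  rw [sum_eq_sum_comp_equiv e]
  · simp_rw [extendMat_apply]
  · intro a ha
    rw [extendMat, dif_neg (fun h => ha h.1), hf]

lemma extendMat_conj {θ : Fin r → ℝ} {α : ℝ} {m : ℕ} (e : Fin m ≃ {a : Fin r // θ a = α})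
    {C : Fin m → Fin m → 𝕜} (hC : ∀ i j, C j i = conj (C i j)) (s t : Fin r) :
    extendMat e C t s = conj (extendMat e C s t) := by
  unfold extendMat
  by_cases h : θ s = α ∧ θ t = α
  · rw [dif_pos h, dif_pos h.symm, hC]
  · rw [dif_neg h, dif_neg (fun h' => h h'.symm), map_zero]

/-- Convergence of the characteristic functions of the coordinates of the rescaled blocks. -/
lemma tendsto_integral_cis_block {ν : Measure 𝕜} {ν₀ : Measure ℝ} {u : Bool → 𝕜}
    {Ω : Type*} [MeasurableSpace Ω] {P : Measure Ω} [IsProbabilityMeasure P]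
    (hd : RealDecomposition ν ν₀ u)
    {x : (n : ℕ) → (Fin r × Fin n) × Bool → Ω → ℝ} (hx : ∀ n, StdFamily ν₀ (x n) P)
    {A : (n : ℕ) → Fin q → Matrix (Fin n) (Fin n) 𝕜} (hA : ∀ n j, (A n j).IsHermitian)
    {β : ℝ} (hβ : ∀ᶠ n in atTop, ∀ j, HermBound (A n j) β) {σ l : Fin q → ℝ}
    (hσ : ∀ j, Tendsto (fun n : ℕ => (n : ℝ)⁻¹ * ∑ a, ∑ b, ‖A n j a b‖ ^ 2) atTop (𝓝 (σ j)))
    (hl : ∀ j, Tendsto (fun n : ℕ => (n : ℝ)⁻¹ * ∑ a, RCLike.re (A n j a a) ^ 2) atTop (𝓝 (l j)))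
    {θ : Fin r → ℝ} {α : Fin q → ℝ} (hα : Function.Injective α)
    (e : (j : Fin q) → Fin (k j) ≃ {a : Fin r // θ a = α j}) (s : Fin q → ℝ)
    (t : (j : Fin q) → Fin (k j) → Fin (k j) → ℝ) :
    Tendsto (fun n : ℕ => ∫ ω, cis (∑ j, ∑ i, ∑ i', t j i i' * coords (block (e j) (s j)
        (of fun a b => (((√(n : ℝ))⁻¹ : ℝ) : 𝕜) * fluct (A n j) (entries u (x n) ω) a b)) i i') ∂P)
      atTop (𝓝 (Complex.exp (-((∑ j, (tauConst 𝕜 * (σ j / s j ^ 2 *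
        ∑ i, ∑ i', coordWeight 𝕜 i i' * t j i i' ^ 2) +
        kappa4 ν * (l j / s j ^ 2 * ∑ i, t j i i ^ 2))) / 2 : ℝ)))) := by
  -- The functional `t` of the block coordinates, carried to all `r` indices by duality and
  -- extension by zero, with the factor `1/s_j` of the block. Different `α_j` have disjoint index
  -- sets, hence disjoint supports.
  let C : Fin q → Fin r → Fin r → 𝕜 := fun j =>
    extendMat (e j) fun i i' => (((s j)⁻¹ : ℝ) : 𝕜) * dualHerm 𝕜 (t j) i i'
  have hC : ∀ j a b, C j b a = conj (C j a b) := fun j a b =>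
    extendMat_conj (e j) (fun i i' => by
      rw [map_mul, RCLike.conj_ofReal, ← isHermitian_dualHerm]) a b
  have hCd : DisjointSupports C := by
    intro a b j j' hj
    by_cases h : θ a = α j
    · right
      simp only [C, extendMat]
      rw [dif_neg]
      exact fun h' => hj (hα (h.symm.trans h'.1))
    · left
      simp only [C, extendMat]
      rw [dif_neg]
      exact fun h' => h h'.1
  have key := tendsto_charFun_fluct hd hx hA hβ hσ hl hC hCd
  have e1 : ∀ (n : ℕ) ω, ∑ j, ∑ a, ∑ b, RCLike.re (C j a b *
      ((((√(n : ℝ))⁻¹ : ℝ) : 𝕜) * fluct (A n j) (entries u (x n) ω) a b)) =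
      ∑ j, ∑ i, ∑ i', t j i i' * coords (block (e j) (s j)
        (of fun a b => (((√(n : ℝ))⁻¹ : ℝ) : 𝕜) * fluct (A n j) (entries u (x n) ω) a b)) i i' := by
    intro n ω
    refine Finset.sum_congr rfl fun j _ => ?_
    have hq : (of fun a b => (((√(n : ℝ))⁻¹ : ℝ) : 𝕜) *
        fluct (A n j) (entries u (x n) ω) a b : Matrix (Fin r) (Fin r) 𝕜).IsHermitian := by
      refine IsHermitian.ext fun a b => ?_
      simp only [of_apply, RCLike.star_def, map_mul, RCLike.conj_ofReal,
        ← fluct_conj (hA n j)]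
    rw [← sum_re_dualHerm_mul _ (isHermitian_block (e j) (s j) hq)]
    simp only [C]
    rw [sum_extendMat (e j) _ (f := fun c a b => RCLike.re (c *
      ((((√(n : ℝ))⁻¹ : ℝ) : 𝕜) * fluct (A n j) (entries u (x n) ω) a b))) (by simp)]
    refine Finset.sum_congr rfl fun i _ => Finset.sum_congr rfl fun i' _ => ?_
    simp only [block, Matrix.smul_apply, submatrix_apply, of_apply, smul_eq_mul]
    congr 1
    ring
  have e2 : ∑ j, (tauConst 𝕜 * (σ j * ∑ a, ∑ b, ‖C j a b‖ ^ 2) +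
      kappa4 ν * (l j * ∑ a, RCLike.re (C j a a) ^ 2)) =
      ∑ j, (tauConst 𝕜 * (σ j / s j ^ 2 * ∑ i, ∑ i', coordWeight 𝕜 i i' * t j i i' ^ 2) +
        kappa4 ν * (l j / s j ^ 2 * ∑ i, t j i i ^ 2)) := by
    refine Finset.sum_congr rfl fun j _ => ?_
    have h1 : ∑ a, ∑ b, ‖C j a b‖ ^ 2 =
        (s j ^ 2)⁻¹ * ∑ i, ∑ i', coordWeight 𝕜 i i' * t j i i' ^ 2 := by
      rw [← sum_norm_dualHerm_sq, Finset.mul_sum]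
      simp only [C]
      rw [sum_extendMat (e j) _ (f := fun c _ _ => ‖c‖ ^ 2) (by simp)]
      refine Finset.sum_congr rfl fun i _ => ?_
      rw [Finset.mul_sum]
      refine Finset.sum_congr rfl fun i' _ => ?_
      rw [norm_mul, mul_pow, RCLike.norm_ofReal, sq_abs, inv_pow]
    have h2 : ∑ a, RCLike.re (C j a a) ^ 2 = (s j ^ 2)⁻¹ * ∑ i, t j i i ^ 2 := by
      simp only [C]
      rw [sum_extendMat_diag (e j) _ (f := fun c => RCLike.re c ^ 2) (by simp), Finset.mul_sum]
      refine Finset.sum_congr rfl fun i _ => ?_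
      rw [RCLike.re_ofReal_mul, re_dualHerm_diag, mul_pow, inv_pow]
    rw [h1, h2]
    ring
  simp_rw [e1, e2] at key
  exact key

end EigenvalueConvergence

/-! ### Convergence in probability of the outliers -/

section InProbability

open Matrix

/-- A quantity that is small whenever `Y` is small and `Z` is bounded converges to zero in
probability if `Y` converges to zero in mean and `Z` is bounded in mean. -/
lemma tendsto_measureReal_of_mean {Ω : Type*} [MeasurableSpace Ω] {P : Measure Ω}
    [IsProbabilityMeasure P] {Y Z err : ℕ → Ω → ℝ} (hY0 : ∀ n ω, 0 ≤ Y n ω)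
    (hZ0 : ∀ n ω, 0 ≤ Z n ω) (hYi : ∀ n, Integrable (Y n) P) (hZi : ∀ n, Integrable (Z n) P)
    (hY : Tendsto (fun n => ∫ ω, Y n ω ∂P) atTop (𝓝 0)) {K : ℝ}
    (hZ : ∀ᶠ n in atTop, ∫ ω, Z n ω ∂P ≤ K)
    (h : ∀ M : ℝ, Tendsto (fun p : ℕ × Ω => err p.1 p.2)
      (comap (fun p : ℕ × Ω => (p.1, Y p.1 p.2)) (atTop ×ˢ 𝓝 0) ⊓ 𝓟 {p | Z p.1 p.2 ≤ M}) (𝓝 0))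
    {ε : ℝ} (hε : 0 < ε) : Tendsto (fun n => P.real {ω | ε ≤ |err n ω|}) atTop (𝓝 0) := by
  have markov : ∀ {f : Ω → ℝ}, (∀ ω, 0 ≤ f ω) → Integrable f P → ∀ {c : ℝ}, 0 < c →
      P.real {ω | c ≤ f ω} ≤ (∫ ω, f ω ∂P) / c := by
    intro f hf hfi c hc
    rw [le_div_iff₀ hc, mul_comm]
    exact mul_meas_ge_le_integral_of_nonneg (ae_of_all _ hf) hfi c
  rw [Metric.tendsto_atTop]
  intro δ hδ
  -- By Markov's inequality, `Z` then exceeds `M` with probability at most `δ/2`.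
  set M : ℝ := 2 * (|K| + 1) / δ with hM
  have hMpos : 0 < M := by positivity
  -- Unfolding the filter yields a threshold for `n` and a radius `ρ` such that `Y < ρ` and `Z ≤ M`
  -- force `|err| < ε`, uniformly in `ω`.
  obtain ⟨s, hs, hsub⟩ := mem_inf_principal.1 (h M (Metric.ball_mem_nhds 0 hε))
  obtain ⟨u, hu, w, hw, huw⟩ := mem_prod_iff.1 hs
  obtain ⟨ρ, hρ, hball⟩ := Metric.mem_nhds_iff.1 hw
  have hsmall : ∀ᶠ n in atTop, ∫ ω, Y n ω ∂P < ρ * (δ / 2) :=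
    hY.eventually (gt_mem_nhds (by positivity))
  obtain ⟨n₀, hn₀⟩ := eventually_atTop.1 ((eventually_mem_set.2 hu).and (hsmall.and hZ))
  refine ⟨n₀, fun n hn => ?_⟩
  obtain ⟨h1, h2, h3⟩ := hn₀ n hn
  have hincl : {ω | ε ≤ |err n ω|} ⊆ {ω | ρ ≤ Y n ω} ∪ {ω | M ≤ Z n ω} := by
    intro ω hω
    by_contra hcon
    simp only [Set.mem_union, Set.mem_ofPred_eq, not_or, not_le] at hcon
    have hmem : (n, ω) ∈ (fun p : ℕ × Ω => (p.1, Y p.1 p.2)) ⁻¹' s := huw ⟨h1, hball (by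
      rw [Metric.mem_ball, Real.dist_eq, sub_zero, abs_of_nonneg (hY0 n ω)]
      exact hcon.1)⟩
    have := hsub hmem hcon.2.le
    rw [Set.mem_preimage, Metric.mem_ball, Real.dist_eq, sub_zero] at this
    exact absurd hω (not_le.2 this)
  have hY' := markov (hY0 n) (hYi n) hρ
  have hZ' := markov (hZ0 n) (hZi n) hMpos
  have e1 : (∫ ω, Y n ω ∂P) / ρ < δ / 2 := by rw [div_lt_iff₀ hρ]; linarith
  have e2 : (∫ ω, Z n ω ∂P) / M ≤ δ / 2 := by
    rw [div_le_iff₀ hMpos, hM]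
    have : δ / 2 * (2 * (|K| + 1) / δ) = |K| + 1 := by field_simp
    rw [this]
    linarith [le_abs_self K]
  rw [Real.dist_eq, sub_zero, abs_of_nonneg measureReal_nonneg]
  calc P.real {ω | ε ≤ |err n ω|} ≤ P.real ({ω | ρ ≤ Y n ω} ∪ {ω | M ≤ Z n ω}) :=
        measureReal_mono hincl
    _ ≤ P.real {ω | ρ ≤ Y n ω} + P.real {ω | M ≤ Z n ω} := measureReal_union_le _ _
    _ < δ := by linarith

variable {𝕜 : Type*} [RCLike 𝕜] {r : ℕ} {ν : Measure 𝕜} {ν₀ : Measure ℝ} {u : Bool → 𝕜}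
  {Ω : Type*} [MeasurableSpace Ω] {P : Measure Ω} [IsProbabilityMeasure P]

/-- The Hilbert-Schmidt norm of the fluctuations. -/
noncomputable def fluctNorm {n : ℕ} (B : Matrix (Fin n) (Fin n) 𝕜) (g : Fin r → Fin n → 𝕜) : ℝ :=
  ∑ s, ∑ t, ‖fluct B g s t‖ ^ 2

lemma fluctNorm_nonneg {n : ℕ} (B : Matrix (Fin n) (Fin n) 𝕜) (g : Fin r → Fin n → 𝕜) :
    0 ≤ fluctNorm B g :=
  Finset.sum_nonneg fun _ _ => Finset.sum_nonneg fun _ _ => sq_nonneg _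

lemma norm_fluct_sq_le {n : ℕ} (B : Matrix (Fin n) (Fin n) 𝕜) (g : Fin r → Fin n → 𝕜)
    (s t : Fin r) : ‖fluct B g s t‖ ^ 2 ≤ fluctNorm B g :=
  (Finset.single_le_sum (f := fun t => ‖fluct B g s t‖ ^ 2) (fun _ _ => sq_nonneg _)
    (Finset.mem_univ t)).trans
    (Finset.single_le_sum (f := fun s => ∑ t, ‖fluct B g s t‖ ^ 2)
      (fun _ _ => Finset.sum_nonneg fun _ _ => sq_nonneg _) (Finset.mem_univ s))

lemma integral_fluctNorm_le {n : ℕ} (hd : RealDecomposition ν ν₀ u)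
    {x : (Fin r × Fin n) × Bool → Ω → ℝ} (hx : StdFamily ν₀ x P) {B : Matrix (Fin n) (Fin n) 𝕜}
    (hB : B.IsHermitian) : Integrable (fun ω => fluctNorm B (entries u x ω)) P ∧
      ∫ ω, fluctNorm B (entries u x ω) ∂P ≤
        (r : ℝ) ^ 2 * fluctConst 𝕜 ν₀ * ∑ a, ∑ b, ‖B a b‖ ^ 2 := by
  have h := integral_norm_fluct_sq_le hd hx hB
  have hi : ∀ s, Integrable (fun ω => ∑ t, ‖fluct B (entries u x ω) s t‖ ^ 2) P := fun s =>
    integrable_finsetSum _ fun t _ => (h s t).1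
  refine ⟨integrable_finsetSum _ fun s _ => hi s, ?_⟩
  unfold fluctNorm
  rw [integral_finsetSum _ fun s _ => hi s]
  calc ∑ s, ∫ ω, ∑ t, ‖fluct B (entries u x ω) s t‖ ^ 2 ∂P
      = ∑ s, ∑ t, ∫ ω, ‖fluct B (entries u x ω) s t‖ ^ 2 ∂P :=
        Finset.sum_congr rfl fun s _ => integral_finsetSum _ fun t _ => (h s t).1
    _ ≤ ∑ _s : Fin r, ∑ _t : Fin r, fluctConst 𝕜 ν₀ * ∑ a, ∑ b, ‖B a b‖ ^ 2 :=
        Finset.sum_le_sum fun s _ => Finset.sum_le_sum fun t _ => (h s t).2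
    _ = _ := by
        simp only [Finset.sum_const, Finset.card_univ, Fintype.card_fin, nsmul_eq_mul]
        ring

/-- Column by column, by two applications of the operator bound. The order `n` suffices, because the
sum is going to be divided by `n²`. -/
lemma SpectralGap.sum_norm_resolv_sq_le {n : ℕ} {X : Matrix (Fin n) (Fin n) 𝕜}
    (hX : X.IsHermitian) {z η : ℝ} (h : SpectralGap X z η) (hη : 0 < η) :
    ∑ a, ∑ b, ‖(resolv X z * resolv X z) a b‖ ^ 2 ≤ η⁻¹ ^ 2 * (η⁻¹ ^ 2 * n) := by
  have key : ∀ b, ∑ a, ‖(resolv X z * resolv X z) a b‖ ^ 2 ≤ η⁻¹ ^ 2 * (η⁻¹ ^ 2 * 1) := by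
    intro b
    have e1 : ∑ a, ‖(resolv X z * resolv X z) a b‖ ^ 2 =
        nsq ((resolv X z).mulVec ((resolv X z).mulVec (Pi.single b 1))) := by
      rw [mulVec_mulVec, nsq]
      refine Finset.sum_congr rfl fun a _ => ?_
      rw [mulVec_single_one]
      rfl
    have e2 : nsq (Pi.single b (1 : 𝕜) : Fin n → 𝕜) = 1 := by
      rw [nsq, Finset.sum_eq_single b]
      · simp
      · intro c _ hc
        simp [Pi.single_eq_of_ne hc]
      · simp
    rw [e1, ← e2]
    exact (h.nsq_resolv_mulVec_le hX hη _).trans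
      (mul_le_mul_of_nonneg_left (h.nsq_resolv_mulVec_le hX hη _) (sq_nonneg _))
  rw [Finset.sum_comm]
  calc _ ≤ ∑ _b : Fin n, η⁻¹ ^ 2 * (η⁻¹ ^ 2 * 1) := Finset.sum_le_sum fun b _ => key b
    _ = _ := by
      simp only [Finset.sum_const, Finset.card_univ, Fintype.card_fin, nsmul_eq_mul]
      ring

/-- A quantity that vanishes in the limit along every filter with the deterministic properties of
the perturbing vectors does so in probability. -/
lemma tendsto_measureReal_of_fluct (mod : Model) (hd : RealDecomposition ν ν₀ u)
    {x : (n : ℕ) → (Fin r × Fin n) × Bool → Ω → ℝ} (hx : ∀ n, StdFamily ν₀ (x n) P)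
    {X : (n : ℕ) → Matrix (Fin n) (Fin n) 𝕜} (hX : ∀ n, (X n).IsHermitian) {z η σ : ℝ}
    (hη : 0 < η) (hgap : ∀ᶠ n in atTop, SpectralGap (X n) z η)
    (hσ : Tendsto (fun n : ℕ => (n : ℝ)⁻¹ * ∑ a, ∑ b, ‖centredResolv mod (X n) z a b‖ ^ 2) atTop
      (𝓝 σ))
    {err : (n : ℕ) → (Fin r → Fin n → 𝕜) → ℝ}
    (herr : ∀ F : Filter (ℕ × Ω), Tendsto Prod.fst F atTop →
      (∀ a b : Fin r, Tendsto (fun p : ℕ × Ω => (((p.1 : ℝ)⁻¹ : ℝ) : 𝕜) *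
        fluct 1 (entries u (x p.1) p.2) a b) F (𝓝 0)) →
      (∀ a b : Fin r, Tendsto (fun p : ℕ × Ω => (((p.1 : ℝ)⁻¹ : ℝ) : 𝕜) *
        fluct (resolv (X p.1) z * resolv (X p.1) z) (entries u (x p.1) p.2) a b) F (𝓝 0)) →
      (∃ M, ∀ᶠ p in F, ∀ a b : Fin r, ‖qmat mod (X p.1) z (entries u (x p.1) p.2) a b‖ ≤ M) →
      Tendsto (fun p : ℕ × Ω => err p.1 (entries u (x p.1) p.2)) F (𝓝 0))
    {ε : ℝ} (hε : 0 < ε) :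
    Tendsto (fun n => P.real {ω | ε ≤ |err n (entries u (x n) ω)|}) atTop (𝓝 0) := by
  -- `Y` gathers the quantities that must vanish; its mean is `O(1/n)`. `Z` gathers those that need
  -- only be bounded. One filter on `ℕ × Ω` encodes both, so the deterministic results apply along
  -- it.
  let Y : ℕ → Ω → ℝ := fun n ω => ((n : ℝ)⁻¹) ^ 2 * (fluctNorm 1 (entries u (x n) ω) +
    fluctNorm (resolv (X n) z * resolv (X n) z) (entries u (x n) ω))
  let Z : ℕ → Ω → ℝ := fun n ω => (n : ℝ)⁻¹ * fluctNorm (centredResolv mod (X n) z)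
    (entries u (x n) ω)
  have hR2 : ∀ n, (resolv (X n) z * resolv (X n) z).IsHermitian := fun n => by
    have := isHermitian_resolv (hX n) z
    rw [IsHermitian, conjTranspose_mul, this.eq]
  have b1 := fun n => integral_fluctNorm_le hd (hx n) (isHermitian_one (n := Fin n) (α := 𝕜))
  have b2 := fun n => integral_fluctNorm_le hd (hx n) (hR2 n)
  have b3 := fun n => integral_fluctNorm_le hd (hx n) (isHermitian_centredResolv mod (hX n) z)
  set c : ℝ := (r : ℝ) ^ 2 * fluctConst 𝕜 ν₀ with hc
  have hc0 : 0 ≤ c := mul_nonneg (sq_nonneg _) (fluctConst_nonneg ν₀)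
  have hone : ∀ n : ℕ, ∑ a, ∑ b, ‖(1 : Matrix (Fin n) (Fin n) 𝕜) a b‖ ^ 2 = n := by
    intro n
    have : ∀ a b, ‖(1 : Matrix (Fin n) (Fin n) 𝕜) a b‖ ^ 2 = if a = b then 1 else 0 := by
      intro a b
      rw [one_apply]
      split_ifs <;> simp
    simp [this]
  refine tendsto_measureReal_of_mean (Y := Y) (Z := Z) (K := c * (σ + 1)) ?_ ?_ ?_ ?_ ?_ ?_ ?_ hε
  · exact fun n ω => mul_nonneg (sq_nonneg _)
      (add_nonneg (fluctNorm_nonneg _ _) (fluctNorm_nonneg _ _))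
  · exact fun n ω => mul_nonneg (by positivity) (fluctNorm_nonneg _ _)
  · exact fun n => ((b1 n).1.add (b2 n).1).const_mul _
  · exact fun n => (b3 n).1.const_mul _
  · have hup : Tendsto (fun n : ℕ => (n : ℝ)⁻¹ * (c * (1 + η⁻¹ ^ 2 * η⁻¹ ^ 2))) atTop (𝓝 0) := by
      have := (tendsto_inv_atTop_zero.comp (tendsto_natCast_atTop_atTop (R := ℝ))).mul_const
        (c * (1 + η⁻¹ ^ 2 * η⁻¹ ^ 2))
      rwa [zero_mul] at this
    refine squeeze_zero' (Eventually.of_forall fun n => integral_nonneg fun ω =>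
      mul_nonneg (sq_nonneg _) (add_nonneg (fluctNorm_nonneg _ _) (fluctNorm_nonneg _ _))) ?_ hup
    filter_upwards [hgap, eventually_gt_atTop 0] with n hn hpos
    have hnpos : (0 : ℝ) < n := Nat.cast_pos.2 hpos
    rw [integral_const_mul, integral_add (b1 n).1 (b2 n).1]
    have i1 := (b1 n).2
    rw [hone n] at i1
    have i2 := (b2 n).2.trans (mul_le_mul_of_nonneg_left (hn.sum_norm_resolv_sq_le (hX n) hη) hc0)
    calc ((n : ℝ)⁻¹) ^ 2 * _ ≤ ((n : ℝ)⁻¹) ^ 2 * (c * n + c * (η⁻¹ ^ 2 * (η⁻¹ ^ 2 * n))) :=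
          mul_le_mul_of_nonneg_left (add_le_add i1 i2) (sq_nonneg _)
      _ = _ := by field_simp
  · filter_upwards [hσ.eventually (gt_mem_nhds (lt_add_one σ))] with n hn
    rw [integral_const_mul]
    calc (n : ℝ)⁻¹ * _ ≤ (n : ℝ)⁻¹ * (c * ∑ a, ∑ b, ‖centredResolv mod (X n) z a b‖ ^ 2) :=
          mul_le_mul_of_nonneg_left (b3 n).2 (by positivity)
      _ = c * ((n : ℝ)⁻¹ * ∑ a, ∑ b, ‖centredResolv mod (X n) z a b‖ ^ 2) := by ring
      _ ≤ c * (σ + 1) := mul_le_mul_of_nonneg_left hn.le hc0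
  · intro M
    have hYt : Tendsto (fun p : ℕ × Ω => (p.1, Y p.1 p.2))
        (comap (fun p : ℕ × Ω => (p.1, Y p.1 p.2)) (atTop ×ˢ 𝓝 0) ⊓ 𝓟 {p | Z p.1 p.2 ≤ M})
        (atTop ×ˢ 𝓝 0) := tendsto_comap.mono_left inf_le_left
    have hY1 := tendsto_fst.comp hYt
    have hY2 := tendsto_snd.comp hYt
    have hsmall : ∀ (B : (n : ℕ) → Matrix (Fin n) (Fin n) 𝕜), (∀ (n : ℕ) ω,
        ((n : ℝ)⁻¹) ^ 2 * fluctNorm (B n) (entries u (x n) ω) ≤ Y n ω) → ∀ a b : Fin r,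
        Tendsto (fun p : ℕ × Ω => (((p.1 : ℝ)⁻¹ : ℝ) : 𝕜) *
          fluct (B p.1) (entries u (x p.1) p.2) a b)
          (comap (fun p : ℕ × Ω => (p.1, Y p.1 p.2)) (atTop ×ˢ 𝓝 0) ⊓ 𝓟 {p | Z p.1 p.2 ≤ M})
          (𝓝 0) := by
      intro B hB a b
      rw [tendsto_zero_iff_norm_tendsto_zero]
      have hs : Tendsto (fun p : ℕ × Ω => √(Y p.1 p.2)) (comap (fun p : ℕ × Ω => (p.1, Y p.1 p.2))
          (atTop ×ˢ 𝓝 0) ⊓ 𝓟 {p | Z p.1 p.2 ≤ M}) (𝓝 0) := by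
        have := (Real.continuous_sqrt.tendsto 0).comp hY2
        rwa [Real.sqrt_zero] at this
      refine squeeze_zero (fun _ => norm_nonneg _) (fun p => ?_) hs
      refine Real.le_sqrt_of_sq_le (le_trans ?_ (hB p.1 p.2))
      rw [norm_mul, mul_pow, RCLike.norm_ofReal, sq_abs]
      exact mul_le_mul_of_nonneg_left (norm_fluct_sq_le _ _ _ _) (sq_nonneg _)
    refine herr _ hY1 (hsmall (fun n => 1) fun n ω => ?_)
      (hsmall (fun n => resolv (X n) z * resolv (X n) z) fun n ω => ?_) ⟨√M, ?_⟩
    · exact mul_le_mul_of_nonneg_left (le_add_of_nonneg_right (fluctNorm_nonneg _ _)) (sq_nonneg _)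
    · exact mul_le_mul_of_nonneg_left (le_add_of_nonneg_left (fluctNorm_nonneg _ _)) (sq_nonneg _)
    · filter_upwards [mem_inf_of_right (mem_principal_self _)] with p hp a b
      refine Real.le_sqrt_of_sq_le (le_trans ?_ hp)
      simp only [qmat, of_apply]
      rw [norm_mul, mul_pow, RCLike.norm_ofReal, sq_abs, inv_pow,
        Real.sq_sqrt (Nat.cast_nonneg _)]
      exact mul_le_mul_of_nonneg_left (norm_fluct_sq_le _ _ _ _) (by positivity)

lemma tendstoInMeasure_pi_zero {ι : Type*} [Fintype ι] {f : ℕ → Ω → ι → ℝ}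
    (h : ∀ i, ∀ ε > 0, Tendsto (fun n => P.real {ω | ε ≤ |f n ω i|}) atTop (𝓝 0)) :
    TendstoInMeasure P f atTop 0 := by
  rw [tendstoInMeasure_iff_measureReal_norm]
  intro ε hε
  have hsum := tendsto_finsetSum Finset.univ fun i (_ : i ∈ Finset.univ) => h i ε hε
  rw [Finset.sum_const_zero] at hsum
  refine squeeze_zero (fun _ => measureReal_nonneg) (fun n => ?_) hsum
  refine le_trans (measureReal_mono ?_ (measure_ne_top _ _))
    (measureReal_biUnion_finset_le Finset.univ _)
  intro ω hω
  by_contra hcon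
  simp only [Finset.mem_univ, Set.iUnion_true, Set.mem_iUnion, Set.mem_ofPred_eq, not_exists,
    not_le] at hcon
  have hω' : ε ≤ ‖f n ω - (0 : Ω → ι → ℝ) ω‖ := hω
  refine absurd hω' (not_le.2 ?_)
  simp only [Pi.zero_apply, sub_zero]
  exact (pi_norm_lt_iff hε).2 hcon

end InProbability

/-! ### The limit law of the outliers -/

section OutlierLimit

open Matrix

variable {𝕜 : Type*} [RCLike 𝕜] {r q : ℕ} {X : (n : ℕ) → Matrix (Fin n) (Fin n) 𝕜} {μ : Measure ℝ}
  {a b : ℝ} {θ : Fin r → ℝ} {α : Fin q → ℝ}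

lemma SpectralHyp.spike_facts (hX : SpectralHyp X μ a b)
    (hα_range : Set.range α = {t | t ∈ Set.range θ ∧ rho μ a b t ∉ ({a, b} : Set ℝ)}) (j : Fin q) :
    ((0 < α j ∧ b < rho μ a b (α j) ∧ ∀ s, α j < θ s → θ s ∈ Set.range α) ∨
      (α j < 0 ∧ rho μ a b (α j) < a ∧ ∀ s, θ s < α j → θ s ∈ Set.range α)) ∧
    cauchyG μ (rho μ a b (α j)) = (α j)⁻¹ := by
  have := hX.isProbabilityMeasure
  have hspec := fun t => rho_spec (μ := μ) hX.ae_mem hX.le (α := t)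
  have hjm : α j ∈ {t | t ∈ Set.range θ ∧ rho μ a b t ∉ ({a, b} : Set ℝ)} :=
    hα_range ▸ Set.mem_range_self j
  have hsup := supercritical_of_rho_ne hjm.2
  -- If the threshold were negative, `0` would count as supercritical, whereas `rho_spec` makes
  -- supercritical values nonzero.
  have hupper : 0 ≤ thetaUpper μ b := by
    by_contra! h
    have := (hspec 0 (Or.inr h)).1
    simp at this
  have hlower : thetaLower μ a ≤ 0 := by
    by_contra! h
    have := (hspec 0 (Or.inl h)).1
    simp at this
  have hmem : ∀ s, θ s < thetaLower μ a ∨ thetaUpper μ b < θ s → θ s ∈ Set.range α := by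
    intro s hs
    rw [hα_range]
    refine ⟨Set.mem_range_self s, ?_⟩
    have hab := hX.le
    simp only [Set.mem_insert_iff, Set.mem_singleton_iff, not_or]
    rcases (hspec _ hs).1 with h | h
    · exact ⟨(hab.trans_lt h.2).ne', h.2.ne'⟩
    · exact ⟨h.2.ne, (h.2.trans_le hab).ne⟩
  refine ⟨?_, (hspec _ hsup).2⟩
  rcases (hspec _ hsup).1 with h | h
  · refine Or.inl ⟨h.1, h.2, fun s hs => hmem s (Or.inr ?_)⟩
    rcases hsup with h' | h'
    · linarith [h.1]
    · exact h'.trans hs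
  · refine Or.inr ⟨h.1, h.2, fun s hs => hmem s (Or.inl ?_)⟩
    rcases hsup with h' | h'
    · exact hs.trans h'
    · linarith [h.1]

lemma SpectralHyp.rho_notMem (hX : SpectralHyp X μ a b)
    (hα_range : Set.range α = {t | t ∈ Set.range θ ∧ rho μ a b t ∉ ({a, b} : Set ℝ)}) (j : Fin q) :
    rho μ a b (α j) ∉ Set.Icc a b ∧ α j ≠ 0 := by
  rcases (hX.spike_facts hα_range j).1 with h | h
  · exact ⟨fun h' => absurd h'.2 (not_le.2 h.2.1), h.1.ne'⟩
  · exact ⟨fun h' => absurd h'.1 (not_le.2 h.2.1), h.1.ne⟩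

/-- The rescaled outliers are close to the eigenvalues of the blocks, along every filter with the
deterministic properties of the perturbing vectors. -/
lemma tendsto_gam_sub (mod : Model) (hX : SpectralHyp X μ a b) (hα : StrictMono α)
    (hα_range : Set.range α = {t | t ∈ Set.range θ ∧ rho μ a b t ∉ ({a, b} : Set ℝ)})
    {j : Fin q} (hrate : Tendsto
      (fun n : ℕ => √(n : ℝ) * (cauchyG (spectralMeasure (X n)) (rho μ a b (α j))
        - cauchyG μ (rho μ a b (α j)))) atTop (𝓝 0))
    (i : Fin (mult θ (α j))) (e : Fin (mult θ (α j)) ≃ {s : Fin r // θ s = α j})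
    {η : ℝ} (hη : 0 < η) (hgap : ∀ᶠ n in atTop, SpectralGap (X n) (rho μ a b (α j)) η ∧
      (b < rho μ a b (α j) → eig (X n) n ≤ rho μ a b (α j) - η) ∧
      (rho μ a b (α j) < a → rho μ a b (α j) + η ≤ eig (X n) 1))
    {ι : Type*} {N : ι → ℕ} {g : (p : ι) → Fin r → Fin (N p) → 𝕜} {F : Filter ι}
    (hN : Tendsto N F atTop)
    (h1 : ∀ s t : Fin r, Tendsto (fun p => (((N p : ℝ)⁻¹ : ℝ) : 𝕜) * fluct 1 (g p) s t) F (𝓝 0))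
    (h2 : ∀ s t : Fin r, Tendsto (fun p => (((N p : ℝ)⁻¹ : ℝ) : 𝕜) *
      fluct (resolv (X (N p)) (rho μ a b (α j)) * resolv (X (N p)) (rho μ a b (α j))) (g p) s t)
      F (𝓝 0))
    (h3 : ∃ M, ∀ᶠ p in F, ∀ s t : Fin r, ‖qmat mod (X (N p)) (rho μ a b (α j)) (g p) s t‖ ≤ M) :
    Tendsto (fun p => gam (perturbed (X (N p)) θ (vecs mod (g p))) α (fun j => rho μ a b (α j))
        (fun j => mult θ (α j)) j i -
      eig (block e (∫ x, 1 / (rho μ a b (α j) - x) ^ 2 ∂μ)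
        (qmat mod (X (N p)) (rho μ a b (α j)) (g p))) (i + 1)) F (𝓝 0) := by
  obtain ⟨hcase, hG⟩ := hX.spike_facts hα_range j
  obtain ⟨hz, hα0⟩ := hX.rho_notMem hα_range j
  have hs0 := hX.integral_sq_pos hz hα0 hG
  have hs := (hX.tendsto_integral_sq hz).comp hN
  have hGN := hrate.comp hN
  rw [hG] at hGN
  have hgapN := hN.eventually hgap
  have hsum := sum_Iio_add_sum_Ioi (fun j => mult θ (α j)) j
  have hi := i.2
  rcases hcase with ⟨hpos, hb, hr⟩ | ⟨hneg, ha, hr⟩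
  · have key := tendsto_outlier_of_pos mod hN hX.hermitian hη (hgapN.mono fun p hp => hp.1) hGN hs
      h1 h2 h3 hs0 (hgapN.mono fun p hp => hp.2.1 hb) hpos e (d := mult θ (α j) - i) (by omega)
      (by omega)
    rw [card_gt_eq_sum_mult hα j hr] at key
    refine key.congr fun p => ?_
    -- The outliers of `gam` are numbered from below, those of `tendsto_outlier_of_pos` from above.
    -- Since `i` starts from `0`, the outlier `i` is the `(k_j - i)`-th largest of its group.
    have e1 : N p + (∑ l ∈ Finset.Iio j, mult θ (α l) + i + 1) - ∑ l, mult θ (α l) =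
        N p + 1 - (∑ l ∈ Finset.Ioi j, mult θ (α l) + (mult θ (α j) - i)) := by
      beta_reduce at hsum
      omega
    have e2 : mult θ (α j) + 1 - (mult θ (α j) - i) = i + 1 := by omega
    simp only [gam, if_neg hpos.not_gt, e1, e2]
  · have key := tendsto_outlier_of_neg mod hN hX.hermitian hη (hgapN.mono fun p hp => hp.1) hGN hs
      h1 h2 h3 hs0 (hgapN.mono fun p hp => hp.2.2 ha) hneg e (d := i + 1) (by omega) (by omega)
    rw [card_lt_eq_sum_mult hα j hr] at key
    refine key.congr fun p => ?_
    simp only [gam, if_pos hneg]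
    rfl

lemma exists_equiv_mult (θ : Fin r → ℝ) (t : ℝ) :
    Nonempty (Fin (mult θ t) ≃ {s : Fin r // θ s = t}) :=
  ⟨(Finite.equivFinOfCardEq rfl).symm⟩

/-- Convergence in distribution of the rescaled outliers on a common probability space. -/
theorem tendstoInDistribution_gam_of_stdFamily (mod : Model) {ν : Measure 𝕜} {ν₀ : Measure ℝ}
    {u : Bool → 𝕜} (hd : RealDecomposition ν ν₀ u)
    {Ω : Type*} [MeasurableSpace Ω] {P : Measure Ω} [IsProbabilityMeasure P]
    {x : (n : ℕ) → (Fin r × Fin n) × Bool → Ω → ℝ} (hx : ∀ n, StdFamily ν₀ (x n) P)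
    (hX : SpectralHyp X μ a b) (hα : StrictMono α)
    (hα_range : Set.range α = {t | t ∈ Set.range θ ∧ rho μ a b t ∉ ({a, b} : Set ℝ)})
    (hrate : ∀ j, Tendsto
      (fun n : ℕ => √(n : ℝ) * (cauchyG (spectralMeasure (X n)) (rho μ a b (α j))
        - cauchyG μ (rho μ a b (α j)))) atTop (𝓝 0))
    {l : ℝ → ℝ} (hl : ∀ z ∉ Set.Icc a b, Tendsto (fun n => diagAverage mod (X n) z) atTop (𝓝 (l z)))
    {Ω' : Type*} [MeasurableSpace Ω'] {P' : Measure Ω'} [IsProbabilityMeasure P']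
    {W' : Ω' → (j : Fin q) → Matrix (Fin (mult θ (α j))) (Fin (mult θ (α j))) 𝕜}
    (hW' : ∀ ω j, (W' ω j).IsHermitian)
    (hm' : ∀ j i i', Measurable fun ω => coords (W' ω j) i i')
    (hlim : ∀ t : (j : Fin q) → Fin (mult θ (α j)) → Fin (mult θ (α j)) → ℝ,
      ∫ ω, cis (∑ j, ∑ i, ∑ i', t j i i' * coords (W' ω j) i i') ∂P' =
      Complex.exp (-((∑ j, (tauConst 𝕜 * (cConst mod μ (α j) (rho μ a b (α j)) ^ 2 *
        ∑ i, ∑ i', coordWeight 𝕜 i i' * t j i i' ^ 2) +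
        extraVar μ l (kappa4 ν) (rho μ a b (α j)) * ∑ i, t j i i ^ 2)) / 2 : ℝ))) :
    TendstoInDistribution (fun n ω (p : (j : Fin q) × Fin (mult θ (α j))) =>
      gam (perturbed (X n) θ (vecs mod (entries u (x n) ω))) α (fun j => rho μ a b (α j))
        (fun j => mult θ (α j)) p.1 p.2) atTop
      (fun ω p => eig (W' ω p.1) (p.2 + 1)) (fun _ => P) P' := by
  have hz := fun j => (hX.rho_notMem hα_range j).1
  have hα0 := fun j => (hX.rho_notMem hα_range j).2
  have hG := fun j => (hX.spike_facts hα_range j).2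
  choose η hη hgap using fun j => hX.eventually_gap (hz j)
  have e : (j : Fin q) → Fin (mult θ (α j)) ≃ {s : Fin r // θ s = α j} := fun j =>
    (exists_equiv_mult θ (α j)).some
  let s : Fin q → ℝ := fun j => ∫ x, 1 / (rho μ a b (α j) - x) ^ 2 ∂μ
  let A : (n : ℕ) → Fin q → Matrix (Fin n) (Fin n) 𝕜 := fun n j =>
    centredResolv mod (X n) (rho μ a b (α j))
  have hA : ∀ n j, (A n j).IsHermitian := fun n j => isHermitian_centredResolv mod (hX.hermitian n) _
  have hσ := fun j => hX.tendsto_hs mod (hz j) (hα0 j) (hG j) (hrate j)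
  have hdiag := fun j => (hX.diagLimit_mem mod (hz j) (hα0 j) (hG j) (hrate j) (hl _ (hz j))).1
  have hβ : ∀ᶠ n in atTop, ∀ j, HermBound (A n j) (∑ j, 2 * (η j)⁻¹) := by
    rw [eventually_all]
    intro j
    filter_upwards [hgap j] with n hn v
    refine (hn.1.hermBound_centred mod (hX.hermitian n) (hη j) v).trans
      (mul_le_mul_of_nonneg_right ?_ (Finset.sum_nonneg fun _ _ => sq_nonneg _))
    have hnn : ∀ j, 0 ≤ 2 * (η j)⁻¹ := fun j => mul_nonneg zero_le_two (inv_nonneg.2 (hη j).le)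
    exact pow_le_pow_left₀ (hnn j)
      (Finset.single_le_sum (f := fun j => 2 * (η j)⁻¹) (fun j _ => hnn j) (Finset.mem_univ j)) 2
  let Q : (n : ℕ) → Ω → (j : Fin q) → Matrix (Fin r) (Fin r) 𝕜 := fun n ω j =>
    qmat mod (X n) (rho μ a b (α j)) (entries u (x n) ω)
  have hent : ∀ n c d, Measurable fun ω => entries u (x n) ω c d := by
    intro n c d
    simp only [entries, entry]
    exact Finset.measurable_fun_sum _ fun b _ =>
      (RCLike.measurable_ofReal.comp ((hx n).meas _)).mul_const _
  have hQm : ∀ n j c d, Measurable fun ω => Q n ω j c d := by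
    intro n j c d
    simp only [Q, qmat, of_apply, fluct]
    refine Measurable.const_mul (Measurable.sub_const ?_ _) _
    refine Finset.measurable_fun_sum _ fun y _ => Finset.measurable_fun_sum _ fun y' _ => ?_
    exact ((RCLike.continuous_conj.measurable.comp (hent n c y)).mul_const _).mul (hent n d y')
  have hconv : TendstoInDistribution (fun n ω (p : (j : Fin q) × Fin (mult θ (α j))) =>
      eig (block (e p.1) (s p.1) (Q n ω p.1)) (p.2 + 1)) atTop
      (fun ω p => eig (W' ω p.1) (p.2 + 1)) (fun _ => P) P' := by
    refine tendstoInDistribution_eig (W := fun n ω j => block (e j) (s j) (Q n ω j))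
      (fun n ω j => isHermitian_block _ _ (isHermitian_qmat mod (hX.hermitian n) _ _)) hW' ?_ hm' ?_
    · intro n j i i'
      simp only [block, Matrix.smul_apply, submatrix_apply, smul_eq_mul]
      exact (hQm n j _ _).const_mul _
    · intro t
      have hexp : ∑ j, (tauConst 𝕜 * (cConst mod μ (α j) (rho μ a b (α j)) ^ 2 *
          ∑ i, ∑ i', coordWeight 𝕜 i i' * t j i i' ^ 2) +
          extraVar μ l (kappa4 ν) (rho μ a b (α j)) * ∑ i, t j i i ^ 2) =
          ∑ j, (tauConst 𝕜 * (hsLimit mod μ (α j) (rho μ a b (α j)) / s j ^ 2 *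
            ∑ i, ∑ i', coordWeight 𝕜 i i' * t j i i' ^ 2) +
            kappa4 ν * (l (rho μ a b (α j)) / s j ^ 2 * ∑ i, t j i i ^ 2)) := by
        refine Finset.sum_congr rfl fun j _ => ?_
        rw [hX.cConst_sq mod (hz j) (hα0 j) (hG j), hX.extraVar_eq (hz j)]
        simp only [s]
        ring
      rw [hlim t, hexp]
      exact tendsto_integral_cis_block hd hx hA hβ hσ hdiag hα.injective e s t
  -- Slutsky's lemma: the eigenvalues of the blocks converge in law, and the outliers differ from
  -- them by a quantity that vanishes in probability.
  refine tendstoInDistribution_of_tendstoInMeasure_sub _ _ hconv ?_ fun n => ?_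
  · refine tendstoInMeasure_pi_zero fun p ε hε => ?_
    exact tendsto_measureReal_of_fluct mod hd hx hX.hermitian (hη p.1)
      ((hgap p.1).mono fun n hn => hn.1) (hσ p.1)
      (err := fun n g => gam (perturbed (X n) θ (vecs mod g)) α (fun j => rho μ a b (α j))
        (fun j => mult θ (α j)) p.1 p.2 - eig (block (e p.1) (s p.1)
          (qmat mod (X n) (rho μ a b (α p.1)) g)) (p.2 + 1))
      (fun F hF h1 h2 h3 => tendsto_gam_sub mod hX hα hα_range (hrate p.1) p.2 (e p.1) (hη p.1)
        (hgap p.1) hF h1 h2 h3) hε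
  · exact Measurable.aemeasurable (measurable_pi_lambda _ fun p =>
      measurable_gam mod (hX.hermitian n) θ (g := fun ω => entries u (x n) ω) (hent n) α
        (fun j => rho μ a b (α j)) (fun j => mult θ (α j)) p.1 p.2)

end OutlierLimit

/-! ### The limit matrices -/

section LimitMatrices

variable {𝕜 : Type*} [RCLike 𝕜] {q : ℕ} {k : Fin q → ℕ}

/-- Both forms of the limit have coordinates `lam x` plus, on the diagonal, `y`, so one computation
of the characteristic function serves for both. -/
lemma integral_cis_coords {w : Fin q → ℝ} (hw : ∀ j, 0 ≤ w j)
    {W : (((j : Fin q) → Fin (k j) → Fin (k j) → ℝ) × ((j : Fin q) → Fin (k j) → ℝ)) →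
      (j : Fin q) → Matrix (Fin (k j)) (Fin (k j)) 𝕜}
    {lam : (j : Fin q) → Fin (k j) → Fin (k j) → ℝ}
    (hW : ∀ xy j i i', coords (W xy j) i i' =
      lam j i i' * xy.1 j i i' + if i = i' then xy.2 j i else 0)
    (t : (j : Fin q) → Fin (k j) → Fin (k j) → ℝ) :
    ∫ xy, cis (∑ j, ∑ i, ∑ i', t j i i' * coords (W xy j) i i') ∂limitMeasure k w =
      Complex.exp (-((∑ j, (∑ i, ∑ i', (t j i i' * lam j i i') ^ 2 + w j * ∑ i, t j i i ^ 2)) / 2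
        : ℝ)) := by
  have h := integral_cis_limitMeasure k w hw (fun j i i' => t j i i' * lam j i i')
    fun j i => t j i i
  have e1 : ∀ xy : (((j : Fin q) → Fin (k j) → Fin (k j) → ℝ) × ((j : Fin q) → Fin (k j) → ℝ)),
      ∑ j, ∑ i, ∑ i', t j i i' * coords (W xy j) i i' =
      (∑ j, ∑ i, ∑ i', t j i i' * lam j i i' * xy.1 j i i') + ∑ j, ∑ i, t j i i * xy.2 j i := by
    intro xy
    rw [← Finset.sum_add_distrib]
    refine Finset.sum_congr rfl fun j _ => ?_
    rw [← Finset.sum_add_distrib]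
    refine Finset.sum_congr rfl fun i _ => ?_
    simp only [hW, mul_add, Finset.sum_add_distrib, mul_ite, mul_zero, Finset.sum_ite_eq,
      Finset.mem_univ, if_true, mul_assoc]
  simp_rw [e1]
  rw [h, ← Complex.ofReal_neg]
  congr 2
  rw [neg_eq_neg_one_mul, Finset.sum_div, Finset.mul_sum]
  refine Finset.sum_congr rfl fun j _ => ?_
  simp_rw [neg_div, Finset.sum_neg_distrib, ← Finset.sum_div, ← Finset.sum_mul]
  ring

lemma measurable_coords_of_eq
    {W : (((j : Fin q) → Fin (k j) → Fin (k j) → ℝ) × ((j : Fin q) → Fin (k j) → ℝ)) →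
      (j : Fin q) → Matrix (Fin (k j)) (Fin (k j)) 𝕜}
    {lam : (j : Fin q) → Fin (k j) → Fin (k j) → ℝ}
    (hW : ∀ xy j i i', coords (W xy j) i i' =
      lam j i i' * xy.1 j i i' + if i = i' then xy.2 j i else 0) (j : Fin q) (i i' : Fin (k j)) :
    Measurable fun xy => coords (W xy j) i i' := by
  simp only [hW]
  split_ifs <;> fun_prop

lemma sum_sumMatrix_dev {m : ℕ} (c w : ℝ) (t : Fin m → Fin m → ℝ) :
    ∑ i, ∑ i', (t i i' * (c * coordDev 𝕜 i i')) ^ 2 + w * ∑ i, t i i ^ 2 =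
      tauConst 𝕜 * (c ^ 2 * ∑ i, ∑ i', coordWeight 𝕜 i i' * t i i' ^ 2) + w * ∑ i, t i i ^ 2 := by
  congr 1
  simp_rw [Finset.mul_sum, mul_pow, coordDev_sq]
  exact Finset.sum_congr rfl fun i _ => Finset.sum_congr rfl fun i' _ => by ring

/-- The diagonal part `τc²` of the Gaussian matrix is moved into the variance of the new diagonal
entries. The exponent is then the one of `c M + D`, but it only needs `τc² + w ≥ 0` and not `w ≥ 0`.
-/
lemma sum_replacedMatrix_dev {m : ℕ} (c w : ℝ) (t : Fin m → Fin m → ℝ) :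
    ∑ i, ∑ i', (t i i' * if i = i' then 0 else c * coordDev 𝕜 i i') ^ 2 +
      (tauConst 𝕜 * c ^ 2 + w) * ∑ i, t i i ^ 2 =
      tauConst 𝕜 * (c ^ 2 * ∑ i, ∑ i', coordWeight 𝕜 i i' * t i i' ^ 2) + w * ∑ i, t i i ^ 2 := by
  have h : ∀ i i', (t i i' * (c * coordDev 𝕜 i i')) ^ 2 =
      (t i i' * if i = i' then 0 else c * coordDev 𝕜 i i') ^ 2 +
        if i = i' then tauConst 𝕜 * c ^ 2 * t i i ^ 2 else 0 := by
    intro i i'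
    split_ifs with hi
    · subst hi
      rw [mul_pow, mul_pow, coordDev_sq, coordWeight, if_pos rfl]
      ring
    · ring
  rw [← sum_sumMatrix_dev]
  simp_rw [h, Finset.sum_add_distrib, Finset.sum_ite_eq, Finset.mem_univ, if_true,
    ← Finset.mul_sum]
  ring

end LimitMatrices

end SpikedModel

open SpikedModel in
theorem theorem3p4 {𝕜 : Type*} [RCLike 𝕜] (mod : Model)
    -- the law of the entries
    (ν : Measure 𝕜) (hν : EntryLaw ν) (hκ : kappa4 ν ≠ 0)
    -- the deterministic matrices
    (X : (n : ℕ) → Matrix (Fin n) (Fin n) 𝕜) (μ : Measure ℝ) (a b : ℝ)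
    (hX : SpectralHyp X μ a b)
    -- the coefficients of the perturbation
    {r : ℕ} (θ : Fin r → ℝ) (hθ : Monotone θ) (hθ0 : ∀ s, θ s ≠ 0)
    -- the different values of the `θ s` with limit outside the bulk
    {q : ℕ} (α : Fin q → ℝ) (hα : StrictMono α)
    (hα_range : Set.range α = {t | t ∈ Set.range θ ∧ rho μ a b t ∉ ({a, b} : Set ℝ)})
    -- rate of convergence of the spectral measures
    (hrate : ∀ j, Tendsto
      (fun n : ℕ => √(n : ℝ) * (cauchyG (spectralMeasure (X n)) (rho μ a b (α j))
        - cauchyG μ (rho μ a b (α j)))) atTop (𝓝 0))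
    -- averaged squares of the diagonal entries of the resolvent
    (l : ℝ → ℝ)
    (hl : ∀ z ∉ Set.Icc a b, Tendsto (fun n => diagAverage mod (X n) z) atTop (𝓝 (l z)))
    -- for each `n`, the `r n` independent entries with law `ν`
    {Ω : ℕ → Type*} [∀ n, MeasurableSpace (Ω n)] (P : (n : ℕ) → Measure (Ω n))
    [∀ n, IsProbabilityMeasure (P n)]
    (g : (n : ℕ) → Fin r → Fin n → Ω n → 𝕜)
    (hg_law : ∀ n s i, HasLaw (g n s i) ν (P n))
    (hg_indep : ∀ n, iIndepFun (fun p : Fin r × Fin n => g n p.1 p.2) (P n)) :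
    let ρ : Fin q → ℝ := fun j => rho μ a b (α j)
    let k : Fin q → ℕ := fun j => mult θ (α j)
    let c : Fin q → ℝ := fun j => cConst mod μ (α j) (ρ j)
    let w : Fin q → ℝ := fun j => extraVar μ l (kappa4 ν) (ρ j)
    let v : Fin q → ℝ := fun j => totalVar 𝕜 mod μ l (kappa4 ν) (α j) (ρ j)
    let γ : (n : ℕ) → Ω n → ((p : (j : Fin q) × Fin (k j)) → ℝ) := fun n ω p =>
      gam (perturbed (X n) θ (vecs mod (fun s i => g n s i ω))) α ρ k p.1 p.2
    -- the limit, for every sign of the fourth cumulant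
    (∀ j, 0 ≤ v j) ∧
    TendstoInDistribution γ atTop
      (fun xy p => eig (replacedMatrix 𝕜 (c p.1) (xy.1 p.1) (xy.2 p.1)) (p.2 + 1))
      P (limitMeasure k v) ∧
    -- for a positive fourth cumulant, in the form `c_j M_j + D_j`
    (0 < kappa4 ν → (∀ j, 0 ≤ w j) ∧
      TendstoInDistribution γ atTop
        (fun xy p => eig (sumMatrix 𝕜 (c p.1) (xy.1 p.1) (xy.2 p.1)) (p.2 + 1))
        P (limitMeasure k w)) := by
  intro ρ k c w v γ
  obtain ⟨ν₀, u, hd⟩ := hν.exists_decomposition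
  have := hd.std.isProbabilityMeasure
  have hz := fun j => (hX.rho_notMem hα_range j).1
  have hα0 := fun j => (hX.rho_notMem hα_range j).2
  have hG := fun j => (hX.spike_facts hα_range j).2
  have hdiag := fun j => (hX.diagLimit_mem mod (hz j) (hα0 j) (hG j) (hrate j) (hl _ (hz j))).2
  -- Up to a positive factor, `v_j` is `τh + κ₄l` with `0 ≤ l ≤ h` and `κ₄ ≥ -τ`, where `h` is the
  -- limit of the normalised Hilbert-Schmidt norm.
  have hv : ∀ j, 0 ≤ v j := by
    intro j
    simp only [v, ρ]
    rw [hX.totalVar_eq mod (hz j) (hα0 j) (hG j)]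
    refine div_nonneg ?_ (sq_nonneg _)
    obtain ⟨h0, h1⟩ := hdiag j
    have h2 := hν.neg_tauConst_le_kappa4
    have h3 := mul_le_mul_of_nonneg_right h2 h0
    have h4 := mul_le_mul_of_nonneg_left h1 (tauConst_pos (𝕜 := 𝕜)).le
    linarith
  have hmeas : ∀ n, Measurable fun (y : Fin r × Fin n → 𝕜) (p : (j : Fin q) × Fin (k j)) =>
      gam (perturbed (X n) θ (vecs mod fun s a => y (s, a))) α ρ k p.1 p.2 := fun n =>
    measurable_pi_lambda _ fun p => measurable_gam mod (hX.hermitian n) θ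
      (g := fun (y : Fin r × Fin n → 𝕜) s a => y (s, a)) (fun s a => measurable_pi_apply (s, a))
      α ρ k p.1 p.2
  refine ⟨hv, ?_, fun hpos => ?_⟩
  · refine tendstoInDistribution_of_entries hd hg_law hg_indep
      (φ := fun n g (p : (j : Fin q) × Fin (k j)) =>
        gam (perturbed (X n) θ (vecs mod g)) α ρ k p.1 p.2) hmeas ?_
    have hW : ∀ (xy : ((j : Fin q) → Fin (k j) → Fin (k j) → ℝ) × ((j : Fin q) → Fin (k j) → ℝ))
        j i i', coords (replacedMatrix 𝕜 (c j) (xy.1 j) (xy.2 j)) i i' =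
        (if i = i' then 0 else c j * coordDev 𝕜 i i') * xy.1 j i i' +
          if i = i' then xy.2 j i else 0 := fun xy j i i' => coords_replacedMatrix _ _ _ i i'
    have key := tendstoInDistribution_gam_of_stdFamily mod hd (x := commonVar r)
      (fun n => stdFamily_commonVar hd.std n) hX hα hα_range hrate hl
      (P' := limitMeasure k v) (W' := fun xy j => replacedMatrix 𝕜 (c j) (xy.1 j) (xy.2 j))
      (fun _ _ => isHermitian_replacedMatrix _ _ _) (measurable_coords_of_eq hW) fun t => ?_
    · exact key
    rw [integral_cis_coords hv hW t]
    congr 4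
    exact Finset.sum_congr rfl fun j _ => sum_replacedMatrix_dev (𝕜 := 𝕜) (c j) (w j) (t j)
  · have hw : ∀ j, 0 ≤ w j := by
      intro j
      simp only [w, ρ]
      rw [hX.extraVar_eq (hz j)]
      exact div_nonneg (mul_nonneg (hdiag j).1 hpos.le) (sq_nonneg _)
    refine ⟨hw, ?_⟩
    refine tendstoInDistribution_of_entries hd hg_law hg_indep
      (φ := fun n g (p : (j : Fin q) × Fin (k j)) =>
        gam (perturbed (X n) θ (vecs mod g)) α ρ k p.1 p.2) hmeas ?_
    have hW : ∀ (xy : ((j : Fin q) → Fin (k j) → Fin (k j) → ℝ) × ((j : Fin q) → Fin (k j) → ℝ))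
        j i i', coords (sumMatrix 𝕜 (c j) (xy.1 j) (xy.2 j)) i i' =
        c j * coordDev 𝕜 i i' * xy.1 j i i' +
          if i = i' then xy.2 j i else 0 := fun xy j i i' => coords_sumMatrix _ _ _ i i'
    have key := tendstoInDistribution_gam_of_stdFamily mod hd (x := commonVar r)
      (fun n => stdFamily_commonVar hd.std n) hX hα hα_range hrate hl
      (P' := limitMeasure k w) (W' := fun xy j => sumMatrix 𝕜 (c j) (xy.1 j) (xy.2 j))
      (fun _ _ => isHermitian_sumMatrix _ _ _) (measurable_coords_of_eq hW) fun t => ?_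
    · exact key
    rw [integral_cis_coords hw hW t]
    congr 4
    exact Finset.sum_congr rfl fun j _ => sum_sumMatrix_dev (𝕜 := 𝕜) (c j) (w j) (t j)
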